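/- **Setting.** Let $k$ be a field complete with respect to a non-Archimedean absolute value, and let $q\in k$ with $|q|=1$ be not a root of unity. Let $\Phi$ be a free $\mathbb Z$-module with $\Phi^*=\mathrm{Hom}(\Phi,\mathbb Z)$, let $\{\alpha_i\}_{i\in I}$ be linearly independent elements of $\Phi$ with span $\Psi\cong\mathbb Z^{I}$ (finitely supported families), let $(\cdot,\cdot):\Phi\times\Phi\to\mathbb Q$ be a symmetric bilinear form with $(\alpha_i,\alpha_i)=2d_i$, $d_i$ a positive integer, and $(\alpha_i,\alpha_j)\le 0$ for $i\ne j$, and let $\lambda_i\in\Phi^*$ satisfy $\lambda_i(\alpha)=2(\alpha_i,\alpha)/(\alpha_i,\alpha_i)$. Put $q_i=q^{d_i}$, and $\nu(\beta)=\sum_i b_id_i\lambda_i\in\Phi^*$ for $\beta=\sum_i b_i\alpha_i\in\Psi$. Let $r,s>0$ with $1\le|q_i-q_i^{-1}|\,rs$ for all $i\in I$. **Ind-Banach spaces.** $\mathrm{IndBan}$ is the Ind-category of non-Archimedean Banach spaces over $k$ with bounded linear maps, symmetric monoidal for the completed projective tensor product $\hat\otimes$, with flip $\tau$. **The Hopf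 algebra $C$.** Let $C=\mathbf f_r^{\mathrm{an}}\rtimes H'$ be the Banach Hopf algebra generated by $F_i$ $(i\in I)$ and $t_\beta$ $(\beta\in\Psi)$ with $t_0=1$, $t_\beta t_\gamma=t_{\beta+\gamma}$, $t_\beta F_i=q^{-(\beta,\alpha_i)}F_it_\beta$ and the relations of the Nichols algebra $\mathbf f$ of $V=\bigoplus_i k\,v_i$ with braiding $v_i\otimes v_j\mapsto q^{(\alpha_i,\alpha_j)}v_j\otimes v_i$ (the largest homogeneous ideal of the tensor algebra $T(V)$, generated in degrees $\ge2$, that is a coideal) among the $F_i$. It is completed for the largest non-Archimedean seminorm for which every word in the generators has norm at most the product of the weights of its letters, $F_i$ having weight $r$ and $t_\beta$ weight $1$. Here $$\Delta F_i=F_i\otimes1+t_{-\alpha_i}\otimes F_i,\quad \Delta t_\beta=t_\beta\otimes t_\beta,\quad \varepsilon(F_i)=0,\quad \varepsilon(t_\beta)=1 .$$ **The analytic quantum group $U$.** Let $U=U_q(\mathfrak g)^{\mathrm{an}}_{r,s}$ be generated by $E_i,F_i$ $(i\in I)$ and $K_\lambda$ $(\lambda\in\Phi^*)$ with $K_0=1$,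 $K_\lambda K_\mu=K_{\lambda+\mu}$, $K_\lambda F_i=q^{-\lambda(\alpha_i)}F_iK_\lambda$, $K_\lambda E_i=q^{\lambda(\alpha_i)}E_iK_\lambda$, $$E_iF_j-F_jE_i=\delta_{ij}\,\frac{K_{d_i\lambda_i}-K_{-d_i\lambda_i}}{q_i-q_i^{-1}},$$ and the relations of $\mathbf f$ among the $F_i$ and among the $E_i$. It is completed in the same way, with weights $s$ for $E_i$, $r$ for $F_i$ and $1$ for $K_\lambda$. Its comultiplication is $\Delta K_\lambda=K_\lambda\otimes K_\lambda$, $\Delta F_i=F_i\otimes 1+K_{-d_i\lambda_i}\otimes F_i$, $\Delta E_i=E_i\otimes K_{d_i\lambda_i}+1\otimes E_i$, and $\varepsilon(E_i)=\varepsilon(F_i)=0$, $\varepsilon(K_\lambda)=1$. There is a homomorphism $C\to U$, $F_i\mapsto F_i$, $t_\beta\mapsto K_{\nu(\beta)}$. **The pairing.** Let $B=H\ltimes\mathbf f_s^{\mathrm{an}}$ be the analogous Banach Hopf algebra on the generators $K_\lambda,E_i$; it maps to $U$. The bounded pairing $\langle\cdot,\cdot\rangle:B\hat\otimes C\to k$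 is determined by $$\langle K_\lambda,t_\beta\rangle=q^{-\lambda(\beta)},\quad \langle K_\lambda,F_j\rangle=\langle E_i,t_\beta\rangle=0,\quad \langle E_i,F_j\rangle=-\frac{\delta_{ij}}{q_i-q_i^{-1}},$$ $$\langle bb',c\rangle=\langle b,c_1\rangle\langle b',c_2\rangle,\quad \langle b,cc'\rangle=\langle b_1,c'\rangle\langle b_2,c\rangle,\quad \langle 1,c\rangle=\varepsilon(c),\quad \langle b,1\rangle=\varepsilon(b).$$ **The category $\mathcal O_\Psi$.** $\mathcal O_\Psi$ is the full subcategory of the category of $U$-modules in $\mathrm{IndBan}$ on those $M$ for which there is a coassociative, counital right coaction $\Delta_M:M\to M\hat\otimes C$, $m\mapsto m_0\otimes m_1$, such that * $M$, with the action of $C$ through $C\to U$, is a crossed (Yetter–Drinfel'd) bimodule over $C$: $c_1m_0\otimes c_2m_1=(c_2m)_0\otimes(c_2m)_1c_1$ as morphisms $C\hat\otimes M\to M\hat\otimes C$; * the action of $B$ through $B\to U$ is the one induced by the coaction: $b\,m=m_0\langle b,m_1\rangle$ as morphisms $B\hat\otimes M\to M$. **Corollary 3.39.** The category $\mathcal O_\Psi$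 is braided monoidal. More precisely, $\mathcal O_\Psi$ carries a monoidal structure for which the forgetful functor to $(\mathrm{IndBan},\hat\otimes)$ is (strong) monoidal, with $U$ acting on $M\hat\otimes N$ diagonally through $\Delta:U\to U\hat\otimes U$ and on the unit object $k$ through $\varepsilon$; and this monoidal category has a braiding (natural isomorphisms satisfying the hexagon axioms) given, for all $M,N\in\mathcal O_\Psi$ and every coaction $\Delta_N$ on $N$ as above, by $$M\hat\otimes N\xrightarrow{\ \tau\ }N\hat\otimes M\xrightarrow{\Delta_N\otimes\mathrm{Id}}N\hat\otimes C\hat\otimes M\xrightarrow{\mathrm{Id}\otimes\mu_M}N\hat\otimes M,\qquad m\otimes n\mapsto n_0\otimes n_1m,$$ where $\mu_M$ is the action of $C$ on $M$ through $C\to U$. -/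

import Mathlib

universe u

open CategoryTheory MonoidalCategory TensorProduct
open scoped NNReal

noncomputable section

namespace AnQG

/-! ### Non-Archimedean Banach spaces -/

/-- A non-Archimedean Banach space over `k`, with a chosen norm. -/
structure Ban (k : Type u) [NormedField k] where
  carrier : Type u
  [grp : NormedAddCommGroup carrier]
  [spc : NormedSpace k carrier]
  [ultra : IsUltrametricDist carrier]
  [complete : CompleteSpace carrier]

attribute [instance] Ban.grp Ban.spc Ban.ultra Ban.complete

instance (k : Type u) [NormedField k] : CoeSort (Ban k) (Type u) := ⟨Ban.carrier⟩

section Ban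

variable {k : Type u} [NormedField k]

/-- Bounded linear maps. -/
structure Ban.Hom (A B : Ban k) where
  lin : A →ₗ[k] B
  bdd : ∃ C : ℝ≥0, ∀ x, ‖lin x‖ ≤ C * ‖x‖

instance : Category (Ban k) where
  Hom A B := Ban.Hom A B
  id A := ⟨LinearMap.id, 1, fun x => by simp⟩
  comp f g := ⟨g.lin ∘ₗ f.lin, by
    obtain ⟨C, hC⟩ := f.bdd
    obtain ⟨D, hD⟩ := g.bdd
    refine ⟨D * C, fun x => (hD _).trans ?_⟩
    rw [NNReal.coe_mul, mul_assoc]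
    exact mul_le_mul_of_nonneg_left (hC x) D.2⟩

instance {A B : Ban k} : CoeFun (A ⟶ B) (fun _ => A → B) := ⟨fun f => Ban.Hom.lin f⟩

theorem Ban.hom_ext {A B : Ban k} {f g : A ⟶ B} (h : ∀ x, f x = g x) : f = g := by
  rcases f with ⟨f, _⟩
  rcases g with ⟨g, _⟩
  obtain rfl : f = g := LinearMap.ext h
  rfl

@[simp] theorem Ban.id_apply (A : Ban k) (x : A) : (𝟙 A : A ⟶ A) x = x := rfl

@[simp] theorem Ban.comp_apply {A B C : Ban k} (f : A ⟶ B) (g : B ⟶ C) (x : A) :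
    (f ≫ g) x = g (f x) := rfl

theorem Ban.hom_continuous {A B : Ban k} (f : A ⟶ B) : Continuous f := by
  obtain ⟨C, hC⟩ := f.bdd
  exact (f.lin.toAddMonoidHom.mkNormedAddGroupHom C hC).continuous

/-! ### Largest seminorms with prescribed bounds, and their completions

A vector space with a spanning family `gen` and weights `wt` carries a largest non-Archimedean
seminorm with `‖gen l‖ ≤ wt l`, namely
`‖x‖ = inf { max_l ‖a_l‖ wt l | x = ∑ a_l gen l }`.  All the Banach spaces below are completions
for such seminorms: completed tensor products, contracting coproducts `∐^{≤1}` of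
one-dimensional spaces, and quotients of Banach tensor algebras. -/

/-- A vector space with a weighted spanning family. -/
structure Pres (k : Type u) [NormedField k] where
  carrier : Type u
  [grp : AddCommGroup carrier]
  [mod : Module k carrier]
  Idx : Type u
  gen : Idx → carrier
  wt : Idx → ℝ≥0
  span : ∀ x, ∃ p : Idx →₀ k, Finsupp.linearCombination k gen p = x

attribute [instance] Pres.grp Pres.mod

namespace Pres

variable (P : Pres k)

/-- `max_l ‖p l‖ wt l` -/
def size (p : P.Idx →₀ k) : ℝ≥0 := p.support.sup fun l => ‖p l‖₊ * P.wt l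

/-- the largest non-Archimedean seminorm with `‖gen l‖ ≤ wt l` -/
def nm (x : P.carrier) : ℝ≥0 :=
  sInf {c | ∃ p : P.Idx →₀ k, Finsupp.linearCombination k P.gen p = x ∧ P.size p = c}

theorem size_le_iff (p : P.Idx →₀ k) (c : ℝ≥0) : P.size p ≤ c ↔ ∀ l, ‖p l‖₊ * P.wt l ≤ c := by
  rw [size, Finset.sup_le_iff]
  refine ⟨fun h l => ?_, fun h l _ => h l⟩
  by_cases hl : p l = 0
  · simp [hl]
  · exact h l (Finsupp.mem_support_iff.2 hl)

theorem le_size (p : P.Idx →₀ k) (l) : ‖p l‖₊ * P.wt l ≤ P.size p :=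
  (P.size_le_iff p _).1 le_rfl l

theorem nm_le (p : P.Idx →₀ k) : P.nm (Finsupp.linearCombination k P.gen p) ≤ P.size p :=
  csInf_le' ⟨p, rfl, rfl⟩

theorem le_nm {x : P.carrier} {c : ℝ≥0}
    (h : ∀ p : P.Idx →₀ k, Finsupp.linearCombination k P.gen p = x → c ≤ P.size p) :
    c ≤ P.nm x := by
  obtain ⟨p, hp⟩ := P.span x
  refine le_csInf ⟨_, p, hp, rfl⟩ ?_
  rintro _ ⟨p, hp, rfl⟩
  exact h p hp

theorem exists_lt {x : P.carrier} {c : ℝ≥0} (h : P.nm x < c) :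
    ∃ p : P.Idx →₀ k, Finsupp.linearCombination k P.gen p = x ∧ P.size p < c := by
  by_contra hc
  push Not at hc
  exact absurd (P.le_nm fun p hp => hc p hp) (not_le.2 h)

theorem nm_smul_le (a : k) (x : P.carrier) : P.nm (a • x) ≤ ‖a‖₊ * P.nm x := by
  by_cases ha : a = 0
  · subst ha
    have := P.nm_le 0
    simpa [size] using this
  have ha' : 0 < ‖a‖₊ := by simpa using ha
  suffices h : ‖a‖₊⁻¹ * P.nm (a • x) ≤ P.nm x by
    rwa [inv_mul_le_iff₀ ha'] at h
  refine P.le_nm fun p hp => ?_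
  rw [inv_mul_le_iff₀ ha', ← hp, ← map_smul]
  refine (P.nm_le _).trans ((P.size_le_iff _ _).2 fun l => ?_)
  rw [Finsupp.smul_apply, smul_eq_mul, nnnorm_mul, mul_assoc]
  exact mul_le_mul_right (P.le_size p l) _

theorem nm_zero : P.nm 0 = 0 := by simpa using P.nm_smul_le 0 0

variable [IsUltrametricDist k]

theorem nm_add_le_max (x y : P.carrier) : P.nm (x + y) ≤ max (P.nm x) (P.nm y) := by
  refine le_of_forall_gt fun c hc => ?_
  obtain ⟨p, rfl, hp⟩ := P.exists_lt ((le_max_left _ _).trans_lt hc)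
  obtain ⟨p', rfl, hp'⟩ := P.exists_lt ((le_max_right _ _).trans_lt hc)
  rw [← map_add]
  refine (P.nm_le _).trans_lt (lt_of_le_of_lt ((P.size_le_iff _ _).2 fun l => ?_)
    (max_lt hp hp'))
  have h : ‖(p + p') l‖₊ ≤ max ‖p l‖₊ ‖p' l‖₊ := IsUltrametricDist.norm_add_le_max _ _
  refine (mul_le_mul_left h _).trans ?_
  rw [max_mul_of_nonneg _ _ zero_le]
  exact max_le_max (P.le_size p l) (P.le_size p' l)

instance : SeminormedAddCommGroup P.carrier :=
  AddGroupSeminorm.toSeminormedAddCommGroup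
    { toFun := fun x => P.nm x
      map_zero' := by simp [nm_zero]
      add_le' := fun x y => by
        exact_mod_cast (P.nm_add_le_max x y).trans (max_le_add_of_nonneg zero_le zero_le)
      neg' := fun x => by
        have h : ∀ y, P.nm (-y) ≤ P.nm y := fun y => by
          simpa using P.nm_smul_le (-1) y
        exact congrArg _ (le_antisymm (h x) (by simpa using h (-x))) }

theorem norm_def (x : P.carrier) : ‖x‖ = P.nm x := rfl

instance : NormedSpace k P.carrier where
  norm_smul_le a x := P.nm_smul_le a x

theorem norm_gen_le (l : P.Idx) : ‖P.gen l‖ ≤ P.wt l := by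
  rw [norm_def, NNReal.coe_le_coe]
  refine (by simp : P.gen l = Finsupp.linearCombination k P.gen (.single l 1)) ▸
    (P.nm_le _).trans ((P.size_le_iff _ _).2 fun l' => ?_)
  classical
  rw [Finsupp.single_apply]
  split_ifs with h
  · simp [h]
  · simp

instance : IsUltrametricDist P.carrier :=
  IsUltrametricDist.isUltrametricDist_of_forall_norm_add_le_max_norm
    fun x y => by exact_mod_cast P.nm_add_le_max x y

theorem bound {X : Type*} [SeminormedAddCommGroup X] [NormedSpace k X] [IsUltrametricDist X]
    (f : P.carrier →ₗ[k] X) (C : ℝ≥0) (h : ∀ l, ‖f (P.gen l)‖ ≤ C * P.wt l) (x : P.carrier) :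
    ‖f x‖ ≤ C * ‖x‖ := by
  have key : ∀ p : P.Idx →₀ k, Finsupp.linearCombination k P.gen p = x → ‖f x‖₊ ≤ C * P.size p := by
    rintro p rfl
    rw [Finsupp.linearCombination_apply, Finsupp.sum, map_sum]
    refine IsUltrametricDist.norm_sum_le_of_forall_le_of_nonneg (C * P.size p).2 fun l _ => ?_
    rw [map_smul, norm_smul]
    calc ‖p l‖ * ‖f (P.gen l)‖ ≤ ‖p l‖ * (C * P.wt l) := by gcongr; exact h l
      _ = C * (‖p l‖ * P.wt l) := by ring
      _ ≤ C * P.size p := mul_le_mul_of_nonneg_left (P.le_size p l) C.2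
  rw [norm_def]
  by_cases hC : C = 0
  · obtain ⟨p, hp⟩ := P.span x
    have := key p hp
    subst hC
    rw [zero_mul, nonpos_iff_eq_zero] at this
    rw [← coe_nnnorm, this]
    simp
  have hC' : 0 < C := pos_iff_ne_zero.2 hC
  have : C⁻¹ * ‖f x‖₊ ≤ P.nm x := P.le_nm fun p hp => by
    rw [inv_mul_le_iff₀ hC']; exact key p hp
  rw [inv_mul_le_iff₀ hC'] at this
  exact_mod_cast this

/-- The completion. -/
def ban : Ban k where
  carrier := UniformSpace.Completion P.carrier
  ultra := IsUltrametricDist.isUltrametricDist_of_forall_norm_add_le_max_norm fun x y => by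
    induction x, y using UniformSpace.Completion.induction_on₂ with
    | hp => exact isClosed_le (by fun_prop) (by fun_prop)
    | ih a b =>
      rw [← UniformSpace.Completion.coe_add]
      simpa only [UniformSpace.Completion.norm_coe] using IsUltrametricDist.norm_add_le_max a b

/-- The canonical map of a presented space to its completion. -/
def toBan : P.carrier →ₗ[k] P.ban where
  toFun x := (x : UniformSpace.Completion P.carrier)
  map_add' x y := UniformSpace.Completion.coe_add x y
  map_smul' a x := UniformSpace.Completion.coe_smul a x

theorem norm_toBan (x : P.carrier) : ‖P.toBan x‖ = ‖x‖ := UniformSpace.Completion.norm_coe x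

theorem ban_induction {p : P.ban → Prop} (hc : IsClosed {x | p x})
    (h : ∀ x, p (P.toBan x)) (x : P.ban) : p x :=
  UniformSpace.Completion.induction_on x hc h

/-- The universal property: a linear map on a presented space, bounded on the spanning family,
extends to the completion. -/
def liftLin {X : Ban k} (f : P.carrier →ₗ[k] X) (C : ℝ≥0)
    (h : ∀ l, ‖f (P.gen l)‖ ≤ C * P.wt l) : P.ban →ₗ[k] X :=
  let F := (f.toAddMonoidHom.mkNormedAddGroupHom C (P.bound f C h)).extension
  { toFun := F
    map_add' := map_add F
    map_smul' := fun a x => by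
      refine P.ban_induction (p := fun x => F (a • x) = a • F x)
        (isClosed_eq (F.continuous.comp (continuous_const_smul a))
          (F.continuous.const_smul a)) (fun x => ?_) x
      rw [← map_smul]
      have hF : ∀ y, F (P.toBan y) = f y := fun y => NormedAddGroupHom.extension_coe _ _
      rw [hF, hF, map_smul] }

theorem liftLin_toBan {X : Ban k} (f : P.carrier →ₗ[k] X) (C : ℝ≥0)
    (h : ∀ l, ‖f (P.gen l)‖ ≤ C * P.wt l) (x : P.carrier) :
    P.liftLin f C h (P.toBan x) = f x := NormedAddGroupHom.extension_coe _ _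

theorem liftLin_bound {X : Ban k} (f : P.carrier →ₗ[k] X) (C : ℝ≥0)
    (h : ∀ l, ‖f (P.gen l)‖ ≤ C * P.wt l) (x : P.ban) : ‖P.liftLin f C h x‖ ≤ C * ‖x‖ := by
  refine P.ban_induction (p := fun x => ‖P.liftLin f C h x‖ ≤ C * ‖x‖) (isClosed_le
    (NormedAddGroupHom.continuous _).norm (continuous_const.mul continuous_norm))
    (fun x => ?_) x
  rw [liftLin_toBan, norm_toBan]
  exact P.bound f C h x

/-- `liftLin` as a morphism of Banach spaces. -/
def lift {X : Ban k} (f : P.carrier →ₗ[k] X) (C : ℝ≥0)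
    (h : ∀ l, ‖f (P.gen l)‖ ≤ C * P.wt l) : P.ban ⟶ X :=
  ⟨P.liftLin f C h, C, P.liftLin_bound f C h⟩

@[simp] theorem lift_toBan {X : Ban k} (f : P.carrier →ₗ[k] X) (C : ℝ≥0)
    (h : ∀ l, ‖f (P.gen l)‖ ≤ C * P.wt l) (x : P.carrier) :
    P.lift f C h (P.toBan x) = f x := P.liftLin_toBan f C h x

variable {P} in
theorem ban_ext {X : Ban k} {f g : P.ban ⟶ X}
    (h : ∀ l, f (P.toBan (P.gen l)) = g (P.toBan (P.gen l))) : f = g := by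
  refine Ban.hom_ext fun x => P.ban_induction (p := fun x => f x = g x)
    (isClosed_eq (Ban.hom_continuous f) (Ban.hom_continuous g)) (fun x => ?_) x
  obtain ⟨p, rfl⟩ := P.span x
  rw [Finsupp.linearCombination_apply, Finsupp.sum]
  simp only [map_sum, map_smul, h]

/-- Version of `liftLin` with a parameter. -/
def liftPar {X : Ban k} {Y : Type u} [AddCommGroup Y] [Module k Y]
    (f : Y →ₗ[k] P.carrier →ₗ[k] X)
    (h : ∀ y, ∃ C : ℝ≥0, ∀ l, ‖f y (P.gen l)‖ ≤ C * P.wt l) : Y →ₗ[k] P.ban →ₗ[k] X :=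
  have ext : ∀ F G : P.ban ⟶ X, (∀ x, F (P.toBan x) = G (P.toBan x)) → F.lin = G.lin :=
    fun F G hFG => congrArg Ban.Hom.lin (ban_ext fun l => hFG _)
  { toFun := fun y => P.liftLin (f y) (h y).choose (h y).choose_spec
    map_add' := fun y z => ext (P.lift _ _ (h (y + z)).choose_spec)
      ⟨P.liftLin _ _ (h y).choose_spec + P.liftLin _ _ (h z).choose_spec,
        (h y).choose + (h z).choose, fun x => by
          rw [NNReal.coe_add, add_mul]
          exact (norm_add_le _ _).trans
            (add_le_add (P.liftLin_bound _ _ _ _) (P.liftLin_bound _ _ _ _))⟩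
      fun x => by
        simp only [lift_toBan, LinearMap.add_apply, liftLin_toBan, map_add]
    map_smul' := fun a y => ext (P.lift _ _ (h (a • y)).choose_spec)
      ⟨a • P.liftLin _ _ (h y).choose_spec, ‖a‖₊ * (h y).choose, fun x => by
          rw [LinearMap.smul_apply, norm_smul, NNReal.coe_mul, mul_assoc]
          exact mul_le_mul_of_nonneg_left (P.liftLin_bound _ _ _ _) (norm_nonneg a)⟩
      fun x => by
        simp only [lift_toBan, LinearMap.smul_apply, liftLin_toBan, map_smul] }

section liftPar

variable {X : Ban k} {Y : Type u} [AddCommGroup Y] [Module k Y]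
  (f : Y →ₗ[k] P.carrier →ₗ[k] X)
  (h : ∀ y, ∃ C : ℝ≥0, ∀ l, ‖f y (P.gen l)‖ ≤ C * P.wt l)

@[simp] theorem liftPar_toBan (y : Y) (x : P.carrier) : P.liftPar f h y (P.toBan x) = f y x :=
  P.liftLin_toBan _ _ (h y).choose_spec _

theorem liftPar_bound (y : Y) (C : ℝ≥0) (hC : ∀ l, ‖f y (P.gen l)‖ ≤ C * P.wt l) (x : P.ban) :
    ‖P.liftPar f h y x‖ ≤ C * ‖x‖ := by
  have : P.lift _ _ (h y).choose_spec = P.lift _ _ hC := ban_ext fun l => by simp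
  exact (congrArg (fun F : P.ban ⟶ X => ‖F x‖) this).le.trans (P.liftLin_bound _ _ hC x)

end liftPar

end Pres

/-! ### The completed tensor product -/

/-- The algebraic tensor product with the projective non-Archimedean seminorm. -/
def tens (A B : Ban k) : Pres k where
  carrier := A ⊗[k] B
  Idx := A × B
  gen ab := ab.1 ⊗ₜ ab.2
  wt ab := ‖ab.1‖₊ * ‖ab.2‖₊
  span x := by
    induction x with
    | zero => exact ⟨0, map_zero _⟩
    | tmul a b => exact ⟨.single (a, b) 1, by simp⟩
    | add x y hx hy =>
      obtain ⟨p, rfl⟩ := hx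
      obtain ⟨p', rfl⟩ := hy
      exact ⟨p + p', map_add _ _ _⟩

variable [IsUltrametricDist k]

/-- The pure tensor `a ⊗ b` in the completed tensor product. -/
def tmk (A B : Ban k) : A →ₗ[k] B →ₗ[k] (tens A B).ban :=
  (TensorProduct.mk k A B).compr₂ (tens A B).toBan

theorem norm_tmk_le {A B : Ban k} (a : A) (b : B) : ‖tmk A B a b‖ ≤ ‖a‖ * ‖b‖ :=
  ((tens A B).norm_toBan _).le.trans ((tens A B).norm_gen_le (a, b))

theorem tens_ext {A B X : Ban k} {f g : (tens A B).ban ⟶ X}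
    (h : ∀ a b, f (tmk A B a b) = g (tmk A B a b)) : f = g :=
  Pres.ban_ext fun ab => h ab.1 ab.2

/-- Bounded bilinear maps factor through the completed tensor product. -/
def tlift {A B X : Ban k} (f : A →ₗ[k] B →ₗ[k] X) (C : ℝ≥0)
    (h : ∀ a b, ‖f a b‖ ≤ C * (‖a‖ * ‖b‖)) : (tens A B).ban ⟶ X :=
  (tens A B).lift (TensorProduct.lift f) C fun ab => h ab.1 ab.2

@[simp] theorem tlift_tmk {A B X : Ban k} (f : A →ₗ[k] B →ₗ[k] X) (C : ℝ≥0)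
    (h : ∀ a b, ‖f a b‖ ≤ C * (‖a‖ * ‖b‖)) (a : A) (b : B) :
    tlift f C h (tmk A B a b) = f a b :=
  ((tens A B).lift_toBan _ _ _ _).trans rfl

/-- `f ⊗ g` -/
def tmap {A A' B B' : Ban k} (f : A ⟶ A') (g : B ⟶ B') : (tens A B).ban ⟶ (tens A' B').ban :=
  tlift ((tmk A' B').compl₁₂ (Ban.Hom.lin f) (Ban.Hom.lin g)) (f.bdd.choose * g.bdd.choose)
    fun a b => (norm_tmk_le _ _).trans <| (mul_le_mul (f.bdd.choose_spec a)
      (g.bdd.choose_spec b) (norm_nonneg _) (by positivity)).trans (le_of_eq <| by push_cast; ring)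

@[simp] theorem tmap_tmk {A A' B B' : Ban k} (f : A ⟶ A') (g : B ⟶ B') (a : A) (b : B) :
    tmap f g (tmk A B a b) = tmk A' B' (f a) (g b) := tlift_tmk _ _ _ _ _

/-- the flip -/
def tswap (A B : Ban k) : (tens A B).ban ⟶ (tens B A).ban :=
  tlift (tmk B A).flip 1 fun a b => by
    simpa [mul_comm] using norm_tmk_le b a

@[simp] theorem tswap_tmk (A B : Ban k) (a : A) (b : B) :
    tswap A B (tmk A B a b) = tmk B A b a := tlift_tmk _ _ _ _ _

/-- `c ↦ (a ⊗ b ↦ a ⊗ (b ⊗ c))` -/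
def assocAux (A B C : Ban k) :
    C →ₗ[k] (tens A B).carrier →ₗ[k] (tens A (tens B C).ban).ban :=
  (TensorProduct.lift (LinearMap.mk₂ k (fun a b => tmk A (tens B C).ban a ∘ₗ tmk B C b)
    (fun _ _ _ => by ext; simp) (fun _ _ _ => by ext; simp)
    (fun _ _ _ => by ext; simp) (fun _ _ _ => by ext; simp))).flip

theorem assocAux_bound (A B C : Ban k) (c : C) (ab : A × B) :
    ‖assocAux A B C c ((tens A B).gen ab)‖ ≤ ‖c‖₊ * (tens A B).wt ab := by
  refine (norm_tmk_le ab.1 (tmk B C ab.2 c)).trans ?_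
  refine (mul_le_mul_of_nonneg_left (norm_tmk_le _ _) (norm_nonneg _)).trans (le_of_eq ?_)
  simp only [tens, NNReal.coe_mul, coe_nnnorm]
  ring

theorem assocAux_bound' (A B C : Ban k) (c : C) :
    ∃ K : ℝ≥0, ∀ ab, ‖assocAux A B C c ((tens A B).gen ab)‖ ≤ K * (tens A B).wt ab :=
  ⟨_, assocAux_bound A B C c⟩

/-- `(a ⊗ b) ⊗ c ↦ a ⊗ (b ⊗ c)` -/
def tassoc (A B C : Ban k) : (tens (tens A B).ban C).ban ⟶ (tens A (tens B C).ban).ban :=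
  tlift ((tens A B).liftPar (assocAux A B C) (assocAux_bound' A B C)).flip 1 fun x c => by
    have := (tens A B).liftPar_bound _ (assocAux_bound' A B C) c _ (assocAux_bound A B C c) x
    simpa [mul_comm] using this

@[simp] theorem tassoc_tmk (A B C : Ban k) (a : A) (b : B) (c : C) :
    tassoc A B C (tmk _ _ (tmk A B a b) c) = tmk _ _ a (tmk _ _ b c) :=
  (tlift_tmk _ _ _ _ _).trans
    ((tens A B).liftPar_toBan _ (assocAux_bound' A B C) c (a ⊗ₜ b))

/-- `a ⊗ (b ⊗ c) ↦ (a ⊗ b) ⊗ c` -/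
def tassocInv (A B C : Ban k) : (tens A (tens B C).ban).ban ⟶ (tens (tens A B).ban C).ban :=
  tswap _ _ ≫ tmap (tswap _ _) (𝟙 _) ≫ tassoc C B A ≫ tswap _ _ ≫ tmap (tswap _ _) (𝟙 _)

@[simp] theorem tassocInv_tmk (A B C : Ban k) (a : A) (b : B) (c : C) :
    tassocInv A B C (tmk _ _ a (tmk _ _ b c)) = tmk _ _ (tmk A B a b) c := by
  simp [tassocInv]

/-- `x ↦ x ⊗ c` -/
def tmkR (A : Ban k) {C : Ban k} (c : C) : A ⟶ (tens A C).ban :=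
  ⟨(tmk A C).flip c, ‖c‖₊, fun x => by simpa [mul_comm] using norm_tmk_le x c⟩

/-- `x ↦ a ⊗ x` -/
def tmkL {A : Ban k} (C : Ban k) (a : A) : C ⟶ (tens A C).ban :=
  ⟨tmk A C a, ‖a‖₊, fun x => norm_tmk_le a x⟩

theorem tens_ext₃ {A B C X : Ban k} {f g : (tens (tens A B).ban C).ban ⟶ X}
    (h : ∀ a b c, f (tmk _ _ (tmk A B a b) c) = g (tmk _ _ (tmk A B a b) c)) : f = g :=
  tens_ext fun x c => congrArg (fun G : (tens A B).ban ⟶ X => G x)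
    (tens_ext (f := tmkR _ c ≫ f) (g := tmkR _ c ≫ g) fun a b => h a b c)

theorem tens_ext₃' {A B C X : Ban k} {f g : (tens A (tens B C).ban).ban ⟶ X}
    (h : ∀ a b c, f (tmk _ _ a (tmk B C b c)) = g (tmk _ _ a (tmk B C b c))) : f = g :=
  tens_ext fun a x => congrArg (fun G : (tens B C).ban ⟶ X => G x)
    (tens_ext (f := tmkL _ a ≫ f) (g := tmkL _ a ≫ g) fun b c => h a b c)

theorem tens_ext₄ {A B C D X : Ban k} {f g : (tens (tens (tens A B).ban C).ban D).ban ⟶ X}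
    (h : ∀ a b c d, f (tmk _ _ (tmk _ _ (tmk A B a b) c) d) =
      g (tmk _ _ (tmk _ _ (tmk A B a b) c) d)) : f = g :=
  tens_ext fun x d => congrArg (fun G : (tens (tens A B).ban C).ban ⟶ X => G x)
    (tens_ext₃ (f := tmkR _ d ≫ f) (g := tmkR _ d ≫ g) fun a b c => h a b c d)

variable [CompleteSpace k]

/-- The base field as a Banach space. -/
def unitBan (k : Type u) [NormedField k] [IsUltrametricDist k] [CompleteSpace k] : Ban k := ⟨k⟩

/-- `1` -/
def uone : unitBan k := (1 : k)

/-- the identification of the unit object with `k` -/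
def uval : unitBan k →ₗ[k] k := LinearMap.id (M := k)

@[simp] theorem uval_uone : uval (uone : unitBan k) = 1 := rfl

@[simp] theorem uval_smul_uone (a : unitBan k) : uval a • (uone : unitBan k) = a := mul_one (uval a)

/-- `a ⊗ x ↦ a x` -/
def tleft (A : Ban k) : (tens (unitBan k) A).ban ⟶ A :=
  tlift (LinearMap.lsmul k A ∘ₗ uval) 1 fun a x => by
    rw [NNReal.coe_one, one_mul]; exact norm_smul_le (uval a) x

@[simp] theorem tleft_tmk (A : Ban k) (a : unitBan k) (x : A) :
    tleft A (tmk _ A a x) = uval a • x := tlift_tmk _ _ _ _ _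

/-- `x ↦ 1 ⊗ x` -/
def tleftInv (A : Ban k) : A ⟶ (tens (unitBan k) A).ban := tmkL A uone

@[simp] theorem tleftInv_apply (A : Ban k) (x : A) : tleftInv A x = tmk (unitBan k) A uone x :=
  rfl

/-- `x ⊗ a ↦ a x` -/
def tright (A : Ban k) : (tens A (unitBan k)).ban ⟶ A := tswap _ _ ≫ tleft A

@[simp] theorem tright_tmk (A : Ban k) (a : unitBan k) (x : A) :
    tright A (tmk A _ x a) = uval a • x := by simp [tright]

/-- `x ↦ x ⊗ 1` -/
def trightInv (A : Ban k) : A ⟶ (tens A (unitBan k)).ban := tmkR A uone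

@[simp] theorem trightInv_apply (A : Ban k) (x : A) : trightInv A x = tmk A (unitBan k) x uone :=
  rfl

/-- The completed projective tensor product on non-Archimedean Banach spaces. -/
instance : MonoidalCategoryStruct (Ban k) where
  tensorObj A B := (tens A B).ban
  tensorUnit := unitBan k
  tensorHom f g := tmap f g
  whiskerLeft A _ _ g := tmap (𝟙 A) g
  whiskerRight f B := tmap f (𝟙 B)
  associator A B C := ⟨tassoc A B C, tassocInv A B C,
    tens_ext₃ fun _ _ _ => by simp, tens_ext₃' fun _ _ _ => by simp⟩
  leftUnitor A := ⟨tleft A, tleftInv A,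
    tens_ext fun a x => by
      simp only [Ban.comp_apply, tleft_tmk, tleftInv_apply, Ban.id_apply]
      rw [map_smul, ← LinearMap.smul_apply, ← map_smul, uval_smul_uone],
    Ban.hom_ext fun x => by simp⟩
  rightUnitor A := ⟨tright A, trightInv A,
    tens_ext fun x a => by
      simp only [Ban.comp_apply, tright_tmk, trightInv_apply, Ban.id_apply]
      rw [map_smul, LinearMap.smul_apply, ← map_smul, uval_smul_uone],
    Ban.hom_ext fun x => by simp⟩

instance : MonoidalCategory (Ban k) :=
  MonoidalCategory.ofTensorHom
    (id_tensorHom_id := fun A B => tens_ext (f := tmap (𝟙 A) (𝟙 B)) fun _ _ => by simp)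
    (id_tensorHom := fun _ _ _ _ => rfl)
    (tensorHom_id := fun _ _ => rfl)
    (tensorHom_comp_tensorHom := fun f₁ f₂ g₁ g₂ =>
      tens_ext (f := tmap f₁ f₂ ≫ tmap g₁ g₂) (g := tmap (f₁ ≫ g₁) (f₂ ≫ g₂)) fun _ _ => by simp)
    (associator_naturality := fun f g h => tens_ext₃ (f := tmap (tmap f g) h ≫ tassoc _ _ _)
      (g := tassoc _ _ _ ≫ tmap f (tmap g h)) fun _ _ _ => by simp)
    (leftUnitor_naturality := fun f => tens_ext (f := tmap (𝟙 _) f ≫ tleft _)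
      (g := tleft _ ≫ f) fun _ _ => by simp)
    (rightUnitor_naturality := fun f => tens_ext (f := tmap f (𝟙 _) ≫ tright _)
      (g := tright _ ≫ f) fun _ _ => by simp)
    (pentagon := fun A B C D => tens_ext₄
      (f := tmap (tassoc A B C) (𝟙 D) ≫ tassoc A _ D ≫ tmap (𝟙 A) (tassoc B C D))
      (g := tassoc _ C D ≫ tassoc A B _) fun _ _ _ _ => by simp)
    (triangle := fun A B => tens_ext₃ (f := tassoc A _ B ≫ tmap (𝟙 A) (tleft B))
      (g := tmap (tright A) (𝟙 B)) fun _ _ _ => by simp)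

instance : BraidedCategory (Ban k) where
  braiding A B := ⟨tswap A B, tswap B A,
    tens_ext (f := tswap A B ≫ tswap B A) (g := 𝟙 _) fun _ _ => by simp,
    tens_ext (f := tswap B A ≫ tswap A B) (g := 𝟙 _) fun _ _ => by simp⟩
  braiding_naturality_right A _ _ f := tens_ext (f := tmap (𝟙 A) f ≫ tswap _ _)
    (g := tswap _ _ ≫ tmap f (𝟙 A)) fun _ _ => by simp
  braiding_naturality_left f A := tens_ext (f := tmap f (𝟙 A) ≫ tswap _ _)
    (g := tswap _ _ ≫ tmap (𝟙 A) f) fun _ _ => by simp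
  hexagon_forward A B C := tens_ext₃ (f := tassoc A B C ≫ tswap A _ ≫ tassoc B C A)
    (g := tmap (tswap A B) (𝟙 C) ≫ tassoc B A C ≫ tmap (𝟙 B) (tswap A C)) fun _ _ _ => by simp
  hexagon_reverse A B C := tens_ext₃' (f := tassocInv A B C ≫ tswap _ C ≫ tassocInv C A B)
    (g := tmap (𝟙 A) (tswap B C) ≫ tassocInv A C B ≫ tmap (tswap A C) (𝟙 B)) fun _ _ _ => by simp

instance : SymmetricCategory (Ban k) where
  symmetry A B := tens_ext (f := tswap A B ≫ tswap B A) (g := 𝟙 _) fun _ _ => by simp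

end Ban

/-! ### Ind-completion of a symmetric monoidal category -/

/-- A formal filtered colimit of objects of `D`. -/
structure IndObj (D : Type (u + 1)) [Category.{u} D] where
  J : Type u
  [cat : SmallCategory J]
  [filt : IsFiltered J]
  F : J ⥤ D

attribute [instance] IndObj.cat IndObj.filt

namespace IndObj

variable {D : Type (u + 1)} [Category.{u} D]

/-- two representatives `A ⟶ F j` of an element of `colim_j Hom(A, F j)` are related -/
def Rel (X : IndObj D) (A : D) (p q : Σ j : X.J, A ⟶ X.F.obj j) : Prop :=
  ∃ f : p.1 ⟶ q.1, p.2 ≫ X.F.map f = q.2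

/-- `X(A) = colim_j Hom(A, F j)` -/
def El (X : IndObj D) (A : D) : Type u := Quot (X.Rel A)

/-- the class of `f : A ⟶ F j` -/
def cl (X : IndObj D) {A : D} (j : X.J) (f : A ⟶ X.F.obj j) : X.El A := Quot.mk _ ⟨j, f⟩

theorem cl_map (X : IndObj D) {A : D} {j j' : X.J} (f : A ⟶ X.F.obj j) (u : j ⟶ j') :
    X.cl j' (f ≫ X.F.map u) = X.cl j f := (Quot.sound ⟨u, rfl⟩).symm

theorem El.ind {X : IndObj D} {A : D} {p : X.El A → Prop} (h : ∀ j f, p (X.cl j f)) (x) : p x :=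
  Quot.ind (fun y => h y.1 y.2) x

/-- restriction along `a : B ⟶ A` -/
def res {X : IndObj D} {A B : D} (a : B ⟶ A) : X.El A → X.El B :=
  Quot.map (fun p => ⟨p.1, a ≫ p.2⟩) fun p q ⟨u, hu⟩ => ⟨u, by simp [← hu]⟩

@[simp] theorem res_cl {X : IndObj D} {A B : D} (a : B ⟶ A) (j : X.J) (f : A ⟶ X.F.obj j) :
    res a (X.cl j f) = X.cl j (a ≫ f) := rfl

/-- Morphisms: elements of `lim_i colim_j Hom(F i, G j)`. -/
@[ext] structure Hom (X Y : IndObj D) where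
  el : ∀ i, Y.El (X.F.obj i)
  compat : ∀ {i i' : X.J} (u : i ⟶ i'), res (X.F.map u) (el i') = el i

/-- the map `X(A) → Y(A)` given by a morphism -/
def Hom.app {X Y : IndObj D} (φ : Hom X Y) {A : D} : X.El A → Y.El A :=
  Quot.lift (fun p => res p.2 (φ.el p.1)) fun p q ⟨u, hu⟩ => by
    rw [← hu, ← φ.compat u]
    induction φ.el q.1 using El.ind
    simp

@[simp] theorem Hom.app_cl {X Y : IndObj D} (φ : Hom X Y) {A : D} (j : X.J)
    (f : A ⟶ X.F.obj j) : φ.app (X.cl j f) = res f (φ.el j) := rfl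

theorem Hom.app_res {X Y : IndObj D} (φ : Hom X Y) {A B : D} (a : B ⟶ A) (x : X.El A) :
    φ.app (res a x) = res a (φ.app x) := by
  induction x using El.ind with
  | h j f =>
    simp only [res_cl, app_cl]
    induction φ.el j using El.ind
    simp

instance : Category (IndObj D) where
  Hom := Hom
  id X := ⟨fun i => X.cl i (𝟙 _), fun u => by
    rw [← X.cl_map (𝟙 _) u]; simp⟩
  comp φ ψ := ⟨fun i => ψ.app (φ.el i), fun u => by rw [← ψ.app_res, φ.compat]⟩
  id_comp φ := Hom.ext <| funext fun i => by
    simp only [Hom.app_cl]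
    induction φ.el i using El.ind
    simp
  comp_id φ := Hom.ext <| funext fun i => by
    dsimp only
    induction φ.el i using El.ind
    simp
  assoc φ ψ χ := Hom.ext <| funext fun i => by
    dsimp only
    induction φ.el i using El.ind with
    | h j f => simp [Hom.app_res]

theorem hom_ext {X Y : IndObj D} {φ ψ : X ⟶ Y} (h : ∀ i, Hom.el φ i = Hom.el ψ i) : φ = ψ :=
  Hom.ext (funext h)

@[simp] theorem id_el (X : IndObj D) (i : X.J) : Hom.el (𝟙 X) i = X.cl i (𝟙 _) := rfl

@[simp] theorem comp_el {X Y Z : IndObj D} (φ : X ⟶ Y) (ψ : Y ⟶ Z) (i : X.J) :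
    Hom.el (φ ≫ ψ) i = Hom.app ψ (Hom.el φ i) := rfl

/-- a morphism given by a morphism of diagrams -/
def lev {X Y : IndObj D} (e : X.J ⥤ Y.J) (α : ∀ i, X.F.obj i ⟶ Y.F.obj (e.obj i))
    (h : ∀ {i i'} (u : i ⟶ i'), X.F.map u ≫ α i' = α i ≫ Y.F.map (e.map u)) : X ⟶ Y :=
  Hom.mk (fun i => Y.cl (e.obj i) (α i)) fun u => by
    rw [res_cl, h u]
    exact Y.cl_map _ (e.map u)

@[simp] theorem lev_el {X Y : IndObj D} (e : X.J ⥤ Y.J) (α : ∀ i, X.F.obj i ⟶ Y.F.obj (e.obj i))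
    (h : ∀ {i i'} (u : i ⟶ i'), X.F.map u ≫ α i' = α i ≫ Y.F.map (e.map u)) (i : X.J) :
    Hom.el (lev e α h) i = Y.cl (e.obj i) (α i) := rfl

variable [MonoidalCategory D]

/-- `colim_i F i ⊗ colim_j G j = colim_{(i,j)} F i ⊗ G j` -/
abbrev tens (X Y : IndObj D) : IndObj D where
  J := X.J × Y.J
  F :=
    { obj := fun i => X.F.obj i.1 ⊗ Y.F.obj i.2
      map := fun u => X.F.map u.1 ⊗ₘ Y.F.map u.2 }

theorem tens_map (X Y : IndObj D) {i i' : (tens X Y).J} (u : i ⟶ i') :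
    (tens X Y).F.map u = (X.F.map u.1 ⊗ₘ Y.F.map u.2) := rfl

/-- `X(A) × Y(B) → (X ⊗ Y)(A ⊗ B)` -/
def box {X Y : IndObj D} {A B : D} (x : X.El A) (y : Y.El B) : (tens X Y).El (A ⊗ B) :=
  Quot.map₂ (fun p q => ⟨(p.1, q.1), p.2 ⊗ₘ q.2⟩)
    (fun p q q' ⟨u, hu⟩ => ⟨((𝟙 p.1, u) : (p.1, q.1) ⟶ (p.1, q'.1)), by
      rw [tens_map, tensorHom_comp_tensorHom, hu, X.F.map_id, Category.comp_id]⟩)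
    (fun p p' q ⟨u, hu⟩ => ⟨((u, 𝟙 q.1) : (p.1, q.1) ⟶ (p'.1, q.1)), by
      rw [tens_map, tensorHom_comp_tensorHom, hu, Y.F.map_id, Category.comp_id]⟩) x y

@[simp] theorem box_cl {X Y : IndObj D} {A B : D} (i : X.J) (f : A ⟶ X.F.obj i) (j : Y.J)
    (g : B ⟶ Y.F.obj j) : box (X.cl i f) (Y.cl j g) = (tens X Y).cl (i, j) (f ⊗ₘ g) := rfl

/-- `φ ⊗ ψ` -/
def tensHom {X X' Y Y' : IndObj D} (φ : X ⟶ X') (ψ : Y ⟶ Y') : tens X Y ⟶ tens X' Y' :=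
  Hom.mk (fun i => box (Hom.el φ i.1) (Hom.el ψ i.2)) fun {i i'} u => by
    rw [← Hom.compat φ u.1, ← Hom.compat ψ u.2]
    induction Hom.el φ i'.1 using El.ind
    induction Hom.el ψ i'.2 using El.ind
    simp only [res_cl, box_cl, tens_map, tensorHom_comp_tensorHom]

@[simp] theorem tensHom_el {X X' Y Y' : IndObj D} (φ : X ⟶ X') (ψ : Y ⟶ Y') (i) :
    Hom.el (tensHom φ ψ) i = box (Hom.el φ i.1) (Hom.el ψ i.2) := rfl

variable (D) in
/-- An object of `D` as a formal colimit. -/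
def emb : D ⥤ IndObj D where
  obj A := ⟨Discrete PUnit, (Functor.const _).obj A⟩
  map {A B} f := lev (𝟭 _) (fun _ => f) fun u => (Category.id_comp f).trans (Category.comp_id f).symm
  map_id A := hom_ext fun i => rfl
  map_comp f g := hom_ext fun i => rfl

/-- associativity -/
def assoc (X Y Z : IndObj D) : tens (tens X Y) Z ≅ tens X (tens Y Z) where
  hom := lev (prod.associator _ _ _) (fun i => (α_ _ _ _).hom)
    fun u => associator_naturality (X.F.map u.1.1) (Y.F.map u.1.2) (Z.F.map u.2)
  inv := lev (prod.inverseAssociator _ _ _) (fun i => (α_ _ _ _).inv)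
    fun u => associator_inv_naturality (X.F.map u.1) (Y.F.map u.2.1) (Z.F.map u.2.2)
  hom_inv_id := hom_ext fun i => congrArg ((tens (tens X Y) Z).cl i) (Iso.hom_inv_id (α_ _ _ _))
  inv_hom_id := hom_ext fun i => congrArg ((tens X (tens Y Z)).cl i) (Iso.inv_hom_id (α_ _ _ _))

/-- left unit -/
def lunit (X : IndObj D) : tens ((emb D).obj (𝟙_ D)) X ≅ X where
  hom := lev (CategoryTheory.Prod.snd _ _) (fun i => (λ_ (X.F.obj i.2)).hom)
    fun {i i'} u => by
      refine Eq.trans ?_ (leftUnitor_naturality (X.F.map u.2))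
      rw [tens_map, ← id_tensorHom]
      rfl
  inv := lev (Functor.prod' ((Functor.const _).obj ⟨⟨⟩⟩) (𝟭 _)) (fun i => (λ_ (X.F.obj i)).inv)
    fun u => (leftUnitor_inv_naturality (X.F.map u)).trans (by rw [← id_tensorHom]; rfl)
  hom_inv_id := hom_ext fun i => congrArg ((tens _ X).cl i) (Iso.hom_inv_id (λ_ _))
  inv_hom_id := hom_ext fun i => congrArg (X.cl i) (Iso.inv_hom_id (λ_ _))

/-- right unit -/
def runit (X : IndObj D) : tens X ((emb D).obj (𝟙_ D)) ≅ X where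
  hom := lev (CategoryTheory.Prod.fst _ _) (fun i => (ρ_ (X.F.obj i.1)).hom)
    fun {i i'} u => by
      refine Eq.trans ?_ (rightUnitor_naturality (X.F.map u.1))
      rw [tens_map, ← tensorHom_id]
      rfl
  inv := lev (Functor.prod' (𝟭 _) ((Functor.const _).obj ⟨⟨⟩⟩)) (fun i => (ρ_ (X.F.obj i)).inv)
    fun u => (rightUnitor_inv_naturality (X.F.map u)).trans (by rw [← tensorHom_id]; rfl)
  hom_inv_id := hom_ext fun i => congrArg ((tens X _).cl i) (Iso.hom_inv_id (ρ_ _))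
  inv_hom_id := hom_ext fun i => congrArg (X.cl i) (Iso.inv_hom_id (ρ_ _))

instance : MonoidalCategoryStruct (IndObj D) where
  tensorObj := tens
  tensorUnit := (emb D).obj (𝟙_ D)
  tensorHom := tensHom
  whiskerLeft X _ _ ψ := tensHom (𝟙 X) ψ
  whiskerRight φ Y := tensHom φ (𝟙 Y)
  associator := assoc
  leftUnitor := lunit
  rightUnitor := runit

instance : MonoidalCategory (IndObj D) :=
  MonoidalCategory.ofTensorHom
    (id_tensorHom_id := fun X Y => hom_ext fun i =>
      congrArg ((tens X Y).cl i) (id_tensorHom_id _ _))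
    (id_tensorHom := fun _ _ _ _ => rfl)
    (tensorHom_id := fun _ _ => rfl)
    (tensorHom_comp_tensorHom := fun {X₁ Y₁ Z₁ X₂ Y₂ Z₂} f₁ f₂ g₁ g₂ => hom_ext fun i => by
      change Hom.app (tensHom g₁ g₂) (box (Hom.el f₁ i.1) (Hom.el f₂ i.2)) =
        box (Hom.app g₁ (Hom.el f₁ i.1)) (Hom.app g₂ (Hom.el f₂ i.2))
      induction Hom.el f₁ i.1 using El.ind with
      | h j₁ a₁ =>
      induction Hom.el f₂ i.2 using El.ind with
      | h j₂ a₂ =>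
      simp only [box_cl, Hom.app_cl, tensHom_el]
      induction Hom.el g₁ j₁ using El.ind
      induction Hom.el g₂ j₂ using El.ind
      simp only [box_cl, res_cl, tensorHom_comp_tensorHom])
    (associator_naturality := fun {X₁ X₂ X₃ Y₁ Y₂ Y₃} f₁ f₂ f₃ => hom_ext fun i => by
      change Hom.app (assoc Y₁ Y₂ Y₃).hom
          (box (box (Hom.el f₁ i.1.1) (Hom.el f₂ i.1.2)) (Hom.el f₃ i.2)) =
        res (α_ (X₁.F.obj i.1.1) (X₂.F.obj i.1.2) (X₃.F.obj i.2)).hom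
          (box (Hom.el f₁ i.1.1) (box (Hom.el f₂ i.1.2) (Hom.el f₃ i.2)))
      induction Hom.el f₁ i.1.1 using El.ind
      induction Hom.el f₂ i.1.2 using El.ind
      induction Hom.el f₃ i.2 using El.ind
      exact congrArg ((tens Y₁ (tens Y₂ Y₃)).cl _) (associator_naturality _ _ _))
    (leftUnitor_naturality := fun {X Y} f => hom_ext fun i => by
      change Hom.app (lunit Y).hom (box (((emb D).obj (𝟙_ D)).cl i.1 (𝟙 _)) (Hom.el f i.2)) =
        res (λ_ (X.F.obj i.2)).hom (Hom.el f i.2)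
      induction Hom.el f i.2 using El.ind
      refine congrArg (Y.cl _) (Eq.trans ?_ (leftUnitor_naturality _))
      rw [← id_tensorHom]
      rfl)
    (rightUnitor_naturality := fun {X Y} f => hom_ext fun i => by
      change Hom.app (runit Y).hom (box (Hom.el f i.1) (((emb D).obj (𝟙_ D)).cl i.2 (𝟙 _))) =
        res (ρ_ (X.F.obj i.1)).hom (Hom.el f i.1)
      induction Hom.el f i.1 using El.ind
      refine congrArg (Y.cl _) (Eq.trans ?_ (rightUnitor_naturality _))
      rw [← tensorHom_id]
      rfl)
    (pentagon := fun W X Y Z => hom_ext fun i => by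
      refine congrArg ((tens W (tens X (tens Y Z))).cl _)
        (Eq.trans ?_ (MonoidalCategory.pentagon _ _ _ _))
      rw [← id_tensorHom, ← tensorHom_id]
      rfl)
    (triangle := fun X Y => hom_ext fun i => by
      refine congrArg ((tens X Y).cl (i.1.1, i.2))
        (Eq.trans ?_ ((MonoidalCategory.triangle _ _).trans ?_))
      · rw [← id_tensorHom]
        rfl
      · rw [← tensorHom_id]
        rfl)

/-- the flip -/
def flip [BraidedCategory D] (X Y : IndObj D) : tens X Y ⟶ tens Y X :=
  lev (CategoryTheory.Prod.swap _ _) (fun i => (β_ (X.F.obj i.1) (Y.F.obj i.2)).hom)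
    fun u => BraidedCategory.braiding_naturality (X.F.map u.1) (Y.F.map u.2)

variable [SymmetricCategory D]

theorem flip_flip (X Y : IndObj D) : flip X Y ≫ flip Y X = 𝟙 (tens X Y) := hom_ext fun i =>
  congrArg ((tens X Y).cl i) (SymmetricCategory.symmetry _ _)

instance : BraidedCategory (IndObj D) where
  braiding X Y := ⟨flip X Y, flip Y X, flip_flip X Y, flip_flip Y X⟩
  braiding_naturality_right X Y Z f := hom_ext fun i => by
    change Hom.app (flip X Z) (box (X.cl i.1 (𝟙 _)) (Hom.el f i.2)) =
      res (β_ (X.F.obj i.1) (Y.F.obj i.2)).hom (box (Hom.el f i.2) (X.cl i.1 (𝟙 _)))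
    induction Hom.el f i.2 using El.ind
    exact congrArg ((tens Z X).cl _) (BraidedCategory.braiding_naturality _ _)
  braiding_naturality_left {X Y} f Z := hom_ext fun i => by
    change Hom.app (flip Y Z) (box (Hom.el f i.1) (Z.cl i.2 (𝟙 _))) =
      res (β_ (X.F.obj i.1) (Z.F.obj i.2)).hom (box (Z.cl i.2 (𝟙 _)) (Hom.el f i.1))
    induction Hom.el f i.1 using El.ind
    exact congrArg ((tens Z Y).cl _) (BraidedCategory.braiding_naturality _ _)
  hexagon_forward X Y Z := hom_ext fun i => by
    refine congrArg ((tens Y (tens Z X)).cl _)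
      (Eq.trans ?_ ((BraidedCategory.hexagon_forward _ _ _).trans ?_))
    · rfl
    · rw [← id_tensorHom, ← tensorHom_id]
      rfl
  hexagon_reverse X Y Z := hom_ext fun i => by
    refine congrArg ((tens (tens Z X) Y).cl _)
      (Eq.trans ?_ ((BraidedCategory.hexagon_reverse _ _ _).trans ?_))
    · rfl
    · rw [← id_tensorHom, ← tensorHom_id]
      rfl

instance : SymmetricCategory (IndObj D) where
  symmetry := flip_flip

section emb

variable {D : Type (u + 1)} [Category.{u} D] [MonoidalCategory D]

/-- `emb A ⊗ emb B = emb (A ⊗ B)` -/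
def embTens (A B : D) : (emb D).obj A ⊗ (emb D).obj B ≅ (emb D).obj (A ⊗ B) where
  hom := lev ((Functor.const _).obj ⟨⟨⟩⟩) (fun _ => 𝟙 (A ⊗ B)) fun _ => by
    change (𝟙 A ⊗ₘ 𝟙 B) ≫ 𝟙 (A ⊗ B) = 𝟙 (A ⊗ B) ≫ 𝟙 (A ⊗ B)
    simp
  inv := lev ((Functor.const _).obj (⟨⟨⟩⟩, ⟨⟨⟩⟩)) (fun _ => 𝟙 (A ⊗ B)) fun _ => by
    change 𝟙 (A ⊗ B) ≫ 𝟙 (A ⊗ B) = 𝟙 (A ⊗ B) ≫ (𝟙 A ⊗ₘ 𝟙 B)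
    simp
  hom_inv_id := hom_ext fun i => congrArg ((tens ((emb D).obj A) ((emb D).obj B)).cl i)
    (Category.id_comp _)
  inv_hom_id := hom_ext fun i => congrArg (((emb D).obj (A ⊗ B)).cl i) (Category.id_comp _)

variable (D) in
/-- the data exhibiting `emb` as a monoidal functor -/
def embCore : (emb D).CoreMonoidal where
  εIso := Iso.refl _
  μIso := embTens
  μIso_hom_natural_left {A B} f C := hom_ext fun i =>
    congrArg (((emb D).obj (B ⊗ C)).cl ⟨⟨⟩⟩) (by
      change (f ⊗ₘ 𝟙 C) ≫ 𝟙 (B ⊗ C) = 𝟙 (A ⊗ C) ≫ f ▷ C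
      simp)
  μIso_hom_natural_right {A B} C f := hom_ext fun i =>
    congrArg (((emb D).obj (C ⊗ B)).cl ⟨⟨⟩⟩) (by
      change (𝟙 C ⊗ₘ f) ≫ 𝟙 (C ⊗ B) = 𝟙 (C ⊗ A) ≫ C ◁ f
      simp)
  associativity A B C := hom_ext fun i =>
    congrArg (((emb D).obj (A ⊗ (B ⊗ C))).cl ⟨⟨⟩⟩) (by
      change (𝟙 (A ⊗ B) ⊗ₘ 𝟙 C) ≫ 𝟙 ((A ⊗ B) ⊗ C) ≫ (α_ A B C).hom =
        (α_ A B C).hom ≫ (𝟙 A ⊗ₘ 𝟙 (B ⊗ C)) ≫ 𝟙 (A ⊗ B ⊗ C)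
      simp)
  left_unitality A := hom_ext fun i =>
    congrArg (((emb D).obj A).cl ⟨⟨⟩⟩) (by
      change (λ_ A).hom = (𝟙 (𝟙_ D) ⊗ₘ 𝟙 A) ≫ 𝟙 (𝟙_ D ⊗ A) ≫ (λ_ A).hom
      simp)
  right_unitality A := hom_ext fun i =>
    congrArg (((emb D).obj A).cl ⟨⟨⟩⟩) (by
      change (ρ_ A).hom = (𝟙 A ⊗ₘ 𝟙 (𝟙_ D)) ≫ 𝟙 (A ⊗ 𝟙_ D) ≫ (ρ_ A).hom
      simp)

instance (D : Type (u + 1)) [Category.{u} D] [MonoidalCategory D] : (emb D).Monoidal := (embCore D).toMonoidal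

end emb

end IndObj

/-! ### Banach algebras given by weighted generators -/

section Alg

variable {k : Type u} [NormedField k]

/-- An algebra spanned by a weighted monoid. -/
structure APres (k : Type u) [NormedField k] where
  carrier : Type u
  [ring : Ring carrier]
  [alg : Algebra k carrier]
  Idx : Type u
  [mon : Monoid Idx]
  gen : Idx →* carrier
  wt : Idx →* ℝ≥0
  span : ∀ x, ∃ p : Idx →₀ k, Finsupp.linearCombination k gen p = x

attribute [instance] APres.ring APres.alg APres.mon

namespace APres

/-- the underlying weighted vector space -/
@[reducible] def pres (P : APres k) : Pres k := ⟨P.carrier, P.Idx, P.gen, P.wt, P.span⟩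

/-- the algebraic tensor product -/
def tensA (P Q : APres k) : APres k where
  carrier := P.carrier ⊗[k] Q.carrier
  Idx := P.Idx × Q.Idx
  gen :=
    { toFun := fun l => P.gen l.1 ⊗ₜ Q.gen l.2
      map_one' := by simp [Algebra.TensorProduct.one_def]
      map_mul' := by simp }
  wt := (P.wt.comp (MonoidHom.fst _ _)) * (Q.wt.comp (MonoidHom.snd _ _))
  span x := by
    induction x with
    | zero => exact ⟨0, map_zero _⟩
    | tmul a b =>
      obtain ⟨p, rfl⟩ := P.span a
      obtain ⟨p', rfl⟩ := Q.span b
      refine ⟨p.sum fun i c => p'.sum fun j c' => .single (i, j) (c * c'), ?_⟩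
      change Finsupp.linearCombination k (fun l : P.Idx × Q.Idx => P.gen l.1 ⊗ₜ[k] Q.gen l.2) _ = _
      simp only [Finsupp.sum, map_sum, Finsupp.linearCombination_single]
      simp only [Finsupp.linearCombination_apply, Finsupp.sum, TensorProduct.sum_tmul,
        TensorProduct.tmul_sum, TensorProduct.smul_tmul_smul]
      rw [Finset.sum_comm]
    | add x y hx hy =>
      obtain ⟨p, rfl⟩ := hx
      obtain ⟨p', rfl⟩ := hy
      exact ⟨p + p', map_add _ _ _⟩

variable [IsUltrametricDist k]

/-- the completed algebra -/
abbrev ban (P : APres k) : Ban k := P.pres.ban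

/-- the map to the completion -/
def tb (P : APres k) : P.carrier →ₗ[k] P.ban := P.pres.toBan

/-- the seminorm on the algebra -/
def nrm (P : APres k) (x : P.carrier) : ℝ := P.pres.nm x

theorem norm_tb (P : APres k) (x : P.carrier) : ‖P.tb x‖ = P.nrm x := P.pres.norm_toBan x

theorem nrm_gen_le (P : APres k) (l : P.Idx) : P.nrm (P.gen l) ≤ P.wt l := P.pres.norm_gen_le l

theorem nrm_nonneg (P : APres k) (x : P.carrier) : 0 ≤ P.nrm x := NNReal.coe_nonneg _

theorem nrm_mul_le (P : APres k) (x y : P.carrier) : P.nrm (x * y) ≤ P.nrm x * P.nrm y := by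
  have h₁ : ∀ m, P.nrm (x * P.gen m) ≤ P.wt m * P.nrm x := fun m => by
    have := P.pres.bound (P.tb ∘ₗ LinearMap.mulRight k (P.gen m)) (P.wt m) (fun l => by
      have := P.nrm_gen_le (l * m)
      rw [map_mul, map_mul, NNReal.coe_mul, mul_comm (P.wt l : ℝ)] at this
      exact (P.norm_tb _).trans_le this) x
    exact (P.norm_tb _).symm.trans_le this
  have := P.pres.bound (P.tb ∘ₗ LinearMap.mulLeft k x) (P.pres.nm x)
    (fun m => (P.norm_tb _).trans_le ((h₁ m).trans_eq (mul_comm _ _))) y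
  exact (P.norm_tb _).symm.trans_le this

theorem nrm_one_le (P : APres k) : P.nrm 1 ≤ 1 := by
  have := P.nrm_gen_le 1
  rwa [map_one, map_one] at this

theorem nrm_smul_le (P : APres k) (a : k) (x : P.carrier) : P.nrm (a • x) ≤ ‖a‖ * P.nrm x :=
  P.pres.nm_smul_le a x

theorem nrm_add_le (P : APres k) (x y : P.carrier) : P.nrm (x + y) ≤ max (P.nrm x) (P.nrm y) := by
  exact_mod_cast P.pres.nm_add_le_max x y

end APres

variable [IsUltrametricDist k]

/-- Bilinear maps on presented spaces, bounded by `1` on the spanning families, extend. -/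
def Pres.lift₂ (P Q : Pres k) {X : Ban k} (f : P.carrier →ₗ[k] Q.carrier →ₗ[k] X)
    (h : ∀ l m, ‖f (P.gen l) (Q.gen m)‖ ≤ P.wt l * Q.wt m) :
    (tens P.ban Q.ban).ban ⟶ X :=
  have h₁ : ∀ l y, ‖f (P.gen l) y‖ ≤ P.wt l * ‖y‖ := fun l => Q.bound (f (P.gen l)) (P.wt l) (h l)
  have h₂ : ∀ y, ∃ C : ℝ≥0, ∀ l, ‖f.flip y (P.gen l)‖ ≤ C * P.wt l := fun y =>
    ⟨‖y‖₊, fun l => (h₁ l y).trans_eq (mul_comm _ _)⟩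
  have h₃ : ∀ m x, ‖P.liftPar f.flip h₂ (Q.gen m) x‖ ≤ Q.wt m * ‖x‖ := fun m x =>
    P.liftPar_bound _ h₂ _ _ (fun l => (h l m).trans_eq (mul_comm _ _)) x
  have h₄ : ∀ x, ∃ C : ℝ≥0, ∀ m, ‖(P.liftPar f.flip h₂).flip x (Q.gen m)‖ ≤ C * Q.wt m :=
    fun x => ⟨‖x‖₊, fun m => (h₃ m x).trans_eq (mul_comm _ _)⟩
  tlift (Q.liftPar (P.liftPar f.flip h₂).flip h₄) 1 fun x y => by
    rw [NNReal.coe_one, one_mul]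
    exact Q.liftPar_bound _ h₄ x ‖x‖₊ (fun m => (h₃ m x).trans_eq (mul_comm _ _)) y

@[simp] theorem Pres.lift₂_tmk (P Q : Pres k) {X : Ban k} (f : P.carrier →ₗ[k] Q.carrier →ₗ[k] X)
    (h : ∀ l m, ‖f (P.gen l) (Q.gen m)‖ ≤ P.wt l * Q.wt m) (x : P.carrier) (y : Q.carrier) :
    P.lift₂ Q f h (tmk _ _ (P.toBan x) (Q.toBan y)) = f x y := by
  simp [lift₂]

theorem Pres.ban_ext' {P : Pres k} {X : Ban k} {f g : P.ban ⟶ X}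
    (h : ∀ x, f (P.toBan x) = g (P.toBan x)) : f = g := ban_ext fun _ => h _

namespace APres

variable (P Q : APres k)

/-- multiplication -/
def mulB : (tens P.ban P.ban).ban ⟶ P.ban :=
  P.pres.lift₂ P.pres ((LinearMap.mul k P.carrier).compr₂ P.tb) fun l m => by
    have := P.nrm_gen_le (l * m)
    rw [map_mul, map_mul, NNReal.coe_mul] at this
    rw [LinearMap.compr₂_apply, LinearMap.mul_apply', norm_tb]
    exact this

@[simp] theorem mulB_tmk (x y : P.carrier) :
    P.mulB (tmk _ _ (P.tb x) (P.tb y)) = P.tb (x * y) :=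
  Pres.lift₂_tmk _ _ _ _ _ _

/-- a bounded linear map between algebras -/
def map (f : P.carrier →ₗ[k] Q.carrier)
    (h : ∀ l, Q.nrm (f (P.gen l)) ≤ P.wt l) : P.ban ⟶ Q.ban :=
  P.pres.lift (Q.tb ∘ₗ f) 1 fun l => by
    rw [NNReal.coe_one, one_mul, LinearMap.comp_apply, norm_tb]
    exact h l

@[simp] theorem map_toBan (f : P.carrier →ₗ[k] Q.carrier)
    (h : ∀ l, Q.nrm (f (P.gen l)) ≤ P.wt l) (x : P.carrier) :
    P.map Q f h (P.tb x) = Q.tb (f x) :=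
  Pres.lift_toBan _ _ _ _ _

/-- from the algebraic to the completed tensor product -/
def toTens : (tensA P Q).ban ⟶ (tens P.ban Q.ban).ban :=
  (tensA P Q).pres.lift
    (TensorProduct.lift ((tmk P.ban Q.ban).compl₁₂ P.tb Q.tb)) 1 fun l => by
      refine (norm_tmk_le (A := P.ban) (B := Q.ban) _ _).trans ?_
      rw [NNReal.coe_one, one_mul, norm_tb, norm_tb]
      exact mul_le_mul (P.nrm_gen_le l.1) (Q.nrm_gen_le l.2) (Q.nrm_nonneg _)
        (NNReal.coe_nonneg _)

variable [CompleteSpace k]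

/-- the unit -/
def oneB : unitBan k ⟶ P.ban :=
  ⟨uval.smulRight (P.tb 1), ‖P.tb 1‖₊, fun a => by
    rw [LinearMap.smulRight_apply, norm_smul, mul_comm]
    exact le_rfl⟩

theorem oneB_apply (a : unitBan k) : P.oneB a = uval a • P.tb 1 := rfl

instance : MonObj P.ban where
  one := P.oneB
  mul := P.mulB
  one_mul := tens_ext (f := tmap P.oneB (𝟙 _) ≫ P.mulB) (g := tleft _) fun a x => by
    simp only [Ban.comp_apply, tmap_tmk, oneB_apply, Ban.id_apply, tleft_tmk, map_smul,
      LinearMap.smul_apply]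
    congr 1
    exact congrArg (fun G : P.ban ⟶ P.ban => G x)
      (Pres.ban_ext' (f := tmkL _ (P.tb 1) ≫ P.mulB) (g := 𝟙 _) fun x =>
        (P.mulB_tmk 1 x).trans (congrArg P.tb (_root_.one_mul x)))
  mul_one := tens_ext (f := tmap (𝟙 _) P.oneB ≫ P.mulB) (g := tright _) fun x a => by
    simp only [Ban.comp_apply, tmap_tmk, oneB_apply, Ban.id_apply, tright_tmk, map_smul,
      LinearMap.smul_apply]
    congr 1
    exact congrArg (fun G : P.ban ⟶ P.ban => G x)
      (Pres.ban_ext' (f := tmkR _ (P.tb 1) ≫ P.mulB) (g := 𝟙 _) fun x =>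
        (P.mulB_tmk x 1).trans (congrArg P.tb (_root_.mul_one x)))
  mul_assoc := tens_ext₃ (f := tmap P.mulB (𝟙 _) ≫ P.mulB)
    (g := tassoc _ _ _ ≫ tmap (𝟙 _) P.mulB ≫ P.mulB) fun x y z => by
    revert z
    refine fun z => congrArg (fun G : P.ban ⟶ P.ban => G z) (Pres.ban_ext'
      (f := tmkL _ (tmk _ _ x y) ≫ tmap P.mulB (𝟙 _) ≫ P.mulB)
      (g := tmkL _ (tmk _ _ x y) ≫ tassoc _ _ _ ≫ tmap (𝟙 _) P.mulB ≫ P.mulB) fun z => ?_)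
    refine congrArg (fun G : P.ban ⟶ P.ban => G y) (Pres.ban_ext'
      (f := tmkL _ x ≫ tmkR _ (P.tb z) ≫ tmap P.mulB (𝟙 _) ≫ P.mulB)
      (g := tmkL _ x ≫ tmkR _ (P.tb z) ≫ tassoc _ _ _ ≫ tmap (𝟙 _) P.mulB ≫ P.mulB)
      fun y => ?_)
    refine congrArg (fun G : P.ban ⟶ P.ban => G x) (Pres.ban_ext'
      (f := tmkR _ (P.tb y) ≫ tmkR _ (P.tb z) ≫ tmap P.mulB (𝟙 _) ≫ P.mulB)
      (g := tmkR _ (P.tb y) ≫ tmkR _ (P.tb z) ≫ tassoc _ _ _ ≫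
        tmap (𝟙 _) P.mulB ≫ P.mulB)
      fun x => ?_)
    change P.mulB (tmap P.mulB (𝟙 _) (tmk _ _ (tmk _ _ (P.tb x) (P.tb y))
      (P.tb z))) = P.mulB (tmap (𝟙 _) P.mulB (tassoc _ _ _ (tmk _ _ (tmk _ _
        (P.tb x) (P.tb y)) (P.tb z))))
    rw [tmap_tmk, mulB_tmk, tassoc_tmk, tmap_tmk, mulB_tmk, Ban.id_apply, Ban.id_apply,
      mulB_tmk, mulB_tmk, _root_.mul_assoc]

end APres

/-- The algebra generated by `X` subject to relations `rel`, with the words in `X` weighted by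
the products of the weights of their letters. -/
def wordAlg (k : Type u) [NormedField k] {X : Type u} (w : X → ℝ≥0)
    (rel : FreeAlgebra k X → FreeAlgebra k X → Prop) : APres k where
  carrier := RingQuot rel
  Idx := FreeMonoid X
  gen := FreeMonoid.lift fun x => RingQuot.mkAlgHom k rel (FreeAlgebra.ι k x)
  wt := FreeMonoid.lift w
  span x := by
    obtain ⟨x, rfl⟩ := RingQuot.mkAlgHom_surjective k rel x
    induction x using FreeAlgebra.induction with
    | grade0 a => exact ⟨.single 1 a, by simp [Algebra.algebraMap_eq_smul_one]⟩
    | grade1 x => exact ⟨.single (.of x) 1, by simp⟩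
    | add x y hx hy =>
      obtain ⟨p, hp⟩ := hx
      obtain ⟨p', hp'⟩ := hy
      exact ⟨p + p', by rw [map_add, map_add, hp, hp']⟩
    | mul x y hx hy =>
      obtain ⟨p, hp⟩ := hx
      obtain ⟨p', hp'⟩ := hy
      refine ⟨p.sum fun i c => p'.sum fun j c' => .single (i * j) (c * c'), ?_⟩
      rw [map_mul, ← hp, ← hp']
      simp only [Finsupp.sum, map_sum, Finsupp.linearCombination_single]
      simp only [Finsupp.linearCombination_apply, Finsupp.sum, Finset.sum_mul, Finset.mul_sum]
      rw [Finset.sum_comm]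
      simp [smul_smul, mul_comm]

theorem word_bound {X : Type u} {w : X → ℝ≥0} {A : Type*} [Monoid A] (N : A → ℝ)
    (h₀ : ∀ a, 0 ≤ N a) (h₁ : N 1 ≤ 1) (hm : ∀ a b, N (a * b) ≤ N a * N b)
    (f : FreeMonoid X →* A) (hf : ∀ x, N (f (.of x)) ≤ w x) (l : FreeMonoid X) :
    N (f l) ≤ FreeMonoid.lift w l := by
  induction l using FreeMonoid.inductionOn' with
  | one => simpa using h₁
  | of_mul x l ih =>
    rw [map_mul, map_mul, NNReal.coe_mul, FreeMonoid.lift_eval_of]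
    exact (hm _ _).trans (mul_le_mul (hf x) ih (h₀ _) (NNReal.coe_nonneg _))

end Alg

/-! ### Root data and the analytic quantum group -/

/-- A root datum with weight lattice `Φ` and simple roots indexed by `I`, a deformation parameter
`q ∈ k` of norm one that is not a root of unity, and two radii `r`, `s` with
`1 ≤ |q_i - q_i⁻¹| r s`. -/
structure QuantumDatum (k I Φ : Type u) [NormedField k] [AddCommGroup Φ] where
  /-- simple roots, a basis of the root lattice -/
  root : I → Φ
  root_indep : LinearIndependent ℤ root
  /-- the symmetric form -/
  form : Φ →ₗ[ℤ] Φ →ₗ[ℤ] ℚ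
  form_symm : ∀ a b, form a b = form b a
  /-- `(α_i, α_i) / 2` -/
  d : I → ℕ
  d_pos : ∀ i, 0 < d i
  form_self : ∀ i, form (root i) (root i) = 2 * d i
  form_nonpos : ∀ i j, i ≠ j → form (root i) (root j) ≤ 0
  /-- simple coroots -/
  coroot : I → (Φ →ₗ[ℤ] ℤ)
  coroot_apply : ∀ i a, (coroot i a : ℚ) = 2 * form (root i) a / form (root i) (root i)
  q : k
  norm_q : ‖q‖ = 1
  q_pow_ne_one : ∀ n : ℕ, 0 < n → q ^ n ≠ 1
  r : ℝ≥0
  s : ℝ≥0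
  r_pos : 0 < r
  s_pos : 0 < s
  le_mul : ∀ i, 1 ≤ ‖q ^ d i - (q ^ d i)⁻¹‖₊ * r * s

/-- Generators `F_i`, `t_β` of `f_r ⋊ H'`; here `β` runs through the root lattice `ℤ^I`. -/
inductive CGen (I : Type u) : Type u
  | F (i : I)
  | t (b : I →₀ ℤ)

/-- Generators `E_i`, `F_i`, `K_λ` of the quantum group. -/
inductive UGen (I Φ : Type u) [AddCommGroup Φ] : Type u
  | E (i : I)
  | F (i : I)
  | K (l : Φ →ₗ[ℤ] ℤ)

/-- Generators `E_i`, `K_λ` of `H ⋉ f_s`. -/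
inductive BGen (I Φ : Type u) [AddCommGroup Φ] : Type u
  | E (i : I)
  | K (l : Φ →ₗ[ℤ] ℤ)

namespace QuantumDatum

variable {k I Φ : Type u} [NormedField k] [AddCommGroup Φ] (D : QuantumDatum k I Φ)

/-- the element `∑ b_i α_i` of the root lattice -/
def wt (b : I →₀ ℤ) : Φ := Finsupp.linearCombination ℤ D.root b

/-- The coweight `∑ b_i d_i λ_i`, so that `t_β` maps to `K_{ν β}` and `ν(β)(γ) = (β, γ)`. -/
def nu (b : I →₀ ℤ) : Φ →ₗ[ℤ] ℤ :=
  Finsupp.linearCombination ℤ (fun i => (D.d i : ℤ) • D.coroot i) b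

/-- `d_i λ_i` -/
abbrev nu1 (i : I) : Φ →ₗ[ℤ] ℤ := D.nu (.single i 1)

/-- `q_i - q_i⁻¹` -/
def qq (i : I) : k := D.q ^ D.d i - (D.q ^ D.d i)⁻¹

theorem nu1_apply (i : I) (a : Φ) : (D.nu1 i a : ℚ) = D.form (D.root i) a := by
  have h : (D.d i : ℚ) ≠ 0 := by exact_mod_cast (D.d_pos i).ne'
  simp only [nu1, nu, Finsupp.linearCombination_single, one_smul, LinearMap.smul_apply,
    smul_eq_mul]
  push_cast
  rw [D.coroot_apply, D.form_self]
  field_simp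

theorem nu1_symm (i j : I) : D.nu1 i (D.root j) = D.nu1 j (D.root i) := by
  have : (D.nu1 i (D.root j) : ℚ) = D.nu1 j (D.root i) := by
    rw [nu1_apply, nu1_apply, D.form_symm]
  exact_mod_cast this

theorem q_ne_zero : D.q ≠ 0 := norm_pos_iff.1 (by rw [D.norm_q]; exact one_pos)

theorem norm_q_zpow (n : ℤ) : ‖D.q ^ n‖ = 1 := by rw [norm_zpow, D.norm_q, one_zpow]

/-! #### The Hopf algebra `C = f_r ⋊ H'` -/

/-- Relations of the bosonization of `T(V) / J`. -/
inductive CRel (J : Set (FreeAlgebra k I)) : FreeAlgebra k (CGen I) → FreeAlgebra k (CGen I) → Prop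
  | one : CRel J (.ι k (.t 0)) 1
  | add (b c : I →₀ ℤ) : CRel J (.ι k (.t (b + c))) (.ι k (.t b) * .ι k (.t c))
  | comm (b : I →₀ ℤ) (i : I) : CRel J (.ι k (.t b) * .ι k (.F i))
      (D.q ^ (-(D.nu b (D.root i))) • (.ι k (.F i) * .ι k (.t b)))
  | nichols (x : FreeAlgebra k I) (hx : x ∈ J) :
      CRel J (FreeAlgebra.lift k (fun i => FreeAlgebra.ι k (CGen.F i)) x) 0

/-- The bosonization of `T(V) / J`. -/
abbrev CAlg (J : Set (FreeAlgebra k I)) : Type u := RingQuot (D.CRel J)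

/-- generator of `CAlg` -/
def cg (J : Set (FreeAlgebra k I)) (g : CGen I) : D.CAlg J :=
  RingQuot.mkAlgHom k (D.CRel J) (FreeAlgebra.ι k g)

/-- `F_i ↦ F_i ⊗ 1 + t_i⁻¹ ⊗ F_i` -/
def copF (J : Set (FreeAlgebra k I)) : FreeAlgebra k I →ₐ[k] D.CAlg J ⊗[k] D.CAlg J :=
  FreeAlgebra.lift k fun i =>
    D.cg J (.F i) ⊗ₜ 1 + D.cg J (.t (.single i (-1))) ⊗ₜ D.cg J (.F i)

/-- `J` consists of multihomogeneous elements of `T(V)` of degree at least two and generates a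
coideal (for the braided comultiplication of `T(V)`, here written in the bosonization). -/
def Admissible (J : Set (FreeAlgebra k I)) : Prop :=
  ∀ x ∈ J, (∃ m : Multiset I, 2 ≤ m.card ∧
      x ∈ Submodule.span k {y | ∃ l : List I, (l : Multiset I) = m ∧
        y = (l.map (FreeAlgebra.ι k)).prod}) ∧
    D.copF J x = 0

/-- Homogeneous generators of the defining ideal of the Nichols algebra of `V`: the largest
homogeneous ideal of `T(V)` which is generated in degrees at least two and is a coideal. -/
def nichols : Set (FreeAlgebra k I) := {x | ∃ J, D.Admissible J ∧ x ∈ J}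

/-- A map out of the bosonization. -/
def cLift {J : Set (FreeAlgebra k I)} {A : Type u} [Ring A] [Algebra k A] (f : CGen I → A)
    (h₁ : f (.t 0) = 1) (h₂ : ∀ b c, f (.t (b + c)) = f (.t b) * f (.t c))
    (h₃ : ∀ b i, f (.t b) * f (.F i) = D.q ^ (-(D.nu b (D.root i))) • (f (.F i) * f (.t b)))
    (h₄ : ∀ x ∈ J, FreeAlgebra.lift k (fun i => f (.F i)) x = 0) : D.CAlg J →ₐ[k] A :=
  RingQuot.liftAlgHom k ⟨FreeAlgebra.lift k f, fun x y h => by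
    induction h with
    | one => simpa using h₁
    | add b c => simpa using h₂ b c
    | comm b i => simpa using h₃ b i
    | nichols x hx =>
      rw [map_zero, ← h₄ x hx, ← AlgHom.comp_apply]
      congr 1
      ext i
      simp⟩

@[simp] theorem cLift_cg {J : Set (FreeAlgebra k I)} {A : Type u} [Ring A] [Algebra k A]
    (f : CGen I → A) (h₁ h₂ h₃ h₄) (g : CGen I) :
    D.cLift (J := J) f h₁ h₂ h₃ h₄ (D.cg J g) = f g := by
  simp [cLift, cg]

theorem cg_one (J : Set (FreeAlgebra k I)) : D.cg J (.t 0) = 1 := by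
  rw [cg, RingQuot.mkAlgHom_rel k (CRel.one (D := D) (J := J)), map_one]

theorem cg_add (J : Set (FreeAlgebra k I)) (b c : I →₀ ℤ) :
    D.cg J (.t (b + c)) = D.cg J (.t b) * D.cg J (.t c) := by
  rw [cg, RingQuot.mkAlgHom_rel k (CRel.add (D := D) (J := J) b c), map_mul]
  rfl

theorem cg_comm (J : Set (FreeAlgebra k I)) (b : I →₀ ℤ) (i : I) :
    D.cg J (.t b) * D.cg J (.F i) =
      D.q ^ (-(D.nu b (D.root i))) • (D.cg J (.F i) * D.cg J (.t b)) := by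
  have := RingQuot.mkAlgHom_rel k (CRel.comm (D := D) (J := J) b i)
  rwa [map_mul, map_smul, map_mul] at this

theorem cg_nichols (J : Set (FreeAlgebra k I)) (x : FreeAlgebra k I) (hx : x ∈ J) :
    FreeAlgebra.lift k (fun i => D.cg J (.F i)) x = 0 := by
  have := RingQuot.mkAlgHom_rel k (CRel.nichols (D := D) x hx)
  rw [map_zero, ← AlgHom.comp_apply] at this
  rw [← this]
  congr 1
  ext i
  simp [cg]

/-- enlarging `J` -/
def cMono {J J' : Set (FreeAlgebra k I)} (h : J ⊆ J') : D.CAlg J →ₐ[k] D.CAlg J' :=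
  D.cLift (D.cg J') (D.cg_one J') (D.cg_add J') (D.cg_comm J')
    fun x hx => D.cg_nichols J' x (h hx)

theorem copF_nichols (x : FreeAlgebra k I) (hx : x ∈ D.nichols) : D.copF D.nichols x = 0 := by
  obtain ⟨J, hJ, hx⟩ := hx
  have hs : J ⊆ D.nichols := fun y hy => ⟨J, hJ, hy⟩
  have h : D.copF D.nichols =
      (Algebra.TensorProduct.map (D.cMono hs) (D.cMono hs)).comp (D.copF J) := by
    ext i
    simp [copF, cMono]
  rw [h, AlgHom.comp_apply, (hJ x hx).2, map_zero]

theorem nichols_lift {x : FreeAlgebra k I} (hx : x ∈ D.nichols) {A : Type u} [Ring A]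
    [Algebra k A] (f : I → A) (hf : ∀ i j, f i * f j = 0) : FreeAlgebra.lift k f x = 0 := by
  obtain ⟨J, hJ, hx⟩ := hx
  obtain ⟨⟨m, hm, hx⟩, -⟩ := hJ x hx
  refine (Submodule.span_le (p := LinearMap.ker (FreeAlgebra.lift k f).toLinearMap)).2 ?_ hx
  rintro _ ⟨l, rfl, rfl⟩
  rcases l with - | ⟨i, - | ⟨j, l⟩⟩
  · simp at hm
  · simp at hm
  · simp [← mul_assoc, hf]

theorem nichols_counit {x : FreeAlgebra k I} (hx : x ∈ D.nichols) {A : Type u} [Ring A]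
    [Algebra k A] : FreeAlgebra.lift k (fun _ : I => (0 : A)) x = 0 :=
  D.nichols_lift hx _ (by simp)

/-- the comultiplication of `C` on generators -/
def cCopGen : CGen I → D.CAlg D.nichols ⊗[k] D.CAlg D.nichols
  | .F i => D.cg _ (.F i) ⊗ₜ 1 + D.cg _ (.t (.single i (-1))) ⊗ₜ D.cg _ (.F i)
  | .t b => D.cg _ (.t b) ⊗ₜ D.cg _ (.t b)

/-- comultiplication of `C` -/
def cCop : D.CAlg D.nichols →ₐ[k] D.CAlg D.nichols ⊗[k] D.CAlg D.nichols :=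
  D.cLift D.cCopGen
    (by simp [cCopGen, cg_one, Algebra.TensorProduct.one_def])
    (fun b c => by simp [cCopGen, cg_add])
    (fun b i => by
      simp only [cCopGen, mul_add, add_mul, Algebra.TensorProduct.tmul_mul_tmul, mul_one, one_mul, smul_add,
        cg_comm]
      rw [← cg_add, ← cg_add, add_comm b, TensorProduct.smul_tmul', TensorProduct.tmul_smul])
    D.copF_nichols

theorem cCop_cg (g : CGen I) : D.cCop (D.cg _ g) = D.cCopGen g :=
  (RingQuot.liftAlgHom_mkAlgHom_apply k _ _ _).trans (FreeAlgebra.lift_ι_apply _ _)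

/-- counit of `C` -/
def cCounit : D.CAlg D.nichols →ₐ[k] k :=
  D.cLift
    (fun
      | .F _ => 0
      | .t _ => 1)
    rfl (by simp) (by simp) fun x hx => D.nichols_counit hx

/-! #### The quantum group -/

/-- Relations of the quantum group. -/
inductive URel : FreeAlgebra k (UGen I Φ) → FreeAlgebra k (UGen I Φ) → Prop
  | one : URel (.ι k (.K 0)) 1
  | add (l m : Φ →ₗ[ℤ] ℤ) : URel (.ι k (.K (l + m))) (.ι k (.K l) * .ι k (.K m))
  | KF (l : Φ →ₗ[ℤ] ℤ) (i : I) : URel (.ι k (.K l) * .ι k (.F i))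
      (D.q ^ (-(l (D.root i))) • (.ι k (.F i) * .ι k (.K l)))
  | KE (l : Φ →ₗ[ℤ] ℤ) (i : I) : URel (.ι k (.K l) * .ι k (.E i))
      (D.q ^ (l (D.root i)) • (.ι k (.E i) * .ι k (.K l)))
  | EF_ne (i j : I) (h : i ≠ j) : URel (.ι k (.E i) * .ι k (.F j)) (.ι k (.F j) * .ι k (.E i))
  | EF (i : I) : URel (.ι k (.E i) * .ι k (.F i)) (.ι k (.F i) * .ι k (.E i) +
      (D.qq i)⁻¹ • (.ι k (.K (D.nu1 i)) - .ι k (.K (-D.nu1 i))))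
  | nicholsF (x : FreeAlgebra k I) (hx : x ∈ D.nichols) :
      URel (FreeAlgebra.lift k (fun i => FreeAlgebra.ι k (UGen.F i)) x) 0
  | nicholsE (x : FreeAlgebra k I) (hx : x ∈ D.nichols) :
      URel (FreeAlgebra.lift k (fun i => FreeAlgebra.ι k (UGen.E i)) x) 0

/-- The algebraic quantum group, with `t_i = K_{d_i λ_i}`. -/
abbrev UAlg : Type u := RingQuot D.URel

/-- generator of `UAlg` -/
def ug (g : UGen I Φ) : D.UAlg := RingQuot.mkAlgHom k D.URel (FreeAlgebra.ι k g)

/-- A map out of the quantum group. -/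
def uLift {A : Type u} [Ring A] [Algebra k A] (f : UGen I Φ → A)
    (h₁ : f (.K 0) = 1) (h₂ : ∀ l m, f (.K (l + m)) = f (.K l) * f (.K m))
    (h₃ : ∀ l i, f (.K l) * f (.F i) = D.q ^ (-(l (D.root i))) • (f (.F i) * f (.K l)))
    (h₄ : ∀ l i, f (.K l) * f (.E i) = D.q ^ (l (D.root i)) • (f (.E i) * f (.K l)))
    (h₅ : ∀ i j, i ≠ j → f (.E i) * f (.F j) = f (.F j) * f (.E i))
    (h₆ : ∀ i, f (.E i) * f (.F i) = f (.F i) * f (.E i) +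
      (D.qq i)⁻¹ • (f (.K (D.nu1 i)) - f (.K (-D.nu1 i))))
    (h₇ : ∀ x ∈ D.nichols, FreeAlgebra.lift k (fun i => f (.F i)) x = 0)
    (h₈ : ∀ x ∈ D.nichols, FreeAlgebra.lift k (fun i => f (.E i)) x = 0) : D.UAlg →ₐ[k] A :=
  RingQuot.liftAlgHom k ⟨FreeAlgebra.lift k f, fun x y h => by
    induction h with
    | one => simpa using h₁
    | add b c => simpa using h₂ b c
    | KF b i => simpa using h₃ b i
    | KE b i => simpa using h₄ b i
    | EF_ne i j h => simpa using h₅ i j h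
    | EF i => simpa using h₆ i
    | nicholsF x hx =>
      rw [map_zero, ← h₇ x hx, ← AlgHom.comp_apply]
      congr 1
      ext i
      simp
    | nicholsE x hx =>
      rw [map_zero, ← h₈ x hx, ← AlgHom.comp_apply]
      congr 1
      ext i
      simp⟩

@[simp] theorem uLift_ug {A : Type u} [Ring A] [Algebra k A]
    (f : UGen I Φ → A) (h₁ h₂ h₃ h₄ h₅ h₆ h₇ h₈) (g : UGen I Φ) :
    D.uLift f h₁ h₂ h₃ h₄ h₅ h₆ h₇ h₈ (D.ug g) = f g := by
  simp [uLift, ug]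

theorem ug_one : D.ug (.K 0) = 1 := by
  rw [ug, RingQuot.mkAlgHom_rel k (URel.one (D := D)), map_one]

theorem ug_add (l m : Φ →ₗ[ℤ] ℤ) : D.ug (.K (l + m)) = D.ug (.K l) * D.ug (.K m) := by
  rw [ug, RingQuot.mkAlgHom_rel k (URel.add (D := D) l m), map_mul]
  rfl

theorem ug_KF (l : Φ →ₗ[ℤ] ℤ) (i : I) : D.ug (.K l) * D.ug (.F i) =
    D.q ^ (-(l (D.root i))) • (D.ug (.F i) * D.ug (.K l)) := by
  have := RingQuot.mkAlgHom_rel k (URel.KF (D := D) l i)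
  rwa [map_mul, map_smul, map_mul] at this

theorem ug_KE (l : Φ →ₗ[ℤ] ℤ) (i : I) : D.ug (.K l) * D.ug (.E i) =
    D.q ^ (l (D.root i)) • (D.ug (.E i) * D.ug (.K l)) := by
  have := RingQuot.mkAlgHom_rel k (URel.KE (D := D) l i)
  rwa [map_mul, map_smul, map_mul] at this

theorem ug_EF_ne (i j : I) (h : i ≠ j) : D.ug (.E i) * D.ug (.F j) = D.ug (.F j) * D.ug (.E i) := by
  have := RingQuot.mkAlgHom_rel k (URel.EF_ne (D := D) i j h)
  rwa [map_mul, map_mul] at this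

theorem ug_EF (i : I) : D.ug (.E i) * D.ug (.F i) = D.ug (.F i) * D.ug (.E i) +
    (D.qq i)⁻¹ • (D.ug (.K (D.nu1 i)) - D.ug (.K (-D.nu1 i))) := by
  have := RingQuot.mkAlgHom_rel k (URel.EF (D := D) i)
  rwa [map_add, map_mul, map_mul, map_smul, map_sub] at this

theorem ug_nicholsF (x : FreeAlgebra k I) (hx : x ∈ D.nichols) :
    FreeAlgebra.lift k (fun i => D.ug (.F i)) x = 0 := by
  have := RingQuot.mkAlgHom_rel k (URel.nicholsF (D := D) x hx)
  rw [map_zero, ← AlgHom.comp_apply] at this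
  rw [← this]
  congr 1
  ext i
  simp [ug]

theorem ug_nicholsE (x : FreeAlgebra k I) (hx : x ∈ D.nichols) :
    FreeAlgebra.lift k (fun i => D.ug (.E i)) x = 0 := by
  have := RingQuot.mkAlgHom_rel k (URel.nicholsE (D := D) x hx)
  rw [map_zero, ← AlgHom.comp_apply] at this
  rw [← this]
  congr 1
  ext i
  simp [ug]

theorem nu_add (b c : I →₀ ℤ) : D.nu (b + c) = D.nu b + D.nu c := map_add _ _ _

theorem nu1_wt (i : I) (b : I →₀ ℤ) : D.nu1 i (D.wt b) = D.nu b (D.root i) := by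
  induction b using Finsupp.induction_linear with
  | zero => simp [wt, nu]
  | add b c hb hc =>
    have : D.wt (b + c) = D.wt b + D.wt c := map_add _ _ _
    rw [this, map_add, hb, hc, nu_add, LinearMap.add_apply]
  | single j n =>
    have h₁ : D.wt (.single j n) = n • D.root j := by simp [wt]
    have h₂ : D.nu (.single j n) = n • D.nu1 j := by simp [nu, nu1]
    rw [h₁, h₂, map_smul, LinearMap.smul_apply, D.nu1_symm]

theorem nu_neg (b : I →₀ ℤ) : D.nu (-b) = -D.nu b := map_neg _ _

/-- The homomorphism `C → U`, `F_i ↦ F_i`, `t_β ↦ K_{ν β}`. -/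
def cToU : D.CAlg D.nichols →ₐ[k] D.UAlg :=
  D.cLift
    (fun
      | .F i => D.ug (.F i)
      | .t b => D.ug (.K (D.nu b)))
    (by simp [nu, ug_one]) (fun b c => by simp [nu_add, ug_add])
    (fun b i => D.ug_KF _ i) D.ug_nicholsF

/-- The homomorphism `C → U`, `F_i ↦ E_i`, `t_β ↦ K_{-ν β}`. -/
def cToU' : D.CAlg D.nichols →ₐ[k] D.UAlg :=
  D.cLift
    (fun
      | .F i => D.ug (.E i)
      | .t b => D.ug (.K (-D.nu b)))
    (by simp [nu, ug_one]) (fun b c => by simp only [nu_add, neg_add, ug_add])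
    (fun b i => D.ug_KE _ i) D.ug_nicholsE

/-- the comultiplication of `U` on generators -/
def uCopGen : UGen I Φ → D.UAlg ⊗[k] D.UAlg
  | .E i => D.ug (.E i) ⊗ₜ D.ug (.K (D.nu1 i)) + 1 ⊗ₜ D.ug (.E i)
  | .F i => D.ug (.F i) ⊗ₜ 1 + D.ug (.K (-D.nu1 i)) ⊗ₜ D.ug (.F i)
  | .K l => D.ug (.K l) ⊗ₜ D.ug (.K l)

theorem uCop_EF (i j : I) : D.uCopGen (.E i) * D.uCopGen (.F j) - D.uCopGen (.F j) * D.uCopGen (.E i) =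
    (D.ug (.E i) * D.ug (.F j) - D.ug (.F j) * D.ug (.E i)) ⊗ₜ D.ug (.K (D.nu1 i)) +
      D.ug (.K (-D.nu1 j)) ⊗ₜ (D.ug (.E i) * D.ug (.F j) - D.ug (.F j) * D.ug (.E i)) := by
  simp only [uCopGen, mul_add, add_mul, Algebra.TensorProduct.tmul_mul_tmul, mul_one, one_mul,
    ug_KF, ug_KE, TensorProduct.sub_tmul, TensorProduct.tmul_sub, TensorProduct.tmul_smul,
    ← TensorProduct.smul_tmul', LinearMap.neg_apply, D.nu1_symm i j]
  abel

/-- comultiplication of `U` -/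
def uCop : D.UAlg →ₐ[k] D.UAlg ⊗[k] D.UAlg :=
  D.uLift D.uCopGen
    (by simp [uCopGen, ug_one, Algebra.TensorProduct.one_def])
    (fun l m => by simp [uCopGen, ug_add])
    (fun l i => by
      simp only [uCopGen, mul_add, add_mul, Algebra.TensorProduct.tmul_mul_tmul, mul_one, one_mul,
        smul_add, ug_KF]
      rw [← ug_add, ← ug_add, add_comm l, TensorProduct.smul_tmul', TensorProduct.tmul_smul])
    (fun l i => by
      simp only [uCopGen, mul_add, add_mul, Algebra.TensorProduct.tmul_mul_tmul, mul_one, one_mul,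
        smul_add, ug_KE]
      rw [← ug_add, ← ug_add, add_comm l, TensorProduct.smul_tmul', TensorProduct.tmul_smul])
    (fun i j h => sub_eq_zero.1 <| by
      rw [uCop_EF, ug_EF_ne _ _ _ h]
      simp)
    (fun i => by
      have h : D.uCopGen (.E i) * D.uCopGen (.F i) - D.uCopGen (.F i) * D.uCopGen (.E i) =
          (D.qq i)⁻¹ • (D.uCopGen (.K (D.nu1 i)) - D.uCopGen (.K (-D.nu1 i))) := by
        rw [uCop_EF, ug_EF]
        simp only [uCopGen, add_sub_cancel_left, TensorProduct.sub_tmul, TensorProduct.tmul_sub,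
          TensorProduct.tmul_smul, ← TensorProduct.smul_tmul', smul_sub]
        abel
      rw [← h]
      abel)
    (fun x hx => by
      have h := congrArg (Algebra.TensorProduct.map D.cToU D.cToU) (D.copF_nichols x hx)
      rw [map_zero, ← AlgHom.comp_apply] at h
      rw [← h]
      congr 1
      ext i
      simp [copF, uCopGen, cToU, nu_neg])
    (fun x hx => by
      have h := congrArg ((Algebra.TensorProduct.comm k D.UAlg D.UAlg).toAlgHom.comp
        (Algebra.TensorProduct.map D.cToU' D.cToU')) (D.copF_nichols x hx)
      rw [map_zero, ← AlgHom.comp_apply] at h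
      rw [← h]
      congr 1
      ext i
      simp [copF, uCopGen, cToU', nu_neg, add_comm])

theorem uCop_ug (g : UGen I Φ) : D.uCop (D.ug g) = D.uCopGen g :=
  (RingQuot.liftAlgHom_mkAlgHom_apply k _ _ _).trans (FreeAlgebra.lift_ι_apply _ _)

/-- counit of `U` -/
def uCounit : D.UAlg →ₐ[k] k :=
  D.uLift
    (fun
      | .E _ => 0
      | .F _ => 0
      | .K _ => 1)
    rfl (by simp) (by simp) (by simp) (by simp) (by simp)
    (fun x hx => D.nichols_counit hx) (fun x hx => D.nichols_counit hx)

end QuantumDatum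

namespace QuantumDatum

variable {k I Φ : Type u} [NormedField k] [AddCommGroup Φ] (D : QuantumDatum k I Φ)

/-! #### Norms and completions -/

/-- weights of the generators of `C` -/
def cWt : CGen I → ℝ≥0
  | .F _ => D.r
  | .t _ => 1

/-- weights of the generators of `U` -/
def uWt : UGen I Φ → ℝ≥0
  | .E _ => D.s
  | .F _ => D.r
  | .K _ => 1

/-- weights of the generators of `H ⋉ f_s` -/
def bWt : BGen I Φ → ℝ≥0
  | .E _ => D.s
  | .K _ => 1

/-- `C` as a weighted algebra -/
def cP : APres k := wordAlg k D.cWt (D.CRel D.nichols)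

/-- `U` as a weighted algebra -/
def uP : APres k := wordAlg k D.uWt D.URel

variable [IsUltrametricDist k]

/-- The Banach algebra `f_r ⋊ H'`, with underlying Banach space `f_r ⊗ H'` (completed). -/
abbrev C : Ban k := D.cP.ban

/-- The analytic quantum group, with underlying Banach space `f_r ⊗ H ⊗ f_s` (completed), by the
triangular decomposition. -/
abbrev U : Ban k := D.uP.ban

theorem nrm_add_tmul_le {P : APres k} {a b c d : P.carrier} {n : ℝ≥0} (l₁ l₂ m₁ m₂ : P.Idx)
    (ha : P.gen l₁ = a) (hb : P.gen l₂ = b) (hc : P.gen m₁ = c) (hd : P.gen m₂ = d)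
    (h₁ : P.wt l₁ * P.wt l₂ ≤ n) (h₂ : P.wt m₁ * P.wt m₂ ≤ n) :
    (APres.tensA P P).nrm (a ⊗ₜ[k] b + c ⊗ₜ[k] d) ≤ n := by
  subst ha hb hc hd
  refine ((APres.tensA P P).nrm_add_le _ _).trans (max_le ?_ ?_)
  · exact ((APres.tensA P P).nrm_gen_le (l₁, l₂)).trans (by exact_mod_cast h₁)
  · exact ((APres.tensA P P).nrm_gen_le (m₁, m₂)).trans (by exact_mod_cast h₂)

theorem nrm_tmul_le {P : APres k} {a b : P.carrier} {n : ℝ≥0} (l₁ l₂ : P.Idx)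
    (ha : P.gen l₁ = a) (hb : P.gen l₂ = b) (h₁ : P.wt l₁ * P.wt l₂ ≤ n) :
    (APres.tensA P P).nrm (a ⊗ₜ[k] b) ≤ n := by
  subst ha hb
  exact ((APres.tensA P P).nrm_gen_le (l₁, l₂)).trans (by exact_mod_cast h₁)

theorem cP_gen (g : CGen I) : D.cP.gen (FreeMonoid.of g) = D.cg D.nichols g :=
  FreeMonoid.lift_eval_of _ _

theorem cP_wt (g : CGen I) : D.cP.wt (FreeMonoid.of g) = D.cWt g := FreeMonoid.lift_eval_of _ _

theorem uP_gen (g : UGen I Φ) : D.uP.gen (FreeMonoid.of g) = D.ug g := FreeMonoid.lift_eval_of _ _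

theorem uP_wt (g : UGen I Φ) : D.uP.wt (FreeMonoid.of g) = D.uWt g := FreeMonoid.lift_eval_of _ _

theorem cCop_bound (l : D.cP.Idx) :
    (APres.tensA D.cP D.cP).nrm (D.cCop (D.cP.gen l)) ≤ D.cP.wt l := by
  refine word_bound (APres.tensA D.cP D.cP).nrm (APres.nrm_nonneg _) (APres.nrm_one_le _)
    (APres.nrm_mul_le _) ((MonoidHomClass.toMonoidHom D.cCop).comp D.cP.gen) (fun g => ?_) l
  refine (congrArg _ ((congrArg D.cCop (D.cP_gen g)).trans (D.cCop_cg g))).trans_le ?_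
  rcases g with i | b
  · refine nrm_add_tmul_le (FreeMonoid.of (.F i)) 1 (FreeMonoid.of (.t _)) (FreeMonoid.of (.F i))
      (D.cP_gen _) (map_one _) (D.cP_gen _) (D.cP_gen _) ?_ ?_
    · rw [cP_wt, map_one, mul_one]
    · rw [cP_wt, cP_wt]
      exact (one_mul _).le
  · refine nrm_tmul_le (FreeMonoid.of (.t b)) (FreeMonoid.of (.t b)) (D.cP_gen _) (D.cP_gen _) ?_
    rw [cP_wt]
    exact (one_mul _).le

theorem uCop_bound (l : D.uP.Idx) :
    (APres.tensA D.uP D.uP).nrm (D.uCop (D.uP.gen l)) ≤ D.uP.wt l := by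
  refine word_bound (APres.tensA D.uP D.uP).nrm (APres.nrm_nonneg _) (APres.nrm_one_le _)
    (APres.nrm_mul_le _) ((MonoidHomClass.toMonoidHom D.uCop).comp D.uP.gen) (fun g => ?_) l
  refine (congrArg _ ((congrArg D.uCop (D.uP_gen g)).trans (D.uCop_ug g))).trans_le ?_
  rcases g with i | i | b
  · refine nrm_add_tmul_le (FreeMonoid.of (.E i)) (FreeMonoid.of (.K _)) 1 (FreeMonoid.of (.E i))
      (D.uP_gen _) (D.uP_gen _) (map_one _) (D.uP_gen _) ?_ ?_
    · rw [uP_wt, uP_wt]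
      exact (mul_one _).le
    · rw [uP_wt, map_one, one_mul]
  · refine nrm_add_tmul_le (FreeMonoid.of (.F i)) 1 (FreeMonoid.of (.K _)) (FreeMonoid.of (.F i))
      (D.uP_gen _) (map_one _) (D.uP_gen _) (D.uP_gen _) ?_ ?_
    · rw [uP_wt, map_one, mul_one]
    · rw [uP_wt, uP_wt]
      exact (one_mul _).le
  · refine nrm_tmul_le (FreeMonoid.of (.K b)) (FreeMonoid.of (.K b)) (D.uP_gen _) (D.uP_gen _) ?_
    rw [uP_wt]
    exact (one_mul _).le

theorem cToU_bound (l : D.cP.Idx) : D.uP.nrm (D.cToU (D.cP.gen l)) ≤ D.cP.wt l := by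
  refine word_bound D.uP.nrm (APres.nrm_nonneg _) (APres.nrm_one_le _)
    (APres.nrm_mul_le _) ((MonoidHomClass.toMonoidHom D.cToU).comp D.cP.gen) (fun g => ?_) l
  have h : ∀ g', D.cToU (D.cg _ g) = D.ug g' → D.uWt g' = D.cWt g →
      D.uP.nrm (D.cToU (D.cP.gen (FreeMonoid.of g))) ≤ D.cWt g := fun g' h₁ h₂ => by
    rw [cP_gen, h₁, ← h₂, ← uP_gen, ← uP_wt]
    exact D.uP.nrm_gen_le _
  rcases g with i | b
  · exact h (.F i) (D.cLift_cg _ _ _ _ _ _) rfl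
  · exact h (.K (D.nu b)) (D.cLift_cg _ _ _ _ _ _) rfl

/-- a multiplicative functional on `C` given by a character of the root lattice, zero on `F_i` -/
def cChar (f : (I →₀ ℤ) → k) (h₁ : f 0 = 1) (h₂ : ∀ b c, f (b + c) = f b * f c) :
    D.CAlg D.nichols →ₐ[k] k :=
  D.cLift
    (fun
      | .F _ => 0
      | .t b => f b)
    h₁ h₂ (by simp) fun x hx => D.nichols_counit hx

/-- evaluation at `K_λ`: `F_i ↦ 0`, `t_β ↦ q^{-λ(β)}` -/
def pairK (l : Φ →ₗ[ℤ] ℤ) : D.CAlg D.nichols →ₐ[k] k :=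
  D.cChar (fun b => D.q ^ (-(l (D.wt b)))) (by simp [wt]) fun b c => by
    rw [← zpow_add₀ D.q_ne_zero, wt, map_add, map_add, neg_add]
    rfl

/-- the two-dimensional representation of `C` -/
def matGen [DecidableEq I] (i : I) : CGen I → Matrix (Fin 2) (Fin 2) k
  | .F j => if i = j then !![0, -(D.qq i)⁻¹; 0, 0] else 0
  | .t b => !![D.q ^ (-(D.nu1 i (D.wt b))), 0; 0, 1]

open Classical in
/-- The representation of `C` whose upper right entry is evaluation at `E_i`. -/
def mat (i : I) : D.CAlg D.nichols →ₐ[k] Matrix (Fin 2) (Fin 2) k :=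
  D.cLift (D.matGen i) (by
      simp only [matGen, wt, map_zero, neg_zero, zpow_zero]
      exact Matrix.one_fin_two.symm)
    (fun b c => by
      simp [matGen, wt, zpow_add₀ D.q_ne_zero, mul_comm])
    (fun b j => by
      by_cases h : i = j
      · subst h
        simp [matGen, nu1_wt, mul_comm]
      · simp [matGen, h])
    (fun x hx => D.nichols_lift hx _ fun j l => by
      simp only [matGen]
      split_ifs
      · ext a b
        fin_cases a <;> fin_cases b <;> simp
      all_goals simp)

theorem matGen_bound [DecidableEq I] (i : I) (l : FreeMonoid (CGen I)) :
    FreeMonoid.lift (D.matGen i) l 1 0 = 0 ∧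
      ‖FreeMonoid.lift (D.matGen i) l 0 0‖ ≤ FreeMonoid.lift D.cWt l ∧
      ‖FreeMonoid.lift (D.matGen i) l 1 1‖ ≤ FreeMonoid.lift D.cWt l ∧
      ‖FreeMonoid.lift (D.matGen i) l 0 1‖ ≤ D.s * FreeMonoid.lift D.cWt l := by
  induction l using FreeMonoid.inductionOn' with
  | one => simp
  | of_mul g l ih =>
    obtain ⟨h₁, h₂, h₃, h₄⟩ := ih
    rw [map_mul, map_mul, FreeMonoid.lift_eval_of, FreeMonoid.lift_eval_of]
    generalize FreeMonoid.lift (D.matGen i) l = X at *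
    generalize FreeMonoid.lift D.cWt l = w at *
    have hw : (0 : ℝ) ≤ w := w.2
    have hr : (0 : ℝ) ≤ D.r := D.r.2
    have hs : (0 : ℝ) ≤ D.s := D.s.2
    simp only [Matrix.mul_apply, Fin.sum_univ_two, h₁]
    rcases g with j | b
    · by_cases hj : i = j
      · have hq : ‖(D.qq i)⁻¹‖ ≤ D.r * D.s := by
          have h := D.le_mul i
          have hq : 0 < ‖D.qq i‖ := by
            refine norm_pos_iff.2 fun h0 => ?_
            rw [show D.q ^ D.d i - (D.q ^ D.d i)⁻¹ = 0 from h0] at h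
            simp at h
          rw [norm_inv, inv_le_iff_one_le_mul₀ hq]
          have : (1 : ℝ) ≤ ‖D.qq i‖ * D.r * D.s := by exact_mod_cast h
          linarith
        simp only [matGen, hj, if_true, cWt]
        subst hj
        simp only [Matrix.of_apply, Matrix.cons_val', Matrix.cons_val_zero, Matrix.cons_val_one,
          zero_mul, mul_zero, add_zero, zero_add, norm_zero, NNReal.coe_mul, norm_mul, norm_neg,
          true_and]
        refine ⟨by positivity, by positivity, ?_⟩
        calc ‖(D.qq i)⁻¹‖ * ‖X 1 1‖ ≤ (D.r * D.s) * w :=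
              mul_le_mul hq h₃ (norm_nonneg _) (by positivity)
          _ = D.s * (D.r * w) := by ring
      · simp only [matGen, hj, if_false, cWt, Matrix.zero_apply, zero_mul, add_zero, norm_zero,
          NNReal.coe_mul, true_and]
        exact ⟨by positivity, by positivity, by positivity⟩
    · simp only [matGen, cWt, Matrix.of_apply, Matrix.cons_val', Matrix.cons_val_zero,
        Matrix.cons_val_one, zero_mul, mul_zero, add_zero, zero_add, one_mul, norm_mul,
        D.norm_q_zpow, true_and]
      exact ⟨h₂, h₃, h₄⟩

theorem mat_bound (i : I) (l : D.cP.Idx) :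
    ‖D.mat i (D.cP.gen l) 0 1‖ ≤ D.s * D.cP.wt l := by
  classical
  have h : (MonoidHomClass.toMonoidHom (D.mat i)).comp D.cP.gen =
      FreeMonoid.lift (D.matGen i) := FreeMonoid.hom_eq fun g => by
    refine (congrArg (D.mat i) (D.cP_gen g)).trans ?_
    rw [FreeMonoid.lift_eval_of, mat, cLift_cg]
  have h' := congrArg (fun f => ‖f l 0 1‖) h
  exact h'.trans_le (D.matGen_bound i l).2.2.2

/-- Evaluation of `C` at the generators `K_λ` and `E_i`: `⟨K_λ, t_β⟩ = q^{-λ(β)}`,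
`⟨K_λ, F_j⟩ = 0`, `⟨E_i, t_β⟩ = 0`, `⟨E_i, F_j⟩ = -δ_ij (q_i - q_i⁻¹)⁻¹`, with
`⟨K_λ, c c'⟩ = ⟨K_λ, c⟩ ⟨K_λ, c'⟩` and
`⟨E_i, c c'⟩ = ⟨t_i, c⟩ ⟨E_i, c'⟩ + ⟨E_i, c⟩ ε(c')`. -/
def pairGen : BGen I Φ → D.CAlg D.nichols →ₗ[k] k
  | .K l => (D.pairK l).toLinearMap
  | .E i => Matrix.entryLinearMap k k 0 1 ∘ₗ (D.mat i).toLinearMap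

/-- Evaluation of `C` at a word in the `K_λ` and `E_i`:
`⟨b b', c⟩ = ⟨b, c₁⟩ ⟨b', c₂⟩`, `⟨1, c⟩ = ε(c)`. -/
def pairWord : List (BGen I Φ) → D.CAlg D.nichols →ₗ[k] k
  | [] => D.cCounit.toLinearMap
  | g :: l => LinearMap.mul' k k ∘ₗ TensorProduct.map (D.pairGen g) (pairWord l) ∘ₗ
      D.cCop.toLinearMap

theorem char_bound (χ : D.CAlg D.nichols →ₐ[k] k) (h : ∀ g, ‖χ (D.cg _ g)‖ ≤ D.cWt g)
    (l : D.cP.Idx) : ‖χ (D.cP.gen l)‖ ≤ D.cP.wt l :=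
  word_bound (fun a : k => ‖a‖) norm_nonneg norm_one.le (fun a b => (norm_mul a b).le)
    ((MonoidHomClass.toMonoidHom χ).comp D.cP.gen)
    (fun g => (congrArg (fun x => ‖χ x‖) (D.cP_gen g)).trans_le (h g)) l

theorem cCounit_bound (l : D.cP.Idx) : ‖D.cCounit (D.cP.gen l)‖ ≤ D.cP.wt l :=
  D.char_bound _ (fun g => by
    rcases g with i | b
    · rw [cCounit, cLift_cg, norm_zero]; exact NNReal.coe_nonneg _
    · rw [cCounit, cLift_cg, norm_one]; exact le_rfl) l

theorem uCounit_bound (l : D.uP.Idx) : ‖D.uCounit (D.uP.gen l)‖ ≤ D.uP.wt l :=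
  word_bound (fun a : k => ‖a‖) norm_nonneg norm_one.le (fun a b => (norm_mul a b).le)
    ((MonoidHomClass.toMonoidHom D.uCounit).comp D.uP.gen)
    (fun g => (congrArg (fun x => ‖D.uCounit x‖) (D.uP_gen g)).trans_le (by
      rcases g with i | i | l
      · rw [uCounit, uLift_ug, norm_zero]; exact NNReal.coe_nonneg _
      · rw [uCounit, uLift_ug, norm_zero]; exact NNReal.coe_nonneg _
      · rw [uCounit, uLift_ug, norm_one]; exact le_rfl)) l

theorem pairGen_bound (g : BGen I Φ) (l : D.cP.Idx) :
    ‖D.pairGen g (D.cP.gen l)‖ ≤ D.bWt g * D.cP.wt l := by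
  rcases g with i | m
  · exact D.mat_bound i l
  · refine (D.char_bound (D.pairK m) (fun g => ?_) l).trans_eq (one_mul _).symm
    rcases g with i | b
    · rw [pairK, cChar, cLift_cg, norm_zero]; exact NNReal.coe_nonneg _
    · rw [pairK, cChar, cLift_cg, D.norm_q_zpow]; exact le_rfl

/-- weight of a word -/
def wordWt (w : List (BGen I Φ)) : ℝ≥0 := (w.map D.bWt).prod

theorem pairWord_bound (w : List (BGen I Φ)) (l : D.cP.Idx) :
    ‖D.pairWord w (D.cP.gen l)‖ ≤ D.wordWt w * D.cP.wt l := by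
  induction w generalizing l with
  | nil => simpa [wordWt, pairWord] using D.cCounit_bound l
  | cons g w ih =>
    have h := (APres.tensA D.cP D.cP).pres.bound
      (LinearMap.mul' k k ∘ₗ TensorProduct.map (D.pairGen g) (D.pairWord w))
      (D.wordWt (g :: w)) (fun l => by
        change ‖D.pairGen g (D.cP.gen l.1) * D.pairWord w (D.cP.gen l.2)‖ ≤
          D.wordWt (g :: w) * (D.cP.wt l.1 * D.cP.wt l.2 : ℝ≥0)
        rw [norm_mul]
        refine (mul_le_mul (D.pairGen_bound g l.1) (ih l.2) (norm_nonneg _)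
          (by positivity)).trans_eq ?_
        simp only [wordWt, List.map_cons, List.prod_cons, NNReal.coe_mul]
        ring) (D.cCop (D.cP.gen l))
    exact h.trans (mul_le_mul_of_nonneg_left (D.cCop_bound l) (NNReal.coe_nonneg _))

variable [CompleteSpace k]

/-- from `k` to the unit object -/
def toUnit : k →ₗ[k] unitBan k := LinearMap.id (M := k)

/-- the comultiplication of the Banach Hopf algebra `C` -/
def comul : D.C ⟶ D.C ⊗ D.C :=
  D.cP.map (APres.tensA D.cP D.cP) D.cCop.toLinearMap D.cCop_bound ≫ APres.toTens D.cP D.cP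

/-- the counit of `C` -/
def counit : D.C ⟶ 𝟙_ (Ban k) :=
  D.cP.pres.lift (X := unitBan k) (toUnit ∘ₗ D.cCounit.toLinearMap) 1 fun l =>
    (D.cCounit_bound l).trans_eq (one_mul _).symm

/-- the comultiplication of the analytic quantum group -/
def ucomul : D.U ⟶ D.U ⊗ D.U :=
  D.uP.map (APres.tensA D.uP D.uP) D.uCop.toLinearMap D.uCop_bound ≫ APres.toTens D.uP D.uP

/-- the counit of the analytic quantum group -/
def ucounit : D.U ⟶ 𝟙_ (Ban k) :=
  D.uP.pres.lift (X := unitBan k) (toUnit ∘ₗ D.uCounit.toLinearMap) 1 fun l =>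
    (D.uCounit_bound l).trans_eq (one_mul _).symm

/-- the homomorphism of Banach algebras `C → U` -/
def incl : D.C ⟶ D.U := D.cP.map D.uP D.cToU.toLinearMap D.cToU_bound

/-- The Banach tensor algebra on the generators `E_i`, `K_λ` of `H ⋉ f_s`: formal words, each
weighted by the product of the weights of its letters. -/
def tP : Pres k where
  carrier := List (BGen I Φ) →₀ k
  Idx := List (BGen I Φ)
  gen w := .single w 1
  wt := D.wordWt
  span x := ⟨x, by simp [Finsupp.linearCombination_apply]⟩

/-- The Banach tensor algebra on the generators of `B = H ⋉ f_s`, of which `B` is a strict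
quotient; the pairing of `B` with `C` and the map `B → U` are given by maps out of `T`. -/
abbrev T : Ban k := D.tP.ban

/-- generators of `B` in `U` -/
def bToU : BGen I Φ → D.UAlg
  | .E i => D.ug (.E i)
  | .K l => D.ug (.K l)

theorem inclT_bound (w : List (BGen I Φ)) : D.uP.nrm ((w.map D.bToU).prod) ≤ D.wordWt w := by
  induction w with
  | nil => exact D.uP.nrm_one_le
  | cons g w ih =>
    have hg : D.uP.nrm (D.bToU g) ≤ D.bWt g := by
      rcases g with i | l
      · have := D.uP.nrm_gen_le (FreeMonoid.of (.E i))
        rwa [uP_gen, uP_wt] at this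
      · have := D.uP.nrm_gen_le (FreeMonoid.of (.K l))
        rwa [uP_gen, uP_wt] at this
    rw [List.map_cons, List.prod_cons, wordWt, List.map_cons, List.prod_cons, NNReal.coe_mul]
    exact (D.uP.nrm_mul_le _ _).trans
      (mul_le_mul hg ih (D.uP.nrm_nonneg _) (NNReal.coe_nonneg _))

/-- `T → B → U` -/
def inclT : D.T ⟶ D.U :=
  D.tP.lift (D.uP.tb ∘ₗ Finsupp.linearCombination k fun w : List (BGen I Φ) =>
    (w.map D.bToU).prod) 1 fun w => by
    rw [NNReal.coe_one, one_mul]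
    refine le_trans (le_of_eq ?_) (D.inclT_bound w)
    exact (congrArg (fun x => ‖D.uP.tb x‖) ((Finsupp.linearCombination_single k 1 w).trans
      (one_smul _ _))).trans (D.uP.norm_tb _)

/-- The pairing of `B` with `C`, as a map on `T ⊗ C`. -/
def pairing : D.T ⊗ D.C ⟶ 𝟙_ (Ban k) :=
  D.tP.lift₂ (X := unitBan k) D.cP.pres
    (Finsupp.linearCombination k fun w => toUnit ∘ₗ D.pairWord w) fun w l => by
    refine le_trans (le_of_eq ?_) (D.pairWord_bound w l)
    refine congrArg (fun f : D.cP.pres.carrier →ₗ[k] unitBan k => ‖f (D.cP.gen l)‖) ?_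
    exact (Finsupp.linearCombination_single k 1 w).trans (one_smul _ _)

end QuantumDatum

/-! ### Ind-Banach modules, comodules, and the category `O_Ψ` -/

/-- Ind-Banach spaces -/
abbrev IndBan (k : Type u) [NormedField k] : Type (u + 1) := IndObj (Ban k)

/-- A Banach space as an Ind-Banach space. -/
abbrev emb (k : Type u) [NormedField k] : Ban k ⥤ IndBan k := IndObj.emb (Ban k)

namespace QuantumDatum

variable {k I Φ : Type u} [NormedField k] [IsUltrametricDist k] [CompleteSpace k]
  [AddCommGroup Φ] (D : QuantumDatum k I Φ)

/-- `C = f_r ⋊ H'` as a monoid in Ind-Banach spaces -/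
abbrev iC : IndBan k := (emb k).obj D.C

/-- the analytic quantum group as a monoid in Ind-Banach spaces -/
abbrev iU : IndBan k := (emb k).obj D.U

instance : MonObj D.iC := Functor.monObjObj (F := emb k) D.C

instance : MonObj D.iU := Functor.monObjObj (F := emb k) D.U

/-- comultiplication of `C` -/
def iComul : D.iC ⟶ D.iC ⊗ D.iC := (emb k).map D.comul ≫ Functor.OplaxMonoidal.δ (emb k) _ _

/-- counit of `C` -/
def iCounit : D.iC ⟶ 𝟙_ (IndBan k) := (emb k).map D.counit ≫ Functor.OplaxMonoidal.η (emb k)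

/-- comultiplication of `U` -/
def iUcomul : D.iU ⟶ D.iU ⊗ D.iU := (emb k).map D.ucomul ≫ Functor.OplaxMonoidal.δ (emb k) _ _

/-- counit of `U` -/
def iUcounit : D.iU ⟶ 𝟙_ (IndBan k) := (emb k).map D.ucounit ≫ Functor.OplaxMonoidal.η (emb k)

/-- pairing of `B` with `C` -/
def iPairing : (emb k).obj D.T ⊗ D.iC ⟶ 𝟙_ (IndBan k) :=
  Functor.LaxMonoidal.μ (emb k) _ _ ≫ (emb k).map D.pairing ≫ Functor.OplaxMonoidal.η (emb k)

/-- Ind-Banach modules over the analytic quantum group -/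
abbrev UMod : Type (u + 1) := Mod (IndBan k) D.iU

variable {D}

/-- the action of `U` -/
def actU (M : D.UMod) : D.iU ⊗ M.X ⟶ M.X := ModObj.smul (M := D.iU) (X := M.X)

/-- the action of `C` through `C → U` -/
def actC (M : D.UMod) : D.iC ⊗ M.X ⟶ M.X := (emb k).map D.incl ▷ M.X ≫ actU M

/-- the action of `B`, as an action of `T`, through `B → U` -/
def actB (M : D.UMod) : (emb k).obj D.T ⊗ M.X ⟶ M.X := (emb k).map D.inclT ▷ M.X ≫ actU M

/-- A right coaction of `C` on a `U`-module which makes it a crossed bimodule (Yetter-Drinfel'd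
module) over `C`, and which induces the given action of `B` by `b · v = v₀ ⟨b, v₁⟩`. -/
structure IsCrossed (M : D.UMod) (ρ : M.X ⟶ M.X ⊗ D.iC) : Prop where
  coassoc : ρ ≫ ρ ▷ D.iC ≫ (α_ _ _ _).hom = ρ ≫ M.X ◁ D.iComul
  counit : ρ ≫ M.X ◁ D.iCounit ≫ (ρ_ M.X).hom = 𝟙 M.X
  /-- `c₁ v₀ ⊗ c₂ v₁ = (c₂ v)₀ ⊗ (c₂ v)₁ c₁` -/
  crossed : (D.iComul ⊗ₘ ρ) ≫ tensorμ D.iC D.iC M.X D.iC ≫ (actC M ⊗ₘ MonObj.mul) =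
    D.iComul ▷ M.X ≫ (α_ _ _ _).hom ≫ D.iC ◁ actC M ≫ (β_ _ _).hom ≫ ρ ▷ D.iC ≫
      (α_ _ _ _).hom ≫ M.X ◁ MonObj.mul
  /-- `b v = v₀ ⟨b, v₁⟩` -/
  actB : actB M = (emb k).obj D.T ◁ ρ ≫ (α_ _ _ _).inv ≫ (β_ _ _).hom ▷ D.iC ≫ (α_ _ _ _).hom ≫
    M.X ◁ D.iPairing ≫ (ρ_ M.X).hom

variable (D)

/-- The modules over the analytic quantum group that come from crossed bimodules over `C`: the
action of `C` (through `C → U`) is part of a crossed bimodule structure, and the action of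
`B = H ⋉ f_s` is the one induced by the coaction of `C` and the pairing of `B` with `C`. -/
def isOPsi : ObjectProperty D.UMod := fun M => ∃ ρ, IsCrossed M ρ

/-- The category `O_Ψ`. -/
abbrev OPsi : Type (u + 1) := D.isOPsi.FullSubcategory

/-- The underlying Ind-Banach space of a module in `O_Ψ`. -/
abbrev forget : D.OPsi ⥤ IndBan k := D.isOPsi.ι ⋙ Mod.forget D.iU

variable {D}

/-- The braiding of crossed bimodules: `m ⊗ n ↦ n₀ ⊗ n₁ m`. -/
def crossedBraiding (M N : D.UMod) (ρ : N.X ⟶ N.X ⊗ D.iC) : M.X ⊗ N.X ⟶ N.X ⊗ M.X :=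
  (β_ M.X N.X).hom ≫ ρ ▷ M.X ≫ (α_ _ _ _).hom ≫ N.X ◁ actC M

/-- The diagonal action of `U` on a tensor product. -/
def diagAct (M N : D.UMod) : D.iU ⊗ (M.X ⊗ N.X) ⟶ M.X ⊗ N.X :=
  D.iUcomul ▷ (M.X ⊗ N.X) ≫ tensorμ D.iU D.iU M.X N.X ≫ (actU M ⊗ₘ actU N)

end QuantumDatum

end AnQG

end

/-! The proof has a formal half, valid in any symmetric monoidal category, and an analytic half that
supplies its hypotheses.

Formal half. Let `φ : C ⟶ U` be a map of bialgebras and let `T` be an object of elements of `U`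
paired with `C`, subject to the conditions collected in `YD.Duality`. The modules of interest are
`U`-modules with a crossed `C`-coaction that induces the action of `T`. The tensor product carries
the diagonal action and the coaction m ⊗ n ↦ m₀ ⊗ n₀ ⊗ n₁m₁. The braiding m ⊗ n ↦ n₀ ⊗ n₁m is
`C`-linear and `C`-colinear because of the crossed condition (`br_linear`, `br_colinear`).
Colinearity makes it `T`-linear, since `T` acts through the coaction, and it is then `U`-linear
because products of elements of `C` and `T` generate `U`. The hexagons are coassociativity of the
coaction (`br_tact`) and associativity of the action (`br_tcoact`). The inverse comes from the
antipode, since the maps n ⊗ m ↦ n₀ ⊗ f(n₁)m compose by convolution of the functions f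
(`fuse_fuse`). That the tensor product is again crossed needs no direct computation: the crossed
condition follows from linearity of the braiding with the regular module `C` (`crossed_of_linear`),
and a hexagon factors that braiding into two linear maps. Finally, the pairing separates points of Y
⊗ C for every Y. Hence coactions are unique and `U`-linear maps are colinear, which gives naturality
of the braiding and its independence of the chosen coaction.

Analytic half. The object `T` is the Banach tensor algebra on the generators of `B`, so that a
pairing is defined word by word and no relation of `B` has to be verified. Generation is the
triangular decomposition in its weak form: elements of `C` times words in the `E_i`, `K_λ` span the
algebraic quantum group (`mem_triSpan`). The antipode and the separation property both rest on the
nondegeneracy of the pairing on the algebraic `C` (`pairWord_nondegenerate`). The radical is an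
ideal, and it contains the homogeneous components of its elements. Its multihomogeneous elements of
degree at least two in the `F_i` form a coideal, so they are relations already by the maximality in
the definition of the Nichols algebra. Degrees zero and one are checked by pairing with 1 and with
`E_i`. The antipode passes to the Nichols quotient since its transpose sends words to multiples of
words.

Separation in a completed tensor product needs uniform control. Convolution with `K_λ` on the left
and on the right multiplies homogeneous elements by powers of q, and q is not a root of unity, so
polynomials in these operators isolate one degree among finitely many. Lagrange interpolation would
have small denominators q^n - 1. Gaussian binomials do the same and have norm at most 1, by Pascal's
rule and the ultrametric inequality (`norm_gauss_le`). Consequently an element of Y ⊗ C all of whose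
slices along words vanish has homogeneous components with the same property. Such a component lies
in the part of Y ⊗ C given by a finite-dimensional space, hence vanishes by nondegeneracy. The
element itself is approximated by finite sums of its components, so it is zero
(`eq_zero_of_slice_eq_zero`).

All of this is proved among Banach spaces and carried to Ind-objects in `duality_emb`, where
filteredness turns equalities in a colimit into equalities at one stage. -/

noncomputable section

set_option linter.unusedSectionVars false

/-! ### Crossed bimodules over a bialgebra: linearity and colinearity of the braiding -/

namespace AnQG
namespace YD
open MonObj ComonObj BraidedCategory
universe v w
variable {V : Type w} [Category.{v} V] [MonoidalCategory V] [SymmetricCategory V]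

section
variable {A : V} [MonObj A] {M N : V}

/-- A left action of a monoid. -/
structure IsAct (a : A ⊗ M ⟶ M) : Prop where
  one : η[A] ▷ M ≫ a = (λ_ M).hom
  mul : μ[A] ▷ M ≫ a = (α_ A A M).hom ≫ A ◁ a ≫ a
end

section
variable {C : V} [BimonObj C] {M N P : V}

/-- The diagonal action on a tensor product. -/
def tact (a : C ⊗ M ⟶ M) (b : C ⊗ N ⟶ N) : C ⊗ (M ⊗ N) ⟶ M ⊗ N :=
  Δ[C] ▷ (M ⊗ N) ≫ tensorμ C C M N ≫ (a ⊗ₘ b)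

/-- The coaction `m ⊗ n ↦ m₀ ⊗ n₀ ⊗ n₁ m₁`. -/
def tcoact (ρ : M ⟶ M ⊗ C) (σ : N ⟶ N ⊗ C) : M ⊗ N ⟶ (M ⊗ N) ⊗ C :=
  (ρ ⊗ₘ σ) ≫ tensorμ M C N C ≫ (M ⊗ N) ◁ ((β_ C C).hom ≫ μ[C])

/-- `m ⊗ n ↦ n₀ ⊗ n₁ m` -/
def br (a : C ⊗ M ⟶ M) (σ : N ⟶ N ⊗ C) : M ⊗ N ⟶ N ⊗ M :=
  (β_ M N).hom ≫ σ ▷ M ≫ (α_ _ _ _).hom ≫ N ◁ a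

/-- `c ⊗ m ↦ (c₂ m)₀ ⊗ (c₂ m)₁ c₁` -/
def crossR (a : C ⊗ M ⟶ M) (ρ : M ⟶ M ⊗ C) : C ⊗ M ⟶ M ⊗ C :=
  Δ[C] ▷ M ≫ (α_ _ _ _).hom ≫ C ◁ a ≫ (β_ _ _).hom ≫ ρ ▷ C ≫ (α_ _ _ _).hom ≫ M ◁ μ[C]

/-- `c ⊗ m ↦ c₁ m₀ ⊗ c₂ m₁` -/
def crossL (a : C ⊗ M ⟶ M) (ρ : M ⟶ M ⊗ C) : C ⊗ M ⟶ M ⊗ C :=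
  (Δ[C] ⊗ₘ ρ) ≫ tensorμ C C M C ≫ (a ⊗ₘ μ[C])

/-- Yetter-Drinfel'd modules. -/
structure IsYD (a : C ⊗ M ⟶ M) (ρ : M ⟶ M ⊗ C) : Prop where
  coassoc : ρ ≫ ρ ▷ C ≫ (α_ _ _ _).hom = ρ ≫ M ◁ Δ[C]
  counit : ρ ≫ M ◁ ε[C] ≫ (ρ_ M).hom = 𝟙 M
  crossed : crossL a ρ = crossR a ρ

variable {a : C ⊗ M ⟶ M} {b : C ⊗ N ⟶ N} {ρ : M ⟶ M ⊗ C} {σ : N ⟶ N ⊗ C}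

theorem tensorμ_assoc_right (X₁ X₂ Y₁ Y₂ Z : V) :
    tensorμ X₁ X₂ Y₁ Y₂ ▷ Z ≫ (α_ _ _ _).hom ≫ (X₁ ⊗ Y₁) ◁ (α_ _ _ _).hom =
      (α_ _ _ _).hom ≫ (X₁ ⊗ X₂) ◁ (α_ _ _ _).hom ≫ tensorμ X₁ X₂ Y₁ (Y₂ ⊗ Z) := by
  simp only [tensorμ]
  monoidal

theorem whiskerLeft_tact (f : P ⟶ M) :
    C ◁ (N ◁ f) ≫ tact b a = Δ[C] ▷ _ ≫ tensorμ C C N P ≫ (b ⊗ₘ (C ◁ f ≫ a)) := by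
  have h := tensorμ_natural (𝟙 C) (𝟙 C) (𝟙 N) f
  simp only [MonoidalCategory.whiskerLeft_id, id_tensorHom] at h
  rw [tact, whisker_exchange_assoc, reassoc_of% h, ← id_tensorHom, tensorHom_comp_tensorHom,
    Category.id_comp]

/-- `n ⊗ m ↦ n₀ ⊗ n₁ m` -/
def fuse (a : C ⊗ M ⟶ M) (σ : N ⟶ N ⊗ C) : N ⊗ M ⟶ N ⊗ M :=
  σ ▷ M ≫ (α_ _ _ _).hom ≫ N ◁ a

/-- Associativity of the action gives c₁p₀ ⊗ (c₂p₁)m = c₁p₀ ⊗ c₂(p₁m). Thus the left side of the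
crossed condition, once its last factor acts on m, becomes the diagonal action of c applied after
`fuse`. -/
theorem crossL_mul (ha : IsAct a) (ρ : P ⟶ P ⊗ C) (b : C ⊗ P ⟶ P) :
    crossL b ρ ▷ M ≫ (α_ _ _ _).hom ≫ P ◁ a =
      (α_ _ _ _).hom ≫ C ◁ fuse a ρ ≫ tact b a := by
  have h : (b ⊗ₘ μ[C]) ▷ M ≫ (α_ P C M).hom ≫ P ◁ a =
      (α_ _ _ _).hom ≫ (C ⊗ P) ◁ (α_ _ _ _).hom ≫ (b ⊗ₘ (C ◁ a ≫ a)) := by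
    rw [← tensorHom_id, associator_naturality_assoc, ← id_tensorHom, tensorHom_comp_tensorHom,
      ← id_tensorHom, tensorHom_comp_tensorHom, tensorHom_id, ha.mul]
    simp
  simp only [fuse, MonoidalCategory.whiskerLeft_comp, Category.assoc, whiskerLeft_tact, crossL,
    comp_whiskerRight, h]
  rw [reassoc_of% tensorμ_assoc_right]
  simp only [MonoidalCategory.tensorHom_def, whisker_exchange_assoc, comp_whiskerRight,
    Category.assoc]
  monoidal

/-- Counterpart of `crossL_mul` for the right side of the crossed condition: (c₂p)₀ ⊗ ((c₂p)₁c₁)m is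
`fuse` applied to c₂p ⊗ c₁m, again by associativity of the action. -/
theorem crossR_mul (ha : IsAct a) (ρ : P ⟶ P ⊗ C) (b : C ⊗ P ⟶ P) :
    crossR b ρ ▷ M ≫ (α_ _ _ _).hom ≫ P ◁ a =
      (Δ[C] ▷ P ≫ (α_ _ _ _).hom ≫ C ◁ b ≫ (β_ _ _).hom) ▷ M ≫ (α_ _ _ _).hom ≫ P ◁ a ≫
        fuse a ρ := by
  have h : (P ◁ μ[C]) ▷ M ≫ (α_ P C M).hom ≫ P ◁ a =
      (α_ _ _ _).hom ≫ P ◁ (α_ _ _ _).hom ≫ P ◁ C ◁ a ≫ P ◁ a := by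
    rw [associator_naturality_middle_assoc, ← MonoidalCategory.whiskerLeft_comp, ha.mul]
    simp
  simp only [fuse, crossR, comp_whiskerRight, Category.assoc, h, whisker_exchange_assoc]
  monoidal

/-- On elements this is c₁m ⊗ c₂n ↦ c₂n ⊗ c₁m. It produces the input c₂n ⊗ c₁m that `crossR_mul`
expects, without any cocommutativity. -/
theorem tact_braid :
    tact a b ≫ (β_ M N).hom = C ◁ (β_ M N).hom ≫ (α_ _ _ _).inv ≫
      (Δ[C] ▷ N ≫ (α_ _ _ _).hom ≫ C ◁ b ≫ (β_ _ _).hom) ▷ M ≫ (α_ _ _ _).hom ≫ N ◁ a := by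
  have h : (β_ (C ⊗ M) (C ⊗ N)).hom ≫ (b ⊗ₘ a) = (a ⊗ₘ b) ≫ (β_ _ _).hom :=
    (BraidedCategory.braiding_naturality _ _).symm
  rw [tact, Category.assoc, Category.assoc, ← h, braiding_tensor_left_hom C M (C ⊗ N),
    braiding_tensor_right_hom M C N, braiding_naturality_right C b,
    MonoidalCategory.tensorHom_def b a]
  calc
    _ = Δ[C] ▷ (M ⊗ N) ⊗≫ C ◁ ((β_ C M).hom ≫ (β_ M C).hom) ▷ N ⊗≫ C ◁ C ◁ (β_ M N).hom ⊗≫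
        (β_ C (C ⊗ N)).hom ▷ M ⊗≫ b ▷ C ▷ M ⊗≫ N ◁ a := by
      simp only [tensorμ]
      monoidal
    _ = Δ[C] ▷ (M ⊗ N) ⊗≫ C ◁ C ◁ (β_ M N).hom ⊗≫
        (β_ C (C ⊗ N)).hom ▷ M ⊗≫ b ▷ C ▷ M ⊗≫ N ◁ a := by
      rw [SymmetricCategory.symmetry]
      monoidal
    _ = (Δ[C] ▷ (M ⊗ N) ≫ (C ⊗ C) ◁ (β_ M N).hom) ⊗≫
        (β_ C (C ⊗ N)).hom ▷ M ⊗≫ b ▷ C ▷ M ⊗≫ N ◁ a := by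
      monoidal
    _ = _ := by
      rw [← whisker_exchange]
      monoidal

/-- By `crossL_mul` and `crossR_mul`, linearity of the braiding is the crossed condition for N with
its last factor acting on M. -/
theorem br_linear (ha : IsAct a) (h : crossL b σ = crossR b σ) :
    C ◁ br a σ ≫ tact b a = tact a b ≫ br a σ := by
  have h₁ : br a σ = (β_ M N).hom ≫ fuse a σ := rfl
  have h₂ := crossL_mul ha σ b
  rw [← cancel_epi (α_ _ _ _).inv, Iso.inv_hom_id_assoc] at h₂
  rw [h₁, MonoidalCategory.whiskerLeft_comp, Category.assoc, ← h₂, h, crossR_mul ha,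
    ← Category.assoc (tact a b), tact_braid]
  simp only [Category.assoc]

/-- By coassociativity of σ, both composites are n₀ followed by one side of the crossed condition
for M evaluated at n₁ ⊗ m: the coaction after the braiding gives `crossR`, the braiding after the
coaction gives `crossL`. -/
theorem br_colinear (hσ : σ ≫ σ ▷ C ≫ (α_ _ _ _).hom = σ ≫ N ◁ Δ[C])
    (h : crossL a ρ = crossR a ρ) :
    br a σ ≫ tcoact σ ρ = tcoact ρ σ ≫ br a σ ▷ C := by
  have h₁ : fuse a σ ≫ tcoact σ ρ =
      σ ▷ M ≫ (α_ _ _ _).hom ≫ N ◁ crossR a ρ ≫ (α_ _ _ _).inv := by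
    calc
      _ = σ ▷ M ⊗≫ (N ◁ a ≫ σ ▷ M) ⊗≫ N ◁ C ◁ ρ ⊗≫ N ◁ (β_ C M).hom ▷ C ⊗≫
          N ◁ M ◁ (β_ C C).hom ⊗≫ (N ⊗ M) ◁ μ[C] := by
        simp only [fuse, tcoact, tensorμ, MonoidalCategory.tensorHom_def]
        monoidal
      _ = (σ ≫ σ ▷ C ≫ (α_ _ _ _).hom) ▷ M ⊗≫ N ◁ C ◁ a ⊗≫ N ◁ (C ◁ ρ ⊗≫ (β_ C M).hom ▷ C ⊗≫
          M ◁ (β_ C C).hom) ⊗≫ (N ⊗ M) ◁ μ[C] := by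
        rw [whisker_exchange]
        monoidal
      _ = (σ ≫ N ◁ Δ[C]) ▷ M ⊗≫ N ◁ C ◁ a ⊗≫ N ◁ (C ◁ ρ ≫ (β_ C (M ⊗ C)).hom) ⊗≫
          (N ⊗ M) ◁ μ[C] := by
        rw [hσ, braiding_tensor_right_hom]
        monoidal
      _ = (σ ≫ N ◁ Δ[C]) ▷ M ⊗≫ N ◁ C ◁ a ⊗≫ N ◁ ((β_ C M).hom ≫ ρ ▷ C) ⊗≫
          (N ⊗ M) ◁ μ[C] := by
        rw [braiding_naturality_right]
      _ = _ := by
        simp only [crossR]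
        monoidal
  have h₂ : (β_ _ _).hom ≫ σ ▷ M ≫ (α_ _ _ _).hom ≫ N ◁ crossL a ρ ≫ (α_ _ _ _).inv =
      tcoact ρ σ ≫ br a σ ▷ C := by
    symm
    calc
      _ = ρ ▷ N ⊗≫ (M ⊗ C) ◁ σ ⊗≫ M ◁ (β_ C N).hom ▷ C ⊗≫ M ◁ N ◁ (β_ C C).hom ⊗≫
          ((M ⊗ N) ◁ μ[C] ≫ br a σ ▷ C) := by
        simp only [tcoact, tensorμ, MonoidalCategory.tensorHom_def]
        monoidal
      _ = ρ ▷ N ⊗≫ (M ⊗ C) ◁ σ ⊗≫ M ◁ (β_ C (N ⊗ C)).hom ⊗≫ ((β_ M N).hom ≫ σ ▷ M) ▷ C ▷ C ⊗≫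
          N ◁ a ▷ C ▷ C ⊗≫ (N ⊗ M) ◁ μ[C] := by
        rw [whisker_exchange, br, braiding_tensor_right_hom]
        monoidal
      _ = ρ ▷ N ⊗≫ (M ⊗ C) ◁ σ ⊗≫ M ◁ ((β_ C (N ⊗ C)).hom ≫ (σ ▷ C) ▷ C) ⊗≫
          (β_ M (N ⊗ C)).hom ▷ C ▷ C ⊗≫
          N ◁ a ▷ C ▷ C ⊗≫ (N ⊗ M) ◁ μ[C] := by
        rw [← braiding_naturality_right]
        monoidal
      _ = ρ ▷ N ⊗≫ (M ⊗ C) ◁ (σ ≫ σ ▷ C ≫ (α_ _ _ _).hom) ⊗≫ M ◁ (β_ C (N ⊗ (C ⊗ C))).hom ⊗≫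
          (β_ M (N ⊗ C)).hom ▷ C ▷ C ⊗≫
          N ◁ a ▷ C ▷ C ⊗≫ (N ⊗ M) ◁ μ[C] := by
        rw [← braiding_naturality_right]
        simp only [braiding_tensor_right_hom]
        monoidal
      -- A cancelling pair of flips of M and C is inserted, so that the whole of M ⊗ C moves past N
      -- ⊗ (C ⊗ C) and naturality of the flip applies.
      _ = ρ ▷ N ⊗≫ (M ⊗ C) ◁ (σ ≫ N ◁ Δ[C]) ⊗≫ M ◁ (β_ C (N ⊗ (C ⊗ C))).hom ⊗≫
          (β_ M (N ⊗ C)).hom ▷ C ▷ C ⊗≫ N ◁ C ◁ ((β_ M C).hom ≫ (β_ C M).hom) ▷ C ⊗≫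
          N ◁ a ▷ C ▷ C ⊗≫ (N ⊗ M) ◁ μ[C] := by
        rw [hσ, SymmetricCategory.symmetry]
        monoidal
      _ = ρ ▷ N ⊗≫ ((M ⊗ C) ◁ (σ ≫ N ◁ Δ[C]) ≫ (β_ (M ⊗ C) (N ⊗ (C ⊗ C))).hom) ⊗≫
          N ◁ C ◁ (β_ C M).hom ▷ C ⊗≫ N ◁ a ▷ C ▷ C ⊗≫ (N ⊗ M) ◁ μ[C] := by
        simp only [braiding_tensor_left_hom M, braiding_tensor_right_hom]
        monoidal
      _ = (ρ ▷ N ≫ (β_ (M ⊗ C) N).hom) ⊗≫ (σ ≫ N ◁ Δ[C]) ▷ (M ⊗ C) ⊗≫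
          N ◁ C ◁ (β_ C M).hom ▷ C ⊗≫ N ◁ a ▷ C ▷ C ⊗≫ (N ⊗ M) ◁ μ[C] := by
        rw [braiding_naturality_right]
        monoidal
      _ = (β_ M N).hom ⊗≫ (N ◁ ρ ≫ (σ ≫ N ◁ Δ[C]) ▷ (M ⊗ C)) ⊗≫
          N ◁ C ◁ (β_ C M).hom ▷ C ⊗≫ N ◁ a ▷ C ▷ C ⊗≫ (N ⊗ M) ◁ μ[C] := by
        rw [braiding_naturality_left]
        monoidal
      _ = _ := by
        rw [whisker_exchange]
        simp only [crossL, tensorμ, MonoidalCategory.tensorHom_def]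
        monoidal
  rw [← h₂, h, ← h₁]
  simp [br, fuse]

end
end YD
end AnQG

/-! ### Tensor products of crossed bimodules, hexagons, and the induced action of a paired object -/

namespace AnQG
namespace YD
open MonObj ComonObj BraidedCategory
universe v w
variable {V : Type w} [Category.{v} V] [MonoidalCategory V] [SymmetricCategory V]
variable {C : V} [BimonObj C] {M N P : V}
variable {a : C ⊗ M ⟶ M} {b : C ⊗ N ⟶ N} {ρ : M ⟶ M ⊗ C} {σ : N ⟶ N ⊗ C}

/-- The comultiplication of a bialgebra is multiplicative and unital. -/
theorem tact_isAct (ha : IsAct a) (hb : IsAct b) : IsAct (tact a b) where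
  one := by
    rw [tact, ← comp_whiskerRight_assoc, BimonObj.one_comul, MonObj.tensorObj.one_def,
      comp_whiskerRight_assoc, tensorμ_natural_left_assoc, tensorHom_comp_tensorHom, ha.one, hb.one]
    exact (tensor_left_unitality M N).symm
  mul := by
    rw [tact, ← comp_whiskerRight_assoc, BimonObj.mul_comul, comp_whiskerRight_assoc,
      comp_whiskerRight_assoc, tensorμ_natural_left_assoc, tensorHom_comp_tensorHom, ha.mul, hb.mul,
      ← tensorHom_comp_tensorHom, tensor_associativity_assoc,
      ← tensorHom_comp_tensorHom, ← tensorμ_natural_right_assoc, MonoidalCategory.tensorHom_def Δ[C]]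
    simp only [MonoidalCategory.whiskerLeft_comp, Category.assoc, whisker_exchange_assoc,
      comp_whiskerRight]
    monoidal

/-- The opposite multiplication is again compatible with the comultiplication. It enters because the
coaction on a tensor product multiplies as n₁m₁. The proof lets two adjacent flips cancel, which
uses that the category is symmetric. -/
theorem op_mul_comul : ((β_ C C).hom ≫ μ[C]) ≫ Δ[C] =
    (Δ[C] ⊗ₘ Δ[C]) ≫ tensorμ C C C C ≫ (((β_ C C).hom ≫ μ[C]) ⊗ₘ ((β_ C C).hom ≫ μ[C])) := by
  have h : (β_ (C ⊗ C) (C ⊗ C)).hom ≫ tensorμ C C C C =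
      tensorμ C C C C ≫ ((β_ C C).hom ⊗ₘ (β_ C C).hom) := by
    rw [braiding_tensor_left_hom, braiding_tensor_right_hom]
    calc
      _ = 𝟙 _ ⊗≫ C ◁ (β_ C C).hom ▷ C ⊗≫ (C ⊗ C) ◁ (β_ C C).hom ⊗≫ (β_ C C).hom ▷ (C ⊗ C) ⊗≫
          C ◁ ((β_ C C).hom ≫ (β_ C C).hom) ▷ C ⊗≫ 𝟙 _ := by
        simp only [tensorμ]
        monoidal
      _ = 𝟙 _ ⊗≫ C ◁ (β_ C C).hom ▷ C ⊗≫ ((C ⊗ C) ◁ (β_ C C).hom ≫ (β_ C C).hom ▷ (C ⊗ C)) ⊗≫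
          𝟙 _ := by
        rw [SymmetricCategory.symmetry]
        monoidal
      _ = _ := by
        rw [whisker_exchange]
        simp only [tensorμ, MonoidalCategory.tensorHom_def]
        monoidal
  rw [Category.assoc, BimonObj.mul_comul, ← braiding_naturality_assoc, reassoc_of% h,
    tensorHom_comp_tensorHom]

/-- Both sides are m₀ ⊗ n₀ ⊗ n₁m₁ ⊗ n₂m₂: one by compatibility of the opposite multiplication with
the comultiplication, the other by coacting twice. -/
theorem tcoact_coassoc (hρ : ρ ≫ ρ ▷ C ≫ (α_ _ _ _).hom = ρ ≫ M ◁ Δ[C])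
    (hσ : σ ≫ σ ▷ C ≫ (α_ _ _ _).hom = σ ≫ N ◁ Δ[C]) :
    tcoact ρ σ ≫ tcoact ρ σ ▷ C ≫ (α_ _ _ _).hom = tcoact ρ σ ≫ (M ⊗ N) ◁ Δ[C] := by
  have h₁ : tcoact ρ σ ≫ (M ⊗ N) ◁ Δ[C] = ((ρ ≫ M ◁ Δ[C]) ⊗ₘ (σ ≫ N ◁ Δ[C])) ≫
      tensorμ M (C ⊗ C) N (C ⊗ C) ≫ (M ⊗ N) ◁ (tensorμ C C C C ≫
        (((β_ C C).hom ≫ μ[C]) ⊗ₘ ((β_ C C).hom ≫ μ[C]))) := by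
    have := tensorμ_natural (𝟙 M) Δ[C] (𝟙 N) Δ[C]
    simp only [id_tensorHom, MonoidalCategory.whiskerLeft_id] at this
    simp only [tcoact, Category.assoc]
    rw [← MonoidalCategory.whiskerLeft_comp, op_mul_comul, MonoidalCategory.whiskerLeft_comp,
      ← tensorHom_comp_tensorHom_assoc, reassoc_of% this]
  have h₂ : tcoact ρ σ ≫ tcoact ρ σ ▷ C ≫ (α_ _ _ _).hom =
      ((ρ ≫ ρ ▷ C) ⊗ₘ (σ ≫ σ ▷ C)) ≫ tensorμ (M ⊗ C) C (N ⊗ C) C ≫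
        tensorμ M C N C ▷ (C ⊗ C) ≫ (α_ _ _ _).hom ≫ (M ⊗ N) ◁
        (((β_ C C).hom ≫ μ[C]) ⊗ₘ ((β_ C C).hom ≫ μ[C])) := by
    have := tensorμ_natural ρ (𝟙 C) σ (𝟙 C)
    simp only [tensorHom_id, id_whiskerRight] at this
    rw [← tensorHom_comp_tensorHom_assoc, reassoc_of% this]
    simp only [tcoact, comp_whiskerRight, Category.assoc]
    simp only [whisker_exchange_assoc, MonoidalCategory.tensorHom_def ((β_ C C).hom ≫ μ[C])]
    monoidal
  rw [h₁, h₂, associator_monoidal_assoc, ← hρ, ← hσ]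
  simp only [MonoidalCategory.whiskerLeft_comp, tensorHom_comp_tensorHom_assoc, Category.assoc]

theorem tcoact_counit (hρ : ρ ≫ M ◁ ε[C] ≫ (ρ_ M).hom = 𝟙 M)
    (hσ : σ ≫ N ◁ ε[C] ≫ (ρ_ N).hom = 𝟙 N) :
    tcoact ρ σ ≫ (M ⊗ N) ◁ ε[C] ≫ (ρ_ (M ⊗ N)).hom = 𝟙 (M ⊗ N) := by
  have h₀ : ((β_ C C).hom ≫ μ[C]) ≫ ε[C] = (ε[C] ⊗ₘ ε[C]) ≫ (λ_ _).hom := by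
    rw [Category.assoc, BimonObj.mul_counit, Comon.tensorObj_counit,
      ← braiding_naturality_assoc, braiding_leftUnitor, unitors_equal]
  have h := tensorμ_natural (𝟙 M) ε[C] (𝟙 N) ε[C]
  simp only [id_tensorHom, MonoidalCategory.whiskerLeft_id] at h
  simp only [tcoact, Category.assoc]
  rw [← MonoidalCategory.whiskerLeft_comp_assoc, h₀, MonoidalCategory.whiskerLeft_comp_assoc,
    ← reassoc_of% h, tensorHom_comp_tensorHom_assoc, ← rightUnitor_monoidal,
    tensorHom_comp_tensorHom]
  simp only [Category.assoc, hρ, hσ, id_tensorHom_id]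

/-- Hexagon in the variable that is acted on: n₀ ⊗ n₁m ⊗ n₂p is obtained by coacting once and
splitting n₁, or by coacting twice. -/
theorem br_tact (b' : C ⊗ P ⟶ P) (hσ : σ ≫ σ ▷ C ≫ (α_ _ _ _).hom = σ ≫ N ◁ Δ[C]) :
    (α_ _ _ _).inv ≫ br (tact a b') σ ≫ (α_ _ _ _).inv =
      M ◁ br b' σ ≫ (α_ _ _ _).inv ≫ br a σ ▷ P := by
  symm
  calc
    _ = 𝟙 _ ⊗≫ M ◁ (β_ P N).hom ⊗≫ M ◁ σ ▷ P ⊗≫ ((M ⊗ N) ◁ b' ≫ br a σ ▷ P) := by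
      simp only [br]
      monoidal
    _ = 𝟙 _ ⊗≫ M ◁ (β_ P N).hom ⊗≫ M ◁ σ ▷ P ⊗≫ ((β_ M N).hom ≫ σ ▷ M) ▷ C ▷ P ⊗≫
        N ◁ a ▷ C ▷ P ⊗≫ (N ⊗ M) ◁ b' := by
      rw [whisker_exchange]
      simp only [br]
      monoidal
    _ = 𝟙 _ ⊗≫ M ◁ (β_ P N).hom ⊗≫ M ◁ (σ ≫ σ ▷ C ≫ (α_ _ _ _).hom) ▷ P ⊗≫
        (β_ M (N ⊗ C)).hom ▷ C ▷ P ⊗≫ N ◁ a ▷ C ▷ P ⊗≫ (N ⊗ M) ◁ b' := by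
      rw [← braiding_naturality_right]
      monoidal
    _ = 𝟙 _ ⊗≫ M ◁ (β_ P N).hom ⊗≫ M ◁ (σ ≫ N ◁ Δ[C]) ▷ P ⊗≫
        (β_ M (N ⊗ C)).hom ▷ C ▷ P ⊗≫ N ◁ C ◁ ((β_ M C).hom ≫ (β_ C M).hom) ▷ P ⊗≫
        N ◁ a ▷ C ▷ P ⊗≫ (N ⊗ M) ◁ b' := by
      rw [hσ, SymmetricCategory.symmetry]
      monoidal
    _ = 𝟙 _ ⊗≫ M ◁ (β_ P N).hom ⊗≫ (M ◁ (σ ≫ N ◁ Δ[C]) ≫ (β_ M (N ⊗ (C ⊗ C))).hom) ▷ P ⊗≫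
        N ◁ C ◁ (β_ C M).hom ▷ P ⊗≫ N ◁ a ▷ C ▷ P ⊗≫ (N ⊗ M) ◁ b' := by
      simp only [braiding_tensor_right_hom]
      monoidal
    _ = 𝟙 _ ⊗≫ M ◁ (β_ P N).hom ⊗≫ ((β_ M N).hom ≫ (σ ≫ N ◁ Δ[C]) ▷ M) ▷ P ⊗≫
        N ◁ C ◁ (β_ C M).hom ▷ P ⊗≫ N ◁ a ▷ C ▷ P ⊗≫ (N ⊗ M) ◁ b' := by
      rw [braiding_naturality_right]
    _ = _ := by
      simp only [br, tact, tensorμ, MonoidalCategory.tensorHom_def, braiding_tensor_left_hom]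
      monoidal

/-- Hexagon in the variable that coacts: n₀ ⊗ p₀ ⊗ (p₁n₁)m = n₀ ⊗ p₀ ⊗ p₁(n₁m). This identity forces
the order of multiplication in `tcoact`. -/
theorem br_tcoact (ha : IsAct a) (σ' : P ⟶ P ⊗ C) :
    (α_ _ _ _).hom ≫ br a (tcoact σ σ') ≫ (α_ _ _ _).hom =
      br a σ ▷ P ≫ (α_ _ _ _).hom ≫ N ◁ br a σ' := by
  symm
  calc
    _ = (β_ M N).hom ▷ P ⊗≫ σ ▷ M ▷ P ⊗≫ N ◁ (a ▷ P ≫ (β_ M P).hom) ⊗≫ N ◁ σ' ▷ M ⊗≫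
        N ◁ P ◁ a := by
      simp only [br]
      monoidal
    _ = (β_ M N).hom ▷ P ⊗≫ σ ▷ M ▷ P ⊗≫ N ◁ (β_ (C ⊗ M) P).hom ⊗≫ N ◁ (P ◁ a ≫ σ' ▷ M) ⊗≫
        N ◁ P ◁ a := by
      rw [braiding_naturality_left]
      monoidal
    _ = (β_ M N).hom ▷ P ⊗≫ (σ ▷ (M ⊗ P) ≫ (N ⊗ C) ◁ (β_ M P).hom) ⊗≫
        N ◁ ((β_ C P).hom ≫ σ' ▷ C) ▷ M ⊗≫
        N ◁ P ◁ (C ◁ a ≫ a) := by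
      rw [whisker_exchange, braiding_tensor_left_hom]
      monoidal
    _ = (β_ M N).hom ▷ P ⊗≫ N ◁ (β_ M P).hom ⊗≫ σ ▷ P ▷ M ⊗≫
        N ◁ (C ◁ σ' ≫ (β_ C (P ⊗ C)).hom) ▷ M ⊗≫
        N ◁ P ◁ ((α_ _ _ _).inv ≫ μ[C] ▷ M ≫ a) := by
      rw [← whisker_exchange, ← braiding_naturality_right, ha.mul, Iso.inv_hom_id_assoc]
      monoidal
    _ = _ := by
      simp only [br, tcoact, tensorμ, MonoidalCategory.tensorHom_def, braiding_tensor_right_hom]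
      monoidal

/-- Applying f and then g gives n₀ ⊗ g(n₁)f(n₂)m, so these operators compose by convolution; the map
applied second stands on the left. -/
theorem fuse_fuse (ha : IsAct a) (hσ : σ ≫ σ ▷ C ≫ (α_ _ _ _).hom = σ ≫ N ◁ Δ[C])
    (f g : C ⟶ C) : fuse (f ▷ M ≫ a) σ ≫ fuse (g ▷ M ≫ a) σ =
      fuse ((Δ[C] ≫ (g ⊗ₘ f) ≫ μ[C]) ▷ M ≫ a) σ := by
  calc
    _ = σ ▷ M ⊗≫ N ◁ f ▷ M ⊗≫ (N ◁ a ≫ σ ▷ M) ⊗≫ N ◁ g ▷ M ⊗≫ N ◁ a := by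
      simp only [fuse]
      monoidal
    _ = σ ▷ M ⊗≫ (N ◁ f ≫ σ ▷ C) ▷ M ⊗≫ N ◁ (C ◁ a ≫ g ▷ M) ⊗≫ N ◁ a := by
      rw [whisker_exchange]
      monoidal
    _ = (σ ≫ σ ▷ C ≫ (α_ _ _ _).hom) ▷ M ⊗≫ N ◁ (C ◁ f ≫ g ▷ C) ▷ M ⊗≫ N ◁ (C ◁ a ≫ a) := by
      rw [whisker_exchange, whisker_exchange]
      monoidal
    _ = (σ ≫ N ◁ Δ[C]) ▷ M ⊗≫ N ◁ (g ⊗ₘ f) ▷ M ⊗≫ N ◁ ((α_ _ _ _).inv ≫ μ[C] ▷ M ≫ a) := by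
      rw [hσ, ← MonoidalCategory.tensorHom_def', ha.mul, Iso.inv_hom_id_assoc]
    _ = _ := by
      simp only [fuse]
      monoidal

/-- The unit for convolution acts as the identity. Together with `fuse_fuse` this makes the antipode
invert the braiding. -/
theorem fuse_counit (ha : IsAct a) (hσ : σ ≫ N ◁ ε[C] ≫ (ρ_ N).hom = 𝟙 N) :
    fuse ((ε[C] ≫ η[C]) ▷ M ≫ a) σ = 𝟙 _ := by
  calc
    _ = (σ ≫ N ◁ ε[C]) ▷ M ⊗≫ N ◁ (η[C] ▷ M ≫ a) := by
      simp only [fuse]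
      monoidal
    _ = (σ ≫ N ◁ ε[C] ≫ (ρ_ N).hom) ▷ M ⊗≫ 𝟙 _ := by
      rw [ha.one]
      monoidal
    _ = _ := by
      rw [hσ]
      monoidal

/-- Coassociativity of the comultiplication. -/
theorem tact_assoc (b' : C ⊗ P ⟶ P) :
    tact (tact a b) b' ≫ (α_ _ _ _).hom = C ◁ (α_ _ _ _).hom ≫ tact a (tact b b') := by
  have h : (tact a b ⊗ₘ b') = (Δ[C] ▷ (M ⊗ N) ⊗ₘ 𝟙 (C ⊗ P)) ≫ tensorμ C C M N ▷ (C ⊗ P) ≫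
      ((a ⊗ₘ b) ⊗ₘ b') := by
    rw [← tensorHom_id (tensorμ C C M N), tensorHom_comp_tensorHom, tensorHom_comp_tensorHom]
    simp [tact]
  have h' : (a ⊗ₘ tact b b') = (𝟙 (C ⊗ M) ⊗ₘ Δ[C] ▷ (N ⊗ P)) ≫ (C ⊗ M) ◁ tensorμ C C N P ≫
      (a ⊗ₘ (b ⊗ₘ b')) := by
    rw [← id_tensorHom _ (tensorμ C C N P), tensorHom_comp_tensorHom, tensorHom_comp_tensorHom]
    simp [tact]
  have e₁ := tensorμ_natural_left Δ[C] (𝟙 C) (M ⊗ N) P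
  have e₂ := tensorμ_natural_left (𝟙 C) Δ[C] M (N ⊗ P)
  simp only [id_whiskerRight] at e₁ e₂
  have h₁ : tact (tact a b) b' = Δ[C] ▷ ((M ⊗ N) ⊗ P) ≫ tensorμ C C (M ⊗ N) P ≫
    (tact a b ⊗ₘ b') := rfl
  have h₂ : tact a (tact b b') = Δ[C] ▷ (M ⊗ (N ⊗ P)) ≫ tensorμ C C M (N ⊗ P) ≫
    (a ⊗ₘ tact b b') := rfl
  rw [h₁, h₂, h, h', ← reassoc_of% e₁, ← reassoc_of% e₂]
  simp only [Category.assoc]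
  rw [associator_naturality, associator_monoidal_assoc, whisker_exchange_assoc,
    whisker_exchange_assoc, ← comp_whiskerRight_assoc, ← comp_whiskerRight_assoc,
    tensorHom_id, id_tensorHom, ComonObj.comul_assoc]
  simp only [MonoidalCategory.tensorHom_def, Category.assoc, comp_whiskerRight]

theorem trivial_isAct : IsAct ((ρ_ C).hom ≫ ε[C]) where
  one := by
    rw [rightUnitor_naturality_assoc, BimonObj.one_counit, Category.comp_id, unitors_equal]
  mul := by
    rw [rightUnitor_naturality_assoc, BimonObj.mul_counit, Comon.tensorObj_counit]
    calc
      _ = 𝟙 _ ⊗≫ (ε[C] ⊗ₘ ε[C]) ⊗≫ 𝟙 _ := by monoidal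
      _ = _ := by
        rw [MonoidalCategory.tensorHom_def']
        monoidal

theorem tact_leftUnitor : tact ((ρ_ C).hom ≫ ε[C]) a ≫ (λ_ M).hom = C ◁ (λ_ M).hom ≫ a := by
  have h : (((ρ_ C).hom ≫ ε[C]) ⊗ₘ a) = (ε[C] ▷ 𝟙_ V ⊗ₘ 𝟙 C ▷ M) ≫ ((ρ_ _).hom ⊗ₘ a) := by
    rw [tensorHom_comp_tensorHom, rightUnitor_naturality]
    simp
  have e : ((ρ_ (𝟙_ V)).hom ⊗ₘ a) ≫ (λ_ M).hom = (λ_ (𝟙_ V)).hom ▷ (C ⊗ M) ≫ (λ_ _).hom ≫ a := by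
    rw [MonoidalCategory.tensorHom_def, Category.assoc, leftUnitor_naturality, unitors_equal]
  rw [tact, h, ← tensorμ_natural_left_assoc, tensorHom_id, ← comp_whiskerRight_assoc,
    ComonObj.counit_comul, Category.assoc, Category.assoc, e, ← leftUnitor_monoidal_assoc]
  simp [MonoidalCategory.tensorHom_def]

theorem tact_rightUnitor : tact a ((ρ_ C).hom ≫ ε[C]) ≫ (ρ_ M).hom = C ◁ (ρ_ M).hom ≫ a := by
  have h : (a ⊗ₘ ((ρ_ C).hom ≫ ε[C])) = (𝟙 C ▷ M ⊗ₘ ε[C] ▷ 𝟙_ V) ≫ (a ⊗ₘ (ρ_ _).hom) := by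
    rw [tensorHom_comp_tensorHom, rightUnitor_naturality]
    simp
  have e : (a ⊗ₘ (ρ_ (𝟙_ V)).hom) ≫ (ρ_ M).hom = (C ⊗ M) ◁ (λ_ (𝟙_ V)).hom ≫ (ρ_ _).hom ≫ a := by
    rw [MonoidalCategory.tensorHom_def', Category.assoc, rightUnitor_naturality, unitors_equal]
  rw [tact, h, ← tensorμ_natural_left_assoc, id_tensorHom, ← comp_whiskerRight_assoc,
    ComonObj.comul_counit, Category.assoc, Category.assoc, e, ← rightUnitor_monoidal_assoc]
  simp [MonoidalCategory.tensorHom_def]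

theorem tact_whiskerLeft {b' : C ⊗ P ⟶ P} (f : N ⟶ P) (h : C ◁ f ≫ b' = b ≫ f) :
    C ◁ (M ◁ f) ≫ tact a b' = tact a b ≫ M ◁ f := by
  rw [whiskerLeft_tact, h, tact]
  simp [MonoidalCategory.tensorHom_def]

theorem tact_whiskerRight {a' : C ⊗ P ⟶ P} (f : M ⟶ P) (h : C ◁ f ≫ a' = a ≫ f) :
    C ◁ (f ▷ N) ≫ tact a' b = tact a b ≫ f ▷ N := by
  have h' := tensorμ_natural (𝟙 C) (𝟙 C) f (𝟙 N)
  simp only [id_tensorHom, tensorHom_id, id_whiskerRight, MonoidalCategory.whiskerLeft_id] at h'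
  rw [tact, whisker_exchange_assoc, reassoc_of% h', tact]
  simp only [MonoidalCategory.tensorHom_def, Category.assoc, ← comp_whiskerRight_assoc, h]
  rw [comp_whiskerRight_assoc, ← whisker_exchange]

theorem mul_isAct : IsAct μ[C] where
  one := MonObj.one_mul C
  mul := MonObj.mul_assoc C

/-- Converse of `br_linear` for the regular module: with M = C no information is lost when the last
factor acts, since it can be evaluated at 1. -/
theorem crossed_of_linear (h : C ◁ br μ[C] σ ≫ tact b μ[C] = tact μ[C] b ≫ br μ[C] σ) :
    crossL b σ = crossR b σ := by
  have key : crossL b σ ▷ C ≫ (α_ _ _ _).hom ≫ N ◁ μ[C] =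
      crossR b σ ▷ C ≫ (α_ _ _ _).hom ≫ N ◁ μ[C] := by
    have h₀ : br μ[C] σ = (β_ C N).hom ≫ fuse μ[C] σ := rfl
    rw [crossL_mul mul_isAct, crossR_mul mul_isAct]
    rw [h₀, ← Category.assoc (tact _ _), tact_braid, MonoidalCategory.whiskerLeft_comp] at h
    simp only [Category.assoc] at h
    rw [cancel_epi, ← cancel_epi (α_ _ _ _).hom, Iso.hom_inv_id_assoc] at h
    exact h
  -- Any map into N ⊗ C is recovered by inserting the unit of C and multiplying.
  have e : ∀ x : C ⊗ N ⟶ N ⊗ C, (ρ_ _).inv ≫ (C ⊗ N) ◁ η[C] ≫ x ▷ C ≫ (α_ _ _ _).hom ≫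
      N ◁ μ[C] = x := fun x => by
    rw [whisker_exchange_assoc, associator_naturality_right_assoc,
      ← MonoidalCategory.whiskerLeft_comp, MonObj.mul_one]
    monoidal
  rw [← e (crossL b σ), key, e]

/-- By `crossed_of_linear` it suffices that the braiding of the regular module with M ⊗ N is linear.
The hexagon `br_tcoact` factors it into the braidings with M and with N, and both are linear by
`br_linear`. -/
theorem tcoact_crossed (hρ : crossL a ρ = crossR a ρ) (hσ : crossL b σ = crossR b σ) :
    crossL (tact a b) (tcoact ρ σ) = crossR (tact a b) (tcoact ρ σ) := by
  refine crossed_of_linear ?_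
  have h := br_tcoact (σ := ρ) (mul_isAct (C := C)) σ
  rw [← Iso.eq_inv_comp, ← Category.assoc, ← Iso.eq_comp_inv] at h
  have e₁ := br_linear (mul_isAct (C := C)) hρ
  have e₂ := br_linear (mul_isAct (C := C)) hσ
  have a₁ := tact_assoc (a := a) (b := b) μ[C]
  have a₂ := tact_assoc (a := a) (b := μ[C]) b
  have a₃ := tact_assoc (a := μ[C]) (b := a) b
  have a₁' : C ◁ (α_ M N C).inv ≫ tact (tact a b) μ[C] = tact a (tact b μ[C]) ≫ (α_ _ _ _).inv := by
    rw [Iso.eq_comp_inv, Category.assoc, a₁, ← MonoidalCategory.whiskerLeft_comp_assoc]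
    simp
  have a₃' : C ◁ (α_ C M N).inv ≫ tact (tact μ[C] a) b = tact μ[C] (tact a b) ≫ (α_ _ _ _).inv := by
    rw [Iso.eq_comp_inv, Category.assoc, a₃, ← MonoidalCategory.whiskerLeft_comp_assoc]
    simp
  rw [h]
  simp only [MonoidalCategory.whiskerLeft_comp, Category.assoc]
  rw [a₁', reassoc_of% (tact_whiskerLeft (a := a) _ e₂), ← reassoc_of% a₂,
    reassoc_of% (tact_whiskerRight (b := b) _ e₁), reassoc_of% a₃']

section
variable {T : V}

/-- `b ⊗ m ↦ m₀ ⟨b, m₁⟩` -/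
def pact (p : T ⊗ C ⟶ 𝟙_ V) (ρ : M ⟶ M ⊗ C) : T ⊗ M ⟶ M :=
  T ◁ ρ ≫ (α_ _ _ _).inv ≫ (β_ _ _).hom ▷ C ≫ (α_ _ _ _).hom ≫ M ◁ p ≫ (ρ_ M).hom

/-- In elements, m₀ ⊗ n₀⟨t, n₁m₁⟩ = m₀⟨t₁, m₁⟩ ⊗ n₀⟨t₂, n₁⟩. The reversed order in the
multiplicativity of the pairing matches the reversed order in `tcoact`. -/
theorem pact_tcoact (p : T ⊗ C ⟶ 𝟙_ V) (d : T ⟶ T ⊗ T)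
    (h : T ◁ ((β_ C C).hom ≫ μ[C]) ≫ p = d ▷ (C ⊗ C) ≫ tensorμ T T C C ≫ (p ⊗ₘ p) ≫ (λ_ _).hom) :
    pact p (tcoact ρ σ) = d ▷ (M ⊗ N) ≫ tensorμ T T M N ≫ (pact p ρ ⊗ₘ pact p σ) := by
  -- Common form of both sides: t is split and both coactions are applied, all flips follow, and the
  -- two evaluations come last.
  have hl : pact p (tcoact ρ σ) = d ▷ (M ⊗ N) ⊗≫ (T ⊗ T) ◁ ρ ▷ N ⊗≫ (T ⊗ T) ◁ (M ⊗ C) ◁ σ ⊗≫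
      (β_ (T ⊗ T) M).hom ▷ (C ⊗ N ⊗ C) ⊗≫ M ◁ (T ⊗ T) ◁ (β_ C N).hom ▷ C ⊗≫
      M ◁ (β_ (T ⊗ T) N).hom ▷ (C ⊗ C) ⊗≫ (M ⊗ N) ◁ T ◁ (β_ T C).hom ▷ C ⊗≫
      (M ⊗ N) ◁ p ▷ (T ⊗ C) ⊗≫ (M ⊗ N) ◁ p ⊗≫ 𝟙 _ := by
    calc
      _ = T ◁ ((ρ ⊗ₘ σ) ≫ tensorμ M C N C) ⊗≫ ((T ⊗ (M ⊗ N)) ◁ ((β_ C C).hom ≫ μ[C]) ≫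
          (β_ T (M ⊗ N)).hom ▷ C) ⊗≫ (M ⊗ N) ◁ p ⊗≫ 𝟙 _ := by
        simp only [pact, tcoact]
        monoidal
      _ = T ◁ ((ρ ⊗ₘ σ) ≫ tensorμ M C N C) ⊗≫ (β_ T (M ⊗ N)).hom ▷ (C ⊗ C) ⊗≫
          (M ⊗ N) ◁ (T ◁ ((β_ C C).hom ≫ μ[C]) ≫ p) ⊗≫ 𝟙 _ := by
        rw [whisker_exchange]
        monoidal
      _ = T ◁ ((ρ ⊗ₘ σ) ≫ tensorμ M C N C) ⊗≫ ((β_ T (M ⊗ N)).hom ≫ (M ⊗ N) ◁ d) ▷ (C ⊗ C) ⊗≫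
          (M ⊗ N) ◁ (tensorμ T T C C ≫ (p ⊗ₘ p)) ⊗≫ 𝟙 _ := by
        rw [h]
        monoidal
      _ = (T ◁ ((ρ ⊗ₘ σ) ≫ tensorμ M C N C) ≫ d ▷ _) ⊗≫ (β_ (T ⊗ T) (M ⊗ N)).hom ▷ (C ⊗ C) ⊗≫
          (M ⊗ N) ◁ (tensorμ T T C C ≫ (p ⊗ₘ p)) ⊗≫ 𝟙 _ := by
        rw [← braiding_naturality_left]
        monoidal
      _ = d ▷ (M ⊗ N) ⊗≫ (T ⊗ T) ◁ ρ ▷ N ⊗≫ (T ⊗ T) ◁ (M ⊗ C) ◁ σ ⊗≫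
          (((T ⊗ T) ⊗ M) ◁ (β_ C N).hom ≫ (β_ (T ⊗ T) M).hom ▷ (N ⊗ C)) ▷ C ⊗≫
          M ◁ (β_ (T ⊗ T) N).hom ▷ (C ⊗ C) ⊗≫
          (M ⊗ N) ◁ (tensorμ T T C C ≫ (p ⊗ₘ p)) ⊗≫ 𝟙 _ := by
        rw [whisker_exchange, braiding_tensor_right_hom (T ⊗ T)]
        simp only [tensorμ, MonoidalCategory.tensorHom_def ρ]
        monoidal
      _ = _ := by
        rw [whisker_exchange]
        simp only [tensorμ, MonoidalCategory.tensorHom_def]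
        monoidal
  -- An evaluation may be postponed past N because the flip with the unit object is trivial.
  have hp : p ▷ N = (β_ (T ⊗ C) N).hom ≫ N ◁ p ≫ (ρ_ N).hom ≫ (λ_ N).inv := by
    rw [← braiding_naturality_left_assoc, braiding_tensorUnit_left]
    simp
  rw [hl]
  symm
  calc
    _ = d ▷ (M ⊗ N) ⊗≫ T ◁ (β_ T M).hom ▷ N ⊗≫ T ◁ ρ ▷ T ▷ N ⊗≫ (β_ T M).hom ▷ (C ⊗ T ⊗ N) ⊗≫
        M ◁ (p ▷ (T ⊗ N) ≫ 𝟙_ V ◁ (T ◁ σ ≫ (α_ _ _ _).inv ≫ (β_ T N).hom ▷ C)) ⊗≫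
        (M ⊗ N) ◁ p ⊗≫ 𝟙 _ := by
      simp only [pact, tensorμ, MonoidalCategory.tensorHom_def]
      monoidal
    _ = d ▷ (M ⊗ N) ⊗≫ T ◁ ((β_ T M).hom ≫ ρ ▷ T) ▷ N ⊗≫ (β_ T M).hom ▷ (C ⊗ T ⊗ N) ⊗≫
        M ◁ (T ⊗ C) ◁ (T ◁ σ ≫ (α_ _ _ _).inv ≫ (β_ T N).hom ▷ C) ⊗≫ M ◁ p ▷ N ▷ (T ⊗ C) ⊗≫
        (M ⊗ N) ◁ p ⊗≫ 𝟙 _ := by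
      rw [← whisker_exchange]
      monoidal
    _ = d ▷ (M ⊗ N) ⊗≫ (T ⊗ T) ◁ ρ ▷ N ⊗≫
        ((T ◁ (β_ T (M ⊗ C)).hom ⊗≫ (β_ T M).hom ▷ (C ⊗ T)) ▷ N ≫
        ((M ⊗ T) ⊗ (C ⊗ T)) ◁ σ) ⊗≫
        M ◁ (T ⊗ C) ◁ (β_ T N).hom ▷ C ⊗≫ M ◁ (β_ (T ⊗ C) N).hom ▷ (T ⊗ C) ⊗≫
        (M ⊗ N) ◁ p ▷ (T ⊗ C) ⊗≫ (M ⊗ N) ◁ p ⊗≫ 𝟙 _ := by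
      rw [hp, ← braiding_naturality_right]
      monoidal
    _ = d ▷ (M ⊗ N) ⊗≫ (T ⊗ T) ◁ ρ ▷ N ⊗≫ (T ⊗ T) ◁ (M ⊗ C) ◁ σ ⊗≫
        T ◁ (β_ T M).hom ▷ (C ⊗ N ⊗ C) ⊗≫
        ((T ⊗ M) ◁ (β_ T C).hom ≫ (β_ T M).hom ▷ (C ⊗ T)) ▷ (N ⊗ C) ⊗≫
        M ◁ (T ⊗ C) ◁ (β_ T N).hom ▷ C ⊗≫ M ◁ (β_ (T ⊗ C) N).hom ▷ (T ⊗ C) ⊗≫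
        (M ⊗ N) ◁ p ▷ (T ⊗ C) ⊗≫ (M ⊗ N) ◁ p ⊗≫ 𝟙 _ := by
      rw [← whisker_exchange, braiding_tensor_right_hom T M C]
      monoidal
    _ = d ▷ (M ⊗ N) ⊗≫ (T ⊗ T) ◁ ρ ▷ N ⊗≫ (T ⊗ T) ◁ (M ⊗ C) ◁ σ ⊗≫
        (β_ (T ⊗ T) M).hom ▷ (C ⊗ N ⊗ C) ⊗≫
        M ◁ T ◁ ((β_ T C).hom ▷ N ≫ (β_ (C ⊗ T) N).hom) ▷ C ⊗≫
        M ◁ (β_ T N).hom ▷ (C ⊗ T ⊗ C) ⊗≫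
        (M ⊗ N) ◁ p ▷ (T ⊗ C) ⊗≫ (M ⊗ N) ◁ p ⊗≫ 𝟙 _ := by
      rw [whisker_exchange, braiding_tensor_left_hom T C N, braiding_tensor_left_hom C T N,
        braiding_tensor_left_hom T T M]
      monoidal
    _ = d ▷ (M ⊗ N) ⊗≫ (T ⊗ T) ◁ ρ ▷ N ⊗≫ (T ⊗ T) ◁ (M ⊗ C) ◁ σ ⊗≫
        (β_ (T ⊗ T) M).hom ▷ (C ⊗ N ⊗ C) ⊗≫
        M ◁ T ◁ (β_ (T ⊗ C) N).hom ▷ C ⊗≫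
        M ◁ ((T ⊗ N) ◁ (β_ T C).hom ≫ (β_ T N).hom ▷ (C ⊗ T)) ▷ C ⊗≫
        (M ⊗ N) ◁ p ▷ (T ⊗ C) ⊗≫ (M ⊗ N) ◁ p ⊗≫ 𝟙 _ := by
      rw [braiding_naturality_left]
      monoidal
    _ = _ := by
      rw [whisker_exchange, braiding_tensor_left_hom T C N, braiding_tensor_left_hom T T N]
      monoidal

/-- the trivial coaction on the unit -/
def ucoact : 𝟙_ V ⟶ 𝟙_ V ⊗ C := η[C] ≫ (λ_ C).inv

/-- For the crossed condition, both sides reduce to c ⊗ 1 ↦ 1 ⊗ c by the counit and unit axioms. -/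
theorem ucoact_isYD : IsYD ((ρ_ C).hom ≫ ε[C]) (ucoact (C := C)) where
  coassoc := by
    simp only [ucoact, Category.assoc]
    rw [← leftUnitor_inv_naturality, BimonObj.one_comul_assoc, MonObj.tensorObj.one_def]
    calc
      _ = 𝟙 _ ⊗≫ (η[C] ≫ (λ_ C).inv ≫ 𝟙_ V ◁ 𝟙 C ≫ η[C] ▷ C) ⊗≫ 𝟙 _ := by monoidal
      _ = _ := by
        simp only [MonoidalCategory.tensorHom_def', MonoidalCategory.whiskerLeft_id,
          Category.id_comp, leftUnitor_inv_naturality_assoc]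
        monoidal
  counit := by
    simp only [ucoact, Category.assoc]
    rw [← leftUnitor_inv_naturality_assoc, BimonObj.one_counit_assoc]
    monoidal
  crossed := by
    have hl : crossL ((ρ_ C).hom ≫ ε[C]) (ucoact (C := C)) = 𝟙 _ ⊗≫ 𝟙 _ := by
      calc
        _ = Δ[C] ▷ 𝟙_ V ⊗≫ (C ◁ (C ◁ η[C]) ≫ ε[C] ▷ (C ⊗ C)) ⊗≫ μ[C] ⊗≫ 𝟙 _ := by
          simp only [crossL, ucoact, tensorμ, braiding_tensorUnit_right,
            MonoidalCategory.tensorHom_def]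
          monoidal
        _ = Δ[C] ▷ 𝟙_ V ⊗≫ ε[C] ▷ C ▷ 𝟙_ V ⊗≫ (C ◁ η[C] ≫ μ[C]) ⊗≫ 𝟙 _ := by
          rw [whisker_exchange]
          monoidal
        _ = (Δ[C] ≫ ε[C] ▷ C) ▷ 𝟙_ V ⊗≫ (C ◁ η[C] ≫ μ[C]) ⊗≫ 𝟙 _ := by monoidal
        _ = _ := by
          rw [ComonObj.counit_comul, MonObj.mul_one]
          monoidal
    have hr : crossR ((ρ_ C).hom ≫ ε[C]) (ucoact (C := C)) = 𝟙 _ ⊗≫ 𝟙 _ := by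
      calc
        _ = (Δ[C] ≫ C ◁ ε[C]) ▷ 𝟙_ V ⊗≫ (η[C] ▷ C ≫ μ[C]) ⊗≫ 𝟙 _ := by
          simp only [crossR, ucoact, braiding_tensorUnit_right]
          monoidal
        _ = _ := by
          rw [ComonObj.comul_counit, MonObj.one_mul]
          monoidal
    rw [hl, hr]

theorem pact_ucoact (p : T ⊗ C ⟶ 𝟙_ V) (e : T ⟶ 𝟙_ V) (h : T ◁ η[C] ≫ p = (ρ_ T).hom ≫ e) :
    pact p ucoact = (ρ_ T).hom ≫ e := by
  rw [← h]
  simp only [pact, ucoact, braiding_tensorUnit_right]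
  monoidal
end
end YD
end AnQG

/-! ### Naturality and invertibility of the braiding; modules over a bialgebra generated by a dual
pair -/

namespace AnQG
namespace YD
open MonObj ComonObj BraidedCategory
universe v w
variable {V : Type w} [Category.{v} V] [MonoidalCategory V] [SymmetricCategory V]

section
variable {C M N P : V} {a : C ⊗ M ⟶ M} {σ : N ⟶ N ⊗ C}
theorem br_natural_left {a' : C ⊗ P ⟶ P} (f : M ⟶ P) (h : a ≫ f = C ◁ f ≫ a') :
    f ▷ N ≫ br a' σ = br a σ ≫ N ◁ f := by
  simp only [br, Category.assoc]
  rw [← MonoidalCategory.whiskerLeft_comp, h, braiding_naturality_left_assoc,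
    whisker_exchange_assoc, MonoidalCategory.whiskerLeft_comp]
  simp

theorem br_natural_right {σ' : P ⟶ P ⊗ C} (f : N ⟶ P) (h : σ ≫ f ▷ C = f ≫ σ') :
    M ◁ f ≫ br a σ' = br a σ ≫ f ▷ M := by
  simp only [br, Category.assoc]
  rw [braiding_naturality_right_assoc, ← comp_whiskerRight_assoc, ← h, whisker_exchange]
  simp

end

section
variable {C : V} [BimonObj C] {M N : V}
variable {a : C ⊗ M ⟶ M} {b : C ⊗ N ⟶ N} {ρ : M ⟶ M ⊗ C} {σ : N ⟶ N ⊗ C}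

/-- The inverse of `br`, given an antipode. -/
theorem br_inverse (ha : IsAct a) (hσ : σ ≫ σ ▷ C ≫ (α_ _ _ _).hom = σ ≫ N ◁ Δ[C])
    (hc : σ ≫ N ◁ ε[C] ≫ (ρ_ N).hom = 𝟙 N) (S : C ⟶ C)
    (h₁ : Δ[C] ≫ S ▷ C ≫ μ[C] = ε[C] ≫ η[C]) (h₂ : Δ[C] ≫ C ◁ S ≫ μ[C] = ε[C] ≫ η[C]) :
    br a σ ≫ fuse (S ▷ M ≫ a) σ ≫ (β_ N M).hom = 𝟙 _ ∧
      (fuse (S ▷ M ≫ a) σ ≫ (β_ N M).hom) ≫ br a σ = 𝟙 _ := by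
  -- The braiding is the flip followed by the operator attached to the identity of C, whose
  -- convolution inverse is the antipode.
  have e : br a σ = (β_ M N).hom ≫ fuse (𝟙 C ▷ M ≫ a) σ := by simp [br, fuse]
  constructor
  · rw [e, Category.assoc, reassoc_of% (fuse_fuse ha hσ), tensorHom_id, h₁, fuse_counit ha hc]
    simp
  · rw [e, Category.assoc, SymmetricCategory.symmetry_assoc, fuse_fuse ha hσ, id_tensorHom, h₂,
      fuse_counit ha hc]
end

section
variable {U C A : V} [BimonObj U] [BimonObj C] {M N P : V}

theorem whiskerRight_tact {f : A ⟶ U} {d : A ⟶ A ⊗ A} (h : f ≫ Δ[U] = d ≫ (f ⊗ₘ f))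
    (u : U ⊗ M ⟶ M) (w : U ⊗ N ⟶ N) : f ▷ (M ⊗ N) ≫ tact u w =
      d ▷ (M ⊗ N) ≫ tensorμ A A M N ≫ ((f ▷ M ≫ u) ⊗ₘ (f ▷ N ≫ w)) := by
  rw [tact, ← comp_whiskerRight_assoc, h, comp_whiskerRight_assoc, tensorμ_natural_left_assoc,
    tensorHom_comp_tensorHom]

theorem IsAct.whiskerRight {f : C ⟶ U} [IsMonHom f] {u : U ⊗ M ⟶ M} (h : IsAct u) :
    IsAct (f ▷ M ≫ u) where
  one := by rw [← comp_whiskerRight_assoc, IsMonHom.one_hom, h.one]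
  mul := by
    rw [← comp_whiskerRight_assoc, IsMonHom.mul_hom, comp_whiskerRight_assoc, h.mul,
      MonoidalCategory.tensorHom_def', MonoidalCategory.whiskerLeft_comp, Category.assoc,
      comp_whiskerRight_assoc, associator_naturality_left_assoc, ← whisker_exchange_assoc]
    simp

/-- The evaluation of a map to `Y ⊗ C` at a functional parametrized by `T`. -/
def evalAt {T : V} (p : T ⊗ C ⟶ 𝟙_ V) (Y : V) : T ⊗ (Y ⊗ C) ⟶ Y :=
  (α_ _ _ _).inv ≫ (β_ _ _).hom ▷ C ≫ (α_ _ _ _).hom ≫ Y ◁ p ≫ (ρ_ Y).hom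

/-- A bialgebra map `φ : C → U`, and an object `T` of elements of `U` paired with `C`, which
together with `C` generates `U`. -/
structure Duality (φ : C ⟶ U) [IsBimonHom φ] {T : V} (j : T ⟶ U) (d : T ⟶ T ⊗ T)
    (p : T ⊗ C ⟶ 𝟙_ V) (S : C ⟶ C) : Prop where
  comul : j ≫ Δ[U] = d ≫ (j ⊗ₘ j)
  pair_mul : T ◁ ((β_ C C).hom ≫ μ[C]) ≫ p =
    d ▷ (C ⊗ C) ≫ tensorμ T T C C ≫ (p ⊗ₘ p) ≫ (λ_ _).hom
  pair_one : T ◁ η[C] ≫ p = (ρ_ T).hom ≫ j ≫ ε[U]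
  separating : ∀ {X Y : V} (f g : X ⟶ Y ⊗ C),
    T ◁ f ≫ evalAt p Y = T ◁ g ≫ evalAt p Y → f = g
  generating : ∀ {X Y : V} (f g : U ⊗ X ⟶ Y),
    ((φ ⊗ₘ j) ≫ μ[U]) ▷ X ≫ f = ((φ ⊗ₘ j) ≫ μ[U]) ▷ X ≫ g → f = g
  antipode_left : Δ[C] ≫ S ▷ C ≫ μ[C] = ε[C] ≫ η[C]
  antipode_right : Δ[C] ≫ C ◁ S ≫ μ[C] = ε[C] ≫ η[C]

variable {φ : C ⟶ U} [IsBimonHom φ] {T : V} {j : T ⟶ U} {d : T ⟶ T ⊗ T}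
    {p : T ⊗ C ⟶ 𝟙_ V} {S : C ⟶ C}

theorem tact_restrict (u : U ⊗ M ⟶ M) (w : U ⊗ N ⟶ N) :
    φ ▷ (M ⊗ N) ≫ tact u w = tact (φ ▷ M ≫ u) (φ ▷ N ≫ w) :=
  whiskerRight_tact (IsComonHom.hom_comul φ) u w

variable (φ j p) in
/-- Coactions which make a `U`-module a crossed bimodule and induce the action of `T`. -/
structure Compat (u : U ⊗ M ⟶ M) (ρ : M ⟶ M ⊗ C) : Prop where
  yd : IsYD (φ ▷ M ≫ u) ρ
  act : j ▷ M ≫ u = pact p ρ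

namespace Duality
variable (D : Duality φ j d p S) {u : U ⊗ M ⟶ M} {w : U ⊗ N ⟶ N} {x : U ⊗ P ⟶ P}
  {ρ : M ⟶ M ⊗ C} {σ : N ⟶ N ⊗ C}

include D

theorem compat_tensor (hρ : Compat φ j p u ρ) (hσ : Compat φ j p w σ) :
    Compat φ j p (tact u w) (tcoact ρ σ) where
  yd := by
    rw [tact_restrict]
    exact ⟨tcoact_coassoc hρ.yd.coassoc hσ.yd.coassoc, tcoact_counit hρ.yd.counit hσ.yd.counit,
      tcoact_crossed hρ.yd.crossed hσ.yd.crossed⟩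
  act := by
    rw [whiskerRight_tact D.comul, pact_tcoact p d D.pair_mul, hρ.act, hσ.act]

theorem compat_unit : Compat φ j p ((ρ_ U).hom ≫ ε[U]) (ucoact (C := C)) where
  yd := by
    rw [rightUnitor_naturality_assoc, IsComonHom.hom_counit φ]
    exact ucoact_isYD
  act := by
    rw [rightUnitor_naturality_assoc, pact_ucoact p _ D.pair_one]

/-- The action of `T` determines all evaluations of the coaction, and these separate points. -/
theorem coact_unique {ρ' : M ⟶ M ⊗ C} (h : Compat φ j p u ρ) (h' : Compat φ j p u ρ') :
    ρ = ρ' := D.separating _ _ (h.act.symm.trans h'.act)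

/-- A `U`-linear map commutes with the action of `T`, that is, with every evaluation of the
coactions. Separation lifts this to the coactions themselves, and naturality of the braiding in the
coacting variable follows. -/
theorem colinear (hρ : Compat φ j p u ρ) (hσ : Compat φ j p w σ) (f : M ⟶ N)
    (h : u ≫ f = U ◁ f ≫ w) : ρ ≫ f ▷ C = f ≫ σ := by
  refine D.separating _ _ ?_
  have h₁ : T ◁ (ρ ≫ f ▷ C) ≫ evalAt p N = pact p ρ ≫ f := by
    simp only [pact, evalAt, MonoidalCategory.whiskerLeft_comp, Category.assoc]
    rw [associator_inv_naturality_middle_assoc, ← comp_whiskerRight_assoc,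
      braiding_naturality_right, comp_whiskerRight_assoc, associator_naturality_left_assoc,
      ← whisker_exchange_assoc, rightUnitor_naturality]
  have h₂ : T ◁ (f ≫ σ) ≫ evalAt p N = T ◁ f ≫ pact p σ := by
    simp [pact, evalAt]
  rw [h₁, h₂, ← hρ.act, ← hσ.act, Category.assoc, h, whisker_exchange_assoc]

/-- A map which commutes with the actions of `C` and of `T` commutes with products φ(c)j(t), and
these suffice by `generating`. -/
theorem linear_of (hu : IsAct u) (hw : IsAct w) (f : M ⟶ N)
    (h₁ : C ◁ f ≫ φ ▷ N ≫ w = (φ ▷ M ≫ u) ≫ f) (h₂ : T ◁ f ≫ j ▷ N ≫ w = (j ▷ M ≫ u) ≫ f) :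
    U ◁ f ≫ w = u ≫ f := by
  refine D.generating _ _ ?_
  have e : ∀ {Q : V} {z : U ⊗ Q ⟶ Q}, IsAct z → ((φ ⊗ₘ j) ≫ μ[U]) ▷ Q ≫ z =
      (α_ _ _ _).hom ≫ C ◁ (j ▷ Q ≫ z) ≫ φ ▷ Q ≫ z := fun hz => by
    rw [comp_whiskerRight_assoc, hz.mul, MonoidalCategory.tensorHom_def',
      MonoidalCategory.whiskerLeft_comp, Category.assoc,
      comp_whiskerRight_assoc, associator_naturality_left_assoc, ← whisker_exchange_assoc]
    simp
  rw [← whisker_exchange_assoc, e hw, ← Category.assoc _ u, e hu,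
    associator_naturality_right_assoc, ← MonoidalCategory.whiskerLeft_comp_assoc, h₂]
  simp only [MonoidalCategory.whiskerLeft_comp, Category.assoc] at h₁ ⊢
  rw [h₁]

/-- `C`-linearity is the crossed condition on N. For `T`, the action on both tensor products comes
from the tensor product coaction, so the colinearity of the braiding, which uses the crossed
condition on M, gives `T`-linearity. -/
theorem braiding_linear (hu : IsAct u) (hw : IsAct w) (hρ : Compat φ j p u ρ)
    (hσ : Compat φ j p w σ) :
    U ◁ br (φ ▷ M ≫ u) σ ≫ tact w u = tact u w ≫ br (φ ▷ M ≫ u) σ := by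
  refine D.linear_of (tact_isAct hu hw) (tact_isAct hw hu) _ ?_ ?_
  · rw [tact_restrict, tact_restrict]
    exact br_linear hu.whiskerRight hσ.yd.crossed
  · rw [(D.compat_tensor hσ hρ).act, (D.compat_tensor hρ hσ).act]
    have h := br_colinear (a := φ ▷ M ≫ u) hσ.yd.coassoc hρ.yd.crossed
    have h₁ : T ◁ (tcoact ρ σ ≫ br (φ ▷ M ≫ u) σ ▷ C) ≫ evalAt p (N ⊗ M) =
        pact p (tcoact ρ σ) ≫ br (φ ▷ M ≫ u) σ := by
      generalize br (φ ▷ M ≫ u) σ = f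
      generalize tcoact ρ σ = ρ
      simp only [pact, evalAt, MonoidalCategory.whiskerLeft_comp, Category.assoc]
      rw [associator_inv_naturality_middle_assoc, ← comp_whiskerRight_assoc,
        braiding_naturality_right, comp_whiskerRight_assoc, associator_naturality_left_assoc,
        ← whisker_exchange_assoc, rightUnitor_naturality]
    rw [← h₁, ← h]
    simp [pact, evalAt]

end Duality
end
end YD
end AnQG

/-! ### Completions of weighted bialgebras as bimonoids among Banach spaces -/

namespace AnQG

section Elements
variable {k : Type u} [NormedField k] [IsUltrametricDist k]

/-- the algebraic tensor product in the completed one -/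
def APres.theta (P Q : APres k) : P.carrier ⊗[k] Q.carrier →ₗ[k] (tens P.ban Q.ban).ban :=
  TensorProduct.lift ((tmk P.ban Q.ban).compl₁₂ P.tb Q.tb)

theorem APres.theta_tmul (P Q : APres k) (a : P.carrier) (b : Q.carrier) :
    P.theta Q (a ⊗ₜ b) = tmk P.ban Q.ban (P.tb a) (Q.tb b) := rfl

theorem APres.toTens_tb (P Q : APres k) (z : (tensA P Q).carrier) :
    P.toTens Q ((tensA P Q).tb z) = P.theta Q z := by
  have := (tensA P Q).pres.lift_toBan (X := (tens P.ban Q.ban).ban)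
    (TensorProduct.lift ((tmk P.ban Q.ban).compl₁₂ P.tb Q.tb)) 1
  unfold toTens tb
  exact this _ z

/-- Density of the uncompleted spaces, used in one variable at a time. With this, identities between
maps on completions reduce to algebraic ones. -/
theorem Pres.tens_ban_ext {P Q : Pres k} {X : Ban k} {f g : (tens P.ban Q.ban).ban ⟶ X}
    (h : ∀ x y, f (tmk _ _ (P.toBan x) (Q.toBan y)) = g (tmk _ _ (P.toBan x) (Q.toBan y))) :
    f = g := by
  refine tens_ext (f := f) (g := g) fun a b => ?_
  revert a
  refine fun a => congrArg (fun G : P.ban ⟶ X => G a) (Pres.ban_ext' (f := tmkR _ b ≫ f)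
    (g := tmkR _ b ≫ g) fun x => ?_)
  exact congrArg (fun G : Q.ban ⟶ X => G b) (Pres.ban_ext' (f := tmkL _ (P.toBan x) ≫ f)
    (g := tmkL _ (P.toBan x) ≫ g) fun y => h x y)

variable [CompleteSpace k]

theorem Ban.tensorμ_tmk {X Y Z W : Ban k} (a : X) (b : Y) (c : Z) (d : W) :
    tensorμ X Y Z W (tmk (tens X Y).ban (tens Z W).ban (tmk X Y a b) (tmk Z W c d)) =
      tmk (tens X Z).ban (tens Y W).ban (tmk X Z a c) (tmk Y W b d) := by
  have h : tensorμ X Y Z W = (tassoc X Y _ ≫ tmap (𝟙 X) (tassocInv Y Z W) ≫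
    tmap (𝟙 X) (tmap (tswap Y Z) (𝟙 W)) ≫ tmap (𝟙 X) (tassoc Z Y W) ≫ tassocInv X Z _) := rfl
  rw [h]
  change tassocInv X Z _ (tmap (𝟙 X) (tassoc Z Y W) (tmap (𝟙 X) (tmap (tswap Y Z) (𝟙 W))
    (tmap (𝟙 X) (tassocInv Y Z W) (tassoc X Y _
      (tmk (tens X Y).ban (tens Z W).ban (tmk X Y a b) (tmk Z W c d)))))) = _
  simp

end Elements

variable {k : Type u} [NormedField k] [IsUltrametricDist k] [CompleteSpace k]

/-- A bialgebra structure on a weighted algebra, compatible with the weights. -/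
structure APres.Bialg (P : APres k) where
  cop : P.carrier →ₐ[k] P.carrier ⊗[k] P.carrier
  cou : P.carrier →ₐ[k] k
  cop_bound : ∀ l, (APres.tensA P P).nrm (cop.toLinearMap (P.gen l)) ≤ P.wt l
  cou_bound : ∀ l, ‖cou (P.gen l)‖ ≤ P.wt l
  coassoc : ∀ x, Algebra.TensorProduct.assoc k k k _ _ _
    (Algebra.TensorProduct.map cop (.id k _) (cop x)) =
      Algebra.TensorProduct.map (.id k _) cop (cop x)
  counit_left : ∀ x, Algebra.TensorProduct.lid k _
    (Algebra.TensorProduct.map cou (.id k _) (cop x)) = x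
  counit_right : ∀ x, Algebra.TensorProduct.rid k k _
    (Algebra.TensorProduct.map (.id k _) cou (cop x)) = x

namespace APres.Bialg
variable {P : APres k} (B : P.Bialg)

/-- the comultiplication of the completion -/
def comulB : P.ban ⟶ P.ban ⊗ P.ban :=
  P.map (APres.tensA P P) B.cop.toLinearMap B.cop_bound ≫ APres.toTens P P

/-- the counit of the completion -/
def counitB : P.ban ⟶ 𝟙_ (Ban k) :=
  P.pres.lift (X := unitBan k) (QuantumDatum.toUnit ∘ₗ B.cou.toLinearMap) 1 fun l =>
    (B.cou_bound l).trans_eq (_root_.one_mul _).symm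

theorem comulB_tb (x : P.carrier) : B.comulB (P.tb x) = P.theta P (B.cop x) :=
  (congrArg (APres.toTens P P)
    (APres.map_toBan P (APres.tensA P P) B.cop.toLinearMap B.cop_bound x)).trans
      (APres.toTens_tb _ _ _)

theorem counitB_tb (x : P.carrier) : uval (B.counitB (P.tb x)) = B.cou x :=
  Pres.lift_toBan P.pres (X := unitBan k) (QuantumDatum.toUnit ∘ₗ B.cou.toLinearMap) 1
    (fun l => (B.cou_bound l).trans_eq (_root_.one_mul _).symm) x

theorem theta_mul (u v : P.carrier ⊗[k] P.carrier) :
    tmap P.mulB P.mulB (tensorμ P.ban P.ban P.ban P.ban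
      (tmk (tens P.ban P.ban).ban (tens P.ban P.ban).ban (P.theta P u) (P.theta P v))) =
        P.theta P (u * v) := by
  induction u with
  | zero => simp only [map_zero, LinearMap.zero_apply, zero_mul]
  | add x y hx hy => simp only [map_add, LinearMap.add_apply, add_mul, hx, hy]
  | tmul a b =>
    induction v with
    | zero => simp only [map_zero, mul_zero]
    | add x y hx hy => simp only [map_add, mul_add, hx, hy]
    | tmul c d =>
      rw [APres.theta_tmul, APres.theta_tmul, Ban.tensorμ_tmk, tmap_tmk, APres.mulB_tmk,
        APres.mulB_tmk, Algebra.TensorProduct.tmul_mul_tmul]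
      rfl

/-- the triple tensor product in its completion -/
def theta₃ (P : APres k) : P.carrier ⊗[k] (P.carrier ⊗[k] P.carrier) →ₗ[k]
    (tens P.ban (tens P.ban P.ban).ban).ban :=
  TensorProduct.lift ((tmk P.ban (tens P.ban P.ban).ban).compl₁₂ P.tb (P.theta P))

theorem comul_right (z : P.carrier ⊗[k] P.carrier) :
    tmap (𝟙 P.ban) B.comulB (P.theta P z) =
      theta₃ P (Algebra.TensorProduct.map (.id k _) B.cop z) := by
  induction z with
  | zero => simp only [map_zero]
  | add x y hx hy => simp only [map_add, hx, hy]
  | tmul a b =>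
    rw [APres.theta_tmul, tmap_tmk, comulB_tb]
    rfl

theorem comul_left (z : P.carrier ⊗[k] P.carrier) :
    tassoc _ _ _ (tmap B.comulB (𝟙 P.ban) (P.theta P z)) =
      theta₃ P (Algebra.TensorProduct.assoc k k k _ _ _
        (Algebra.TensorProduct.map B.cop (.id k _) z)) := by
  induction z with
  | zero => simp only [map_zero]
  | add x y hx hy => simp only [map_add, hx, hy]
  | tmul a b =>
    rw [APres.theta_tmul, tmap_tmk, comulB_tb, Algebra.TensorProduct.map_tmul]
    generalize B.cop a = w
    induction w with
    | zero => simp only [map_zero, LinearMap.zero_apply, TensorProduct.zero_tmul]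
    | add x y hx hy => simp only [map_add, LinearMap.add_apply, TensorProduct.add_tmul, hx, hy]
    | tmul c d =>
      exact tassoc_tmk _ _ _ _ _ _

theorem counit_left' (z : P.carrier ⊗[k] P.carrier) :
    tleft _ (tmap B.counitB (𝟙 P.ban) (P.theta P z)) =
      P.tb (Algebra.TensorProduct.lid k _ (Algebra.TensorProduct.map B.cou (.id k _) z)) := by
  induction z with
  | zero => simp only [map_zero]
  | add x y hx hy => simp only [map_add, hx, hy]
  | tmul a b =>
    rw [APres.theta_tmul, tmap_tmk]
    refine (tleft_tmk _ _ _).trans ?_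
    rw [counitB_tb]
    simp

theorem counit_right' (z : P.carrier ⊗[k] P.carrier) :
    tright _ (tmap (𝟙 P.ban) B.counitB (P.theta P z)) =
      P.tb (Algebra.TensorProduct.rid k k _ (Algebra.TensorProduct.map (.id k _) B.cou z)) := by
  induction z with
  | zero => simp only [map_zero]
  | add x y hx hy => simp only [map_add, hx, hy]
  | tmul a b =>
    rw [APres.theta_tmul, tmap_tmk]
    refine (tright_tmk _ _ _).trans ?_
    rw [counitB_tb]
    simp

theorem uval_injective : Function.Injective (uval (k := k)) := fun _ _ h => h

/-- the completion of a bialgebra -/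
@[reducible] def comon : ComonObj P.ban where
  comul := B.comulB
  counit := B.counitB
  counit_comul := Pres.ban_ext' (f := B.comulB ≫ tmap B.counitB (𝟙 P.ban)) (g := tleftInv _)
    fun x => by
      have h := (B.counit_left' (B.cop x)).trans (congrArg P.tb (B.counit_left x))
      rw [← B.comulB_tb] at h
      refine Eq.trans ?_ (congrArg (tleftInv P.ban) h)
      exact congrArg (fun G : (tens (unitBan k) P.ban).ban ⟶ _ =>
        G (tmap B.counitB (𝟙 P.ban) (B.comulB (P.tb x)))) (λ_ P.ban).hom_inv_id.symm
  comul_counit := Pres.ban_ext' (f := B.comulB ≫ tmap (𝟙 P.ban) B.counitB) (g := trightInv _)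
    fun x => by
      have h := (B.counit_right' (B.cop x)).trans (congrArg P.tb (B.counit_right x))
      rw [← B.comulB_tb] at h
      refine Eq.trans ?_ (congrArg (trightInv P.ban) h)
      exact congrArg (fun G : (tens P.ban (unitBan k)).ban ⟶ _ =>
        G (tmap (𝟙 P.ban) B.counitB (B.comulB (P.tb x)))) (ρ_ P.ban).hom_inv_id.symm
  comul_assoc := Pres.ban_ext' (f := B.comulB ≫ tmap (𝟙 P.ban) B.comulB)
    (g := B.comulB ≫ tmap B.comulB (𝟙 P.ban) ≫ tassoc _ _ _) fun x => by
      refine (congrArg (tmap (𝟙 P.ban) B.comulB) (B.comulB_tb x)).trans ?_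
      refine Eq.trans ?_ (congrArg (fun y => tassoc P.ban P.ban P.ban
        (tmap B.comulB (𝟙 P.ban) y)) (B.comulB_tb x)).symm
      rw [comul_right, comul_left, B.coassoc]

/-- the completion of a bialgebra -/
@[reducible] def bimon : BimonObj P.ban where
  toMonObj := inferInstance
  toComonObj := B.comon
  mul_comul := Pres.tens_ban_ext (f := P.mulB ≫ B.comulB) (g := tmap B.comulB B.comulB ≫
    tensorμ P.ban P.ban P.ban P.ban ≫ tmap P.mulB P.mulB) fun x y => by
      refine (congrArg B.comulB (P.mulB_tmk x y)).trans ?_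
      refine Eq.trans ?_ (congrArg (fun y => tmap P.mulB P.mulB
        (tensorμ P.ban P.ban P.ban P.ban y)) (tmap_tmk B.comulB B.comulB (P.tb x) (P.tb y))).symm
      refine (B.comulB_tb _).trans (Eq.trans ?_ (congrArg₂ (fun y z => tmap P.mulB P.mulB
        (tensorμ P.ban P.ban P.ban P.ban (tmk (tens P.ban P.ban).ban (tens P.ban P.ban).ban y z)))
          (B.comulB_tb x) (B.comulB_tb y)).symm)
      rw [theta_mul, map_mul]
  one_comul := by
    refine Ban.hom_ext (f := P.oneB ≫ B.comulB) (g := tleftInv (unitBan k) ≫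
      tmap P.oneB P.oneB) fun a => ?_
    refine (map_smul (Ban.Hom.lin B.comulB) _ _).trans ?_
    refine (congrArg _ ((B.comulB_tb 1).trans (congrArg _ (map_one B.cop)))).trans ?_
    refine Eq.trans ?_ (tmap_tmk P.oneB P.oneB uone a).symm
    rw [APres.oneB_apply, APres.oneB_apply, map_smul, uval_uone, one_smul]
    rfl
  mul_counit := Pres.tens_ban_ext (f := P.mulB ≫ B.counitB) (g := tmap B.counitB B.counitB ≫
      tleft (unitBan k)) fun x y => by
    refine (congrArg B.counitB (P.mulB_tmk x y)).trans ?_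
    refine Eq.trans ?_ (congrArg (tleft (unitBan k))
      (tmap_tmk B.counitB B.counitB (P.tb x) (P.tb y))).symm
    refine Eq.trans ?_ (tleft_tmk (unitBan k) _ _).symm
    refine uval_injective ?_
    refine (B.counitB_tb _).trans ?_
    rw [map_mul, map_smul, ← B.counitB_tb, ← B.counitB_tb]
    rfl
  one_counit := by
    refine Ban.hom_ext (f := P.oneB ≫ B.counitB) (g := 𝟙 (unitBan k)) fun a => ?_
    refine (map_smul (Ban.Hom.lin B.counitB) _ _).trans ?_
    refine uval_injective ?_
    rw [map_smul]
    refine (congrArg _ (B.counitB_tb 1)).trans ?_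
    rw [map_one]
    exact mul_one (uval a)

end APres.Bialg
end AnQG

/-! ### The bialgebra structures of `C` and `U` and the bialgebra map between them -/

namespace AnQG

namespace APres.Bialg
variable {k : Type u} [NormedField k] [IsUltrametricDist k] [CompleteSpace k] {P Q : APres k}
  {B : P.Bialg} {B' : Q.Bialg} (f : P.carrier →ₐ[k] Q.carrier)
  (hf : ∀ l, Q.nrm (f.toLinearMap (P.gen l)) ≤ P.wt l)

theorem map_theta (z : P.carrier ⊗[k] P.carrier) :
    tmap (P.map Q f.toLinearMap hf) (P.map Q f.toLinearMap hf) (P.theta P z) =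
      Q.theta Q (Algebra.TensorProduct.map f f z) := by
  induction z with
  | zero => simp only [map_zero]
  | add x y hx hy => simp only [map_add, hx, hy]
  | tmul a b =>
    rw [theta_tmul, tmap_tmk, map_toBan, map_toBan]
    rfl

theorem isBimonHom_map (h : ∀ x, B'.cop (f x) = Algebra.TensorProduct.map f f (B.cop x))
    (h' : ∀ x, B'.cou (f x) = B.cou x) :
    letI := B.bimon
    letI := B'.bimon
    IsBimonHom (P.map Q f.toLinearMap hf) :=
  letI := B.bimon
  letI := B'.bimon
  { one_hom := Ban.hom_ext (f := P.oneB ≫ P.map Q f.toLinearMap hf) (g := Q.oneB) fun a => by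
      refine (map_smul (Ban.Hom.lin (P.map Q f.toLinearMap hf)) _ _).trans ?_
      refine congrArg (fun x : Q.ban => uval a • x) ((map_toBan _ _ _ _ 1).trans ?_)
      exact congrArg Q.tb (map_one f)
    mul_hom := Pres.tens_ban_ext (f := P.mulB ≫ P.map Q f.toLinearMap hf)
      (g := tmap (P.map Q f.toLinearMap hf) (P.map Q f.toLinearMap hf) ≫ Q.mulB) fun x y => by
        refine (congrArg (P.map Q f.toLinearMap hf) (P.mulB_tmk x y)).trans
          ((map_toBan _ _ _ _ _).trans ?_)
        refine Eq.trans ?_ (congrArg Q.mulB (tmap_tmk _ _ (P.tb x) (P.tb y))).symm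
        rw [map_toBan, map_toBan, mulB_tmk]
        exact congrArg Q.tb (map_mul f x y)
    hom_comul := Pres.ban_ext' (f := P.map Q f.toLinearMap hf ≫ B'.comulB)
      (g := B.comulB ≫ tmap (P.map Q f.toLinearMap hf) (P.map Q f.toLinearMap hf)) fun x => by
        refine (congrArg B'.comulB (map_toBan P Q f.toLinearMap hf x)).trans ?_
        refine (B'.comulB_tb _).trans ?_
        refine Eq.trans ?_ (congrArg (tmap (P.map Q f.toLinearMap hf) (P.map Q f.toLinearMap hf))
          (B.comulB_tb x)).symm
        rw [map_theta]
        exact congrArg _ (h x)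
    hom_counit := Pres.ban_ext' (f := P.map Q f.toLinearMap hf ≫ B'.counitB)
      (g := B.counitB) fun x => by
        refine (congrArg B'.counitB (map_toBan P Q f.toLinearMap hf x)).trans ?_
        refine uval_injective ((B'.counitB_tb _).trans ((h' x).trans (B.counitB_tb x).symm)) }

end APres.Bialg

namespace QuantumDatum
variable {k I Φ : Type u} [NormedField k] [AddCommGroup Φ] (D : QuantumDatum k I Φ)

-- The bialgebra axioms of `C` are equalities of algebra maps, so this reduces them to the
-- generators `F_i` and `t_β`.
variable {D} in
theorem cAlg_hom_ext {J : Set (FreeAlgebra k I)} {A : Type*} [Semiring A] [Algebra k A]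
    {f g : D.CAlg J →ₐ[k] A} (h : ∀ x, f (D.cg J x) = g (D.cg J x)) : f = g :=
  RingQuot.ringQuot_ext' k _ _ (FreeAlgebra.hom_ext (funext h))

variable {D} in
theorem uAlg_hom_ext {A : Type*} [Semiring A] [Algebra k A]
    {f g : D.UAlg →ₐ[k] A} (h : ∀ x, f (D.ug x) = g (D.ug x)) : f = g :=
  RingQuot.ringQuot_ext' k _ _ (FreeAlgebra.hom_ext (funext h))

theorem cCounit_F (i : I) : D.cCounit (D.cg _ (.F i)) = 0 := D.cLift_cg _ _ _ _ _ _
theorem cCounit_t (b : I →₀ ℤ) : D.cCounit (D.cg _ (.t b)) = 1 := D.cLift_cg _ _ _ _ _ _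
theorem uCounit_E (i : I) : D.uCounit (D.ug (.E i)) = 0 := D.uLift_ug _ _ _ _ _ _ _ _ _ _
theorem uCounit_F (i : I) : D.uCounit (D.ug (.F i)) = 0 := D.uLift_ug _ _ _ _ _ _ _ _ _ _
theorem uCounit_K (l : Φ →ₗ[ℤ] ℤ) : D.uCounit (D.ug (.K l)) = 1 :=
  D.uLift_ug _ _ _ _ _ _ _ _ _ _

theorem cCop_F (i : I) : D.cCop (D.cg _ (.F i)) = D.cg _ (.F i) ⊗ₜ 1 +
    D.cg _ (.t (.single i (-1))) ⊗ₜ D.cg _ (.F i) := D.cCop_cg _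
theorem cCop_t (b : I →₀ ℤ) : D.cCop (D.cg _ (.t b)) = D.cg _ (.t b) ⊗ₜ D.cg _ (.t b) := D.cCop_cg _
theorem uCop_E (i : I) : D.uCop (D.ug (.E i)) =
    D.ug (.E i) ⊗ₜ D.ug (.K (D.nu1 i)) + 1 ⊗ₜ D.ug (.E i) := D.uCop_ug _
theorem uCop_F (i : I) : D.uCop (D.ug (.F i)) =
    D.ug (.F i) ⊗ₜ 1 + D.ug (.K (-D.nu1 i)) ⊗ₜ D.ug (.F i) := D.uCop_ug _
theorem uCop_K (l : Φ →ₗ[ℤ] ℤ) : D.uCop (D.ug (.K l)) = D.ug (.K l) ⊗ₜ D.ug (.K l) := D.uCop_ug _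

theorem cToU_F (i : I) : D.cToU (D.cg _ (.F i)) = D.ug (.F i) := D.cLift_cg _ _ _ _ _ _
theorem cToU_t (b : I →₀ ℤ) : D.cToU (D.cg _ (.t b)) = D.ug (.K (D.nu b)) :=
  D.cLift_cg _ _ _ _ _ _

theorem cCop_coassoc : ((Algebra.TensorProduct.assoc k k k (D.CAlg D.nichols) (D.CAlg D.nichols)
      (D.CAlg D.nichols)).toAlgHom.comp
    (Algebra.TensorProduct.map D.cCop (.id k _))).comp D.cCop =
    (Algebra.TensorProduct.map (.id k _) D.cCop).comp D.cCop := by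
  refine cAlg_hom_ext fun x => ?_
  rcases x with i | b
  · simp [cCop_F, cCop_t, TensorProduct.add_tmul, TensorProduct.tmul_add,
      Algebra.TensorProduct.one_def, add_assoc]
  · simp [cCop_t]

theorem cCop_counit_left : ((Algebra.TensorProduct.lid k (D.CAlg D.nichols)).toAlgHom.comp
    (Algebra.TensorProduct.map D.cCounit (.id k _))).comp D.cCop = .id k _ := by
  refine cAlg_hom_ext fun x => ?_
  rcases x with i | b
  · simp [cCop_F, cCounit_F, cCounit_t]
  · simp [cCop_t, cCounit_t]

theorem cCop_counit_right : ((Algebra.TensorProduct.rid k k (D.CAlg D.nichols)).toAlgHom.comp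
    (Algebra.TensorProduct.map (.id k _) D.cCounit)).comp D.cCop = .id k _ := by
  refine cAlg_hom_ext fun x => ?_
  rcases x with i | b
  · simp [cCop_F, cCounit_F]
  · simp [cCop_t, cCounit_t]

theorem uCop_coassoc : ((Algebra.TensorProduct.assoc k k k D.UAlg D.UAlg D.UAlg).toAlgHom.comp
    (Algebra.TensorProduct.map D.uCop (.id k _))).comp D.uCop =
    (Algebra.TensorProduct.map (.id k _) D.uCop).comp D.uCop := by
  refine uAlg_hom_ext fun x => ?_
  rcases x with i | i | b
  · simp [uCop_E, uCop_K, TensorProduct.add_tmul, TensorProduct.tmul_add,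
      Algebra.TensorProduct.one_def, add_assoc]
  · simp [uCop_F, uCop_K, TensorProduct.add_tmul, TensorProduct.tmul_add,
      Algebra.TensorProduct.one_def, add_assoc]
  · simp [uCop_K]

theorem uCop_counit_left : ((Algebra.TensorProduct.lid k D.UAlg).toAlgHom.comp
    (Algebra.TensorProduct.map D.uCounit (.id k _))).comp D.uCop = .id k _ := by
  refine uAlg_hom_ext fun x => ?_
  rcases x with i | i | b
  · simp [uCop_E, uCounit_E]
  · simp [uCop_F, uCounit_F, uCounit_K]
  · simp [uCop_K, uCounit_K]

theorem uCop_counit_right : ((Algebra.TensorProduct.rid k k D.UAlg).toAlgHom.comp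
    (Algebra.TensorProduct.map (.id k _) D.uCounit)).comp D.uCop = .id k _ := by
  refine uAlg_hom_ext fun x => ?_
  rcases x with i | i | b
  · simp [uCop_E, uCounit_E, uCounit_K]
  · simp [uCop_F, uCounit_F]
  · simp [uCop_K, uCounit_K]

theorem cToU_cop : D.uCop.comp D.cToU = (Algebra.TensorProduct.map D.cToU D.cToU).comp D.cCop := by
  refine cAlg_hom_ext fun x => ?_
  rcases x with i | b
  · have h : D.nu (.single i (-1)) = -D.nu1 i := by
      rw [← D.nu_neg, Finsupp.single_neg]
    simp [-Finsupp.single_neg, cToU_F, cToU_t, cCop_F, uCop_F, h]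
  · simp [cToU_t, cCop_t, uCop_K]

theorem cToU_counit : D.uCounit.comp D.cToU = D.cCounit := by
  refine cAlg_hom_ext fun x => ?_
  rcases x with i | b
  · simp [cToU_F, cCounit_F, uCounit_F]
  · simp [cToU_t, cCounit_t, uCounit_K]

variable [IsUltrametricDist k] [CompleteSpace k]

/-- the bialgebra `C` -/
def cBialg : D.cP.Bialg where
  cop := D.cCop
  cou := D.cCounit
  cop_bound := D.cCop_bound
  cou_bound := D.cCounit_bound
  coassoc x := DFunLike.congr_fun D.cCop_coassoc x
  counit_left x := DFunLike.congr_fun D.cCop_counit_left x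
  counit_right x := DFunLike.congr_fun D.cCop_counit_right x

/-- the bialgebra `U` -/
def uBialg : D.uP.Bialg where
  cop := D.uCop
  cou := D.uCounit
  cop_bound := D.uCop_bound
  cou_bound := D.uCounit_bound
  coassoc x := DFunLike.congr_fun D.uCop_coassoc x
  counit_left x := DFunLike.congr_fun D.uCop_counit_left x
  counit_right x := DFunLike.congr_fun D.uCop_counit_right x

instance : BimonObj D.C := D.cBialg.bimon
instance : BimonObj D.U := D.uBialg.bimon

theorem comul_tb (x : D.CAlg D.nichols) : D.comul (D.cP.tb x) = D.cP.theta D.cP (D.cCop x) :=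
  D.cBialg.comulB_tb x

theorem counit_tb (x : D.CAlg D.nichols) : uval (D.counit (D.cP.tb x)) = D.cCounit x :=
  D.cBialg.counitB_tb x

theorem ucomul_tb (x : D.UAlg) : D.ucomul (D.uP.tb x) = D.uP.theta D.uP (D.uCop x) :=
  D.uBialg.comulB_tb x

theorem ucounit_tb (x : D.UAlg) : uval (D.ucounit (D.uP.tb x)) = D.uCounit x :=
  D.uBialg.counitB_tb x

instance : IsBimonHom D.incl :=
  APres.Bialg.isBimonHom_map (B := D.cBialg) (B' := D.uBialg) D.cToU D.cToU_bound
    (fun x => DFunLike.congr_fun D.cToU_cop x) (fun x => DFunLike.congr_fun D.cToU_counit x)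

end QuantumDatum

end AnQG

/-! ### Transfer from Banach spaces to Ind-objects -/

namespace AnQG

namespace IndObj
open MonObj ComonObj

variable {D : Type (u + 1)} [Category.{u} D] [MonoidalCategory D] [SymmetricCategory D]

section
variable {D : Type (u + 1)} [Category.{u} D]

theorem emb_hom_ext {A : D} {X : IndObj D} {f g : (emb D).obj A ⟶ X}
    (h : Hom.el f ⟨⟨⟩⟩ = Hom.el g ⟨⟨⟩⟩) : f = g := hom_ext fun ⟨⟨⟩⟩ => h

theorem emb_tens_hom_ext [MonoidalCategory D] {A B : D} {X : IndObj D}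
    {f g : (emb D).obj A ⊗ (emb D).obj B ⟶ X}
    (h : Hom.el f (⟨⟨⟩⟩, ⟨⟨⟩⟩) = Hom.el g (⟨⟨⟩⟩, ⟨⟨⟩⟩)) : f = g := hom_ext fun ⟨⟨⟨⟩⟩, ⟨⟨⟩⟩⟩ => h

/-- Equality of classes is a priori a zigzag of transition maps. Filteredness allows a zigzag to be
closed up at a single later stage. -/
theorem exists_of_cl_eq {X : IndObj D} {A : D} {i j : X.J} {f : A ⟶ X.F.obj i}
    {g : A ⟶ X.F.obj j} (h : X.cl i f = X.cl j g) :
    ∃ (m : X.J) (u : i ⟶ m) (v : j ⟶ m), f ≫ X.F.map u = g ≫ X.F.map v := by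
  have key : ∀ x y : Σ j : X.J, A ⟶ X.F.obj j, Relation.EqvGen (X.Rel A) x y →
      ∃ (m : X.J) (u : x.1 ⟶ m) (v : y.1 ⟶ m), x.2 ≫ X.F.map u = y.2 ≫ X.F.map v := by
    intro x y h
    induction h with
    | rel x y h =>
      obtain ⟨u, hu⟩ := h
      exact ⟨y.1, u, 𝟙 _, by simp [hu]⟩
    | refl x => exact ⟨x.1, 𝟙 _, 𝟙 _, rfl⟩
    | symm x y _ ih =>
      obtain ⟨m, u, v, h⟩ := ih
      exact ⟨m, v, u, h.symm⟩
    | trans x y z _ _ ih ih' =>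
      obtain ⟨m, u, v, h⟩ := ih
      obtain ⟨m', u', v', h'⟩ := ih'
      -- Two arrows out of the middle stage are completed to a commutative square, which is where
      -- filteredness enters.
      obtain ⟨n, a, b, hab⟩ := IsFiltered.span v u'
      refine ⟨n, u ≫ a, v' ≫ b, ?_⟩
      rw [X.F.map_comp, X.F.map_comp, reassoc_of% h, ← reassoc_of% h', ← X.F.map_comp,
        ← X.F.map_comp, hab]
  exact key _ _ (Quot.eqvGen_exact h)

end

/-- a bimonoid as a bimonoid in the Ind-completion -/
@[reducible] def embBimon (A : D) [BimonObj A] : BimonObj ((emb D).obj A) where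
  toMonObj := Functor.monObjObj (F := emb D) A
  toComonObj := Functor.obj.instComonObj A (emb D)
  mul_comul := emb_tens_hom_ext (congrArg (IndObj.cl (tens ((emb D).obj A) ((emb D).obj A))
    ((⟨⟨⟩⟩, ⟨⟨⟩⟩) : Discrete PUnit × Discrete PUnit)) (by
      change (𝟙 (A ⊗ A) ≫ μ[A]) ≫ Δ[A] ≫ 𝟙 (A ⊗ A) = ((Δ[A] ≫ 𝟙 (A ⊗ A)) ⊗ₘ
        (Δ[A] ≫ 𝟙 (A ⊗ A))) ≫ ((α_ A A (A ⊗ A)).hom ≫ (𝟙 A ⊗ₘ (α_ A A A).inv) ≫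
          (𝟙 A ⊗ₘ ((β_ A A).hom ⊗ₘ 𝟙 A)) ≫ (𝟙 A ⊗ₘ (α_ A A A).hom) ≫ (α_ A A (A ⊗ A)).inv) ≫
            ((𝟙 (A ⊗ A) ≫ μ[A]) ⊗ₘ (𝟙 (A ⊗ A) ≫ μ[A]))
      simp only [Category.id_comp, Category.comp_id, id_tensorHom, tensorHom_id]
      exact BimonObj.mul_comul A))
  one_comul := emb_hom_ext (congrArg (IndObj.cl (tens ((emb D).obj A) ((emb D).obj A))
    ((⟨⟨⟩⟩, ⟨⟨⟩⟩) : Discrete PUnit × Discrete PUnit)) (by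
      change (𝟙 (𝟙_ D) ≫ η[A]) ≫ Δ[A] ≫ 𝟙 (A ⊗ A) =
        (λ_ (𝟙_ D)).inv ≫ ((𝟙 (𝟙_ D) ≫ η[A]) ⊗ₘ (𝟙 (𝟙_ D) ≫ η[A]))
      simp only [Category.id_comp, Category.comp_id]
      exact BimonObj.one_comul A))
  mul_counit := emb_tens_hom_ext (congrArg (IndObj.cl ((emb D).obj (𝟙_ D))
    (⟨⟨⟩⟩ : Discrete PUnit)) (by
      change (𝟙 (A ⊗ A) ≫ μ[A]) ≫ ε[A] ≫ 𝟙 (𝟙_ D) =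
        ((ε[A] ≫ 𝟙 (𝟙_ D)) ⊗ₘ (ε[A] ≫ 𝟙 (𝟙_ D))) ≫ (λ_ (𝟙_ D)).hom
      simp only [Category.id_comp, Category.comp_id]
      exact BimonObj.mul_counit A))
  one_counit := emb_hom_ext (congrArg (IndObj.cl ((emb D).obj (𝟙_ D))
    (⟨⟨⟩⟩ : Discrete PUnit)) (by
      change (𝟙 (𝟙_ D) ≫ η[A]) ≫ ε[A] ≫ 𝟙 (𝟙_ D) = 𝟙 (𝟙_ D)
      simp only [Category.id_comp, Category.comp_id]
      exact BimonObj.one_counit A))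

theorem isBimonHom_emb {A B : D} [BimonObj A] [BimonObj B] (f : A ⟶ B) [IsBimonHom f] :
    letI := embBimon A
    letI := embBimon B
    IsBimonHom ((emb D).map f) :=
  letI := embBimon A
  letI := embBimon B
  { one_hom := emb_hom_ext (congrArg (IndObj.cl ((emb D).obj B) (⟨⟨⟩⟩ : Discrete PUnit)) (by
      change (𝟙 (𝟙_ D) ≫ η[A]) ≫ f = 𝟙 (𝟙_ D) ≫ η[B]
      simp only [Category.id_comp]
      exact IsMonHom.one_hom f))
    mul_hom := emb_tens_hom_ext (congrArg (IndObj.cl ((emb D).obj B)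
      (⟨⟨⟩⟩ : Discrete PUnit)) (by
        change (𝟙 (A ⊗ A) ≫ μ[A]) ≫ f = (f ⊗ₘ f) ≫ 𝟙 (B ⊗ B) ≫ μ[B]
        simp only [Category.id_comp]
        exact IsMonHom.mul_hom f))
    hom_comul := emb_hom_ext (congrArg (IndObj.cl (tens ((emb D).obj B) ((emb D).obj B))
      ((⟨⟨⟩⟩, ⟨⟨⟩⟩) : Discrete PUnit × Discrete PUnit)) (by
        change f ≫ Δ[B] ≫ 𝟙 (B ⊗ B) = (Δ[A] ≫ 𝟙 (A ⊗ A)) ≫ (f ⊗ₘ f)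
        simp only [Category.comp_id]
        exact IsComonHom.hom_comul f))
    hom_counit := emb_hom_ext (congrArg (IndObj.cl ((emb D).obj (𝟙_ D))
      (⟨⟨⟩⟩ : Discrete PUnit)) (by
        change f ≫ ε[B] ≫ 𝟙 (𝟙_ D) = ε[A] ≫ 𝟙 (𝟙_ D)
        simp only [Category.comp_id]
        exact IsComonHom.hom_counit f)) }

/-- Constant Ind-objects are indexed by a point, so the equational conditions are those in the base
category. Separation and generation involve arbitrary Ind-objects; there an equality in the colimit
is first realized at one stage, where the condition in the base category applies. -/
theorem duality_emb {U C T : D} [BimonObj U] [BimonObj C] {φ : C ⟶ U} [IsBimonHom φ] {j : T ⟶ U}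
    {d : T ⟶ T ⊗ T} {p : T ⊗ C ⟶ 𝟙_ D} {S : C ⟶ C} (h : YD.Duality φ j d p S) :
    letI := embBimon U
    letI := embBimon C
    letI := isBimonHom_emb φ
    YD.Duality ((emb D).map φ) ((emb D).map j) ((emb D).map d ≫ Functor.OplaxMonoidal.δ (emb D) _ _)
      (Functor.LaxMonoidal.μ (emb D) _ _ ≫ (emb D).map p ≫ Functor.OplaxMonoidal.η (emb D))
      ((emb D).map S) :=
  letI := embBimon U
  letI := embBimon C
  letI := isBimonHom_emb φ
  { comul := emb_hom_ext (congrArg (IndObj.cl (tens ((emb D).obj U) ((emb D).obj U))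
      ((⟨⟨⟩⟩, ⟨⟨⟩⟩) : Discrete PUnit × Discrete PUnit)) (by
        change j ≫ Δ[U] ≫ 𝟙 (U ⊗ U) = (d ≫ 𝟙 (T ⊗ T)) ≫ (j ⊗ₘ j)
        simp only [Category.comp_id]
        exact h.comul))
    pair_mul := hom_ext fun ⟨⟨⟨⟩⟩, ⟨⟨⟩⟩, ⟨⟨⟩⟩⟩ => congrArg (IndObj.cl ((emb D).obj (𝟙_ D))
      (⟨⟨⟩⟩ : Discrete PUnit)) (by
        change (𝟙 T ⊗ₘ ((β_ C C).hom ≫ 𝟙 (C ⊗ C) ≫ μ[C])) ≫ 𝟙 (T ⊗ C) ≫ p ≫ 𝟙 (𝟙_ D) =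
          ((d ≫ 𝟙 (T ⊗ T)) ⊗ₘ 𝟙 (C ⊗ C)) ≫ ((α_ T T (C ⊗ C)).hom ≫ (𝟙 T ⊗ₘ (α_ T C C).inv) ≫
          (𝟙 T ⊗ₘ ((β_ T C).hom ⊗ₘ 𝟙 C)) ≫ (𝟙 T ⊗ₘ (α_ C T C).hom) ≫ (α_ T C (T ⊗ C)).inv) ≫
          ((𝟙 (T ⊗ C) ≫ p ≫ 𝟙 (𝟙_ D)) ⊗ₘ (𝟙 (T ⊗ C) ≫ p ≫ 𝟙 (𝟙_ D))) ≫ (λ_ (𝟙_ D)).hom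
        simp only [Category.id_comp, Category.comp_id, id_tensorHom, tensorHom_id]
        exact h.pair_mul)
    pair_one := emb_tens_hom_ext (congrArg (IndObj.cl ((emb D).obj (𝟙_ D))
      (⟨⟨⟩⟩ : Discrete PUnit)) (by
        change (𝟙 T ⊗ₘ (𝟙 (𝟙_ D) ≫ η[C])) ≫ 𝟙 (T ⊗ C) ≫ p ≫ 𝟙 (𝟙_ D) =
          (ρ_ T).hom ≫ j ≫ ε[U] ≫ 𝟙 (𝟙_ D)
        simp only [Category.id_comp, Category.comp_id, id_tensorHom]
        exact h.pair_one))
    antipode_left := emb_hom_ext (congrArg (IndObj.cl ((emb D).obj C)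
      (⟨⟨⟩⟩ : Discrete PUnit)) (by
        change (Δ[C] ≫ 𝟙 (C ⊗ C)) ≫ (S ⊗ₘ 𝟙 C) ≫ 𝟙 (C ⊗ C) ≫ μ[C] =
          (ε[C] ≫ 𝟙 (𝟙_ D)) ≫ 𝟙 (𝟙_ D) ≫ η[C]
        simp only [Category.id_comp, Category.comp_id, tensorHom_id]
        exact h.antipode_left))
    antipode_right := emb_hom_ext (congrArg (IndObj.cl ((emb D).obj C)
      (⟨⟨⟩⟩ : Discrete PUnit)) (by
        change (Δ[C] ≫ 𝟙 (C ⊗ C)) ≫ (𝟙 C ⊗ₘ S) ≫ 𝟙 (C ⊗ C) ≫ μ[C] =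
          (ε[C] ≫ 𝟙 (𝟙_ D)) ≫ 𝟙 (𝟙_ D) ≫ η[C]
        simp only [Category.id_comp, Category.comp_id, id_tensorHom]
        exact h.antipode_right))
    separating := fun {X Y} f g hfg => hom_ext fun i => by
      have H := congrArg (fun F : (emb D).obj T ⊗ X ⟶ Y => Hom.el F
        ((⟨⟨⟩⟩, i) : Discrete PUnit × X.J)) hfg
      change Hom.app (YD.evalAt _ Y) (box (((emb D).obj T).cl (⟨⟨⟩⟩ : Discrete PUnit) (𝟙 T))
        (Hom.el f i)) = Hom.app (YD.evalAt _ Y) (box (((emb D).obj T).cl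
          (⟨⟨⟩⟩ : Discrete PUnit) (𝟙 T)) (Hom.el g i)) at H
      revert H
      induction Hom.el f i using El.ind with
      | h m a =>
      induction Hom.el g i using El.ind with
      | h n b =>
      obtain ⟨m, ⟨⟨⟩⟩⟩ := m
      obtain ⟨n, ⟨⟨⟩⟩⟩ := n
      intro H
      change Y.cl m ((𝟙 T ⊗ₘ a) ≫ (α_ _ _ _).inv ≫ ((β_ _ _).hom ⊗ₘ 𝟙 C) ≫
        (α_ _ _ _).hom ≫ (𝟙 _ ⊗ₘ (𝟙 (T ⊗ C) ≫ p ≫ 𝟙 (𝟙_ D))) ≫ (ρ_ _).hom) =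
        Y.cl n ((𝟙 T ⊗ₘ b) ≫ (α_ _ _ _).inv ≫ ((β_ _ _).hom ⊗ₘ 𝟙 C) ≫
        (α_ _ _ _).hom ≫ (𝟙 _ ⊗ₘ (𝟙 (T ⊗ C) ≫ p ≫ 𝟙 (𝟙_ D))) ≫ (ρ_ _).hom) at H
      obtain ⟨l, u, v, H⟩ := exists_of_cl_eq H
      -- Evaluation is natural in Y, so the transition map to the later stage can be moved in front
      -- of it.
      have e : ∀ {Z W : D} (a : X.F.obj i ⟶ Z ⊗ C) (t : Z ⟶ W), ((𝟙 T ⊗ₘ a) ≫ (α_ _ _ _).inv ≫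
          ((β_ _ _).hom ⊗ₘ 𝟙 C) ≫ (α_ _ _ _).hom ≫ (𝟙 _ ⊗ₘ (𝟙 (T ⊗ C) ≫ p ≫ 𝟙 (𝟙_ D))) ≫
            (ρ_ _).hom) ≫ t = T ◁ (a ≫ t ▷ C) ≫ YD.evalAt p W := fun a t => by
        simp only [YD.evalAt, MonoidalCategory.whiskerLeft_comp, Category.assoc, id_tensorHom,
          tensorHom_id, Category.id_comp, Category.comp_id]
        rw [associator_inv_naturality_middle_assoc, ← comp_whiskerRight_assoc,
          BraidedCategory.braiding_naturality_right, comp_whiskerRight_assoc,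
          associator_naturality_left_assoc, ← whisker_exchange_assoc, rightUnitor_naturality]
      have H' := h.separating _ _ ((e (Z := Y.F.obj m) a (Y.F.map u)).symm.trans
        (H.trans (e (Z := Y.F.obj n) b (Y.F.map v))))
      have c : ∀ {m : Y.J × Discrete PUnit} {l : Y.J} (a : X.F.obj i ⟶ Y.F.obj m.1 ⊗ C)
          (u : m.1 ⟶ l), (tens Y ((emb D).obj C)).cl (l, m.2) (a ≫ Y.F.map u ▷ C) =
            (tens Y ((emb D).obj C)).cl m a := fun {m l} a u => by
        rw [← tensorHom_id]
        exact (tens Y ((emb D).obj C)).cl_map a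
          ((u, 𝟙 _) : m ⟶ ((l, m.2) : Y.J × Discrete PUnit))
      exact (c a u).symm.trans ((congrArg _ H').trans (c b v))
    generating := fun {X Y} f g hfg => hom_ext fun ⟨⟨⟨⟩⟩, i⟩ => by
      have H := congrArg (fun F : ((emb D).obj C ⊗ (emb D).obj T) ⊗ X ⟶ Y => Hom.el F
        (((⟨⟨⟩⟩, ⟨⟨⟩⟩), i) : (Discrete PUnit × Discrete PUnit) × X.J)) hfg
      change res (((φ ⊗ₘ j) ≫ 𝟙 (U ⊗ U) ≫ μ[U]) ⊗ₘ 𝟙 (X.F.obj i))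
          (Hom.el f ((⟨⟨⟩⟩, i) : Discrete PUnit × X.J)) =
        res (((φ ⊗ₘ j) ≫ 𝟙 (U ⊗ U) ≫ μ[U]) ⊗ₘ 𝟙 (X.F.obj i))
          (Hom.el g ((⟨⟨⟩⟩, i) : Discrete PUnit × X.J)) at H
      change Hom.el f ((⟨⟨⟩⟩, i) : Discrete PUnit × X.J) =
        Hom.el g ((⟨⟨⟩⟩, i) : Discrete PUnit × X.J)
      revert H
      induction Hom.el f ((⟨⟨⟩⟩, i) : Discrete PUnit × X.J) using El.ind with
      | h m a =>
      induction Hom.el g ((⟨⟨⟩⟩, i) : Discrete PUnit × X.J) using El.ind with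
      | h n b =>
      intro H
      obtain ⟨l, u, v, H⟩ := exists_of_cl_eq H
      rw [← Y.cl_map a u, ← Y.cl_map b v]
      refine congrArg (Y.cl l) (h.generating (X := X.F.obj i) _ _ ?_)
      rw [Category.id_comp, tensorHom_id, Category.assoc, Category.assoc] at H
      exact H }

end IndObj

namespace QuantumDatum
variable {k I Φ : Type u} [NormedField k] [IsUltrametricDist k] [CompleteSpace k]
  [AddCommGroup Φ] (D : QuantumDatum k I Φ)

instance : BimonObj D.iC := IndObj.embBimon D.C
instance : BimonObj D.iU := IndObj.embBimon D.U
instance : IsBimonHom ((emb k).map D.incl) := IndObj.isBimonHom_emb D.incl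

end QuantumDatum
end AnQG

/-! ### Functionals on `C` given by words: convolution and comultiplication -/

namespace AnQG
namespace QuantumDatum
variable {k I Φ : Type u} [NormedField k] [AddCommGroup Φ] (D : QuantumDatum k I Φ)

/-- monomials in the bosonization -/
def cword (J : Set (FreeAlgebra k I)) : FreeMonoid (CGen I) →* D.CAlg J :=
  FreeMonoid.lift (D.cg J)

@[simp] theorem cword_of (J : Set (FreeAlgebra k I)) (x : CGen I) :
    D.cword J (.of x) = D.cg J x := FreeMonoid.lift_eval_of _ _

theorem cword_span (J : Set (FreeAlgebra k I)) (c : D.CAlg J) :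
    c ∈ Submodule.span k (Set.range (D.cword J)) := by
  obtain ⟨p, hp⟩ := (wordAlg k D.cWt (D.CRel J)).span c
  rw [← hp]
  exact (Finsupp.mem_span_range_iff_exists_finsupp).2 ⟨p, rfl⟩

variable {D} in
theorem cword_linear_ext {J : Set (FreeAlgebra k I)} {M : Type*} [AddCommMonoid M] [Module k M]
    {f g : D.CAlg J →ₗ[k] M} (h : ∀ w, f (D.cword J w) = g (D.cword J w)) : f = g := by
  refine LinearMap.ext fun c => ?_
  induction D.cword_span J c using Submodule.span_induction with
  | mem x hx => obtain ⟨w, rfl⟩ := hx; exact h w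
  | zero => simp only [map_zero]
  | add x y _ _ hx hy => rw [map_add, map_add, hx, hy]
  | smul a x _ hx => rw [map_smul, map_smul, hx]

variable {D} in
theorem cAlg_induction {J : Set (FreeAlgebra k I)} {p : D.CAlg J → Prop}
    (hs : ∀ (a : k) (c : D.CAlg J), p c → p (a • c)) (h₁ : p 1) (hg : ∀ x, p (D.cg J x))
    (ha : ∀ a b, p a → p b → p (a + b)) (hm : ∀ a b, p a → p b → p (a * b)) (c : D.CAlg J) :
    p c := by
  induction D.cword_span J c using Submodule.span_induction with
  | mem x hx =>
    obtain ⟨w, rfl⟩ := hx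
    induction w using FreeMonoid.inductionOn' with
    | one => rwa [map_one]
    | of_mul x w ih => rw [map_mul, cword_of]; exact hm _ _ (hg x) ih
  | zero => simpa using hs 0 1 h₁
  | add x y _ _ hx hy => exact ha _ _ hx hy
  | smul a x _ hx => exact hs a x hx

theorem pairK_F (l : Φ →ₗ[ℤ] ℤ) (i : I) : D.pairK l (D.cg _ (.F i)) = 0 := by
  rw [pairK, cChar, cLift_cg]

theorem pairK_t (l : Φ →ₗ[ℤ] ℤ) (b : I →₀ ℤ) :
    D.pairK l (D.cg _ (.t b)) = D.q ^ (-(l (D.wt b))) := by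
  rw [pairK, cChar, cLift_cg]

open Classical in
theorem mat_cg (i : I) (x : CGen I) : D.mat i (D.cg _ x) = D.matGen i x := D.cLift_cg _ _ _ _ _ _

/-- The representation is upper triangular with diagonal characters `K_{d_i λ_i}` and ε. Hence its
corner entry is a skew derivation, which is `pairGen_E_mul`. -/
theorem mat_entries (i : I) (c : D.CAlg D.nichols) : D.mat i c 1 0 = 0 ∧
    D.mat i c 0 0 = D.pairK (D.nu1 i) c ∧ D.mat i c 1 1 = D.cCounit c := by
  induction c using cAlg_induction with
  | hs a c h => simp [h]
  | h₁ => simp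
  | hg x =>
    rw [mat_cg]
    rcases x with j | b
    · rw [pairK_F, cCounit_F, matGen]
      split_ifs <;> simp
    · rw [pairK_t, cCounit_t]
      simp [matGen]
  | ha a b ha hb => simp [ha, hb]
  | hm a b ha hb => simp [Matrix.mul_apply, ha, hb]

theorem pairGen_K_mul (l : Φ →ₗ[ℤ] ℤ) (c c' : D.CAlg D.nichols) :
    D.pairGen (.K l) (c * c') = D.pairGen (.K l) c * D.pairGen (.K l) c' := map_mul (D.pairK l) c c'

theorem pairGen_E_mul (i : I) (c c' : D.CAlg D.nichols) : D.pairGen (.E i) (c * c') =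
    D.pairGen (.K (D.nu1 i)) c * D.pairGen (.E i) c' + D.pairGen (.E i) c * D.cCounit c' := by
  have : ∀ c, D.pairGen (.E i) c = D.mat i c 0 1 := fun _ => rfl
  rw [this, this, this, map_mul, Matrix.mul_apply, Fin.sum_univ_two, (D.mat_entries i c).2.1,
    (D.mat_entries i c').2.2]
  rfl

theorem pairGen_E_one (i : I) : D.pairGen (.E i) 1 = 0 := by
  change D.mat i 1 0 1 = 0
  simp

theorem pairGen_K_one (l : Φ →ₗ[ℤ] ℤ) : D.pairGen (.K l) 1 = 1 := map_one (D.pairK l)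

theorem pairGen_E_F_self (i : I) : D.pairGen (.E i) (D.cg _ (.F i)) = -(D.qq i)⁻¹ := by
  change D.mat i _ 0 1 = _
  rw [mat_cg]
  simp [matGen]

theorem pairGen_E_t (i : I) (b : I →₀ ℤ) : D.pairGen (.E i) (D.cg _ (.t b)) = 0 := by
  change D.mat i _ 0 1 = _
  rw [mat_cg]
  simp [matGen]

/-- convolution of functionals on `C` -/
def conv (f g : D.CAlg D.nichols →ₗ[k] k) : D.CAlg D.nichols →ₗ[k] k :=
  LinearMap.mul' k k ∘ₗ TensorProduct.map f g ∘ₗ D.cCop.toLinearMap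

theorem pairWord_cons (g : BGen I Φ) (w : List (BGen I Φ)) :
    D.pairWord (g :: w) = D.conv (D.pairGen g) (D.pairWord w) := rfl

theorem conv_assoc (f g h : D.CAlg D.nichols →ₗ[k] k) :
    D.conv (D.conv f g) h = D.conv f (D.conv g h) := by
  refine LinearMap.ext fun c => ?_
  have e := DFunLike.congr_fun D.cCop_coassoc c
  have h₁ : ∀ z, LinearMap.mul' k k (TensorProduct.map (D.conv f g) h z) =
      LinearMap.mul' k k (TensorProduct.map f (LinearMap.mul' k k ∘ₗ TensorProduct.map g h)
        ((TensorProduct.assoc k _ _ _) (TensorProduct.map D.cCop.toLinearMap .id z))) := fun z => by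
    induction z with
    | zero => simp only [map_zero]
    | add x y hx hy => simp only [map_add, hx, hy]
    | tmul a b =>
      change D.conv f g a * h b = _
      rw [TensorProduct.map_tmul]
      change LinearMap.mul' k k (TensorProduct.map f g (D.cCop a)) * h b =
        LinearMap.mul' k k (TensorProduct.map f (LinearMap.mul' k k ∘ₗ TensorProduct.map g h)
        ((TensorProduct.assoc k _ _ _) (D.cCop a ⊗ₜ b)))
      induction D.cCop a with
      | zero => simp only [map_zero, zero_mul, TensorProduct.zero_tmul]
      | add x y hx hy => simp only [map_add, add_mul, TensorProduct.add_tmul, hx, hy]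
      | tmul a c => simp [mul_assoc]
  have h₂ : ∀ z, LinearMap.mul' k k (TensorProduct.map f (D.conv g h) z) =
      LinearMap.mul' k k (TensorProduct.map f (LinearMap.mul' k k ∘ₗ TensorProduct.map g h)
        (TensorProduct.map .id D.cCop.toLinearMap z)) := fun z => by
    induction z with
    | zero => simp only [map_zero]
    | add x y hx hy => simp only [map_add, hx, hy]
    | tmul a b => rfl
  exact (h₁ _).trans ((congrArg (fun z => LinearMap.mul' k k (TensorProduct.map f
    (LinearMap.mul' k k ∘ₗ TensorProduct.map g h) z)) e).trans (h₂ _).symm)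

theorem counit_conv (f : D.CAlg D.nichols →ₗ[k] k) : D.conv D.cCounit.toLinearMap f = f := by
  refine LinearMap.ext fun c => ?_
  have e := congrArg f (DFunLike.congr_fun D.cCop_counit_left c)
  refine Eq.trans ?_ e
  change LinearMap.mul' k k (TensorProduct.map D.cCounit.toLinearMap f (D.cCop c)) =
    f (TensorProduct.lid k _ (TensorProduct.map D.cCounit.toLinearMap .id (D.cCop c)))
  induction D.cCop c with
  | zero => simp only [map_zero]
  | add x y hx hy => simp only [map_add, hx, hy]
  | tmul a b => simp

theorem conv_counit (f : D.CAlg D.nichols →ₗ[k] k) : D.conv f D.cCounit.toLinearMap = f := by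
  refine LinearMap.ext fun c => ?_
  have e := congrArg f (DFunLike.congr_fun D.cCop_counit_right c)
  refine Eq.trans ?_ e
  change LinearMap.mul' k k (TensorProduct.map f D.cCounit.toLinearMap (D.cCop c)) =
    f (TensorProduct.rid k _ (TensorProduct.map .id D.cCounit.toLinearMap (D.cCop c)))
  induction D.cCop c with
  | zero => simp only [map_zero]
  | add x y hx hy => simp only [map_add, hx, hy]
  | tmul a b => simp [mul_comm]

/-- The functionals given by words multiply by convolution, which is associative because `C` is
coassociative. -/
theorem pairWord_append (w w' : List (BGen I Φ)) :
    D.pairWord (w ++ w') = D.conv (D.pairWord w) (D.pairWord w') := by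
  induction w with
  | nil => exact (D.counit_conv _).symm
  | cons g w ih => rw [List.cons_append, pairWord_cons, ih, pairWord_cons, conv_assoc]

theorem pairWord_singleton (g : BGen I Φ) : D.pairWord [g] = D.pairGen g := D.conv_counit _

/-- The terms of the comultiplication of a word in the generators of `H ⋉ f_s`. -/
def tCop : List (BGen I Φ) → List (List (BGen I Φ) × List (BGen I Φ))
  | [] => [([], [])]
  | .K l :: w => (tCop w).map fun p => (.K l :: p.1, .K l :: p.2)
  | .E i :: w => (tCop w).map (fun p => (.E i :: p.1, .K (D.nu1 i) :: p.2)) ++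
      (tCop w).map fun p => (p.1, .E i :: p.2)

theorem pairWord_one (w : List (BGen I Φ)) :
    D.pairWord w 1 = D.uCounit (w.map D.bToU).prod := by
  induction w with
  | nil => simp [pairWord]
  | cons g w ih =>
    have h : D.pairWord (g :: w) 1 = D.pairGen g 1 * D.pairWord w 1 := by
      change LinearMap.mul' k k (TensorProduct.map _ _ (D.cCop 1)) = _
      rw [map_one, Algebra.TensorProduct.one_def, TensorProduct.map_tmul, LinearMap.mul'_apply]
    rw [h, ih, List.map_cons, List.prod_cons, map_mul]
    congr 1
    rcases g with i | l
    · exact (D.pairGen_E_one i).trans (D.uCounit_E i).symm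
    · exact (D.pairGen_K_one l).trans (D.uCounit_K l).symm

theorem conv_pair (f : D.CAlg D.nichols →ₗ[k] k) (g : D.CAlg D.nichols →ₗ[k] k)
    (c : D.CAlg D.nichols) :
    D.conv f g c = LinearMap.mul' k k (TensorProduct.map f g (D.cCop c)) := rfl

theorem list_sum_map_add {ι M : Type*} [AddCommMonoid M] (L : List ι) (f g : ι → M) :
    (L.map fun i => f i + g i).sum = (L.map f).sum + (L.map g).sum := by
  induction L with
  | nil => simp
  | cons a L ih => simp only [List.map_cons, List.sum_cons, ih]; abel

/-- `⟨b, c c'⟩ = ⟨b₁, c'⟩ ⟨b₂, c⟩` -/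
theorem pairWord_mul (w : List (BGen I Φ)) (c c' : D.CAlg D.nichols) :
    D.pairWord w (c * c') =
      ((D.tCop w).map fun p => D.pairWord p.1 c' * D.pairWord p.2 c).sum := by
  induction w generalizing c c' with
  | nil => simp [tCop, pairWord, mul_comm]
  | cons g w ih =>
    -- The case of a first letter whose comultiplication is a single tensor, applied to the
    -- grouplike `K_λ`. The letter `E_i` contributes two tensors and is treated separately below.
    have key : ∀ (f : D.CAlg D.nichols →ₗ[k] k)
        (f₁ f₂ : (D.CAlg D.nichols →ₗ[k] k)), (∀ a a', f (a * a') = f₁ a' * f₂ a) →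
        ∀ z z', LinearMap.mul' k k (TensorProduct.map f (D.pairWord w) (z * z')) =
          ((D.tCop w).map fun p =>
            LinearMap.mul' k k (TensorProduct.map f₁ (D.pairWord p.1) z') *
            LinearMap.mul' k k (TensorProduct.map f₂ (D.pairWord p.2) z)).sum := by
      intro f f₁ f₂ hf z z'
      induction z with
      | zero => simp
      | add x y hx hy => simp only [add_mul, mul_add, map_add, hx, hy, ← list_sum_map_add]
      | tmul a b =>
        induction z' with
        | zero => simp
        | add x y hx hy => simp only [add_mul, mul_add, map_add, hx, hy, ← list_sum_map_add]
        | tmul a' b' =>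
          simp only [Algebra.TensorProduct.tmul_mul_tmul, TensorProduct.map_tmul,
            LinearMap.mul'_apply, hf, ih, ← List.sum_map_mul_left]
          congr 1
          refine List.map_congr_left fun p _ => ?_
          ring
    rcases g with i | l
    · have h : ∀ z z', LinearMap.mul' k k (TensorProduct.map (D.pairGen (.E i)) (D.pairWord w)
          (z * z')) = ((D.tCop w).map fun p =>
            LinearMap.mul' k k (TensorProduct.map (D.pairGen (.E i)) (D.pairWord p.1) z') *
            LinearMap.mul' k k (TensorProduct.map (D.pairGen (.K (D.nu1 i)))
              (D.pairWord p.2) z)).sum + ((D.tCop w).map fun p =>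
            LinearMap.mul' k k (TensorProduct.map D.cCounit.toLinearMap (D.pairWord p.1) z') *
            LinearMap.mul' k k (TensorProduct.map (D.pairGen (.E i)) (D.pairWord p.2) z)).sum := by
        intro z z'
        induction z with
        | zero => simp
        | add x y hx hy =>
          simp only [add_mul, mul_add, map_add, hx, hy, list_sum_map_add]
          abel
        | tmul a b =>
          induction z' with
          | zero => simp
          | add x y hx hy =>
            simp only [add_mul, mul_add, map_add, hx, hy, list_sum_map_add]
            abel
          | tmul a' b' =>
            simp only [Algebra.TensorProduct.tmul_mul_tmul, TensorProduct.map_tmul,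
              LinearMap.mul'_apply, pairGen_E_mul, ih, ← List.sum_map_mul_left, add_mul]
            rw [← list_sum_map_add]
            congr 1
            refine List.map_congr_left fun p _ => ?_
            change _ = _ + D.cCounit _ * _ * _
            ring
      rw [pairWord_cons, conv_pair, map_mul, h, tCop, List.map_append, List.sum_append,
        List.map_map, List.map_map]
      congr 2
      refine List.map_congr_left fun p _ => ?_
      exact congrArg₂ (· * ·) (DFunLike.congr_fun (D.counit_conv (D.pairWord p.1)) c') rfl
    · rw [pairWord_cons, conv_pair, map_mul, key _ (D.pairGen (.K l)) (D.pairGen (.K l))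
        (fun a a' => (D.pairGen_K_mul l a a').trans (mul_comm _ _)), tCop, List.map_map]
      rfl

/-- the comultiplication of a word in `U` -/
theorem uCop_word (w : List (BGen I Φ)) : D.uCop (w.map D.bToU).prod =
    ((D.tCop w).map fun p => (p.1.map D.bToU).prod ⊗ₜ[k] (p.2.map D.bToU).prod).sum := by
  induction w with
  | nil => simp [tCop, Algebra.TensorProduct.one_def]
  | cons g w ih =>
    rw [List.map_cons, List.prod_cons, map_mul, ih]
    rcases g with i | l
    · rw [tCop, List.map_append, List.sum_append, List.map_map, List.map_map, bToU, uCop_E,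
        add_mul, ← List.sum_map_mul_left, ← List.sum_map_mul_left]
      congr 2
      · refine List.map_congr_left fun p _ => ?_
        simp [bToU]
      · refine List.map_congr_left fun p _ => ?_
        simp [bToU]
    · rw [tCop, List.map_map, bToU, uCop_K, ← List.sum_map_mul_left]
      congr 1
      refine List.map_congr_left fun p _ => ?_
      simp [bToU]

/-- The letters `K_λ` have weight 1, so the extra ones created by splitting `E_i` cost nothing. This
makes the comultiplication of `T` bounded by 1. -/
theorem tCop_wordWt (w : List (BGen I Φ)) : ∀ p ∈ D.tCop w,
    D.wordWt p.1 * D.wordWt p.2 = D.wordWt w := by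
  induction w with
  | nil => simp [tCop, wordWt]
  | cons g w ih =>
    intro p hp
    rcases g with i | l
    · rw [tCop, List.mem_append, List.mem_map, List.mem_map] at hp
      rcases hp with ⟨p, hp, rfl⟩ | ⟨p, hp, rfl⟩
      · have := ih p hp
        simp only [wordWt, List.map_cons, List.prod_cons, bWt] at this ⊢
        rw [← this]
        ring
      · have := ih p hp
        simp only [wordWt, List.map_cons, List.prod_cons, bWt] at this ⊢
        rw [← this]
        ring
    · rw [tCop, List.mem_map] at hp
      obtain ⟨p, hp, rfl⟩ := hp
      have := ih p hp
      simp only [wordWt, List.map_cons, List.prod_cons, bWt] at this ⊢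
      rw [← this]
      ring

end QuantumDatum
end AnQG

/-! ### The bigrading of `C`, multiplier operators, and finite-dimensional components -/

namespace AnQG
namespace QuantumDatum
variable {k I Φ : Type u} [NormedField k] [AddCommGroup Φ] (D : QuantumDatum k I Φ)

/-- the multihomogeneous elements of the tensor algebra of a given degree -/
def monoSpan (k : Type u) {I : Type u} [NormedField k] (m : Multiset I) :
    Submodule k (FreeAlgebra k I) :=
  Submodule.span k {y | ∃ l : List I, (l : Multiset I) = m ∧ y = (l.map (FreeAlgebra.ι k)).prod}

/-- sets of multihomogeneous elements -/
def Homog (J : Set (FreeAlgebra k I)) : Prop := ∀ x ∈ J, ∃ m, x ∈ monoSpan k m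

theorem homog_nichols : Homog D.nichols := by
  rintro x ⟨J, hJ, hx⟩
  obtain ⟨⟨m, -, h⟩, -⟩ := hJ x hx
  exact ⟨m, h⟩

theorem homog_empty : Homog (∅ : Set (FreeAlgebra k I)) := fun _ h => h.elim

/-- The degrees of the bosonization: `F_i` has degree `(-α_i, 0)` and `t_β` has degree `(β, β)`. -/
abbrev Deg (I : Type u) : Type u := (I →₀ ℤ) × (I →₀ ℤ)

/-- degrees of the generators -/
def gdeg : CGen I → Deg I
  | .F i => (-.single i 1, 0)
  | .t b => (b, b)

/-- degrees of monomials -/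
def wdeg (w : FreeMonoid (CGen I)) : Deg I := (FreeMonoid.lift fun x =>
  Multiplicative.ofAdd (gdeg x)) w |>.toAdd

@[simp] theorem wdeg_one : wdeg (1 : FreeMonoid (CGen I)) = 0 := by simp [wdeg]

@[simp] theorem wdeg_mul (w w' : FreeMonoid (CGen I)) : wdeg (w * w') = wdeg w + wdeg w' := by
  simp [wdeg]

@[simp] theorem wdeg_of (x : CGen I) : wdeg (.of x) = gdeg x := by
  rw [wdeg, FreeMonoid.lift_eval_of]
  rfl

/-- All monomials of a given multidegree acquire the same degree in the group algebra. This is what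
lets the homogeneous relations respect the grading. -/
theorem lift_single_monoSpan {A : Type*} [Ring A] [Algebra k A] {G : Type*} [AddCommMonoid G]
    (g : I → G) (f : I → A) {m : Multiset I} {x : FreeAlgebra k I} (hx : x ∈ monoSpan k m) :
    FreeAlgebra.lift k (fun i => AddMonoidAlgebra.single (g i) (f i)) x =
      AddMonoidAlgebra.single (m.map g).sum (FreeAlgebra.lift k f x) := by
  induction hx using Submodule.span_induction with
  | mem x hx =>
    obtain ⟨l, rfl, rfl⟩ := hx
    induction l with
    | nil => simp [AddMonoidAlgebra.one_def]
    | cons i l ih =>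
      rw [List.map_cons, List.prod_cons, map_mul, map_mul, ih, FreeAlgebra.lift_ι_apply,
        FreeAlgebra.lift_ι_apply, AddMonoidAlgebra.single_mul_single]
      rfl
  | zero => simp
  | add x y _ _ hx hy => rw [map_add, hx, hy, map_add, AddMonoidAlgebra.single_add]
  | smul a x _ hx => rw [map_smul, hx, map_smul, AddMonoidAlgebra.smul_single]

variable {J : Set (FreeAlgebra k I)} (hJ : Homog J)

/-- the grading of the bosonization, as a coaction of the group algebra -/
def grade : D.CAlg J →ₐ[k] AddMonoidAlgebra (D.CAlg J) (Deg I) :=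
  D.cLift (fun x => AddMonoidAlgebra.single (gdeg x) (D.cg J x))
    (by rw [cg_one]; rfl)
    (fun b c => by rw [AddMonoidAlgebra.single_mul_single, cg_add]; rfl)
    (fun b i => by
      rw [AddMonoidAlgebra.single_mul_single, AddMonoidAlgebra.single_mul_single, cg_comm,
        AddMonoidAlgebra.smul_single, add_comm])
    (fun x hx => by
      obtain ⟨m, hm⟩ := hJ x hx
      rw [lift_single_monoSpan _ _ hm, D.cg_nichols J x hx, AddMonoidAlgebra.single_zero])

theorem grade_cword (w : FreeMonoid (CGen I)) :
    D.grade hJ (D.cword J w) = AddMonoidAlgebra.single (wdeg w) (D.cword J w) := by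
  induction w using FreeMonoid.inductionOn' with
  | one => simp [AddMonoidAlgebra.one_def]
  | of_mul x w ih =>
    rw [map_mul, map_mul, ih, cword_of, grade, cLift_cg, AddMonoidAlgebra.single_mul_single,
      wdeg_mul, wdeg_of]

/-- the homogeneous components of an element -/
def parts : D.CAlg J →ₗ[k] (Deg I →₀ D.CAlg J) :=
  (AddMonoidAlgebra.coeffLinearEquiv k).toLinearMap ∘ₗ (D.grade hJ).toLinearMap

theorem parts_cword (w : FreeMonoid (CGen I)) :
    D.parts hJ (D.cword J w) = .single (wdeg w) (D.cword J w) :=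
  congrArg AddMonoidAlgebra.coeff (D.grade_cword hJ w)

/-- the operator which multiplies the homogeneous elements of degree `g` by `u g` -/
def dil (u : Deg I → k) : D.CAlg J →ₗ[k] D.CAlg J :=
  Finsupp.lsum k (fun g => u g • LinearMap.id) ∘ₗ D.parts hJ

theorem dil_eq_sum (u : Deg I → k) (c : D.CAlg J) :
    D.dil hJ u c = (D.parts hJ c).sum fun g x => u g • x := rfl

theorem dil_cword (u : Deg I → k) (w : FreeMonoid (CGen I)) :
    D.dil hJ u (D.cword J w) = u (wdeg w) • D.cword J w := by
  rw [dil_eq_sum, parts_cword]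
  exact Finsupp.sum_single_index (smul_zero _)

theorem dil_dil (u v : Deg I → k) (c : D.CAlg J) :
    D.dil hJ u (D.dil hJ v c) = D.dil hJ (u * v) c := by
  refine DFunLike.congr_fun (f := D.dil hJ u ∘ₗ D.dil hJ v) (cword_linear_ext fun w => ?_) c
  rw [LinearMap.comp_apply, dil_cword, map_smul, dil_cword, dil_cword, smul_smul, mul_comm]
  rfl

theorem dil_one (c : D.CAlg J) : D.dil hJ 1 c = c := by
  refine DFunLike.congr_fun (g := LinearMap.id) (cword_linear_ext fun w => ?_) c
  rw [dil_cword]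
  simp

theorem dil_add (u v : Deg I → k) (c : D.CAlg J) :
    D.dil hJ (u + v) c = D.dil hJ u c + D.dil hJ v c := by
  refine DFunLike.congr_fun (g := D.dil hJ u + D.dil hJ v) (cword_linear_ext fun w => ?_) c
  rw [LinearMap.add_apply, dil_cword, dil_cword, dil_cword, ← add_smul]
  rfl

theorem dil_smul (a : k) (u : Deg I → k) (c : D.CAlg J) :
    D.dil hJ (a • u) c = a • D.dil hJ u c := by
  refine DFunLike.congr_fun (g := a • D.dil hJ u) (cword_linear_ext fun w => ?_) c
  rw [LinearMap.smul_apply, dil_cword, dil_cword, smul_smul]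
  rfl

theorem dil_congr {u v : Deg I → k} {c : D.CAlg J}
    (h : ∀ g ∈ (D.parts hJ c).support, u g = v g) : D.dil hJ u c = D.dil hJ v c := by
  rw [dil_eq_sum, dil_eq_sum]
  exact Finsupp.sum_congr fun g hg => by rw [h g hg]

open Classical in
/-- projection to a homogeneous component -/
def proj (g : Deg I) : D.CAlg J →ₗ[k] D.CAlg J := D.dil hJ (Pi.single g 1)

theorem proj_eq (g : Deg I) (c : D.CAlg J) : D.proj hJ g c = D.parts hJ c g := by
  classical
  rw [proj, dil_eq_sum, Finsupp.sum, Finset.sum_eq_single g]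
  · simp
  · intro h _ hne
    simp [hne]
  · intro hg
    simp [Finsupp.notMem_support_iff.1 hg]

theorem sum_proj (c : D.CAlg J) : ∑ g ∈ (D.parts hJ c).support, D.proj hJ g c = c := by
  conv_rhs => rw [← D.dil_one hJ c, dil_eq_sum]
  exact Finset.sum_congr rfl fun g _ => by rw [proj_eq]; simp

theorem dil_cMono {J' : Set (FreeAlgebra k I)} (hJ' : Homog J') (h : J ⊆ J') (u : Deg I → k)
    (c : D.CAlg J) : D.cMono h (D.dil hJ u c) = D.dil hJ' u (D.cMono h c) := by
  have e : ∀ w, D.cMono h (D.cword J w) = D.cword J' w := fun w => by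
    induction w using FreeMonoid.inductionOn' with
    | one => simp
    | of_mul x w ih => rw [map_mul, map_mul, ih, map_mul, cword_of, cword_of, cMono, cLift_cg]
  refine DFunLike.congr_fun (f := (D.cMono h).toLinearMap ∘ₗ D.dil hJ u)
    (g := D.dil hJ' u ∘ₗ (D.cMono h).toLinearMap) (cword_linear_ext fun w => ?_) c
  simp only [LinearMap.comp_apply, AlgHom.toLinearMap_apply, dil_cword, map_smul, e]

variable (J) in
/-- the homogeneous elements of degree `g` -/
def homSpan (g : Deg I) : Submodule k (D.CAlg J) :=
  Submodule.span k (D.cword J '' {w | wdeg w = g})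

theorem proj_mem (g : Deg I) (c : D.CAlg J) : D.proj hJ g c ∈ D.homSpan J g := by
  classical
  induction D.cword_span J c using Submodule.span_induction with
  | mem x hx =>
    obtain ⟨w, rfl⟩ := hx
    rw [proj, dil_cword, Pi.single_apply]
    split_ifs with h
    · rw [one_smul]
      exact Submodule.subset_span ⟨w, h, rfl⟩
    · rw [zero_smul]
      exact zero_mem _
  | zero => rw [map_zero]; exact zero_mem _
  | add x y _ _ hx hy => rw [map_add]; exact add_mem hx hy
  | smul a x _ hx => rw [map_smul]; exact Submodule.smul_mem _ _ hx

variable (J) in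
/-- the algebra map from the tensor algebra to the bosonization -/
def fLift : FreeAlgebra k I →ₐ[k] D.CAlg J := FreeAlgebra.lift k fun i => D.cg J (.F i)

theorem fLift_cMono {J' : Set (FreeAlgebra k I)} (h : J ⊆ J') (x : FreeAlgebra k I) :
    D.cMono h (D.fLift J x) = D.fLift J' x := by
  refine DFunLike.congr_fun (f := (D.cMono h).comp (D.fLift J)) (FreeAlgebra.hom_ext ?_) x
  ext i
  simp [fLift, cMono]

theorem t_fLift (b : I →₀ ℤ) (l : List I) : ∃ a : k, D.cg J (.t b) *
    D.fLift J (l.map (FreeAlgebra.ι k)).prod =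
      a • (D.fLift J (l.map (FreeAlgebra.ι k)).prod * D.cg J (.t b)) := by
  induction l with
  | nil => exact ⟨1, by simp⟩
  | cons i l ih =>
    obtain ⟨a, ih⟩ := ih
    refine ⟨D.q ^ (-(D.nu b (D.root i))) * a, ?_⟩
    have e : D.fLift J (FreeAlgebra.ι k i) = D.cg J (.F i) := FreeAlgebra.lift_ι_apply _ _
    rw [List.map_cons, List.prod_cons, map_mul, e, ← mul_assoc, cg_comm, smul_mul_assoc,
      mul_assoc, ih, mul_smul_comm, smul_smul, mul_assoc]

/-- The t's can be moved to the right up to scalars. Each `F_i` lowers the first degree by α_i and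
keeps the second, and each t raises both equally, so the difference of the two degrees records the
F-part and the second degree is that of the remaining t. -/
theorem cword_normal (w : FreeMonoid (CGen I)) : ∃ (a : k) (l : List I),
    D.cword J w = a • (D.fLift J (l.map (FreeAlgebra.ι k)).prod * D.cg J (.t (wdeg w).2)) ∧
      (l.map fun i => Finsupp.single i (1 : ℤ)).sum = (wdeg w).2 - (wdeg w).1 := by
  induction w using FreeMonoid.inductionOn' with
  | one => exact ⟨1, [], by simp [cg_one], by simp⟩
  | of_mul x w ih =>
    obtain ⟨a, l, h, h'⟩ := ih
    rcases x with i | b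
    · refine ⟨a, i :: l, ?_, ?_⟩
      · have e : D.fLift J (FreeAlgebra.ι k i) = D.cg J (.F i) := FreeAlgebra.lift_ι_apply _ _
        rw [map_mul, cword_of, h, wdeg_mul, wdeg_of, List.map_cons, List.prod_cons, map_mul, e,
          mul_smul_comm, mul_assoc, gdeg, Prod.snd_add, zero_add]
      · rw [List.map_cons, List.sum_cons, h', wdeg_mul, wdeg_of, gdeg, Prod.snd_add, Prod.fst_add,
          zero_add]
        generalize Finsupp.single i (1 : ℤ) = y
        change y + _ = _ - (-y + _)
        abel
    · obtain ⟨a', ha⟩ := D.t_fLift (J := J) b l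
      refine ⟨a * a', l, ?_, ?_⟩
      · rw [map_mul, cword_of, h, wdeg_mul, wdeg_of, gdeg, Prod.snd_add, mul_smul_comm,
          ← mul_assoc, ha, smul_mul_assoc, smul_smul, mul_assoc, cg_add]
      · rw [h', wdeg_mul, wdeg_of, gdeg, Prod.snd_add, Prod.fst_add]
        abel

/-- The coefficients of the sum are the multiplicities of the letters. -/
theorem coe_eq_of_sum_single {l l' : List I} (h : (l.map fun i => Finsupp.single i (1 : ℤ)).sum =
    (l'.map fun i => Finsupp.single i (1 : ℤ)).sum) : (l : Multiset I) = l' := by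
  classical
  have e : ∀ (l : List I) (j : I),
      (l.map fun i => Finsupp.single i (1 : ℤ)).sum j = l.count j := fun l j => by
    induction l with
    | nil => simp
    | cons i l ih =>
      rw [List.map_cons, List.sum_cons, Finsupp.add_apply, ih, List.count_cons,
        Finsupp.single_apply]
      push_cast
      simp [add_comm]
  refine Multiset.ext.2 fun j => ?_
  have := (e l j).symm.trans ((congrArg (fun f : I →₀ ℤ => f j) h).trans (e l' j))
  simpa using this

/-- homogeneous elements are of the form `x t_β` -/
theorem homSpan_normal (g : Deg I) : ∃ m : Multiset I, ∀ (J : Set (FreeAlgebra k I)),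
    ∀ c ∈ D.homSpan J g, ∃ x ∈ monoSpan k m, c = D.fLift J x * D.cg J (.t g.2) := by
  by_cases hg : ∃ l : List I, (l.map fun i => Finsupp.single i (1 : ℤ)).sum = g.2 - g.1
  · obtain ⟨l, hl⟩ := hg
    refine ⟨l, fun J c hc => ?_⟩
    induction hc using Submodule.span_induction with
    | mem c hc =>
      obtain ⟨w, rfl, rfl⟩ := hc
      obtain ⟨a, l', h, h'⟩ := D.cword_normal (J := J) w
      refine ⟨a • (l'.map (FreeAlgebra.ι k)).prod, Submodule.smul_mem _ _
        (Submodule.subset_span ⟨l', coe_eq_of_sum_single (h'.trans hl.symm), rfl⟩), ?_⟩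
      rw [h, map_smul, smul_mul_assoc]
    | zero => exact ⟨0, zero_mem _, by simp⟩
    | add c c' _ _ h h' =>
      obtain ⟨x, hx, rfl⟩ := h
      obtain ⟨x', hx', rfl⟩ := h'
      exact ⟨x + x', add_mem hx hx', by rw [map_add, add_mul]⟩
    | smul a c _ h =>
      obtain ⟨x, hx, rfl⟩ := h
      exact ⟨a • x, Submodule.smul_mem _ _ hx, by rw [map_smul, smul_mul_assoc]⟩
  -- The difference of the degrees is not a sum of simple roots, so no monomial has this degree and
  -- any multiset serves.
  · refine ⟨0, fun J c hc => ⟨0, zero_mem _, ?_⟩⟩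
    have : {w : FreeMonoid (CGen I) | wdeg w = g} = ∅ := by
      refine Set.eq_empty_of_forall_notMem fun w hw => hg ?_
      obtain ⟨_, l, -, h⟩ := D.cword_normal (J := J) w
      have hw : wdeg w = g := hw
      exact ⟨l, hw ▸ h⟩
    rw [homSpan, this, Set.image_empty, Submodule.span_empty, Submodule.mem_bot] at hc
    rw [hc, map_zero, zero_mul]

/-- A multiset has finitely many orderings, even when I is infinite. -/
instance (m : Multiset I) : FiniteDimensional k (monoSpan k m) := by
  refine FiniteDimensional.span_of_finite k ?_
  obtain ⟨l, rfl⟩ := Quot.exists_rep m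
  refine ((l.permutations.finite_toSet).image
    fun l => (l.map (FreeAlgebra.ι k)).prod).subset ?_
  rintro _ ⟨l', h, rfl⟩
  refine ⟨l', ?_, rfl⟩
  exact List.mem_permutations.2 (Multiset.coe_eq_coe.1 h)

/-- The component of degree g is contained in the image of a finite-dimensional space of
noncommutative polynomials under x ↦ x t_β with β fixed by g. -/
instance (J : Set (FreeAlgebra k I)) (g : Deg I) : FiniteDimensional k (D.homSpan J g) := by
  obtain ⟨m, hm⟩ := D.homSpan_normal g
  have h : D.homSpan J g ≤ (monoSpan k m).map
      (LinearMap.mulRight k (D.cg J (.t g.2)) ∘ₗ (D.fLift J).toLinearMap) := fun c hc => by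
    obtain ⟨x, hx, rfl⟩ := hm J c hc
    exact ⟨x, hx, rfl⟩
  exact Submodule.finiteDimensional_of_le h

end QuantumDatum
end AnQG

/-! ### Isolation of degrees and nondegeneracy of the pairing on the algebraic `C` -/

namespace AnQG

/-- Write z = ∑ cₙ ⊗ bₙ along a basis. Applying F i to the left factors gives a vector ∑ F i(cₙ) bₙ
killed by all functionals, hence zero; so all F i(cₙ) vanish, and then all cₙ. -/
theorem eq_zero_of_forall_map_eq_zero {k V ι : Type*} [Field k] [AddCommGroup V] [Module k V]
    (F : ι → V →ₗ[k] k) (hF : ∀ v, (∀ i, F i v = 0) → v = 0) (z : V ⊗[k] V)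
    (hz : ∀ i j, LinearMap.mul' k k (TensorProduct.map (F i) (F j) z) = 0) : z = 0 := by
  let b := Module.Basis.ofVectorSpace k V
  obtain ⟨c, rfl⟩ := TensorProduct.eq_repr_basis_right b z
  suffices c = 0 by simp [this]
  refine Finsupp.ext fun n => hF _ fun i => ?_
  have h : Finsupp.linearCombination k b (c.mapRange (F i) (map_zero _)) = 0 := hF _ fun j => by
    rw [← hz i j, Finsupp.linearCombination_apply, Finsupp.sum_mapRange_index (by simp)]
    simp only [Finsupp.sum, map_sum, map_smul, TensorProduct.map_tmul, LinearMap.mul'_apply,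
      smul_eq_mul]
  have h' := linearIndependent_iff.1 b.linearIndependent _ h
  exact DFunLike.congr_fun h' n

namespace QuantumDatum
variable {k I Φ : Type u} [NormedField k] [AddCommGroup Φ] (D : QuantumDatum k I Φ)

/-! ### Gaussian binomials -/

theorem q_zpow_sub_one_ne {n : ℕ} (h : 0 < n) : D.q ^ n - 1 ≠ 0 :=
  sub_ne_zero.2 (D.q_pow_ne_one n h)

/-- Gaussian binomial coefficient -/
def gauss (N : ℕ) (m : ℤ) : k :=
  ∏ j ∈ Finset.range N, (D.q ^ (m - j) - 1) * (D.q ^ (j + 1) - 1)⁻¹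

theorem gauss_zero {N : ℕ} (h : 0 < N) : D.gauss N 0 = 0 :=
  Finset.prod_eq_zero (Finset.mem_range.2 h) (by simp)

theorem gauss_self (N : ℕ) : D.gauss N N = 1 := by
  rw [gauss, Finset.prod_mul_distrib, ← Finset.prod_range_reflect, ← Finset.prod_mul_distrib]
  refine Finset.prod_eq_one fun j hj => ?_
  have hj := Finset.mem_range.1 hj
  have : (N : ℤ) - ((N - 1 - j : ℕ) : ℤ) = ((j + 1 : ℕ) : ℤ) := by omega
  rw [this, zpow_natCast]
  exact mul_inv_cancel₀ (D.q_zpow_sub_one_ne j.succ_pos)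

theorem gauss_succ_right (N : ℕ) (m : ℤ) :
    D.gauss (N + 1) m = D.gauss N m * ((D.q ^ (m - N) - 1) * (D.q ^ (N + 1) - 1)⁻¹) :=
  Finset.prod_range_succ _ _

theorem gauss_succ_left (N : ℕ) (m : ℤ) : D.gauss (N + 1) (m + 1) =
    D.gauss N m * ((D.q ^ (m + 1) - 1) * (D.q ^ (N + 1) - 1)⁻¹) := by
  rw [gauss, gauss, Finset.prod_mul_distrib, Finset.prod_mul_distrib, Finset.prod_range_succ',
    Finset.prod_range_succ]
  have : ∀ j : ℕ, m + 1 - ((j + 1 : ℕ) : ℤ) = m - j := fun j => by push_cast; ring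
  simp only [this, Nat.cast_zero, sub_zero]
  ring

/-- Pascal's rule for Gaussian binomials, valid for every integer m, so that it can be run in both
directions. -/
theorem gauss_pascal (N : ℕ) (m : ℤ) :
    D.gauss (N + 1) (m + 1) - D.gauss (N + 1) m = D.gauss N m * D.q ^ (m - N) := by
  rw [gauss_succ_left, gauss_succ_right]
  have h := D.q_zpow_sub_one_ne N.succ_pos
  have e : D.q ^ (m + 1) = D.q ^ (m - N) * D.q ^ (N + 1) := by
    rw [← zpow_natCast, ← zpow_add₀ D.q_ne_zero]
    congr 1
    push_cast
    ring
  rw [e]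
  field_simp
  ring

/-- The factors of the quotient can be large since q^n - 1 may be small, but Pascal's rule has
coefficients of norm one. Induction on N, and from m = 0 upwards and downwards, with the ultrametric
inequality gives the bound. -/
theorem norm_gauss_le [IsUltrametricDist k] (N : ℕ) (m : ℤ) : ‖D.gauss N m‖ ≤ 1 := by
  induction N generalizing m with
  | zero => simp [gauss]
  | succ N ih =>
    have h : ∀ m, ‖D.gauss N m * D.q ^ (m - N)‖ ≤ 1 := fun m => by
      rw [norm_mul, D.norm_q_zpow, mul_one]
      exact ih m
    induction m using Int.induction_on with
    | zero => rw [D.gauss_zero N.succ_pos, norm_zero]; exact zero_le_one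
    | succ m ihm =>
      rw [sub_eq_iff_eq_add.1 (D.gauss_pascal N m)]
      exact (IsUltrametricDist.norm_add_le_max _ _).trans (max_le (h _) ihm)
    | pred m ihm =>
      have e := D.gauss_pascal N (-m - 1)
      rw [sub_add_cancel, sub_eq_iff_eq_add, ← sub_eq_iff_eq_add'] at e
      rw [← e, sub_eq_add_neg]
      exact (IsUltrametricDist.norm_add_le_max _ _).trans (max_le ihm ((norm_neg _).trans_le (h _)))

/-! ### Operators on the span of the functionals given by words -/

/-- the span of the functionals given by words -/
def wordSpan : Submodule k (D.CAlg D.nichols →ₗ[k] k) := Submodule.span k (Set.range D.pairWord)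

/-- Functions of the degree which act on the functionals given by words. -/
def theta : Subalgebra k (Deg I → k) where
  carrier := {u | ∀ w, D.pairWord w ∘ₗ D.dil D.homog_nichols u ∈ D.wordSpan}
  mul_mem' {u v} hu hv w := by
    have h : ∀ f ∈ D.wordSpan, f ∘ₗ D.dil D.homog_nichols v ∈ D.wordSpan := fun f hf => by
      induction hf using Submodule.span_induction with
      | mem f hf => obtain ⟨w, rfl⟩ := hf; exact hv w
      | zero => rw [LinearMap.zero_comp]; exact zero_mem _
      | add f g _ _ hf hg => rw [LinearMap.add_comp]; exact add_mem hf hg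
      | smul a f _ hf => rw [LinearMap.smul_comp]; exact Submodule.smul_mem _ _ hf
    convert h _ (hu w) using 1
    refine LinearMap.ext fun c => ?_
    exact congrArg (D.pairWord w) (D.dil_dil D.homog_nichols u v c).symm
  add_mem' {u v} hu hv w := by
    convert add_mem (hu w) (hv w) using 1
    refine LinearMap.ext fun c => ?_
    exact (congrArg (D.pairWord w) (D.dil_add D.homog_nichols u v c)).trans (map_add _ _ _)
  algebraMap_mem' a w := by
    have h : D.pairWord w ∘ₗ D.dil D.homog_nichols (algebraMap k _ a) = a • D.pairWord w := by
      refine LinearMap.ext fun c => ?_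
      refine (congrArg (D.pairWord w) ?_).trans (map_smul _ a c)
      rw [Algebra.algebraMap_eq_smul_one, dil_smul, dil_one]
    rw [h]
    exact Submodule.smul_mem _ a (Submodule.subset_span (Set.mem_range_self w))

/-- Pairing the left leg of the comultiplication with `K_λ` is an algebra map that is diagonal on
generators, with eigenvalue given by the first degree. Its transpose puts the letter `K_λ` in front
of a word. -/
theorem char_left_mem (l : Φ →ₗ[ℤ] ℤ) :
    (fun g : Deg I => D.q ^ (-(l (D.wt g.1)))) ∈ D.theta := fun w => by
  let L := ((Algebra.TensorProduct.lid k (D.CAlg D.nichols)).toAlgHom.comp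
    (Algebra.TensorProduct.map (D.pairK l) (.id k _))).comp D.cCop
  have hL : ∀ v, L (D.cword _ v) = D.q ^ (-(l (D.wt (wdeg v).1))) • D.cword _ v := fun v => by
    induction v using FreeMonoid.inductionOn' with
    | one => simp [wt]
    | of_mul x v ih =>
      have hx : L (D.cg _ x) = D.q ^ (-(l (D.wt (gdeg x).1))) • D.cg _ x := by
        rcases x with i | b
        · simp [L, cCop_F, pairK_F, pairK_t, gdeg, wt]
        · simp [L, cCop_t, pairK_t, gdeg]
      rw [map_mul, map_mul, ih, cword_of, hx, smul_mul_smul_comm, ← zpow_add₀ D.q_ne_zero,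
        wdeg_mul, wdeg_of, Prod.fst_add, wt, wt, wt, map_add, map_add, neg_add]
  suffices hs : D.pairWord w ∘ₗ D.dil D.homog_nichols
      (fun g : Deg I => D.q ^ (-(l (D.wt g.1)))) = D.pairWord (.K l :: w) by
    rw [hs]
    exact Submodule.subset_span (Set.mem_range_self _)
  refine LinearMap.ext fun c => ?_
  have h : D.dil D.homog_nichols (fun g : Deg I => D.q ^ (-(l (D.wt g.1)))) c = L c :=
    DFunLike.congr_fun (g := L.toLinearMap) (cword_linear_ext fun v => by
      rw [dil_cword, AlgHom.toLinearMap_apply, hL]) c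
  rw [LinearMap.comp_apply, h, pairWord_cons, conv_pair]
  change D.pairWord w (TensorProduct.lid k _ (TensorProduct.map (D.pairK l).toLinearMap .id
    (D.cCop c))) = LinearMap.mul' k k (TensorProduct.map (D.pairK l).toLinearMap _ _)
  induction D.cCop c with
  | zero => simp only [map_zero]
  | add x y hx hy => simp only [map_add, hx, hy]
  | tmul a b => simp

/-- As `char_left_mem`, with the right leg: the eigenvalue depends on the second degree, and `K_λ`
is appended to the word. -/
theorem char_right_mem (l : Φ →ₗ[ℤ] ℤ) :
    (fun g : Deg I => D.q ^ (-(l (D.wt g.2)))) ∈ D.theta := fun w => by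
  let L := ((Algebra.TensorProduct.rid k k (D.CAlg D.nichols)).toAlgHom.comp
    (Algebra.TensorProduct.map (.id k _) (D.pairK l))).comp D.cCop
  have hL : ∀ v, L (D.cword _ v) = D.q ^ (-(l (D.wt (wdeg v).2))) • D.cword _ v := fun v => by
    induction v using FreeMonoid.inductionOn' with
    | one => simp [wt]
    | of_mul x v ih =>
      have hx : L (D.cg _ x) = D.q ^ (-(l (D.wt (gdeg x).2))) • D.cg _ x := by
        rcases x with i | b
        · simp [L, cCop_F, pairK_F, gdeg, wt]
        · simp [L, cCop_t, pairK_t, gdeg]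
      rw [map_mul, map_mul, ih, cword_of, hx, smul_mul_smul_comm, ← zpow_add₀ D.q_ne_zero,
        wdeg_mul, wdeg_of, Prod.snd_add, wt, wt, wt, map_add, map_add, neg_add]
  suffices hs : D.pairWord w ∘ₗ D.dil D.homog_nichols
      (fun g : Deg I => D.q ^ (-(l (D.wt g.2)))) = D.pairWord (w ++ [.K l]) by
    rw [hs]
    exact Submodule.subset_span (Set.mem_range_self _)
  refine LinearMap.ext fun c => ?_
  have h : D.dil D.homog_nichols (fun g : Deg I => D.q ^ (-(l (D.wt g.2)))) c = L c :=
    DFunLike.congr_fun (g := L.toLinearMap) (cword_linear_ext fun v => by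
      rw [dil_cword, AlgHom.toLinearMap_apply, hL]) c
  rw [LinearMap.comp_apply, h, pairWord_append, pairWord_singleton, conv_pair]
  change D.pairWord w (TensorProduct.rid k _ (TensorProduct.map .id (D.pairK l).toLinearMap
    (D.cCop c))) = LinearMap.mul' k k (TensorProduct.map _ (D.pairK l).toLinearMap _)
  induction D.cCop c with
  | zero => simp only [map_zero]
  | add x y hx hy => simp only [map_add, hx, hy]
  | tmul a b => simp [mul_comm]

theorem wt_injective : Function.Injective D.wt := D.root_indep

section sep
variable [Module.Free ℤ Φ]

/-- Some coordinate of the free module Φ distinguishes the two images; up to sign it gives a strict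
inequality in the wanted direction, needed so that the order N of the Gaussian binomial below is
positive. -/
theorem exists_functional_ne {b c : I →₀ ℤ} (h : b ≠ c) :
    ∃ l : Φ →ₗ[ℤ] ℤ, l (D.wt b) < l (D.wt c) := by
  have h' : D.wt b ≠ D.wt c := fun e => h (D.wt_injective e)
  let B := Module.Free.chooseBasis ℤ Φ
  obtain ⟨n, hn⟩ : ∃ n, B.coord n (D.wt b) ≠ B.coord n (D.wt c) := by
    by_contra! hc
    exact h' (B.ext_elem fun n => hc n)
  rcases lt_or_gt_of_ne hn with hn | hn
  · exact ⟨B.coord n, hn⟩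
  · exact ⟨-B.coord n, neg_lt_neg hn⟩

theorem exists_char {g g' : Deg I} (h : g ≠ g') :
    ∃ f : Deg I → ℤ, f g' < f g ∧ (fun x => D.q ^ f x) ∈ D.theta := by
  by_cases h₁ : g.1 = g'.1
  · obtain ⟨l, hl⟩ := D.exists_functional_ne (fun h₂ => h (Prod.ext h₁ h₂))
    exact ⟨fun x => -(l (D.wt x.2)), neg_lt_neg hl, D.char_right_mem l⟩
  · obtain ⟨l, hl⟩ := D.exists_functional_ne h₁
    exact ⟨fun x => -(l (D.wt x.1)), neg_lt_neg hl, D.char_left_mem l⟩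

variable [IsUltrametricDist k]

/-- Take the Gaussian binomial of order N = f(g) - f(g') evaluated at f - f(g'). It is 1 at g and 0
at g', is a polynomial in q^f, and has norm at most 1 everywhere, not only at the two degrees. -/
theorem exists_theta_pair {g g' : Deg I} (h : g ≠ g') :
    ∃ u ∈ D.theta, (∀ x, ‖u x‖ ≤ 1) ∧ u g = 1 ∧ u g' = 0 := by
  obtain ⟨f, hf, hmem⟩ := D.exists_char h
  obtain ⟨N, hN⟩ := Int.eq_ofNat_of_zero_le (sub_nonneg.2 hf.le)
  refine ⟨fun x => D.gauss N (f x - f g'), ?_, fun x => D.norm_gauss_le _ _, ?_, ?_⟩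
  -- Each factor is an affine function of q^f, so the product lies in the subalgebra generated by
  -- q^f.
  · have e : (fun x => D.gauss N (f x - f g')) = ∏ j ∈ Finset.range N,
        ((D.q ^ (-f g' - j)) • (fun x : Deg I => D.q ^ f x) - 1) *
          algebraMap k _ (D.q ^ (j + 1) - 1)⁻¹ := by
      funext x
      rw [gauss, Finset.prod_apply]
      refine Finset.prod_congr rfl fun j _ => ?_
      have : f x - f g' - j = (-f g' - j) + f x := by ring
      rw [this, zpow_add₀ D.q_ne_zero]
      rfl
    rw [e]
    exact Subalgebra.prod_mem _ fun j _ => mul_mem (sub_mem (Subalgebra.smul_mem _ hmem _)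
      (one_mem _)) (Subalgebra.algebraMap_mem _ _)
  · change D.gauss N (f g - f g') = 1
    rw [hN]
    exact D.gauss_self N
  · change D.gauss N (f g' - f g') = 0
    rw [sub_self]
    refine D.gauss_zero (Nat.pos_of_ne_zero fun h0 => ?_)
    rw [h0] at hN
    simp at hN
    omega

/-- Product of the functions of `exists_theta_pair`; the bound by 1 survives, whatever the size of
S. -/
theorem exists_theta (S : Finset (Deg I)) (g : Deg I) :
    ∃ u ∈ D.theta, (∀ x, ‖u x‖ ≤ 1) ∧ u g = 1 ∧ ∀ g' ∈ S, g' ≠ g → u g' = 0 := by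
  classical
  induction S using Finset.induction_on with
  | empty => exact ⟨1, one_mem _, fun x => by simp, rfl, by simp⟩
  | insert a S _ ih =>
    obtain ⟨u, hu, hb, h1, h0⟩ := ih
    by_cases hg : a = g
    · refine ⟨u, hu, hb, h1, fun g' hg' hne => ?_⟩
      rcases Finset.mem_insert.1 hg' with rfl | hg'
      · exact absurd hg hne
      · exact h0 _ hg' hne
    · obtain ⟨v, hv, hb', h1', h0'⟩ := D.exists_theta_pair (Ne.symm hg)
      refine ⟨u * v, mul_mem hu hv, fun x => ?_, by simp [h1, h1'], fun g' hg' hne => ?_⟩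
      · rw [Pi.mul_apply, norm_mul]
        exact mul_le_one₀ (hb x) (norm_nonneg _) (hb' x)
      · rcases Finset.mem_insert.1 hg' with rfl | hg'
        · simp [h0']
        · simp [h0 _ hg' hne]

end sep

/-! ### Nondegeneracy -/

/-- The radical of the pairing, as a congruence. -/
def radCon : RingCon (D.CAlg D.nichols) where
  r a b := ∀ w, D.pairWord w a = D.pairWord w b
  iseqv := ⟨fun _ _ => rfl, fun h w => (h w).symm, fun h h' w => (h w).trans (h' w)⟩
  add' h h' w := by rw [map_add, map_add, h, h']
  mul' h h' w := by
    rw [pairWord_mul, pairWord_mul]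
    congr 1
    exact List.map_congr_left fun p _ => by rw [h, h']

/-- the quotient by the radical of the pairing -/
def Bar : Type u := D.radCon.Quotient

instance : Ring D.Bar := inferInstanceAs (Ring D.radCon.Quotient)

instance : Algebra k D.Bar := inferInstanceAs (Algebra k D.radCon.Quotient)

/-- the projection to the quotient by the radical -/
def mkBar : D.CAlg D.nichols →ₐ[k] D.Bar := D.radCon.mkₐ k

/-- the functionals given by words, on the quotient by the radical -/
def pairBar (w : List (BGen I Φ)) : D.Bar →ₗ[k] k where
  toFun := Quotient.lift (D.pairWord w) fun _ _ h => h w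
  map_add' := Quotient.ind₂ fun _ _ => map_add (D.pairWord w) _ _
  map_smul' a := Quotient.ind fun _ => map_smul (D.pairWord w) a _

theorem pairBar_mk (w : List (BGen I Φ)) (c : D.CAlg D.nichols) :
    D.pairBar w (D.mkBar c) = D.pairWord w c := rfl

theorem pairBar_separating (x : D.Bar) (h : ∀ w, D.pairBar w x = 0) : x = 0 := by
  induction x using Quotient.ind with
  | _ x => exact Quotient.sound fun w => (h w).trans (map_zero _).symm

theorem cMono_surjective {J J' : Set (FreeAlgebra k I)} (h : J ⊆ J') :
    Function.Surjective (D.cMono h) := fun c => by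
  change c ∈ (D.cMono h).range
  induction c using cAlg_induction with
  | hs a c hc => exact Subalgebra.smul_mem _ hc a
  | h₁ => exact one_mem _
  | hg x => exact ⟨D.cg J x, by rw [AlgHom.toRingHom_eq_coe, RingHom.coe_coe, cMono, cLift_cg]⟩
  | ha a b ha hb => exact add_mem ha hb
  | hm a b ha hb => exact mul_mem ha hb

/-- multihomogeneous elements of degree at least two in the radical -/
def radSet : Set (FreeAlgebra k I) := {x | ∃ m : Multiset I, 2 ≤ m.card ∧ x ∈ monoSpan k m ∧
  ∀ w, D.pairWord w (D.fLift _ x) = 0}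

theorem qq_ne_zero (i : I) : D.qq i ≠ 0 := fun h => by
  have h' := D.le_mul i
  rw [show D.q ^ D.d i - (D.q ^ D.d i)⁻¹ = 0 from h] at h'
  simp at h'

/-- In degree at least two the element is one of the imposed relations. Degree zero is detected by
the empty word, and degree one by `E_i`, which takes a nonzero value at `F_i`. -/
theorem fLift_eq_zero {J : Set (FreeAlgebra k I)} (hJ : D.radSet ⊆ J) {m : Multiset I}
    {x : FreeAlgebra k I} (hx : x ∈ monoSpan k m) (h : ∀ w, D.pairWord w (D.fLift _ x) = 0) :
    D.fLift J x = 0 := by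
  by_cases hm : 2 ≤ m.card
  · exact D.cg_nichols J x (hJ ⟨m, hm, hx, h⟩)
  have aux : ∀ y, (∀ l : List I, (l : Multiset I) = m → (l.map (FreeAlgebra.ι k)).prod = y) →
      ∃ a : k, x = a • y := fun y hy => by
    refine (Submodule.mem_span_singleton.1 ?_).imp fun a ha => ha.symm
    refine Submodule.span_mono ?_ hx
    rintro _ ⟨l, hl, rfl⟩
    exact hy l hl
  rcases Nat.lt_or_ge m.card 1 with h0 | h0
  · have hm0 : m = 0 := Multiset.card_eq_zero.1 (by omega)
    obtain ⟨a, rfl⟩ := aux 1 fun l hl => by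
      rw [hm0, Multiset.coe_eq_zero] at hl
      simp [hl]
    have := h []
    rw [map_smul, map_one, map_smul, pairWord_one] at this
    simp at this
    simp [this]
  · obtain ⟨i, hi⟩ := Multiset.card_eq_one.1 (show m.card = 1 by omega)
    obtain ⟨a, rfl⟩ := aux (FreeAlgebra.ι k i) fun l hl => by
      rw [hi, Multiset.coe_eq_singleton] at hl
      simp [hl]
    have := h [.E i]
    rw [map_smul, map_smul, fLift, FreeAlgebra.lift_ι_apply, pairWord_singleton,
      pairGen_E_F_self] at this
    have ha : a = 0 := by simpa [D.qq_ne_zero i] using this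
    simp [ha]

theorem pairWord_mul_eq_zero {c : D.CAlg D.nichols} (h : ∀ w, D.pairWord w c = 0)
    (c' : D.CAlg D.nichols) (w : List (BGen I Φ)) : D.pairWord w (c * c') = 0 := by
  rw [pairWord_mul]
  exact List.sum_eq_zero fun x hx => by
    obtain ⟨p, -, rfl⟩ := List.mem_map.1 hx
    rw [h, mul_zero]

theorem wordSpan_eq_zero {c : D.CAlg D.nichols} (h : ∀ w, D.pairWord w c = 0)
    {f : D.CAlg D.nichols →ₗ[k] k} (hf : f ∈ D.wordSpan) : f c = 0 := by
  induction hf using Submodule.span_induction with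
  | mem f hf => obtain ⟨w, rfl⟩ := hf; exact h w
  | zero => rfl
  | add f g _ _ hf hg => rw [LinearMap.add_apply, hf, hg, add_zero]
  | smul a f _ hf => rw [LinearMap.smul_apply, hf, smul_zero]

/-- the map from the bosonization defined by the radical to the quotient by the radical -/
def toBar : D.CAlg D.radSet →ₐ[k] D.Bar :=
  D.cLift (fun x => D.mkBar (D.cg _ x)) (by rw [cg_one, map_one])
    (fun b c => by rw [cg_add, map_mul])
    (fun b i => by rw [← map_mul, cg_comm, map_smul, map_mul])
    (fun x hx => by
      have e : FreeAlgebra.lift k (fun i => D.mkBar (D.cg _ (.F i))) x =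
          D.mkBar (D.fLift _ x) := by
        refine DFunLike.congr_fun (g := (D.mkBar).comp (D.fLift _))
          (FreeAlgebra.hom_ext ?_) x
        ext i
        simp [fLift]
      rw [e]
      obtain ⟨m, -, -, h⟩ := hx
      exact D.pairBar_separating _ h)

theorem toBar_cMono (c : D.CAlg ∅) : D.toBar (D.cMono (Set.empty_subset _) c) =
    D.mkBar (D.cMono (Set.empty_subset _) c) :=
  DFunLike.congr_fun (f := D.toBar.comp (D.cMono (Set.empty_subset _)))
    (g := (D.mkBar).comp (D.cMono (Set.empty_subset _))) (cAlg_hom_ext fun x => by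
      simp only [AlgHom.comp_apply, cMono, cLift_cg, toBar]) c

variable [Module.Free ℤ Φ] [IsUltrametricDist k]

/-- The homogeneous components of a radical element are radical, by `exists_theta` on the finite set
of degrees that occur. Each component is x t_β with x multihomogeneous, and t_β is invertible, so x
itself is radical and `fLift_eq_zero` applies. Working upstairs in the bosonization of the tensor
algebra allows J to be either the radical relations or the Nichols relations. -/
theorem cMono_eq_zero {J : Set (FreeAlgebra k I)} (hJ : D.radSet ⊆ J) (c : D.CAlg ∅)
    (h : ∀ w, D.pairWord w (D.cMono (Set.empty_subset _) c) = 0) :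
    D.cMono (Set.empty_subset J) c = 0 := by
  classical
  rw [← D.sum_proj homog_empty c, map_sum]
  refine Finset.sum_eq_zero fun g hg => ?_
  have hp : ∀ w, D.pairWord w (D.cMono (Set.empty_subset _) (D.proj homog_empty g c)) = 0 :=
    fun w => by
      obtain ⟨u, hu, -, h1, h0⟩ := D.exists_theta (D.parts homog_empty c).support g
      have e : D.proj homog_empty g c = D.dil homog_empty u c := D.dil_congr _ fun g' hg' => by
        by_cases hgg : g' = g
        · subst hgg
          rw [Pi.single_eq_same, h1]
        · rw [Pi.single_eq_of_ne hgg, h0 _ hg' hgg]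
      rw [e, D.dil_cMono homog_empty D.homog_nichols]
      exact D.wordSpan_eq_zero h (hu w)
  have hmem := D.proj_mem homog_empty g c
  obtain ⟨m, hm⟩ := D.homSpan_normal g
  obtain ⟨x, hx, e⟩ := hm ∅ _ hmem
  rw [e] at hp ⊢
  rw [map_mul, fLift_cMono]
  rw [D.fLift_eq_zero hJ hx, zero_mul]
  intro w
  -- The radical is an ideal, so t_β is cancelled by multiplying with its inverse.
  have := D.pairWord_mul_eq_zero hp (D.cg _ (.t (-g.2))) w
  rw [map_mul (D.cMono _), mul_assoc, fLift_cMono] at this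
  have e' : D.cMono (Set.empty_subset D.nichols) (D.cg ∅ (.t g.2)) = D.cg _ (.t g.2) := by
    rw [cMono, cLift_cg]
  rwa [e', ← cg_add, add_neg_cancel, cg_one, mul_one] at this

/-- The quotient of `C` by the radical is thus again presented by multihomogeneous relations of
degree at least two. -/
theorem toBar_injective : Function.Injective D.toBar := by
  refine (injective_iff_map_eq_zero _).2 fun y hy => ?_
  obtain ⟨c, rfl⟩ := D.cMono_surjective (Set.empty_subset _) y
  refine D.cMono_eq_zero subset_rfl c fun w => ?_
  rw [toBar_cMono] at hy
  rw [← pairBar_mk, hy, map_zero]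

/-- The coideal condition is tested in the tensor square of the quotient by the radical, where pairs
of words separate points. There it reads ⟨w w', x⟩ = 0, which holds because x is radical. -/
theorem radSet_admissible : D.Admissible D.radSet := fun x hx => by
  refine ⟨hx.imp fun m hm => ⟨hm.1, hm.2.1⟩, ?_⟩
  -- Over a field the tensor square of an injective map is injective.
  have hinj : Function.Injective (TensorProduct.map D.toBar.toLinearMap D.toBar.toLinearMap) :=
    TensorProduct.map_injective_of_flat_flat _ _ D.toBar_injective D.toBar_injective
  refine hinj ?_
  rw [map_zero]
  have e : TensorProduct.map D.toBar.toLinearMap D.toBar.toLinearMap (D.copF D.radSet x) =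
      TensorProduct.map (D.mkBar).toLinearMap (D.mkBar).toLinearMap
        (D.cCop (D.fLift _ x)) := by
    refine DFunLike.congr_fun (f := (Algebra.TensorProduct.map D.toBar D.toBar).comp
      (D.copF D.radSet)) (g := ((Algebra.TensorProduct.map (D.mkBar)
        (D.mkBar)).comp D.cCop).comp (D.fLift _)) (FreeAlgebra.hom_ext ?_) x
    ext i
    simp [-Finsupp.single_neg, copF, fLift, cCop_F, toBar]
  rw [e]
  refine eq_zero_of_forall_map_eq_zero D.pairBar D.pairBar_separating _ fun w w' => ?_
  obtain ⟨m, -, -, h⟩ := hx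
  rw [← h (w ++ w'), pairWord_append, conv_pair]
  induction D.cCop (D.fLift _ x) with
  | zero => simp only [map_zero]
  | add x y hx hy => simp only [map_add, hx, hy]
  | tmul a b => rfl

/-- Since the radical relations are admissible, the maximality of the Nichols relations says that
they hold already in `C`. -/
theorem pairWord_nondegenerate (c : D.CAlg D.nichols) (h : ∀ w, D.pairWord w c = 0) : c = 0 := by
  obtain ⟨c, rfl⟩ := D.cMono_surjective (Set.empty_subset _) c
  exact D.cMono_eq_zero (fun x hx => show x ∈ D.nichols from ⟨_, D.radSet_admissible, hx⟩) c h

end QuantumDatum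
end AnQG

/-! ### The antipode of `C` -/

namespace AnQG
namespace QuantumDatum
variable {k I Φ : Type u} [NormedField k] [AddCommGroup Φ] (D : QuantumDatum k I Φ)

theorem add_neg_one_smul {k V : Type*} [Ring k] [AddCommGroup V] [Module k V] (v : V) :
    v + (-1 : k) • v = 0 := by rw [neg_one_smul, add_neg_cancel]

theorem neg_one_smul_add {k V : Type*} [Ring k] [AddCommGroup V] [Module k V] (v : V) :
    (-1 : k) • v + v = 0 := by rw [neg_one_smul, neg_add_cancel]

/-- the antipode on generators -/
def antGen : CGen I → D.CAlg D.nichols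
  | .F i => (-1 : k) • (D.cg _ (.t (.single i 1)) * D.cg _ (.F i))
  | .t b => D.cg _ (.t (-b))

theorem antGen_comm (b : I →₀ ℤ) (i : I) :
    D.antGen (.F i) * D.antGen (.t b) =
      D.q ^ (-(D.nu b (D.root i))) • (D.antGen (.t b) * D.antGen (.F i)) := by
  have h : D.cg D.nichols (.t (-b)) * D.cg _ (.t (.single i 1)) =
      D.cg _ (.t (.single i 1)) * D.cg _ (.t (-b)) := by
    rw [← cg_add, ← cg_add, add_comm]
  rw [antGen, antGen, smul_mul_assoc, mul_smul_comm, ← mul_assoc (D.cg _ (.t (-b))), h,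
    mul_assoc _ (D.cg _ (.t (-b))), D.cg_comm _ (-b), nu_neg, LinearMap.neg_apply, neg_neg, mul_smul_comm,
    smul_comm _ (-1 : k), smul_smul (D.q ^ _), ← zpow_add₀ D.q_ne_zero, neg_add_cancel, zpow_zero,
    one_smul, mul_assoc]

/-- the antipode on the bosonization of the tensor algebra -/
def antFree : D.CAlg ∅ →ₐ[k] (D.CAlg D.nichols)ᵐᵒᵖ :=
  D.cLift (fun x => MulOpposite.op (D.antGen x)) (by simp [antGen, cg_one])
    (fun b c => by
      rw [← MulOpposite.op_mul, antGen, antGen, antGen, ← cg_add, ← neg_add_rev])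
    (fun b i => by
      rw [← MulOpposite.op_mul, antGen_comm, ← MulOpposite.op_mul, MulOpposite.op_smul])
    (fun x hx => absurd hx (Set.notMem_empty x))

/-- the comultiplication of the bosonization of the tensor algebra on generators -/
def copFreeGen : CGen I → D.CAlg ∅ ⊗[k] D.CAlg ∅
  | .F i => D.cg _ (.F i) ⊗ₜ 1 + D.cg _ (.t (.single i (-1))) ⊗ₜ D.cg _ (.F i)
  | .t b => D.cg _ (.t b) ⊗ₜ D.cg _ (.t b)

/-- the comultiplication of the bosonization of the tensor algebra -/
def copFree : D.CAlg ∅ →ₐ[k] D.CAlg ∅ ⊗[k] D.CAlg ∅ :=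
  D.cLift D.copFreeGen
    (by simp [copFreeGen, cg_one, Algebra.TensorProduct.one_def])
    (fun b c => by simp [copFreeGen, cg_add])
    (fun b i => by
      simp only [copFreeGen, mul_add, add_mul, Algebra.TensorProduct.tmul_mul_tmul, mul_one, one_mul,
        smul_add, cg_comm]
      rw [← cg_add, ← cg_add, add_comm b, TensorProduct.smul_tmul', TensorProduct.tmul_smul])
    (fun x hx => absurd hx (Set.notMem_empty x))

theorem copFree_cg (x : CGen I) : D.copFree (D.cg _ x) = D.copFreeGen x :=
  (RingQuot.liftAlgHom_mkAlgHom_apply k _ _ _).trans (FreeAlgebra.lift_ι_apply _ _)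

/-- the projection from the bosonization of the tensor algebra -/
abbrev proj₀ : D.CAlg ∅ →ₐ[k] D.CAlg D.nichols := D.cMono (Set.empty_subset _)

theorem proj₀_cg (x : CGen I) : D.proj₀ (D.cg _ x) = D.cg _ x := by rw [proj₀, cMono, cLift_cg]

theorem cCop_proj₀ (c : D.CAlg ∅) : D.cCop (D.proj₀ c) =
    TensorProduct.map D.proj₀.toLinearMap D.proj₀.toLinearMap (D.copFree c) := by
  refine DFunLike.congr_fun (f := D.cCop.comp D.proj₀) (g := (Algebra.TensorProduct.map D.proj₀
    D.proj₀).comp D.copFree) (cAlg_hom_ext fun x => ?_) c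
  rw [AlgHom.comp_apply, AlgHom.comp_apply, proj₀_cg, copFree_cg, copFreeGen.eq_def]
  rcases x with i | b
  · simp [-Finsupp.single_neg, cCop_F, proj₀_cg]
  · simp [cCop_t, proj₀_cg]

/-- `antFree` as a linear map -/
def antLin : D.CAlg ∅ →ₗ[k] D.CAlg D.nichols :=
  (MulOpposite.opLinearEquiv k).symm.toLinearMap ∘ₗ D.antFree.toLinearMap

theorem antLin_mul (a b : D.CAlg ∅) : D.antLin (a * b) = D.antLin b * D.antLin a := by
  simp [antLin]

theorem antLin_one : D.antLin 1 = 1 := by simp [antLin]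

theorem antLin_cg (x : CGen I) : D.antLin (D.cg _ x) = D.antGen x := by
  simp [antLin, antFree]

theorem map_antLin_mul (z z' : D.CAlg ∅ ⊗[k] D.CAlg ∅) :
    TensorProduct.map D.antLin D.antLin (z * z') =
      TensorProduct.map D.antLin D.antLin z' * TensorProduct.map D.antLin D.antLin z := by
  induction z with
  | zero => simp
  | add x y hx hy => simp only [add_mul, mul_add, map_add, hx, hy]
  | tmul a b =>
    induction z' with
    | zero => simp
    | add x y hx hy => simp only [add_mul, mul_add, map_add, hx, hy]
    | tmul a' b' => simp [antLin_mul]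

/-- The antipode reverses the comultiplication. This is proved before it descends to the Nichols
quotient, since the descent uses it. -/
theorem cCop_antLin (c : D.CAlg ∅) : D.cCop (D.antLin c) =
    Algebra.TensorProduct.comm k _ _ (TensorProduct.map D.antLin D.antLin (D.copFree c)) := by
  induction c using cAlg_induction with
  | hs a c h => simp only [map_smul, h]
  | h₁ => simp [antLin_one, Algebra.TensorProduct.one_def]
  | hg x =>
    rw [antLin_cg, copFree_cg, copFreeGen.eq_def]
    rcases x with i | b
    · have e : D.cg D.nichols (.t (.single i 1)) * D.cg D.nichols (.t (.single i (-1))) = 1 := by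
        rw [← cg_add, ← Finsupp.single_add, add_neg_cancel, Finsupp.single_zero, cg_one]
      have e' : D.antGen (.t (.single i (-1))) = D.cg _ (.t (.single i 1)) := by
        rw [antGen, ← Finsupp.single_neg, neg_neg]
      simp only [map_add, TensorProduct.map_tmul, antLin_cg, antLin_one,
        Algebra.TensorProduct.comm_tmul, e']
      simp only [antGen, map_smul, map_mul, cCop_t, cCop_F, mul_add,
        Algebra.TensorProduct.tmul_mul_tmul, e, mul_one, ← TensorProduct.smul_tmul',
        TensorProduct.tmul_smul, smul_add]
      exact add_comm _ _
    · simp only [antGen, TensorProduct.map_tmul, antLin_cg, Algebra.TensorProduct.comm_tmul, cCop_t]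
  | ha a b ha hb => simp only [map_add, ha, hb]
  | hm a b ha hb => rw [antLin_mul, map_mul, ha, hb, map_mul, map_antLin_mul, map_mul]

theorem pairGen_K_antLin (l : Φ →ₗ[ℤ] ℤ) (c : D.CAlg ∅) :
    D.pairGen (.K l) (D.antLin c) = D.pairGen (.K (-l)) (D.proj₀ c) := by
  change D.pairK l _ = D.pairK (-l) _
  induction c using cAlg_induction with
  | hs a c h => simp only [map_smul, h]
  | h₁ => simp [antLin_one]
  | hg x =>
    rw [antLin_cg, proj₀_cg]
    rcases x with i | b
    · simp [antGen, pairK_F]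
    · simp [antGen, pairK_t, wt]
  | ha a b ha hb => simp only [map_add, ha, hb]
  | hm a b ha hb => rw [antLin_mul, map_mul, ha, hb, map_mul, map_mul, mul_comm]

theorem cCounit_antLin (c : D.CAlg ∅) : D.cCounit (D.antLin c) = D.cCounit (D.proj₀ c) := by
  induction c using cAlg_induction with
  | hs a c h => simp only [map_smul, h]
  | h₁ => simp [antLin_one]
  | hg x =>
    rw [antLin_cg, proj₀_cg]
    rcases x with i | b
    · simp [antGen, cCounit_F]
    · simp [antGen, cCounit_t]
  | ha a b ha hb => simp only [map_add, ha, hb]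
  | hm a b ha hb => rw [antLin_mul, map_mul, ha, hb, map_mul, map_mul, mul_comm]

theorem conv_apply_F (f g : D.CAlg D.nichols →ₗ[k] k) (i : I) : D.conv f g (D.cg _ (.F i)) =
    f (D.cg _ (.F i)) * g 1 + f (D.cg _ (.t (.single i (-1)))) * g (D.cg _ (.F i)) := by
  rw [conv_pair, cCop_F, map_add, map_add, TensorProduct.map_tmul, TensorProduct.map_tmul]
  rfl

theorem conv_apply_t (f g : D.CAlg D.nichols →ₗ[k] k) (b : I →₀ ℤ) :
    D.conv f g (D.cg _ (.t b)) = f (D.cg _ (.t b)) * g (D.cg _ (.t b)) := by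
  rw [conv_pair, cCop_t, TensorProduct.map_tmul]
  rfl

theorem pairWord_pair (g h : BGen I Φ) : D.pairWord [g, h] = D.conv (D.pairGen g) (D.pairGen h) := by
  rw [pairWord_cons, pairWord_singleton]

/-- Words are formal, so `K_{-λ}` `K_λ` is not the empty word; it only pairs in the same way. -/
theorem pairWord_K_neg (l : Φ →ₗ[ℤ] ℤ) (c : D.CAlg D.nichols) :
    D.pairWord [.K (-l), .K l] c = D.cCounit c := by
  induction c using cAlg_induction with
  | hs a c h => simp only [map_smul, h]
  | h₁ => rw [pairWord_one]; simp [bToU, uCounit_K]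
  | hg x =>
    rw [pairWord_pair]
    rcases x with i | b
    · rw [conv_apply_F, cCounit_F]
      change D.pairK _ _ * _ + _ * D.pairK _ _ = _
      rw [pairK_F, pairK_F]
      simp
    · rw [conv_apply_t, cCounit_t]
      change D.pairK _ _ * D.pairK _ _ = _
      rw [pairK_t, pairK_t, ← zpow_add₀ D.q_ne_zero]
      simp
  | ha a b ha hb => simp only [map_add, ha, hb]
  | hm a b ha hb =>
    rw [pairWord_mul, map_mul, ← ha, ← hb, mul_comm]
    simp [tCop]

/-- The functional c ↦ ⟨E_i, S(c)⟩ is that of the antipode of `E_i`. Both sides obey the same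
product rule, so agreement on generators suffices. -/
theorem pairGen_E_antLin (i : I) (c : D.CAlg ∅) : D.pairGen (.E i) (D.antLin c) =
    -D.pairWord [.K (-D.nu1 i), .E i] (D.proj₀ c) := by
  induction c using cAlg_induction with
  | hs a c h => rw [map_smul, map_smul, h, map_smul, map_smul, smul_neg]
  | h₁ => rw [antLin_one, map_one D.proj₀, pairGen_E_one, pairWord_one]; simp [bToU, uCounit_E]
  | hg x =>
    rw [antLin_cg, proj₀_cg, pairWord_pair]
    rcases x with j | b
    · rw [conv_apply_F, pairGen_E_one, mul_zero, zero_add, antGen, map_smul, pairGen_E_mul,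
        pairGen_E_t, zero_mul, add_zero, neg_one_smul]
      change -(D.pairK _ _ * _) = -(D.pairK _ _ * _)
      rw [pairK_t, pairK_t]
      simp [wt]
    · rw [conv_apply_t, pairGen_E_t, mul_zero, neg_zero, antGen, pairGen_E_t]
  | ha a b ha hb => rw [map_add, map_add, ha, hb, map_add, map_add, neg_add]
  | hm a b ha hb =>
    have h₁ := D.pairGen_K_antLin (D.nu1 i) b
    rw [antLin_mul, pairGen_E_mul, ha, hb, h₁, cCounit_antLin, map_mul, pairWord_mul]
    simp only [tCop, List.map_cons, List.map_nil, List.cons_append,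
      List.nil_append, List.sum_cons, List.sum_nil, add_zero, pairWord_singleton, pairWord_K_neg]
    ring

/-- The transpose of the antipode sends a word to a multiple of a word. Hence the antipode maps
elements that vanish in `C` into the radical, which is zero. -/
theorem pairWord_antLin (w : List (BGen I Φ)) : ∃ (a : k) (w' : List (BGen I Φ)), ∀ c : D.CAlg ∅,
    D.pairWord w (D.antLin c) = a * D.pairWord w' (D.proj₀ c) := by
  induction w with
  | nil => exact ⟨1, [], fun c => (D.cCounit_antLin c).trans (one_mul _).symm⟩
  | cons g w ih =>
    obtain ⟨a, w', h⟩ := ih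
    obtain ⟨b, v, hg⟩ : ∃ (b : k) (v : List (BGen I Φ)), ∀ c : D.CAlg ∅,
        D.pairGen g (D.antLin c) = b * D.pairWord v (D.proj₀ c) := by
      rcases g with i | l
      · exact ⟨-1, _, fun c => (D.pairGen_E_antLin i c).trans (neg_one_mul _).symm⟩
      · exact ⟨1, [.K (-l)], fun c => by
          rw [pairWord_singleton, one_mul]
          exact D.pairGen_K_antLin l c⟩
    -- The antipode reverses the comultiplication, so the letter's contribution goes to the end.
    refine ⟨a * b, w' ++ v, fun c => ?_⟩
    rw [pairWord_cons, pairWord_append, conv_pair, conv_pair, cCop_antLin, cCop_proj₀]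
    induction D.copFree c with
    | zero => simp only [map_zero, mul_zero]
    | add x y hx hy => simp only [map_add, hx, hy, mul_add]
    | tmul x y =>
      simp only [TensorProduct.map_tmul, Algebra.TensorProduct.comm_tmul, LinearMap.mul'_apply, h,
        hg, AlgHom.toLinearMap_apply]
      ring

theorem t_mul_neg (b : I →₀ ℤ) : D.cg D.nichols (.t b) * D.cg D.nichols (.t (-b)) = 1 := by
  rw [← cg_add, add_neg_cancel, cg_one]

theorem t_neg_mul (b : I →₀ ℤ) : D.cg D.nichols (.t (-b)) * D.cg D.nichols (.t b) = 1 := by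
  rw [← cg_add, neg_add_cancel, cg_one]

theorem antGen_t_single (i : I) :
    D.antGen (.t (.single i (-1))) = D.cg _ (.t (.single i 1)) := by
  rw [antGen, ← Finsupp.single_neg, neg_neg]

section
variable [Module.Free ℤ Φ] [IsUltrametricDist k]

/-- the antipode of `C`, as an algebra map to the opposite algebra -/
def antHom : D.CAlg D.nichols →ₐ[k] (D.CAlg D.nichols)ᵐᵒᵖ :=
  D.cLift (fun x => MulOpposite.op (D.antGen x)) (by simp [antGen, cg_one])
    (fun b c => by
      rw [← MulOpposite.op_mul, antGen, antGen, antGen, ← cg_add, ← neg_add_rev])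
    (fun b i => by
      rw [← MulOpposite.op_mul, antGen_comm, ← MulOpposite.op_mul, MulOpposite.op_smul])
    (fun x hx => by
      have e : FreeAlgebra.lift k (fun i => MulOpposite.op (D.antGen (.F i))) x =
          D.antFree (D.fLift _ x) := by
        refine DFunLike.congr_fun (g := D.antFree.comp (D.fLift _)) (FreeAlgebra.hom_ext ?_) x
        ext i
        simp [fLift, antFree]
      rw [e]
      -- The image of a Nichols relation is tested against words: by `pairWord_antLin` each value is
      -- a multiple of the pairing of another word with the relation itself, which is zero in `C`.
      refine MulOpposite.unop_injective (D.pairWord_nondegenerate _ fun w => ?_)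
      obtain ⟨a, w', h⟩ := D.pairWord_antLin w
      have := h (D.fLift _ x)
      rw [fLift_cMono] at this
      refine this.trans ?_
      rw [show D.fLift D.nichols x = 0 from D.cg_nichols _ x hx, map_zero, mul_zero])

/-- the antipode of `C`, as a linear map -/
def ant : D.CAlg D.nichols →ₗ[k] D.CAlg D.nichols :=
  (MulOpposite.opLinearEquiv k).symm.toLinearMap ∘ₗ D.antHom.toLinearMap

theorem ant_mul (a b : D.CAlg D.nichols) : D.ant (a * b) = D.ant b * D.ant a := by
  simp [ant]

theorem ant_one : D.ant 1 = 1 := by simp [ant]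

theorem ant_cg (x : CGen I) : D.ant (D.cg _ x) = D.antGen x := by
  simp [ant, antHom]

/-- The identity is not multiplicative in c as it stands. It becomes so with a further factor z to
the right of the comultiplication: the inner cancellation is then carried out one letter at a time,
and z = 1 gives the claim. -/
theorem ant_left (c : D.CAlg D.nichols) : LinearMap.mul' k _ (TensorProduct.map D.ant .id
    (D.cCop c)) = algebraMap k _ (D.cCounit c) := by
  have key : ∀ w z, LinearMap.mul' k _ (TensorProduct.map D.ant .id
      (D.cCop (D.cword _ w) * z)) = D.cCounit (D.cword _ w) •
        LinearMap.mul' k _ (TensorProduct.map D.ant .id z) := fun w => by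
    induction w using FreeMonoid.inductionOn with
    | one => intro z; simp
    | of x =>
      intro z
      rw [cword_of]
      induction z with
      | zero => simp
      | add x y hx hy => simp only [mul_add, map_add, hx, hy, smul_add]
      | tmul a b =>
        rcases x with i | b'
        · rw [cCop_F, cCounit_F, add_mul, zero_smul, Algebra.TensorProduct.tmul_mul_tmul,
            Algebra.TensorProduct.tmul_mul_tmul, map_add, map_add, TensorProduct.map_tmul,
            TensorProduct.map_tmul, LinearMap.mul'_apply, LinearMap.mul'_apply, ant_mul, ant_mul,
            ant_cg, ant_cg, antGen_t_single, antGen, one_mul]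
          simp only [LinearMap.id_apply, smul_mul_assoc, mul_smul_comm, mul_assoc]
          exact neg_one_smul_add (k := k) _
        · rw [cCop_t, cCounit_t, one_smul, Algebra.TensorProduct.tmul_mul_tmul,
            TensorProduct.map_tmul, TensorProduct.map_tmul, LinearMap.mul'_apply,
            LinearMap.mul'_apply, ant_mul, ant_cg, antGen]
          simp only [LinearMap.id_apply]
          rw [mul_assoc, ← mul_assoc (D.cg _ _), t_neg_mul, one_mul]
    | mul x y hx hy =>
      intro z
      rw [map_mul (D.cword _), map_mul D.cCop, mul_assoc, hx, hy, smul_smul, map_mul]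
  refine DFunLike.congr_fun (f := LinearMap.mul' k _ ∘ₗ TensorProduct.map D.ant .id ∘ₗ
    D.cCop.toLinearMap) (g := Algebra.linearMap k _ ∘ₗ D.cCounit.toLinearMap)
    (cword_linear_ext fun w => ?_) c
  have := key w 1
  rw [mul_one, Algebra.TensorProduct.one_def, TensorProduct.map_tmul, ant_one,
    LinearMap.mul'_apply, LinearMap.id_apply, mul_one, ← Algebra.algebraMap_eq_smul_one] at this
  exact this

theorem ant_right (c : D.CAlg D.nichols) : LinearMap.mul' k _ (TensorProduct.map .id D.ant
    (D.cCop c)) = algebraMap k _ (D.cCounit c) := by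
  -- Here the auxiliary factor stands on the left, so that the last letter of the word is cancelled
  -- first.
  have key : ∀ w z, LinearMap.mul' k _ (TensorProduct.map .id D.ant
      (z * D.cCop (D.cword _ w))) = D.cCounit (D.cword _ w) •
        LinearMap.mul' k _ (TensorProduct.map .id D.ant z) := fun w => by
    induction w using FreeMonoid.inductionOn with
    | one => intro z; simp
    | of x =>
      intro z
      rw [cword_of]
      induction z with
      | zero => simp
      | add x y hx hy => simp only [add_mul, map_add, hx, hy, smul_add]
      | tmul a b =>
        rcases x with i | b'
        · have e : D.cg D.nichols (.t (.single i (-1))) * D.cg D.nichols (.t (.single i 1)) = 1 := by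
            rw [← cg_add, ← Finsupp.single_add, neg_add_cancel, Finsupp.single_zero, cg_one]
          rw [cCop_F, cCounit_F, mul_add, zero_smul, Algebra.TensorProduct.tmul_mul_tmul,
            Algebra.TensorProduct.tmul_mul_tmul, map_add, map_add, TensorProduct.map_tmul,
            TensorProduct.map_tmul, LinearMap.mul'_apply, LinearMap.mul'_apply, mul_one,
            ant_mul, ant_cg, antGen]
          simp only [LinearMap.id_apply, smul_mul_assoc, mul_smul_comm]
          rw [mul_assoc a (D.cg _ (.t _)), mul_assoc (D.cg _ (.t (.single i 1))),
            ← mul_assoc (D.cg _ (.t _)) (D.cg _ (.t _)), e, one_mul, mul_assoc]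
          exact add_neg_one_smul (k := k) _
        · rw [cCop_t, cCounit_t, one_smul, Algebra.TensorProduct.tmul_mul_tmul,
            TensorProduct.map_tmul, TensorProduct.map_tmul, LinearMap.mul'_apply,
            LinearMap.mul'_apply, ant_mul, ant_cg, antGen]
          simp only [LinearMap.id_apply]
          rw [mul_assoc, ← mul_assoc (D.cg _ _), t_mul_neg, one_mul]
    | mul x y hx hy =>
      intro z
      rw [map_mul (D.cword _), map_mul D.cCop, ← mul_assoc, hy, hx, smul_smul, map_mul, mul_comm (D.cCounit _)]
  refine DFunLike.congr_fun (f := LinearMap.mul' k _ ∘ₗ TensorProduct.map .id D.ant ∘ₗ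
    D.cCop.toLinearMap) (g := Algebra.linearMap k _ ∘ₗ D.cCounit.toLinearMap)
    (cword_linear_ext fun w => ?_) c
  have := key w 1
  rw [one_mul, Algebra.TensorProduct.one_def, TensorProduct.map_tmul, ant_one,
    LinearMap.mul'_apply, LinearMap.id_apply, mul_one, ← Algebra.algebraMap_eq_smul_one] at this
  exact this

/-- The norm is submultiplicative on the opposite algebra too, and the t's have weight 1, so S(F_i)
has norm at most the weight of `F_i`. -/
theorem ant_bound (l : D.cP.Idx) : D.cP.nrm (D.ant (D.cP.gen l)) ≤ D.cP.wt l := by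
  refine word_bound (fun a : (D.CAlg D.nichols)ᵐᵒᵖ => D.cP.nrm a.unop)
    (fun a => APres.nrm_nonneg _ _) (APres.nrm_one_le _)
    (fun a b => (D.cP.nrm_mul_le b.unop a.unop).trans_eq (mul_comm _ _))
    ((MonoidHomClass.toMonoidHom D.antHom).comp D.cP.gen) (fun g => ?_) l
  have hg : ∀ x, D.cP.nrm (D.cg _ x) ≤ D.cWt x := fun x => by
    rw [← cP_gen, ← cP_wt]
    exact D.cP.nrm_gen_le _
  refine (congrArg D.cP.nrm ((congrArg D.ant (D.cP_gen g)).trans (D.ant_cg g))).trans_le ?_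
  rcases g with i | b
  · have h₁ := D.cP.nrm_smul_le (-1) (D.cg _ (.t (.single i 1)) * D.cg _ (.F i) : D.CAlg D.nichols)
    have h₂ := D.cP.nrm_mul_le (D.cg _ (.t (.single i 1)) : D.CAlg D.nichols) (D.cg _ (.F i))
    rw [norm_neg, norm_one, one_mul] at h₁
    have e : (-1 : k) • (D.cg _ (.t (.single i 1)) * D.cg _ (.F i) : D.CAlg D.nichols) =
      D.antGen (.F i) := rfl
    refine (le_of_eq (congrArg D.cP.nrm e.symm)).trans (h₁.trans (h₂.trans ?_))
    refine (mul_le_mul (hg _) (hg _) (APres.nrm_nonneg _ _) (NNReal.coe_nonneg _)).trans_eq ?_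
    simp [cWt]
  · exact hg _

end

end QuantumDatum
end AnQG

/-! ### The duality data on completions, and generation of `U` -/

namespace AnQG

theorem norm_list_sum_le {E : Type*} [SeminormedAddCommGroup E] [IsUltrametricDist E] {L : List E}
    {c : ℝ} (hc : 0 ≤ c) (h : ∀ x ∈ L, ‖x‖ ≤ c) : ‖L.sum‖ ≤ c := by
  induction L with
  | nil => simpa using hc
  | cons a L ih =>
    rw [List.sum_cons]
    exact (IsUltrametricDist.norm_add_le_max _ _).trans (max_le (h a List.mem_cons_self)
      (ih fun x hx => h x (List.mem_cons_of_mem _ hx)))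

namespace APres
variable {k : Type u} [NormedField k] [IsUltrametricDist k] (P Q : APres k)

theorem theta_list_sum {β : Type*} (f : β → P.carrier) (g : β → Q.carrier) (L : List β) :
    P.theta Q (L.map fun p => f p ⊗ₜ[k] g p).sum =
      (L.map fun p => tmk P.ban Q.ban (P.tb (f p)) (Q.tb (g p))).sum := by
  rw [map_list_sum, List.map_map]
  rfl

theorem mulB_map_left (s : P.carrier →ₗ[k] P.carrier) (h) (z : P.carrier ⊗[k] P.carrier) :
    P.mulB (tmap (P.map P s h) (𝟙 P.ban) (P.theta P z)) =
      P.tb (LinearMap.mul' k P.carrier (TensorProduct.map s LinearMap.id z)) := by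
  induction z with
  | zero => simp only [map_zero]
  | add x y hx hy => simp only [map_add, hx, hy]
  | tmul a b => rw [theta_tmul, tmap_tmk, map_toBan, Ban.id_apply, mulB_tmk]; rfl

theorem mulB_map_right (s : P.carrier →ₗ[k] P.carrier) (h) (z : P.carrier ⊗[k] P.carrier) :
    P.mulB (tmap (𝟙 P.ban) (P.map P s h) (P.theta P z)) =
      P.tb (LinearMap.mul' k P.carrier (TensorProduct.map LinearMap.id s z)) := by
  induction z with
  | zero => simp only [map_zero]
  | add x y hx hy => simp only [map_add, hx, hy]
  | tmul a b => rw [theta_tmul, tmap_tmk, map_toBan, Ban.id_apply, mulB_tmk]; rfl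

theorem tens_ext_of_span {X Y : Ban k} {f g : (tens P.ban X).ban ⟶ Y} {S : Set P.carrier}
    (hS : ∀ u, u ∈ Submodule.span k S)
    (h : ∀ u ∈ S, ∀ x, f (tmk _ _ (P.tb u) x) = g (tmk _ _ (P.tb u) x)) : f = g := by
  refine tens_ext fun u x => ?_
  refine congrArg (fun G : P.ban ⟶ Y => G u) (Pres.ban_ext' (P := P.pres) (f := tmkR _ x ≫ f)
    (g := tmkR _ x ≫ g) fun u => ?_)
  change f (tmk _ _ (P.tb u) x) = g (tmk _ _ (P.tb u) x)
  induction hS u using Submodule.span_induction with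
  | mem u hu => exact h u hu x
  | zero => simp only [map_zero, LinearMap.zero_apply]
  | add a b _ _ ha hb => simp only [map_add, LinearMap.add_apply, ha, hb]
  | smul a u _ hu => simp only [map_smul, LinearMap.smul_apply, hu]

end APres

namespace QuantumDatum
variable {k I Φ : Type u} [NormedField k] [IsUltrametricDist k] [AddCommGroup Φ]
  (D : QuantumDatum k I Φ)

/-- a word as an element of `T` -/
def tw (w : List (BGen I Φ)) : D.T := D.tP.toBan (D.tP.gen w)

theorem norm_tw_le (w : List (BGen I Φ)) : ‖D.tw w‖ ≤ D.wordWt w :=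
  (D.tP.norm_toBan _).trans_le (D.tP.norm_gen_le w)

theorem lift_tw {X : Ban k} (f : D.tP.carrier →ₗ[k] X) (C : ℝ≥0)
    (h : ∀ l, ‖f (D.tP.gen l)‖ ≤ C * D.tP.wt l) (w : List (BGen I Φ)) :
    D.tP.lift f C h (D.tw w) = f (D.tP.gen w) := D.tP.lift_toBan _ _ _ _

theorem linearCombination_gen {M : Type*} [AddCommGroup M] [Module k M]
    (v : List (BGen I Φ) → M) (w : List (BGen I Φ)) :
    Finsupp.linearCombination k v (D.tP.gen w) = v w :=
  (Finsupp.linearCombination_single k 1 w).trans (one_smul _ _)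

variable {D} in
theorem tw_ext {X : Ban k} {f g : D.T ⟶ X} (h : ∀ w, f (D.tw w) = g (D.tw w)) : f = g :=
  Pres.ban_ext h

variable {D} in
theorem tw_tens_ext {A X : Ban k} {f g : (tens D.T A).ban ⟶ X}
    (h : ∀ w a, f (tmk _ _ (D.tw w) a) = g (tmk _ _ (D.tw w) a)) : f = g :=
  tens_ext fun t a => congrArg (fun G : D.T ⟶ X => G t)
    (tw_ext (f := tmkR _ a ≫ f) (g := tmkR _ a ≫ g) fun w => h w a)

theorem inclT_tw [CompleteSpace k] (w : List (BGen I Φ)) :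
    D.inclT (D.tw w) = D.uP.tb (w.map D.bToU).prod :=
  (D.tP.lift_toBan _ _ _ _).trans
    (congrArg D.uP.tb (D.linearCombination_gen (fun w => (w.map D.bToU).prod) w))

/-- the comultiplication of `T` -/
def tComul : D.T ⟶ (tens D.T D.T).ban :=
  D.tP.lift (X := (tens D.T D.T).ban) (Finsupp.linearCombination k fun w =>
    ((D.tCop w).map fun p => tmk D.T D.T (D.tw p.1) (D.tw p.2)).sum) 1 fun w => by
    rw [NNReal.coe_one, one_mul]
    refine (congrArg norm (D.linearCombination_gen _ w)).trans_le ?_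
    refine norm_list_sum_le (NNReal.coe_nonneg _) fun x hx => ?_
    obtain ⟨p, hp, rfl⟩ := List.mem_map.1 hx
    refine (norm_tmk_le _ _).trans ((mul_le_mul (D.norm_tw_le _) (D.norm_tw_le _)
      (norm_nonneg _) (NNReal.coe_nonneg _)).trans_eq ?_)
    exact_mod_cast congrArg NNReal.toReal (D.tCop_wordWt w p hp)

theorem tComul_tw (w : List (BGen I Φ)) : D.tComul (D.tw w) =
    ((D.tCop w).map fun p => tmk D.T D.T (D.tw p.1) (D.tw p.2)).sum :=
  (D.lift_tw _ _ _ w).trans (D.linearCombination_gen _ w)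

variable [CompleteSpace k]

theorem pairing_tw (w : List (BGen I Φ)) (c : D.CAlg D.nichols) :
    uval (D.pairing (tmk _ _ (D.tw w) (D.cP.tb c))) = D.pairWord w c := by
  refine (congrArg uval (Pres.lift₂_tmk _ _ _ _ _ _)).trans ?_
  exact congrArg (fun f : D.cP.pres.carrier →ₗ[k] unitBan k => uval (f c))
    (D.linearCombination_gen (fun w => toUnit ∘ₗ D.pairWord w) w)

theorem pairing_pairing (v w : List (BGen I Φ)) (c c' : D.CAlg D.nichols) :
    uval (tleft (unitBan k) (tmap D.pairing D.pairing (tmk (tens D.T D.C).ban (tens D.T D.C).ban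
      (tmk D.T D.C (D.tw v) (D.cP.tb c)) (tmk D.T D.C (D.tw w) (D.cP.tb c'))))) =
        D.pairWord v c * D.pairWord w c' := by
  refine (congrArg (fun z => uval (tleft (unitBan k) z)) (tmap_tmk D.pairing D.pairing _ _)).trans ?_
  refine (congrArg uval (tleft_tmk _ _ _)).trans ((map_smul uval _ _).trans ?_)
  exact congrArg₂ (· * ·) (D.pairing_tw v c) (D.pairing_tw w c')

theorem comul_inclT : D.inclT ≫ D.ucomul = D.tComul ≫ tmap D.inclT D.inclT := by
  refine tw_ext fun w => ?_
  change D.ucomul (D.inclT (D.tw w)) = tmap D.inclT D.inclT (D.tComul (D.tw w))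
  rw [inclT_tw]
  refine (D.ucomul_tb _).trans ?_
  rw [uCop_word, tComul_tw, map_list_sum, List.map_map]
  refine (APres.theta_list_sum D.uP D.uP _ _ _).trans ?_
  congr 1
  refine List.map_congr_left fun p _ => ?_
  simp only [Function.comp_apply, tmap_tmk, inclT_tw]

/-- Both sides are bounded, so this is `pairWord_mul` on words and on the dense algebraic part of
`C`. -/
theorem pairing_mul : tmap (𝟙 D.T) (tswap D.C D.C ≫ D.cP.mulB) ≫ D.pairing =
    tmap D.tComul (𝟙 (tens D.C D.C).ban) ≫ tensorμ D.T D.T D.C D.C ≫ tmap D.pairing D.pairing ≫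
      tleft (unitBan k) := by
  refine tw_tens_ext fun w a => ?_
  refine congrArg (fun G : (tens D.C D.C).ban ⟶ unitBan k => G a) (Pres.tens_ban_ext
    (f := tmkL _ (D.tw w) ≫ tmap (𝟙 D.T) (tswap D.C D.C ≫ D.cP.mulB) ≫ D.pairing)
    (g := tmkL _ (D.tw w) ≫ tmap D.tComul (𝟙 (tens D.C D.C).ban) ≫ tensorμ D.T D.T D.C D.C ≫
      tmap D.pairing D.pairing ≫ tleft (unitBan k)) fun c c' => ?_)
  change D.pairing (tmap (𝟙 D.T) (tswap D.C D.C ≫ D.cP.mulB) (tmk _ _ (D.tw w)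
    (tmk _ _ (D.cP.tb c) (D.cP.tb c')))) = tleft (unitBan k) (tmap D.pairing D.pairing
      (tensorμ D.T D.T D.C D.C (tmap D.tComul (𝟙 _) (tmk _ _ (D.tw w)
        (tmk _ _ (D.cP.tb c) (D.cP.tb c'))))))
  rw [tmap_tmk, tmap_tmk, tComul_tw, map_list_sum, List.map_map, Ban.comp_apply, tswap_tmk,
    APres.mulB_tmk]
  refine APres.Bialg.uval_injective ((D.pairing_tw w (c' * c)).trans
    ((D.pairWord_mul w c' c).trans ?_))
  have h : ∀ L : List (List (BGen I Φ) × List (BGen I Φ)),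
      (L.map fun p => D.pairWord p.1 c * D.pairWord p.2 c').sum =
      uval (tleft (unitBan k) (tmap D.pairing D.pairing (tensorμ D.T D.T D.C D.C
        ((L.map fun p => tmk (tens D.T D.T).ban (tens D.C D.C).ban
          (tmk D.T D.T (D.tw p.1) (D.tw p.2))).sum (tmk _ _ (D.cP.tb c) (D.cP.tb c')))))) :=
    fun L => by
    induction L with
    | nil => simp only [List.map_nil, List.sum_nil, LinearMap.zero_apply, map_zero]
    | cons p L ih =>
      simp only [List.map_cons, List.sum_cons, LinearMap.add_apply, map_add, ih]
      congr 1
      rw [Ban.tensorμ_tmk]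
      exact (D.pairing_pairing p.1 p.2 c c').symm
  exact h _

theorem pairing_one : tmap (𝟙 D.T) D.cP.oneB ≫ D.pairing =
    tright D.T ≫ D.inclT ≫ D.ucounit := by
  refine tw_tens_ext fun w a => ?_
  change D.pairing (tmap (𝟙 D.T) D.cP.oneB (tmk _ _ (D.tw w) a)) =
    D.ucounit (D.inclT (tright D.T (tmk _ _ (D.tw w) a)))
  rw [tmap_tmk, tright_tmk, map_smul, map_smul, APres.oneB_apply, map_smul, map_smul, inclT_tw]
  congr 1
  exact APres.Bialg.uval_injective ((D.pairing_tw w 1).trans ((D.pairWord_one w).trans (D.ucounit_tb _).symm))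

section
variable [Module.Free ℤ Φ]

/-- the antipode of the Banach Hopf algebra `C` -/
def antB : D.C ⟶ D.C := D.cP.map D.cP D.ant D.ant_bound

theorem antB_left : D.comul ≫ tmap D.antB (𝟙 D.C) ≫ D.cP.mulB = D.counit ≫ D.cP.oneB := by
  refine Pres.ban_ext' (P := D.cP.pres) fun c => ?_
  refine (congrArg (fun z => D.cP.mulB (tmap D.antB (𝟙 D.C) z)) (D.comul_tb c)).trans ?_
  refine (APres.mulB_map_left D.cP D.ant D.ant_bound (D.cCop c)).trans ?_
  refine Eq.trans ?_ (congrArg (fun a => a • D.cP.tb 1) (D.counit_tb c).symm)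
  rw [← map_smul]
  exact congrArg D.cP.tb ((D.ant_left c).trans (Algebra.algebraMap_eq_smul_one _))

theorem antB_right : D.comul ≫ tmap (𝟙 D.C) D.antB ≫ D.cP.mulB = D.counit ≫ D.cP.oneB := by
  refine Pres.ban_ext' (P := D.cP.pres) fun c => ?_
  refine (congrArg (fun z => D.cP.mulB (tmap (𝟙 D.C) D.antB z)) (D.comul_tb c)).trans ?_
  refine (APres.mulB_map_right D.cP D.ant D.ant_bound (D.cCop c)).trans ?_
  refine Eq.trans ?_ (congrArg (fun a => a • D.cP.tb 1) (D.counit_tb c).symm)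
  rw [← map_smul]
  exact congrArg D.cP.tb ((D.ant_right c).trans (Algebra.algebraMap_eq_smul_one _))

end

/-! ### Triangular generation -/

end QuantumDatum

namespace QuantumDatum
variable {k I Φ : Type u} [NormedField k] [AddCommGroup Φ] (D : QuantumDatum k I Φ)

theorem uAlg_eq_top {M : Submodule k D.UAlg} (h₁ : 1 ∈ M)
    (h : ∀ g x, x ∈ M → D.ug g * x ∈ M) (x : D.UAlg) : x ∈ M := by
  obtain ⟨p, rfl⟩ := (wordAlg k D.uWt D.URel).span x
  rw [Finsupp.linearCombination_apply]
  refine Submodule.sum_mem _ fun w hw => Submodule.smul_mem _ _ ?_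
  clear hw
  change FreeMonoid.lift D.ug w ∈ M
  induction w using FreeMonoid.inductionOn' with
  | one => rwa [map_one]
  | of_mul g w ih => rw [map_mul, FreeMonoid.lift_eval_of]; exact h _ _ ih

/-- the span of the products of elements of `C` and words in the generators of `H ⋉ f_s` -/
def triSpan : Submodule k D.UAlg := Submodule.span k
  (Set.range fun p : D.CAlg D.nichols × List (BGen I Φ) => D.cToU p.1 * (p.2.map D.bToU).prod)

theorem cToU_mul_mem (c : D.CAlg D.nichols) {x : D.UAlg} (hx : x ∈ D.triSpan) :
    D.cToU c * x ∈ D.triSpan := by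
  induction hx using Submodule.span_induction with
  | mem x hx =>
    obtain ⟨p, rfl⟩ := hx
    refine Submodule.subset_span ⟨(c * p.1, p.2), ?_⟩
    simp only [map_mul, mul_assoc]
  | zero => rw [mul_zero]; exact zero_mem _
  | add x y _ _ hx hy => rw [mul_add]; exact add_mem hx hy
  | smul a x _ hx => rw [mul_smul_comm]; exact Submodule.smul_mem _ _ hx

theorem triSpan_induction {f : D.UAlg →ₗ[k] D.UAlg}
    (h : ∀ (v : FreeMonoid (CGen I)) (w : List (BGen I Φ)), f (D.cToU (D.cword _ v) * (w.map D.bToU).prod) ∈ D.triSpan) {x : D.UAlg}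
    (hx : x ∈ D.triSpan) : f x ∈ D.triSpan := by
  induction hx using Submodule.span_induction with
  | mem x hx =>
    obtain ⟨⟨c, w⟩, rfl⟩ := hx
    change f (D.cToU c * _) ∈ D.triSpan
    induction D.cword_span _ c using Submodule.span_induction with
    | mem c hc => obtain ⟨v, rfl⟩ := hc; exact h v w
    | zero => rw [map_zero, zero_mul, map_zero]; exact zero_mem _
    | add x y _ _ hx hy => rw [map_add, add_mul, map_add]; exact add_mem hx hy
    | smul a x _ hx => rw [map_smul, smul_mul_assoc, map_smul]; exact Submodule.smul_mem _ _ hx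
  | zero => rw [map_zero]; exact zero_mem _
  | add x y _ _ hx hy => rw [map_add]; exact add_mem hx hy
  | smul a x _ hx => rw [map_smul]; exact Submodule.smul_mem _ _ hx

/-- `K_λ` commutes up to scalars with everything in the image of `C`, so it can be moved to the word
on the right. -/
theorem K_mul_mem (l : Φ →ₗ[ℤ] ℤ) {x : D.UAlg} (hx : x ∈ D.triSpan) :
    D.ug (.K l) * x ∈ D.triSpan := by
  refine D.triSpan_induction (f := LinearMap.mulLeft k (D.ug (.K l))) (fun v w => ?_) hx
  rw [LinearMap.mulLeft_apply]
  induction v using FreeMonoid.inductionOn' with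
  | one =>
    rw [map_one, map_one, one_mul]
    exact Submodule.subset_span ⟨((1 : D.CAlg D.nichols), .K l :: w), by simp [bToU]⟩
  | of_mul x v ih =>
    rw [map_mul, map_mul, cword_of]
    rcases x with i | b
    · rw [cToU_F, mul_assoc, ← mul_assoc, ug_KF, smul_mul_assoc, mul_assoc, ← cToU_F]
      exact Submodule.smul_mem _ _ (D.cToU_mul_mem _ ih)
    · have e : D.ug (.K l) * D.ug (.K (D.nu b)) = D.ug (.K (D.nu b)) * D.ug (.K l) := by
        rw [← ug_add, ← ug_add, add_comm]
      rw [cToU_t, mul_assoc, ← mul_assoc, e, mul_assoc, ← cToU_t]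
      exact D.cToU_mul_mem _ ih

/-- `E_i` is moved through the word in `C` letter by letter. The commutator with `F_i` leaves terms
beginning with `K`, which are covered by `K_mul_mem`. -/
theorem E_mul_mem (i : I) {x : D.UAlg} (hx : x ∈ D.triSpan) :
    D.ug (.E i) * x ∈ D.triSpan := by
  refine D.triSpan_induction (f := LinearMap.mulLeft k (D.ug (.E i))) (fun v w => ?_) hx
  rw [LinearMap.mulLeft_apply]
  induction v using FreeMonoid.inductionOn' with
  | one =>
    rw [map_one, map_one, one_mul]
    exact Submodule.subset_span ⟨((1 : D.CAlg D.nichols), .E i :: w), by simp [bToU]⟩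
  | of_mul x v ih =>
    have hv : D.cToU (D.cword _ v) * (w.map D.bToU).prod ∈ D.triSpan :=
      Submodule.subset_span ⟨(D.cword _ v, w), rfl⟩
    rw [map_mul, map_mul, cword_of]
    rcases x with j | b
    · rw [cToU_F, mul_assoc, ← mul_assoc]
      by_cases hij : i = j
      · subst hij
        rw [ug_EF, add_mul, mul_assoc, ← cToU_F, smul_mul_assoc, sub_mul]
        exact add_mem (D.cToU_mul_mem _ ih) (Submodule.smul_mem _ _
          (sub_mem (D.K_mul_mem _ hv) (D.K_mul_mem _ hv)))
      · rw [ug_EF_ne _ _ _ hij, mul_assoc, ← cToU_F]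
        exact D.cToU_mul_mem _ ih
    · have e : D.ug (.E i) * D.ug (.K (D.nu b)) =
          (D.q ^ (D.nu b (D.root i)))⁻¹ • (D.ug (.K (D.nu b)) * D.ug (.E i)) := by
        rw [ug_KE, smul_smul, inv_mul_cancel₀ (zpow_ne_zero _ D.q_ne_zero), one_smul]
      rw [cToU_t, mul_assoc, ← mul_assoc, e, smul_mul_assoc, mul_assoc, ← cToU_t]
      exact Submodule.smul_mem _ _ (D.cToU_mul_mem _ ih)

/-- The span contains 1 and is stable under left multiplication by the generators. Only spanning is
needed, not the linear independence in the triangular decomposition. -/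
theorem mem_triSpan (x : D.UAlg) : x ∈ D.triSpan := by
  refine D.uAlg_eq_top (M := D.triSpan)
    (Submodule.subset_span ⟨((1 : D.CAlg D.nichols), ([] : List (BGen I Φ))), by simp⟩) (fun g x hx => ?_) x
  rcases g with i | i | l
  · exact D.E_mul_mem i hx
  · rw [← cToU_F]; exact D.cToU_mul_mem _ hx
  · exact D.K_mul_mem l hx

variable [IsUltrametricDist k] [CompleteSpace k]

theorem incl_tb (c : D.CAlg D.nichols) : D.incl (D.cP.tb c) = D.uP.tb (D.cToU c) :=
  APres.map_toBan _ _ _ _ _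

theorem mulB_incl_inclT (c : D.CAlg D.nichols) (w : List (BGen I Φ)) :
    D.uP.mulB (tmap D.incl D.inclT (tmk _ _ (D.cP.tb c) (D.tw w))) =
      D.uP.tb (D.cToU c * (w.map D.bToU).prod) := by
  refine (congrArg D.uP.mulB (tmap_tmk D.incl D.inclT _ _)).trans ?_
  rw [inclT_tw, incl_tb]
  exact D.uP.mulB_tmk (D.cToU c) (w.map D.bToU).prod

/-- The products of elements of `C` and words span a dense subspace of `U`. -/
theorem generating_ban {X Y : Ban k} (f g : (tens D.U X).ban ⟶ Y)
    (h : tmap (tmap D.incl D.inclT ≫ D.uP.mulB) (𝟙 X) ≫ f =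
      tmap (tmap D.incl D.inclT ≫ D.uP.mulB) (𝟙 X) ≫ g) : f = g := by
  refine APres.tens_ext_of_span D.uP D.mem_triSpan fun u hu x => ?_
  obtain ⟨⟨c, w⟩, rfl⟩ := hu
  have e : ((tmap (tmap D.incl D.inclT ≫ D.uP.mulB) (𝟙 X) :
      (tens (tens D.C D.T).ban X).ban ⟶ (tens D.U X).ban))
      (tmk _ _ (tmk _ _ (D.cP.tb c) (D.tw w)) x) =
        tmk _ _ (D.uP.tb (D.cToU c * (w.map D.bToU).prod)) x := by
    refine (tmap_tmk _ _ _ _).trans (congrArg (fun z => tmk D.U X z x) ?_)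
    exact D.mulB_incl_inclT c w
  exact (congrArg f e.symm).trans ((congrArg (fun F : (tens (tens D.C D.T).ban X).ban ⟶ Y =>
    F (tmk _ _ (tmk _ _ (D.cP.tb c) (D.tw w)) x)) h).trans (congrArg g e))

end QuantumDatum
end AnQG

/-! ### Separation of points in completed tensor products with `C` -/

namespace AnQG
namespace Ban
variable {k : Type u} [NormedField k] [IsUltrametricDist k]

theorem tens_toBan_ext {P : Pres k} {X Y : Ban k} {f g : (tens Y P.ban).ban →ₗ[k] X}
    (hf : Continuous f) (hg : Continuous g)
    (h : ∀ y c, f (tmk _ _ y (P.toBan c)) = g (tmk _ _ y (P.toBan c))) : f = g := by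
  refine LinearMap.ext fun z => Pres.ban_induction _ (p := fun z => f z = g z)
    (isClosed_eq hf hg) (fun z => ?_) z
  refine DFunLike.congr_fun (f := f ∘ₗ (tens Y P.ban).toBan) (g := g ∘ₗ (tens Y P.ban).toBan)
    (TensorProduct.ext' fun y c => ?_) z
  exact Pres.ban_induction P (p := fun c => f (tmk _ _ y c) = g (tmk _ _ y c))
    (isClosed_eq (hf.comp (hom_continuous (tmkL _ y))) (hg.comp (hom_continuous (tmkL _ y))))
    (h y) c

theorem norm_tmap_id_le {A B : Ban k} (Y : Ban k) (f : A ⟶ B) (hf : ∀ x, ‖f x‖ ≤ ‖x‖)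
    (z : (tens Y A).ban) : ‖tmap (𝟙 Y) f z‖ ≤ ‖z‖ := by
  have h : ∀ y a, ‖(tmk Y B).compl₁₂ LinearMap.id (Ban.Hom.lin f) y a‖ ≤ (1 : ℝ≥0) * (‖y‖ * ‖a‖) :=
    fun y a => ((norm_tmk_le _ _).trans (mul_le_mul_of_nonneg_left (hf a) (norm_nonneg _))).trans_eq
      (one_mul _).symm
  have e : tmap (𝟙 Y) f = tlift _ 1 h := tens_ext fun y a => by
    rw [tmap_tmk, tlift_tmk]; rfl
  rw [e]
  exact ((tens Y A).liftLin_bound _ 1 (fun ab => h ab.1 ab.2) z).trans_eq (one_mul _)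

end Ban

theorem APres.norm_map_le {k : Type u} [NormedField k] [IsUltrametricDist k] (P Q : APres k)
    (f : P.carrier →ₗ[k] Q.carrier) (h : ∀ l, Q.nrm (f (P.gen l)) ≤ P.wt l) (x : P.ban) :
    ‖P.map Q f h x‖ ≤ ‖x‖ :=
  (P.pres.liftLin_bound (Q.tb ∘ₗ f) 1 (fun l => (Q.norm_tb _).trans_le
    ((h l).trans_eq (one_mul _).symm)) x).trans_eq (one_mul _)

/-- Restrictions to N of functionals in S form a subspace of the dual of N with zero annihilator,
hence the whole dual because N is finite-dimensional. So the coordinate functionals of a basis of N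
extend to elements of S. -/
theorem exists_finite_expansion {K V : Type*} [Field K] [AddCommGroup V] [Module K V]
    (S : Submodule K (V →ₗ[K] K)) (hS : ∀ v, (∀ f ∈ S, f v = 0) → v = 0) (N : Submodule K V)
    [FiniteDimensional K N] : ∃ (n : ℕ) (b : Fin n → V) (ψ : Fin n → V →ₗ[K] K),
      (∀ a, ψ a ∈ S) ∧ ∀ x ∈ N, x = ∑ a, ψ a x • b a := by
  let W : Submodule K (Module.Dual K N) := S.map (LinearMap.lcomp K K N.subtype)
  have hW : W = ⊤ := by
    have h : W.dualCoannihilator = ⊥ := (Submodule.eq_bot_iff _).2 fun x hx =>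
      Subtype.ext (hS _ fun f hf => (Submodule.mem_dualCoannihilator _).1 hx _ ⟨f, hf, rfl⟩)
    rw [← Subspace.dualCoannihilator_dualAnnihilator_eq (W := W), h, Submodule.dualAnnihilator_bot]
  let b := Module.finBasis K N
  have key : ∀ a, ∃ ψ ∈ S, ψ ∘ₗ N.subtype = b.coord a := fun a => by
    obtain ⟨ψ, hψ, h⟩ := (hW ▸ Submodule.mem_top : b.coord a ∈ W)
    exact ⟨ψ, hψ, h⟩
  choose ψ hψ hb using key
  refine ⟨_, fun a => b a, ψ, hψ, fun x hx => ?_⟩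
  have := congrArg N.subtype (b.sum_repr ⟨x, hx⟩)
  rw [map_sum] at this
  refine this.symm.trans (Finset.sum_congr rfl fun a _ => ?_)
  rw [map_smul]
  exact congrArg (· • (b a : V)) (DFunLike.congr_fun (hb a) ⟨x, hx⟩).symm

namespace QuantumDatum
variable {k I Φ : Type u} [NormedField k] [IsUltrametricDist k] [AddCommGroup Φ]
  (D : QuantumDatum k I Φ)

/-- the canonical map of the algebra to the Banach Hopf algebra `C` -/
def ctb : D.CAlg D.nichols →ₗ[k] D.C := D.cP.tb

/-- Monomials are homogeneous, so each is multiplied by a scalar of norm at most 1. -/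
theorem dil_bound {u : Deg I → k} (hu : ∀ g, ‖u g‖ ≤ 1) (l : D.cP.Idx) :
    D.cP.nrm (D.dil D.homog_nichols u (D.cP.gen l)) ≤ D.cP.wt l := by
  have e : D.dil D.homog_nichols u (D.cP.gen l) = u (wdeg l) • D.cP.gen l :=
    D.dil_cword D.homog_nichols u l
  rw [e]
  refine (D.cP.nrm_smul_le _ _).trans ?_
  exact (mul_le_mul (hu _) (D.cP.nrm_gen_le l) (D.cP.nrm_nonneg _) zero_le_one).trans_eq (one_mul _)

/-- `dil` on the Banach Hopf algebra `C` -/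
def dilB (u : Deg I → k) (hu : ∀ g, ‖u g‖ ≤ 1) : D.C ⟶ D.C := D.cP.map D.cP _ (D.dil_bound hu)

theorem norm_dilB_le {u : Deg I → k} (hu : ∀ g, ‖u g‖ ≤ 1) (c : D.C) : ‖D.dilB u hu c‖ ≤ ‖c‖ :=
  APres.norm_map_le _ _ _ _ c

/-- `dil` on `Y ⊗ C` -/
def dilT (Y : Ban k) (u : Deg I → k) (hu : ∀ g, ‖u g‖ ≤ 1) : (tens Y D.C).ban ⟶ (tens Y D.C).ban :=
  tmap (𝟙 Y) (D.dilB u hu)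

variable {Y : Ban k}

theorem dilT_tmk {u : Deg I → k} (hu : ∀ g, ‖u g‖ ≤ 1) (y : Y) (c : D.CAlg D.nichols) :
    D.dilT Y u hu (tmk Y D.C y (D.ctb c)) =
      tmk Y D.C y (D.ctb (D.dil D.homog_nichols u c)) :=
  (tmap_tmk _ _ _ _).trans (congrArg (tmk Y D.C y) (APres.map_toBan _ _ _ _ _))

theorem norm_dilT_le {u : Deg I → k} (hu : ∀ g, ‖u g‖ ≤ 1) (z : (tens Y D.C).ban) :
    ‖D.dilT Y u hu z‖ ≤ ‖z‖ := Ban.norm_tmap_id_le Y _ (D.norm_dilB_le hu) z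

/-- Every element of the completed tensor product is concentrated, up to ε, in finitely many
degrees, uniformly over multipliers bounded by 1. The property is stable under sums and limits, and
clear for pure tensors with algebraic second factor. Stability under limits needs the operators to
be contractive, which is why the multipliers have to be bounded. -/
theorem dilT_small (z : (tens Y D.C).ban) : ∀ ε > 0, ∃ S : Finset (Deg I), ∀ u hu,
    (∀ g ∈ S, u g = 0) → ‖D.dilT Y u hu z‖ ≤ ε := by
  classical
  set Q : (tens Y D.C).ban → Prop := fun z => ∀ ε > 0, ∃ S : Finset (Deg I), ∀ u hu,
    (∀ g ∈ S, u g = 0) → ‖D.dilT Y u hu z‖ ≤ ε with hQ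
  have hadd : ∀ x y, Q x → Q y → Q (x + y) := fun x y hx hy ε hε => by
    obtain ⟨S, hS⟩ := hx ε hε
    obtain ⟨S', hS'⟩ := hy ε hε
    refine ⟨S ∪ S', fun u hu h => ?_⟩
    rw [map_add]
    exact (IsUltrametricDist.norm_add_le_max _ _).trans (max_le
      (hS u hu fun g hg => h g (Finset.mem_union_left _ hg))
      (hS' u hu fun g hg => h g (Finset.mem_union_right _ hg)))
  have hcl : IsClosed {z | Q z} := by
    refine closure_subset_iff_isClosed.1 fun x hx ε hε => ?_
    obtain ⟨y, hy, hxy⟩ := Metric.mem_closure_iff.1 hx ε hε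
    obtain ⟨S, hS⟩ := hy ε hε
    refine ⟨S, fun u hu h => ?_⟩
    rw [← sub_add_cancel x y, map_add]
    refine (IsUltrametricDist.norm_add_le_max _ _).trans (max_le ?_ (hS u hu h))
    exact (D.norm_dilT_le hu _).trans ((dist_eq_norm x y).symm.trans_le hxy.le)
  change Q z
  refine Pres.ban_induction _ (p := Q) hcl (fun z => ?_) z
  induction z using TensorProduct.induction_on with
  | zero => exact fun ε hε => ⟨∅, fun u hu _ => by
      rw [show (tens Y D.C).toBan (0 : Y ⊗[k] D.C) = 0 from map_zero (tens Y D.C).toBan, map_zero,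
        norm_zero]
      exact hε.le⟩
  | add x y hx hy => 
    rw [show (tens Y D.C).toBan (x + y : Y ⊗[k] D.C) = (tens Y D.C).toBan x + (tens Y D.C).toBan y
      from map_add (tens Y D.C).toBan _ _]
    exact hadd _ _ hx hy
  | tmul y c =>
    refine Pres.ban_induction D.cP.pres (p := fun c => Q (tmk Y D.C y c))
      (hcl.preimage (Ban.hom_continuous (tmkL _ y))) (fun (c : D.CAlg D.nichols) ε hε => ?_) c
    refine ⟨(D.parts D.homog_nichols c).support, fun u hu h => ?_⟩
    refine (congrArg norm (D.dilT_tmk hu y c)).trans_le ?_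
    have e : D.dil D.homog_nichols u c = 0 := (D.dil_congr _ (v := (0 : k) • 1)
      fun g hg => (h g hg).trans (by simp)).trans ((D.dil_smul _ _ _ _).trans (zero_smul _ _))
    rw [e, map_zero, map_zero, norm_zero]
    exact hε.le

/-- The functionals `ψ` on `C` for which `id ⊗ ψ` kills `z`. -/
def killing (z : (tens Y D.C).ban) : Submodule k (D.CAlg D.nichols →ₗ[k] k) where
  carrier := {ψ | ∃ L : (tens Y D.C).ban →ₗ[k] Y, Continuous L ∧
    (∀ (y : Y) (c : D.CAlg D.nichols), L (tmk Y D.C y (D.ctb c)) = ψ c • y) ∧ L z = 0}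
  zero_mem' := ⟨0, continuous_zero, fun (y : Y) (c : D.CAlg D.nichols) => (zero_smul k y).symm, rfl⟩
  add_mem' := by
    rintro ψ ψ' ⟨L, hL, h, hz⟩ ⟨L', hL', h', hz'⟩
    refine ⟨L + L', hL.add hL', fun y c => ?_, ?_⟩
    · rw [LinearMap.add_apply, h, h', LinearMap.add_apply, add_smul]
    · rw [LinearMap.add_apply, hz, hz', add_zero]
  smul_mem' := by
    rintro a ψ ⟨L, hL, h, hz⟩
    refine ⟨a • L, hL.const_smul a, fun (y : Y) (c : D.CAlg D.nichols) => ?_, ?_⟩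
    · rw [LinearMap.smul_apply, h, LinearMap.smul_apply, smul_assoc]
    · rw [LinearMap.smul_apply, hz, smul_zero]

-- A continuous extension of id ⊗ ψ is unique by density, so membership in `killing` can be tested
-- on any extension.
variable {D} in
theorem killing_unique {z : (tens Y D.C).ban} {ψ : D.CAlg D.nichols →ₗ[k] k} (hψ : ψ ∈ D.killing z)
    {L : (tens Y D.C).ban →ₗ[k] Y} (hL : Continuous L)
    (h : ∀ (y : Y) (c : D.CAlg D.nichols), L (tmk Y D.C y (D.ctb c)) = ψ c • y) : L z = 0 := by
  obtain ⟨L', hL', h', hz⟩ := hψ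
  have e : L = L' := Ban.tens_toBan_ext hL hL' fun (y : Y) (c : D.CAlg D.nichols) => (h y c).trans (h' y c).symm
  rw [e, hz]

variable [CompleteSpace k]

/-- the slice of an element of `Y ⊗ C` along a word -/
def slice (Y : Ban k) (w : List (BGen I Φ)) : (tens Y D.C).ban ⟶ Y :=
  tmkL _ (D.tw w) ≫ YD.evalAt D.pairing Y

theorem slice_tmk (w : List (BGen I Φ)) (y : Y) (c : D.CAlg D.nichols) :
    D.slice Y w (tmk Y D.C y (D.ctb c)) = D.pairWord w c • y := by
  have e : D.slice Y w (tmk Y D.C y (D.ctb c)) =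
      uval (D.pairing (tmk _ _ (D.tw w) (D.ctb c))) • y := by
    change tright Y (tmap (𝟙 Y) D.pairing (tassoc Y D.T D.C (tmap (tswap D.T Y) (𝟙 D.C)
      (tassocInv D.T Y D.C (tmk _ _ (D.tw w) (tmk Y D.C y (D.ctb c))))))) = _
    rw [tassocInv_tmk, tmap_tmk, tswap_tmk]
    refine (congrArg (fun z => tright Y (tmap (𝟙 Y) D.pairing z)) (tassoc_tmk Y D.T D.C _ _ _)).trans ?_
    exact (congrArg (tright Y) (tmap_tmk (𝟙 Y) D.pairing _ _)).trans (tright_tmk _ _ _)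
  exact e.trans (congrArg (· • y) (D.pairing_tw w c))

theorem wordSpan_le_killing {z : (tens Y D.C).ban} (h : ∀ w, D.slice Y w z = 0) :
    D.wordSpan ≤ D.killing z := Submodule.span_le.2 <| by
  rintro _ ⟨w, rfl⟩
  exact ⟨(D.slice Y w).lin, Ban.hom_continuous _, D.slice_tmk w, h w⟩

variable [Module.Free ℤ Φ]

open Classical in
theorem norm_single_le (g x : Deg I) : ‖(Pi.single g 1 : Deg I → k) x‖ ≤ 1 := by
  rw [Pi.single_apply]
  split_ifs <;> simp

-- Projection to one degree is not itself known to act on the span of words; on z it is approximated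
-- by multipliers u that do. With u equal to 1 at g and 0 at the other degrees of a large finite
-- set, the error is controlled by `dilT_small`.
open Classical in
theorem slice_proj_eq_zero {z : (tens Y D.C).ban} (h : ∀ w, D.slice Y w z = 0) (g : Deg I)
    (w : List (BGen I Φ)) : D.slice Y w (D.dilT Y (Pi.single g 1) (norm_single_le g) z) = 0 := by
  obtain ⟨K, hK⟩ := (D.slice Y w).bdd
  set a := D.slice Y w (D.dilT Y (Pi.single g 1) (norm_single_le g) z)
  have key : ∀ ε > 0, ‖a‖ ≤ K * ε := fun ε hε => by
    obtain ⟨S, hS⟩ := D.dilT_small z ε hε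
    obtain ⟨u, hu, hb, hg, hS'⟩ := D.exists_theta S g
    -- The error multiplier vanishes on S and is still bounded by 1, since it is u with its value at
    -- g replaced by 0.
    let v : Deg I → k := u - Pi.single g 1
    have hv : ∀ x, v x = if x = g then 0 else u x := fun x => by
      by_cases hx : x = g
      · subst hx; simp [v, hg]
      · simp [v, hx]
    have hv1 : ∀ x, ‖v x‖ ≤ 1 := fun x => by
      rw [hv]; split_ifs
      · simp
      · exact hb x
    have hvS : ∀ x ∈ S, v x = 0 := fun x hx => by
      rw [hv]; split_ifs with h
      · rfl
      · exact hS' x hx h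
    have hk : ((D.slice Y w).lin ∘ₗ (D.dilT Y (Pi.single g 1) (norm_single_le g)).lin +
        (D.slice Y w).lin ∘ₗ (D.dilT Y v hv1).lin) z = 0 := by
      refine killing_unique (D.wordSpan_le_killing h (hu w)) ?_ fun (y : Y) (c : D.CAlg D.nichols) => ?_
      · exact (Ban.hom_continuous (D.dilT Y (Pi.single g 1) (norm_single_le g) ≫ D.slice Y w)).add
          (Ban.hom_continuous (D.dilT Y v hv1 ≫ D.slice Y w))
      · rw [LinearMap.add_apply, LinearMap.comp_apply, LinearMap.comp_apply, dilT_tmk, dilT_tmk,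
          slice_tmk, slice_tmk, ← add_smul, ← map_add, ← dil_add]
        exact congrArg (fun f => D.pairWord w (D.dil D.homog_nichols f c) • y)
          (add_sub_cancel (Pi.single g 1) u)
    have e : a = -(D.slice Y w (D.dilT Y v hv1 z)) := eq_neg_of_add_eq_zero_left hk
    rw [e, norm_neg]
    exact (hK _).trans (mul_le_mul_of_nonneg_left (hS v hv1 hvS) K.2)
  have h0 : ‖a‖ ≤ 0 := by
    -- The denominator is K + 1 because the bound K of the slice may be 0.
    refine le_of_forall_pos_le_add fun δ hδ => (key (δ / (K + 1)) (by positivity)).trans ?_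
    rw [zero_add, mul_div_assoc', div_le_iff₀ (by positivity)]
    nlinarith [K.2]
  exact norm_le_zero_iff.1 h0

-- The space of elements of degree g in `C` is finite-dimensional, so nondegeneracy gives a basis
-- whose coordinate functionals are combinations of words. The coordinates of the component of z are
-- then combinations of its slices, which vanish.
open Classical in
theorem dilT_single_eq_zero {z : (tens Y D.C).ban} (h : ∀ w, D.slice Y w z = 0) (g : Deg I) :
    D.dilT Y (Pi.single g 1) (norm_single_le g) z = 0 := by
  obtain ⟨n, b, ψ, hψ, hb⟩ := exists_finite_expansion D.wordSpan (fun c hc =>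
    D.pairWord_nondegenerate c fun w => hc _ (Submodule.subset_span ⟨w, rfl⟩))
    (D.homSpan D.nichols g)
  choose L hL h₁ h₂ using fun a => D.wordSpan_le_killing (D.slice_proj_eq_zero h g) (hψ a)
  -- Reconstruction from coordinates: this operator fixes every element in the image of the
  -- projection to degree g.
  let G : (tens Y D.C).ban →ₗ[k] (tens Y D.C).ban :=
    ∑ a, (tmk Y D.C).flip (D.ctb (b a)) ∘ₗ L a
  have hG : Continuous G := by
    have : (G : _ → _) = fun z => ∑ a, tmk Y D.C (L a z) (D.ctb (b a)) := by
      ext z; simp [G]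
    rw [this]
    exact continuous_finsetSum _ fun a _ => (Ban.hom_continuous (tmkR _ _)).comp (hL a)
  have e : G ∘ₗ (D.dilT Y (Pi.single g 1) (norm_single_le g)).lin =
      (D.dilT Y (Pi.single g 1) (norm_single_le g)).lin := by
    refine Ban.tens_toBan_ext (P := D.cP.pres) (hG.comp (Ban.hom_continuous _))
      (Ban.hom_continuous _) fun (y : Y) (c : D.CAlg D.nichols) => ?_
    change G (D.dilT Y (Pi.single g 1) (norm_single_le g) (tmk Y D.C y (D.ctb c))) =
      D.dilT Y (Pi.single g 1) (norm_single_le g) (tmk Y D.C y (D.ctb c))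
    rw [dilT_tmk]
    generalize hx : D.dil D.homog_nichols (Pi.single g 1) c = x
    have hx' : D.ctb x = ∑ a, ψ a x • D.ctb (b a) := by
      conv_lhs => rw [hb x (hx ▸ D.proj_mem _ g c)]
      rw [map_sum]
      exact Finset.sum_congr rfl fun a _ => map_smul D.ctb _ _
    conv_rhs => rw [hx', map_sum]
    refine (LinearMap.sum_apply _ _ _).trans (Finset.sum_congr rfl fun a _ => ?_)
    rw [LinearMap.comp_apply, h₁, map_smul, map_smul]
    rfl
  have := DFunLike.congr_fun e z
  refine this.symm.trans ((LinearMap.sum_apply _ _ _).trans (Finset.sum_eq_zero fun a _ => ?_))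
  exact (congrArg ((tmk Y D.C).flip _) (h₂ a)).trans (map_zero _)

/-- Up to ε the element is the sum of finitely many of its components, and these vanish by
`dilT_single_eq_zero`. -/
theorem eq_zero_of_slice_eq_zero {z : (tens Y D.C).ban} (h : ∀ w, D.slice Y w z = 0) : z = 0 := by
  classical
  refine norm_le_zero_iff.1 (le_of_forall_pos_le_add fun ε hε => ?_)
  rw [zero_add]
  obtain ⟨S, hS⟩ := D.dilT_small z ε hε
  -- The indicator of the complement of S: the corresponding part of z has norm at most ε, and the
  -- rest is a finite sum of components.
  let u : Deg I → k := fun g => if g ∈ S then 0 else 1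
  have hu : ∀ g, ‖u g‖ ≤ 1 := fun g => by
    dsimp only [u]; split_ifs <;> simp
  have e : (D.dilT Y u hu).lin + ∑ g ∈ S, (D.dilT Y (Pi.single g 1) (norm_single_le g)).lin =
      LinearMap.id := by
    refine Ban.tens_toBan_ext (P := D.cP.pres) ?_ continuous_id fun (y : Y) (c : D.CAlg D.nichols) => ?_
    · refine (Ban.hom_continuous (D.dilT Y u hu)).add ?_
      have : ((∑ g ∈ S, (D.dilT Y (Pi.single g 1) (norm_single_le g)).lin :
          (tens Y D.C).ban →ₗ[k] (tens Y D.C).ban) : _ → _) =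
          fun z => ∑ g ∈ S, D.dilT Y (Pi.single g 1) (norm_single_le g) z := by
        ext z; simp
      rw [this]
      exact continuous_finsetSum _ fun a _ => Ban.hom_continuous _
    · rw [LinearMap.add_apply, LinearMap.sum_apply, LinearMap.id_apply]
      change D.dilT Y u hu (tmk Y D.C y (D.ctb c)) +
        ∑ g ∈ S, D.dilT Y (Pi.single g 1) (norm_single_le g) (tmk Y D.C y (D.ctb c)) =
          tmk Y D.C y (D.ctb c)
      rw [dilT_tmk, Finset.sum_congr rfl fun g _ => D.dilT_tmk (norm_single_le g) y c]
      rw [← map_sum, ← map_add, ← map_sum, ← map_add]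
      congr 2
      have h' : D.dil D.homog_nichols u + ∑ g ∈ S, D.dil D.homog_nichols (Pi.single g 1) =
          LinearMap.id := cword_linear_ext fun w => by
        rw [LinearMap.add_apply, LinearMap.sum_apply, LinearMap.id_apply,
          Finset.sum_congr rfl fun g _ => D.dil_cword D.homog_nichols (Pi.single g 1) w,
          dil_cword, ← Finset.sum_smul, ← add_smul]
        simp [u, Pi.single_apply]
        split_ifs <;> simp
      have h'' := DFunLike.congr_fun h' c
      rwa [LinearMap.add_apply, LinearMap.sum_apply, LinearMap.id_apply] at h''
  have hz := DFunLike.congr_fun e z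
  rw [LinearMap.add_apply, LinearMap.sum_apply, Finset.sum_eq_zero fun g _ =>
    D.dilT_single_eq_zero h g, add_zero] at hz
  rw [← show D.dilT Y u hu z = z from hz]
  exact hS u hu fun g hg => if_pos hg

end QuantumDatum
end AnQG

/-! ### The braided monoidal structure on the category of modules -/

namespace AnQG
namespace YD
open MonObj ComonObj
universe v w
variable {V : Type w} [Category.{v} V] [MonoidalCategory V] [SymmetricCategory V]

section
variable {U : V} [MonObj U]

theorem isAct_smul (M : Mod V U) : IsAct (ModObj.smul (M := U) (X := M.X)) where
  one := ModObj.one_smul (M := U) M.X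
  mul := ModObj.mul_smul (M := U) M.X

/-- an action as a module -/
@[reducible] def IsAct.toMod {X : V} {a : U ⊗ X ⟶ X} (h : IsAct a) : Mod V U where
  X := X
  mod := { smul := a, one_smul := h.one, mul_smul := h.mul }

variable {P : ObjectProperty (Mod V U)} {M N : P.FullSubcategory}

/-- linear maps as morphisms of modules -/
def homOf (f : M.obj.X ⟶ N.obj.X)
    (h : U ◁ f ≫ ModObj.smul (M := U) (X := N.obj.X) = ModObj.smul (M := U) (X := M.obj.X) ≫ f) :
    M ⟶ N := ObjectProperty.homMk (Mod.Hom.mk' f h.symm)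

theorem full_hom_ext {f g : M ⟶ N} (h : f.hom.hom = g.hom.hom) : f = g :=
  ObjectProperty.hom_ext _ (Mod.hom_ext _ _ h)

instance : (P.ι ⋙ Mod.forget U).Faithful where
  map_injective h := full_hom_ext h

theorem hom_linear (f : M ⟶ N) : U ◁ f.hom.hom ≫ ModObj.smul (M := U) (X := N.obj.X) =
    ModObj.smul (M := U) (X := M.obj.X) ≫ f.hom.hom :=
  (IsModHom.smul_hom (A := U) (f := f.hom.hom)).symm

/-- linear isomorphisms as isomorphisms of modules -/
def isoOf (e : M.obj.X ≅ N.obj.X) (h : U ◁ e.hom ≫ ModObj.smul (M := U) (X := N.obj.X) =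
    ModObj.smul (M := U) (X := M.obj.X) ≫ e.hom) : M ≅ N where
  hom := homOf e.hom h
  inv := homOf e.inv (by
    rw [← cancel_mono e.hom, Category.assoc, ← h, ← MonoidalCategory.whiskerLeft_comp_assoc]
    simp)
  hom_inv_id := full_hom_ext e.hom_inv_id
  inv_hom_id := full_hom_ext e.inv_hom_id

end

section
variable {U C T : V} [BimonObj U] [BimonObj C] {φ : C ⟶ U} [IsBimonHom φ] {j : T ⟶ U}
  {d : T ⟶ T ⊗ T} {p : T ⊗ C ⟶ 𝟙_ V} {S : C ⟶ C} (D : Duality φ j d p S)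
  {P : ObjectProperty (Mod V U)}
  (hP : ∀ M, P M ↔ ∃ ρ, Compat φ j p (ModObj.smul (M := U) (X := M.X)) ρ)

/-- the coaction -/
def coact (M : P.FullSubcategory) : M.obj.X ⟶ M.obj.X ⊗ C := ((hP M.obj).1 M.property).choose

theorem coact_compat (M : P.FullSubcategory) :
    Compat φ j p (ModObj.smul (M := U) (X := M.obj.X)) (coact hP M) :=
  ((hP M.obj).1 M.property).choose_spec

/-- the action of `U` on an object -/
abbrev actOf (M : P.FullSubcategory) : U ⊗ M.obj.X ⟶ M.obj.X :=
  ModObj.smul (M := U) (X := M.obj.X)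

/-- The tensor product of crossed bimodules. -/
@[reducible] def tensOf (M N : P.FullSubcategory) : P.FullSubcategory where
  obj := (tact_isAct (isAct_smul M.obj) (isAct_smul N.obj)).toMod
  property := (hP _).2 ⟨_, D.compat_tensor (coact_compat hP M) (coact_compat hP N)⟩

/-- The trivial crossed bimodule. -/
@[reducible] def unitOf : P.FullSubcategory where
  obj := (trivial_isAct (C := U)).toMod
  property := (hP _).2 ⟨_, D.compat_unit⟩

theorem tact_hom {M M' N N' : V} {a : U ⊗ M ⟶ M} {a' : U ⊗ M' ⟶ M'} {b : U ⊗ N ⟶ N}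
    {b' : U ⊗ N' ⟶ N'} {f : M ⟶ M'} {g : N ⟶ N'} (hf : U ◁ f ≫ a' = a ≫ f)
    (hg : U ◁ g ≫ b' = b ≫ g) : U ◁ (f ⊗ₘ g) ≫ tact a' b' = tact a b ≫ (f ⊗ₘ g) := by
  rw [MonoidalCategory.tensorHom_def, MonoidalCategory.whiskerLeft_comp, Category.assoc, tact_whiskerLeft g hg,
    ← Category.assoc, tact_whiskerRight f hf, Category.assoc]

/-- The monoidal structure. -/
@[reducible] def monStruct : MonoidalCategoryStruct P.FullSubcategory where
  tensorObj M N := tensOf D hP M N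
  tensorUnit := unitOf D hP
  tensorHom f g := homOf (f.hom.hom ⊗ₘ g.hom.hom) (tact_hom (hom_linear f) (hom_linear g))
  whiskerLeft M _ _ f := homOf (M.obj.X ◁ f.hom.hom) (tact_whiskerLeft _ (hom_linear f))
  whiskerRight f M := homOf (f.hom.hom ▷ M.obj.X) (tact_whiskerRight _ (hom_linear f))
  associator M N Q := isoOf (α_ M.obj.X N.obj.X Q.obj.X) (tact_assoc _).symm
  leftUnitor M := isoOf (λ_ M.obj.X) tact_leftUnitor.symm
  rightUnitor M := isoOf (ρ_ M.obj.X) tact_rightUnitor.symm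

/-- The forgetful functor preserves the monoidal structure. -/
def forgetData : letI := monStruct D hP
    Monoidal.InducingFunctorData (P.ι ⋙ Mod.forget U) :=
  letI := monStruct D hP
  { μIso := fun _ _ => Iso.refl _
    εIso := Iso.refl _
    whiskerLeft_eq := fun X _ _ f =>
      ((Category.id_comp _).trans (Category.comp_id (X.obj.X ◁ f.hom.hom))).symm
    whiskerRight_eq := fun f Y =>
      ((Category.id_comp _).trans (Category.comp_id (f.hom.hom ▷ Y.obj.X))).symm
    tensorHom_eq := fun f g =>
      ((Category.id_comp _).trans (Category.comp_id (f.hom.hom ⊗ₘ g.hom.hom))).symm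
    associator_eq := fun X Y Z => by
      change (α_ X.obj.X Y.obj.X Z.obj.X).hom = (𝟙 _ ≫ (𝟙 _ ⊗ₘ 𝟙 _)) ≫ (α_ _ _ _).hom ≫
        ((𝟙 _ ⊗ₘ 𝟙 _) ≫ 𝟙 _)
      simp
    leftUnitor_eq := fun X => by
      change (λ_ X.obj.X).hom = (𝟙 _ ≫ (𝟙 _ ⊗ₘ 𝟙 _)) ≫ (λ_ _).hom
      simp
    rightUnitor_eq := fun X => by
      change (ρ_ X.obj.X).hom = (𝟙 _ ≫ (𝟙 _ ⊗ₘ 𝟙 _)) ≫ (ρ_ _).hom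
      simp }

/-- The monoidal category of crossed bimodules. -/
@[reducible] def monCat : MonoidalCategory P.FullSubcategory :=
  letI := monStruct D hP
  Monoidal.induced (P.ι ⋙ Mod.forget U) (forgetData D hP)

/-- The forgetful functor is monoidal. -/
@[reducible] def forgetMon : letI := monCat D hP
    (P.ι ⋙ Mod.forget U).Monoidal :=
  letI := monStruct D hP
  Monoidal.fromInducedMonoidal (P.ι ⋙ Mod.forget U) (forgetData D hP)

/-- the braiding on underlying objects -/
abbrev brOf (M N : P.FullSubcategory) : M.obj.X ⊗ N.obj.X ⟶ N.obj.X ⊗ M.obj.X :=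
  br (φ ▷ M.obj.X ≫ actOf M) (coact hP N)

/-- the braiding on underlying objects, as an isomorphism -/
def brIso (M N : P.FullSubcategory) : M.obj.X ⊗ N.obj.X ≅ N.obj.X ⊗ M.obj.X where
  hom := brOf hP M N
  inv := _
  hom_inv_id := (br_inverse (isAct_smul M.obj).whiskerRight (coact_compat hP N).yd.coassoc
    (coact_compat hP N).yd.counit S D.antipode_left D.antipode_right).1
  inv_hom_id := (br_inverse (isAct_smul M.obj).whiskerRight (coact_compat hP N).yd.coassoc
    (coact_compat hP N).yd.counit S D.antipode_left D.antipode_right).2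

/-- The braided category of crossed bimodules. -/
@[reducible] def braidCat : letI := monCat D hP
    BraidedCategory P.FullSubcategory :=
  letI := monCat D hP
  { braiding := fun M N => isoOf (M := tensOf D hP M N) (N := tensOf D hP N M) (brIso D hP M N)
      (D.braiding_linear (isAct_smul M.obj) (isAct_smul N.obj) (coact_compat hP M)
        (coact_compat hP N))
    braiding_naturality_right := fun X {Y Z} f => full_hom_ext (br_natural_right _
      (D.colinear (coact_compat hP Y) (coact_compat hP Z) _ (hom_linear f).symm))
    braiding_naturality_left := fun {X Y} f Z => full_hom_ext (br_natural_left _ (by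
      rw [Category.assoc, ← hom_linear f, whisker_exchange_assoc]))
    hexagon_forward := fun X Y Z => full_hom_ext (by
      -- The coaction chosen on a tensor product is the tensor product coaction, by uniqueness.
      have h : coact hP (tensOf D hP Y Z) = tcoact (coact hP Y) (coact hP Z) :=
        D.coact_unique (coact_compat hP (tensOf D hP Y Z))
          (D.compat_tensor (coact_compat hP Y) (coact_compat hP Z))
      change (α_ _ _ _).hom ≫ br (φ ▷ X.obj.X ≫ actOf X) (coact hP (tensOf D hP Y Z)) ≫
        (α_ _ _ _).hom = brOf hP X Y ▷ Z.obj.X ≫ (α_ _ _ _).hom ≫ Y.obj.X ◁ brOf hP X Z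
      rw [h]
      exact br_tcoact (isAct_smul X.obj).whiskerRight _)
    hexagon_reverse := fun X Y Z => full_hom_ext (by
      change (α_ _ _ _).inv ≫ br (φ ▷ (X.obj.X ⊗ Y.obj.X) ≫ tact (actOf X) (actOf Y))
        (coact hP Z) ≫ (α_ _ _ _).inv =
          X.obj.X ◁ brOf hP Y Z ≫ (α_ _ _ _).inv ≫ brOf hP X Z ▷ Y.obj.X
      rw [tact_restrict]
      exact br_tact _ (coact_compat hP Z).yd.coassoc) }

include D hP in
/-- The crossed bimodules over `C` coming from `U`-modules form a braided monoidal category. -/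
theorem exists_braided : ∃ (_ : MonoidalCategory P.FullSubcategory)
    (_ : BraidedCategory P.FullSubcategory) (_ : (P.ι ⋙ Mod.forget U).Monoidal),
    (∀ M N : P.FullSubcategory, U ◁ Functor.LaxMonoidal.μ (P.ι ⋙ Mod.forget U) M N ≫
      actOf (M ⊗ N) = tact (actOf M) (actOf N) ≫ Functor.LaxMonoidal.μ (P.ι ⋙ Mod.forget U) M N) ∧
    (U ◁ Functor.LaxMonoidal.ε (P.ι ⋙ Mod.forget U) ≫ actOf (𝟙_ P.FullSubcategory) =
      (ρ_ U).hom ≫ ε[U] ≫ Functor.LaxMonoidal.ε (P.ι ⋙ Mod.forget U)) ∧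
    (∀ (M N : P.FullSubcategory) (ρ : N.obj.X ⟶ N.obj.X ⊗ C), Compat φ j p (actOf N) ρ →
      Functor.LaxMonoidal.μ (P.ι ⋙ Mod.forget U) M N ≫ (P.ι ⋙ Mod.forget U).map (β_ M N).hom =
        br (φ ▷ M.obj.X ≫ actOf M) ρ ≫ Functor.LaxMonoidal.μ (P.ι ⋙ Mod.forget U) N M) := by
  refine ⟨monCat D hP, braidCat D hP, forgetMon D hP, fun M N => ?_, ?_, fun M N ρ hρ => ?_⟩
  · change U ◁ (𝟙 (M.obj.X ⊗ N.obj.X)) ≫ tact (actOf M) (actOf N) =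
      tact (actOf M) (actOf N) ≫ 𝟙 (M.obj.X ⊗ N.obj.X)
    simp
  · change U ◁ (𝟙 (𝟙_ V)) ≫ (ρ_ U).hom ≫ ε[U] = (ρ_ U).hom ≫ ε[U] ≫ 𝟙 (𝟙_ V)
    simp
  · change 𝟙 (M.obj.X ⊗ N.obj.X) ≫ brOf hP M N = br (φ ▷ M.obj.X ≫ actOf M) ρ ≫
      𝟙 (N.obj.X ⊗ M.obj.X)
    -- Uniqueness makes the braiding formula hold for every admissible coaction, not only the chosen
    -- one.
    rw [D.coact_unique hρ (coact_compat hP N)]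
    simp

end
end YD

/-! ### Specialization to the analytic quantum group -/

namespace QuantumDatum
variable {k I Φ : Type u} [NormedField k] [IsUltrametricDist k] [CompleteSpace k]
  [AddCommGroup Φ] [Module.Free ℤ Φ] (D : QuantumDatum k I Φ)

/-- Separation is applied to the difference f x - g x, all of whose slices along words vanish; the
remaining conditions are the identities already obtained on completions. -/
theorem duality : YD.Duality D.incl D.inclT D.tComul D.pairing D.antB where
  comul := D.comul_inclT
  pair_mul := D.pairing_mul
  pair_one := D.pairing_one
  separating {X Y} f g h := Ban.hom_ext fun x => by
    refine sub_eq_zero.1 (D.eq_zero_of_slice_eq_zero fun w => ?_)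
    rw [map_sub]
    have e : ∀ f : X ⟶ Y ⊗ D.C, D.slice Y w (f x) =
        (D.T ◁ f ≫ YD.evalAt D.pairing Y) (tmk _ _ (D.tw w) x) := fun f =>
      congrArg (YD.evalAt D.pairing Y : _ → _) (tmap_tmk (𝟙 D.T) f (D.tw w) x).symm
    exact sub_eq_zero.2 ((e f).trans ((congrArg (fun F : D.T ⊗ X ⟶ Y => F _) h).trans (e g).symm))
  generating f g h := D.generating_ban f g h
  antipode_left := D.antB_left
  antipode_right := D.antB_right

theorem isOPsi_iff (M : D.UMod) : D.isOPsi M ↔ ∃ ρ, YD.Compat ((emb k).map D.incl)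
    ((emb k).map D.inclT) D.iPairing (actU M) ρ :=
  exists_congr fun _ => ⟨fun h => ⟨⟨h.coassoc, h.counit, h.crossed⟩, h.actB⟩,
    fun h => ⟨h.yd.coassoc, h.yd.counit, h.yd.crossed, h.act⟩⟩

end QuantumDatum
end AnQG
end

theorem corollary3p39 {k I Φ : Type u} [NormedField k] [IsUltrametricDist k] [CompleteSpace k]
    [AddCommGroup Φ] [Module.Free ℤ Φ] (D : AnQG.QuantumDatum k I Φ) :
    ∃ (_ : MonoidalCategory D.OPsi) (_ : BraidedCategory D.OPsi) (_ : D.forget.Monoidal),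
      (∀ M N : D.OPsi,
        D.iU ◁ Functor.LaxMonoidal.μ D.forget M N ≫ AnQG.QuantumDatum.actU (M ⊗ N).obj =
          AnQG.QuantumDatum.diagAct M.obj N.obj ≫ Functor.LaxMonoidal.μ D.forget M N) ∧
      (D.iU ◁ Functor.LaxMonoidal.ε D.forget ≫ AnQG.QuantumDatum.actU (𝟙_ D.OPsi).obj =
        (ρ_ D.iU).hom ≫ D.iUcounit ≫ Functor.LaxMonoidal.ε D.forget) ∧
      (∀ (M N : D.OPsi) (ρ : N.obj.X ⟶ N.obj.X ⊗ D.iC), AnQG.QuantumDatum.IsCrossed N.obj ρ →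
        Functor.LaxMonoidal.μ D.forget M N ≫ D.forget.map (β_ M N).hom =
          AnQG.QuantumDatum.crossedBraiding M.obj N.obj ρ ≫
            Functor.LaxMonoidal.μ D.forget N M) := by
  obtain ⟨h₁, h₂, h₃, h₄, h₅, h₆⟩ := AnQG.YD.exists_braided
    (AnQG.IndObj.duality_emb D.duality) (P := D.isOPsi) D.isOPsi_iff
  exact ⟨h₁, h₂, h₃, h₄, h₅, fun M N ρ hρ => h₆ M N ρ
    ⟨⟨hρ.coassoc, hρ.counit, hρ.crossed⟩, hρ.actB⟩⟩
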